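/- Let $\mathbb K$ be a field of characteristic $0$ and $N\ge 1$ an integer; write $[N]=\{1,\dots,N\}$, let $p$ denote parity, and use the Koszul sign rule. **Modules and variables.** Let $(V,\nabla)=(V,T,S^1,\dots,S^N)$ be an $\mathcal H_W$-supermodule: a $\mathbb K$-superspace with an even operator $T$ and odd operators $S^i$ such that $TS^i=S^iT$ and $S^iS^j+S^jS^i=0$. $\Pi^{k}V$ is $V$ with parity shifted by $k$ and the same operators. For supervariables $\Lambda_k=(\lambda_k,\theta_k^1,\dots,\theta_k^N)$ ($\lambda_k$ even, $\theta_k^i$ odd) let $\mathbb K[\Lambda_k]_{k=1}^n$ be the free commutative superalgebra, $V[\Lambda_k]_{k=1}^n=\mathbb K[\Lambda_k]_{k=1}^n\otimes V$, and $V_\nabla[\Lambda_k]_{k=1}^n$ the quotient of $V[\Lambda_k]_{k=1}^n$ by the relations $a(-\sum_k\lambda_k)\otimes v=a\otimes Tv$, $a(-\sum_k\theta_k^i)\otimes v=a\otimes S^iv$; it is identified with $V[\Lambda_k]_{k=1}^{n-1}$ through $\Lambda_n\mapsto-\Lambda_1-\dots-\Lambda_{n-1}-\nabla$. In $V[\Lambda]$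 write $\Lambda^{m|I}=\lambda^m\theta^{i_1}\cdots\theta^{i_r}$ for $I=\{i_1<\dots<i_r\}$, with $T\Lambda^{m|I}v=\Lambda^{m|I}Tv$ and $S^i\Lambda^{m|I}v=(-1)^{\#I}\Lambda^{m|I}S^iv$. **Vertex algebras.** A *non-unital $N_W=N$ SUSY vertex algebra* structure on $(V,\nabla)$ is a pair of a linear map $[\cdot_\Lambda\cdot]:V\otimes V\to V[\Lambda]$ of parity $N$ and an even linear map $\mu:V\otimes V\to V$, $ab=\mu(a\otimes b)$, such that for all $i$ and all (homogeneous) $a,b,c$: (a) $[Ta_\Lambda b]=-\lambda[a_\Lambda b]$, $[a_\Lambda Tb]=(\lambda+T)[a_\Lambda b]$, $[S^ia_\Lambda b]=-(-1)^N\theta^i[a_\Lambda b]$, $[a_\Lambda S^ib]=(-1)^{p(a)+N}(\theta^i+S^i)[a_\Lambda b]$; (b) $[b_\Lambda a]=-(-1)^{p(a)p(b)+N}[a_{-\Lambda-\nabla}b]$; (c) $[a_{\Lambda_1}[b_{\Lambda_2}c]]=(-1)^{(p(a)+N)N}[[a_{\Lambda_1}b]_{\Lambda_1+\Lambda_2}c]+(-1)^{(p(a)+N)(p(b)+N)}[b_{\Lambda_2}[a_{\Lambda_1}c]]$;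 (d) $T(ab)=(Ta)b+a(Tb)$, $S^i(ab)=(S^ia)b+(-1)^{p(a)}a(S^ib)$; (e) $ab-(-1)^{p(a)p(b)}ba=\int_{-T}^0d\Lambda\,[a_\Lambda b]$; (f) $(ab)c-a(bc)=\bigl(\int_0^Td\Lambda\,a\bigr)[b_\Lambda c]+(-1)^{p(a)p(b)}\bigl(\int_0^Td\Lambda\,b\bigr)[a_\Lambda c]$; (g) $[a_\Lambda bc]=[a_\Lambda b]c+(-1)^{(p(a)+N)p(b)}b[a_\Lambda c]+\int_0^\lambda d\Gamma\,[[a_\Lambda b]_\Gamma c]$. Here $\int_F^Gd\Lambda\,\Lambda^{m|I}v=\frac{\delta_{I,[N]}}{m+1}(G^{m+1}v-F^{m+1}v)$ and $\bigl(\int_F^Gd\Lambda\,a\bigr)\Lambda^{m|I}v=\bigl(\int_F^Gd\Lambda\,\Lambda^{m|I}a\bigr)v$. **The chiral operad.** For supervariables $Z_k=(z_k,\zeta_k^1,\dots,\zeta_k^N)$ put $z_{k,l}=z_k-z_l$, $\zeta^i_{k,l}=\zeta^i_k-\zeta^i_l$, and let $\mathcal O_n^{\star\mathrm T}=\mathbb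 K[z_{k,l}^{\pm1},\zeta_{k,l}^i]_{k<l}$, a subalgebra of the localization $\mathbb K[Z_k]_{k=1}^n[z_{k,l}^{-1}]_{k<l}$. Let $\mathcal D_n^{\mathrm T}$ be the superalgebra of differential operators generated by the $z_{k,l},\zeta_{k,l}^i,\partial_{z_k},\partial_{\zeta_k^i}$. It acts from the right on $V^{\otimes n}\otimes\mathcal O_n^{\star\mathrm T}$ by multiplication by $z_{k,l},\zeta_{k,l}^i$ on the right and $$(v\otimes f)\cdot\partial_{z_k}=T^{(k)}v\otimes f-v\otimes\partial_{z_k}f,\qquad (v\otimes f)\cdot\partial_{\zeta_k^i}=(-1)^{p(v)+p(f)}(S^i)^{(k)}v\otimes f-(-1)^{p(f)}v\otimes\partial_{\zeta_k^i}f,$$ where $A^{(k)}$ is the operator $A$ acting on the $k$-th tensor factor, and on $V_\nabla[\Lambda_k]_{k=1}^n$ by $$(a\otimes v)\cdot z_{k,l}=(\partial_{\lambda_l}-\partial_{\lambda_k})a\otimes v,\qquad (a\otimes v)\cdot\zeta_{k,l}^i=(-1)^{p(a)+p(v)}(\partial_{\theta_k^i}-\partial_{\theta_l^i})a\otimes v,$$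 $$(a\otimes v)\cdot\partial_{z_k}=-\lambda_ka\otimes v,\qquad (a\otimes v)\cdot\partial_{\zeta_k^i}=-(-1)^{p(a)+p(v)}\theta_k^ia\otimes v.$$ Let $P_V(n)=P^{\mathrm{ch},W}_V(n)$ be the superspace of $\mathcal D_n^{\mathrm T}$-linear maps $V^{\otimes n}\otimes\mathcal O_n^{\star\mathrm T}\to V_\nabla[\Lambda_k]_{k=1}^n$. For $\sigma\in\mathfrak S_n$ put $$X^\sigma(v_1\otimes\dots\otimes v_n\otimes f)=\prod_{k<l,\ \sigma(k)>\sigma(l)}(-1)^{p(v_k)p(v_l)}\,X_{\Lambda_{\sigma^{-1}(1)},\dots,\Lambda_{\sigma^{-1}(n)}}\bigl(v_{\sigma^{-1}(1)}\otimes\dots\otimes v_{\sigma^{-1}(n)}\otimes f(Z_{\sigma(1)},\dots,Z_{\sigma(n)})\bigr).$$ For $X\in P_V(n+1)$ and $Y\in P_V(m+1)$ the composition $X\circ_1Y\in P_V(m+1+n)$ is defined by $$(X\circ_1Y)(w\otimes v\otimes f_0f_1)=X_{\Lambda_1+\dots+\Lambda_{m+1},\Lambda_{m+2},\dots,\Lambda_{m+1+n}}\Bigl(Y_{\Gamma_1,\dots,\Gamma_m}(w\otimes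 f_1)\otimes v\otimes f_0|_{Z_1=\dots=Z_{m+1}}\Bigr)$$ for $w\in V^{\otimes(m+1)}$, $v\in V^{\otimes n}$, $f_1$ a product of elements $z_{k,l}^{-1}$ with $k<l\le m+1$, and $f_0\in\mathcal O_{m+1+n}^{\star\mathrm T}$ without poles at $z_k=z_l$, $k<l\le m+1$. Here $Y_{\Gamma_1,\dots,\Gamma_m}(w\otimes f_1)$ is the image of $Y(w\otimes f_1)$ in $V[\Lambda_k]_{k=1}^m$ with each $\Lambda_k$ replaced by $\Gamma_k=\Lambda_k-\partial_{Z_k}$, where $\partial_{Z_k}$ acts on $f_0$ before the restriction (with the Koszul sign for passing the vectors in between), and $X_{\Lambda'}(au\otimes v\otimes g)=(-1)^{p(a)p(X)}a\,X_{\Lambda'}(u\otimes v\otimes g)$ for $a\in\mathbb K[\Lambda_k]_{k=1}^m$, $u\in V$. Put $L^n(P_V)=P_V(n+1)^{\mathfrak S_{n+1}}$ and, for $X\in L^n$, $Y\in L^m$, $X\,\square\,Y=\sum_\sigma(X\circ_1Y)^{\sigma^{-1}}$, where $\sigma\in\mathfrak S_{m+1+n}$ runs over the permutations increasing on $\{1,\dots,m+1\}$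 and on $\{m+2,\dots,m+1+n\}$. Let $$\mathrm{MC}_{\bar1}=\{X\in L^1(P_{\Pi^{N+1}V})\ \text{odd}\mid X\,\square\,X=0\}.$$ **Theorem.** (0) For every odd $X\in L^1(P_{\Pi^{N+1}V})$ there is exactly one linear map $X\circ_1X$ with the defining property above, and it belongs to $P_{\Pi^{N+1}V}(3)$; so $X\,\square\,X$ is well defined. (1) For $X\in\mathrm{MC}_{\bar1}$ the maps $$[a_\Lambda b]_X=(-1)^{p(a)(N+1)}X_{\Lambda,-\Lambda-\nabla}(a\otimes b\otimes1),\qquad \mu_X(a\otimes b)=(-1)^{p(a)(N+1)+1}\operatorname{Res}_\Lambda\bigl(\lambda^{-1}X_{\Lambda,-\Lambda-\nabla}(a\otimes b\otimes z_{1,2}^{-1})\bigr),$$ with $p(a)$ the parity of $a$ in $V$ and $\operatorname{Res}_\Lambda(\lambda^{-1}\Lambda^{m|I}v)=\delta_{m,0}\delta_{I,[N]}v$, form a non-unital $N_W=N$ SUSY vertex algebra structure on $(V,\nabla)$. (2) The map $X\mapsto([\cdot_\Lambda\cdot]_X,\mu_X)$ is a bijection from $\mathrm{MC}_{\bar1}$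 onto the set of all non-unital $N_W=N$ SUSY vertex algebra structures on $(V,\nabla)$. -/

import Mathlib

open scoped TensorProduct

namespace SUSY

noncomputable section

/-- The sign `(-1)^p` of a parity `p`. -/
def sgn (p : ZMod 2) : ℤ := if p = 0 then 1 else -1

section Super

variable (K : Type*) [Field K] (N : ℕ)

/-- The Grassmann algebra on the odd letters `θ_k^i`, `k ∈ [n]`, `i ∈ [N]`. -/
abbrev Grass (n : ℕ) : Type _ := ExteriorAlgebra K (Fin n × Fin N → K)

/-- The commutative superalgebra `R[θ_k^i]` over a (purely even) commutative `K`-algebra `R`. -/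
abbrev SAlg (R : Type*) [CommRing R] [Algebra K R] (n : ℕ) : Type _ := R ⊗[K] Grass K N n

/-- The polynomial superalgebra `K[Λ_k]_{k=1}^n` in `n` supervariables
`Λ_k = (λ_k, θ_k^1, …, θ_k^N)`. -/
abbrev SPoly (n : ℕ) : Type _ := SAlg K N (MvPolynomial (Fin n) K) n

variable {K N}

section
variable {R : Type*} [CommRing R] [Algebra K R] {n m : ℕ}

/-- The odd generator `θ_k^i`. -/
def odd (k : Fin n) (i : Fin N) : SAlg K N R n :=
  1 ⊗ₜ ExteriorAlgebra.ι K (Pi.single (k, i) 1)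

/-- An element of the even coefficient ring, as an element of the superalgebra. -/
def evn : R →ₐ[K] SAlg K N R n := Algebra.TensorProduct.includeLeft

/-- The parity involution `a ↦ (-1)^{p(a)} a` of the superalgebra. -/
def inv : SAlg K N R n →ₐ[K] SAlg K N R n :=
  Algebra.TensorProduct.map (AlgHom.id K R) CliffordAlgebra.involute

/-- The operator `a ↦ (-1)^{p(a) p} a`. -/
def invPow (p : ZMod 2) : SAlg K N R n →ₐ[K] SAlg K N R n :=
  if p = 0 then AlgHom.id K _ else inv

/-- The extension of an even derivation of the coefficient ring. -/
def dEven (D : R →ₗ[K] R) : SAlg K N R n →ₗ[K] SAlg K N R n := D.rTensor _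

/-- The (left) odd derivation `∂/∂θ_k^i`. -/
def dOdd (k : Fin n) (i : Fin N) : SAlg K N R n →ₗ[K] SAlg K N R n :=
  (CliffordAlgebra.contractLeft (LinearMap.proj (k, i))).lTensor R

/-- The algebra map of Grassmann algebras with `θ_k^i ↦ ∑_l A k l θ_l^i`. -/
def gmap (A : Fin n → Fin m → K) : Grass K N n →ₐ[K] Grass K N m :=
  ExteriorAlgebra.map
    { toFun := fun x p => ∑ k, A k p.1 * x (k, p.2)
      map_add' := fun x y => by
        ext p; simp [mul_add, Finset.sum_add_distrib]
      map_smul' := fun c x => by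
        ext p; simp [Finset.mul_sum, mul_left_comm] }

theorem gmap_ι_single (A : Fin n → Fin m → K) (k : Fin n) (i : Fin N) :
    gmap A (ExteriorAlgebra.ι K (Pi.single (k, i) 1)) =
      ∑ l, A k l • ExteriorAlgebra.ι K (Pi.single (l, i) (1 : K)) := by
  rw [gmap, ExteriorAlgebra.map_apply_ι]
  simp_rw [← map_smul, ← map_sum]
  congr 1
  ext ⟨l, j⟩
  simp only [LinearMap.coe_mk, AddHom.coe_mk, Finset.sum_apply, Pi.smul_apply, smul_eq_mul,
    Pi.single_apply, Prod.mk.injEq]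
  by_cases h : j = i <;> simp [h]

theorem inv_odd (k : Fin n) (i : Fin N) : inv (odd k i : SAlg K N R n) = -odd k i := by
  simp [inv, odd, ExteriorAlgebra.ι, TensorProduct.tmul_neg]

theorem inv_evn (r : R) : inv (evn r : SAlg K N R n) = evn r := by
  simp [inv, evn]

theorem inv_inv (a : SAlg K N R n) : inv (inv a) = a := by
  rw [← AlgHom.comp_apply]
  suffices h : (inv (K := K) (N := N) (R := R) (n := n)).comp inv = AlgHom.id K _ by rw [h]; rfl
  ext <;> simp [inv]

theorem odd_mul_odd (k l : Fin n) (i j : Fin N) :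
    (odd k i : SAlg K N R n) * odd l j + odd l j * odd k i = 0 := by
  simp only [odd, Algebra.TensorProduct.tmul_mul_tmul, one_mul, ← TensorProduct.tmul_add,
    ExteriorAlgebra.ι_add_mul_swap, TensorProduct.tmul_zero]

theorem evn_comm (r : R) (a : SAlg K N R n) : evn r * a = a * evn r := by
  induction a using TensorProduct.induction_on with
  | zero => simp
  | tmul s e => simp [evn, mul_comm]
  | add x y hx hy => rw [mul_add, add_mul, hx, hy]

theorem dEven_mul (D : Derivation K R R) (a b : SAlg K N R n) :
    dEven D.toLinearMap (a * b) = dEven D.toLinearMap a * b + a * dEven D.toLinearMap b := by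
  induction a using TensorProduct.induction_on with
  | zero => simp
  | add x y hx hy => simp only [add_mul, map_add, hx, hy]; abel
  | tmul s e =>
    induction b using TensorProduct.induction_on with
    | zero => simp
    | add x y hx hy => simp only [mul_add, map_add, hx, hy]; abel
    | tmul t f =>
      simp [dEven, TensorProduct.add_tmul, mul_comm, add_comm]

theorem contract_mul (d : Module.Dual K (Fin n × Fin N → K)) (a b : Grass K N n) :
    CliffordAlgebra.contractLeft d (a * b) =
      CliffordAlgebra.contractLeft d a * b +
        CliffordAlgebra.involute a * CliffordAlgebra.contractLeft d b := by
  induction a using CliffordAlgebra.left_induction with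
  | algebraMap r => simp [CliffordAlgebra.contractLeft_algebraMap_mul]
  | add x y hx hy => simp only [add_mul, map_add, hx, hy]; abel
  | ι_mul x m hx =>
    rw [mul_assoc, CliffordAlgebra.contractLeft_ι_mul, hx, CliffordAlgebra.contractLeft_ι_mul,
      map_mul, CliffordAlgebra.involute_ι]
    simp only [mul_add, sub_mul, smul_mul_assoc, mul_assoc, neg_mul]
    abel

theorem dOdd_mul (k : Fin n) (i : Fin N) (a b : SAlg K N R n) :
    dOdd k i (a * b) = dOdd k i a * b + inv a * dOdd k i b := by
  induction a using TensorProduct.induction_on with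
  | zero => simp
  | add x y hx hy => simp only [add_mul, map_add, hx, hy]; abel
  | tmul s e =>
    induction b using TensorProduct.induction_on with
    | zero => simp
    | add x y hx hy => simp only [mul_add, map_add, hx, hy]; abel
    | tmul t f =>
      simp [dOdd, inv, contract_mul, TensorProduct.tmul_add]

theorem dOdd_evn (k : Fin n) (i : Fin N) (r : R) : dOdd k i (evn r : SAlg K N R n) = 0 := by
  simp [dOdd, evn]

theorem dOdd_odd (k l : Fin n) (i j : Fin N) :
    dOdd k i (odd l j : SAlg K N R n) = if (k, i) = (l, j) then 1 else 0 := by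
  simp only [dOdd, odd, LinearMap.lTensor_tmul, ExteriorAlgebra.ι, CliffordAlgebra.contractLeft_ι,
    LinearMap.proj_apply, Pi.single_apply]
  split_ifs <;> simp [Algebra.TensorProduct.one_def]

theorem dEven_odd (D : Derivation K R R) (k : Fin n) (i : Fin N) :
    dEven D.toLinearMap (odd k i : SAlg K N R n) = 0 := by
  simp [dEven, odd]

theorem dEven_evn (D : R →ₗ[K] R) (r : R) :
    dEven D (evn r : SAlg K N R n) = evn (D r) := by
  simp [dEven, evn]

end

section Eval

variable {A : Type*} [Ring A] [Algebra K A] {n : ℕ}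

/-- `t_k`, `s_{k,i}` satisfy the defining relations of the polynomial superalgebra. -/
structure SuperCommute (t : Fin n → A) (s : Fin n × Fin N → A) : Prop where
  tt : ∀ k l, t k * t l = t l * t k
  ts : ∀ k p, t k * s p = s p * t k
  ss : ∀ p q, s p * s q + s q * s p = 0

/-- Evaluation of a polynomial at pairwise commuting elements of a possibly noncommutative
algebra. -/
def aevalComm (t : Fin n → A) (h : ∀ k l, t k * t l = t l * t k) :
    MvPolynomial (Fin n) K →ₐ[K] A :=
  haveI : IsMulCommutative (Algebra.adjoin K (Set.range t)) :=
    Algebra.isMulCommutative_adjoin K (by rintro _ ⟨k, rfl⟩ _ ⟨l, rfl⟩; exact h k l)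
  letI : CommRing (Algebra.adjoin K (Set.range t)) := by
    open scoped IsMulCommutative in infer_instance
  (Algebra.adjoin K (Set.range t)).val.comp
    (MvPolynomial.aeval fun k =>
      (⟨t k, Algebra.subset_adjoin ⟨k, rfl⟩⟩ : Algebra.adjoin K (Set.range t)))

theorem aevalComm_X (t : Fin n → A) (h : ∀ k l, t k * t l = t l * t k) (k : Fin n) :
    aevalComm (K := K) t h (MvPolynomial.X k) = t k := by
  simp [aevalComm]

theorem aevalComm_comm (t : Fin n → A) (h : ∀ k l, t k * t l = t l * t k) (b : A)
    (hb : ∀ k, t k * b = b * t k) (p : MvPolynomial (Fin n) K) :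
    aevalComm t h p * b = b * aevalComm t h p := by
  induction p using MvPolynomial.induction_on with
  | C c => rw [← MvPolynomial.algebraMap_eq, AlgHom.commutes, Algebra.commutes]
  | add x y hx hy => rw [map_add, add_mul, mul_add, hx, hy]
  | mul_X x k hx => rw [map_mul, aevalComm_X, mul_assoc, hb, ← mul_assoc, hx, mul_assoc]

variable [CharZero K]

theorem SuperCommute.sq {t : Fin n → A} {s : Fin n × Fin N → A} (h : SuperCommute t s)
    (x : Fin n × Fin N → K) : (∑ p, x p • s p) * (∑ p, x p • s p) = 0 := by
  have h1 : (∑ p, x p • s p) * (∑ p, x p • s p) =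
      -((∑ p, x p • s p) * (∑ p, x p • s p)) := by
    conv_lhs => rw [Finset.sum_mul_sum, Finset.sum_comm]
    rw [Finset.sum_mul_sum, ← Finset.sum_neg_distrib]
    refine Finset.sum_congr rfl fun p _ => ?_
    rw [← Finset.sum_neg_distrib]
    refine Finset.sum_congr rfl fun q _ => ?_
    rw [smul_mul_smul_comm, smul_mul_smul_comm, mul_comm (x q), ← smul_neg,
      eq_neg_of_add_eq_zero_left (h.ss q p)]
  have h2 : (2 : K) • ((∑ p, x p • s p) * (∑ p, x p • s p)) = 0 := by
    rw [two_smul]; exact eq_neg_iff_add_eq_zero.mp h1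
  exact (smul_eq_zero.mp h2).resolve_left two_ne_zero

/-- The algebra map `K[Λ_k]_{k=1}^n → A` with `λ_k ↦ t_k` and `θ_k^i ↦ s_{k,i}`. -/
def evalHom (t : Fin n → A) (s : Fin n × Fin N → A) (h : SuperCommute t s) :
    SPoly K N n →ₐ[K] A :=
  Algebra.TensorProduct.lift (aevalComm t h.tt)
    (ExteriorAlgebra.lift K
      ⟨∑ p, (LinearMap.proj p : (Fin n × Fin N → K) →ₗ[K] K).smulRight (s p), fun x => by
        simpa using h.sq x⟩)
    (fun p e => by
      induction e using ExteriorAlgebra.induction with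
      | algebraMap r => rw [AlgHom.commutes]; exact (Algebra.commutes _ _).symm
      | ι x =>
        rw [ExteriorAlgebra.lift_ι_apply]
        refine aevalComm_comm t h.tt _ (fun k => ?_) p
        simp [Finset.mul_sum, Finset.sum_mul, h.ts]
      | mul a b ha hb => rw [map_mul]; exact ha.mul_right hb
      | add a b ha hb => rw [map_add]; exact ha.add_right hb)

theorem evalHom_evn (t : Fin n → A) (s : Fin n × Fin N → A) (h : SuperCommute t s) (k : Fin n) :
    evalHom (K := K) t s h (evn (MvPolynomial.X k)) = t k := by
  simp [evalHom, evn, aevalComm_X]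

theorem evalHom_odd (t : Fin n → A) (s : Fin n × Fin N → A) (h : SuperCommute t s) (k : Fin n)
    (i : Fin N) : evalHom (K := K) t s h (odd k i) = s (k, i) := by
  simp [evalHom, odd, Pi.single_apply]

end Eval

section Poly

variable {n m : ℕ}

/-- The even variable `λ_k`. -/
def lam (k : Fin n) : SPoly K N n := evn (MvPolynomial.X k)

/-- `∂/∂λ_k` on `K[Λ_k]_{k=1}^n`. -/
def dlam (k : Fin n) : SPoly K N n →ₗ[K] SPoly K N n :=
  dEven (MvPolynomial.pderiv k).toLinearMap

/-- The substitution `Λ_k ↦ ∑_l A k l Λ_l`, an algebra map `K[Λ_k]_{k=1}^n → K[Λ_l]_{l=1}^m`. -/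
def subst (A : Fin n → Fin m → K) : SPoly K N n →ₐ[K] SPoly K N m :=
  Algebra.TensorProduct.map
    (MvPolynomial.aeval fun k => ∑ l, A k l • MvPolynomial.X l) (gmap A)

theorem subst_lam (A : Fin n → Fin m → K) (k : Fin n) :
    subst (N := N) A (lam k) = ∑ l, A k l • lam l := by
  simp [subst, lam, evn, TensorProduct.sum_tmul, TensorProduct.smul_tmul']

theorem subst_odd (A : Fin n → Fin m → K) (k : Fin n) (i : Fin N) :
    subst A (odd k i) = ∑ l, A k l • (odd l i : SPoly K N m) := by
  simp [subst, odd, gmap_ι_single, TensorProduct.tmul_sum]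

end Poly

end Super

/-- An `H_W`-supermodule structure on `V`: a grading `V = V_0 ⊕ V_1`, an even operator `T` and odd
operators `S^1, …, S^N` with `[T, S^i] = 0` and `S^i S^j + S^j S^i = 0`. -/
structure HWSupermodule (K : Type*) [Field K] (N : ℕ) (V : Type*) [AddCommGroup V]
    [Module K V] where
  deg : ZMod 2 → Submodule K V
  isCompl : ∀ p, IsCompl (deg p) (deg (p + 1))
  T : V →ₗ[K] V
  S : Fin N → V →ₗ[K] V
  T_mem : ∀ p, ∀ v ∈ deg p, T v ∈ deg p
  S_mem : ∀ i p, ∀ v ∈ deg p, S i v ∈ deg (p + 1)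
  T_S : ∀ i v, T (S i v) = S i (T v)
  S_S : ∀ i j v, S i (S j v) + S j (S i v) = 0

namespace HWSupermodule

variable {K : Type*} [Field K] {N : ℕ} {V : Type*} [AddCommGroup V] [Module K V]
  (M : HWSupermodule K N V)

/-- The parity shift `Π^k V`, with the same operators `T`, `S^i`. -/
def shift (k : ℕ) : HWSupermodule K N V where
  deg p := M.deg (p + k)
  isCompl p := by rw [add_right_comm]; exact M.isCompl _
  T := M.T
  S := M.S
  T_mem p := M.T_mem _
  S_mem i p v hv := by rw [add_right_comm]; exact M.S_mem i _ v hv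
  T_S := M.T_S
  S_S := M.S_S

/-- The projection of `V` to its component of parity `p`. -/
def proj (p : ZMod 2) : V →ₗ[K] V := (M.deg p).projection (M.deg (p + 1)) (M.isCompl p)

/-- The parity involution `v ↦ (-1)^{p(v)} v` of `V`. -/
def par : V →ₗ[K] V := M.proj 0 - M.proj 1

theorem par_of_mem {p : ZMod 2} {v : V} (hv : v ∈ M.deg p) : M.par v = sgn p • v := by
  obtain rfl | rfl : p = 0 ∨ p = 1 := by clear hv; revert p; decide
  · have h0 : M.proj 0 v = v := Submodule.projection_apply_of_mem_left _ hv
    have h1 : M.proj 1 v = 0 := Submodule.projection_apply_of_mem_right _ hv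
    simp [par, h0, h1, sgn]
  · have h0 : M.proj 0 v = 0 := Submodule.projection_apply_of_mem_right _ hv
    have h1 : M.proj 1 v = v := Submodule.projection_apply_of_mem_left _ hv
    simp [par, h0, h1, sgn]

theorem homogeneous_induction {C : V → Prop} (h : ∀ p, ∀ v ∈ M.deg p, C v)
    (hadd : ∀ v w, C v → C w → C (v + w)) (v : V) : C v := by
  obtain ⟨a, ha, b, hb, rfl⟩ := Submodule.mem_sup.mp
    ((M.isCompl 0).sup_eq_top ▸ Submodule.mem_top : v ∈ M.deg 0 ⊔ M.deg (0 + 1))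
  exact hadd _ _ (h _ _ ha) (h _ _ hb)

theorem sgn_add_one (p : ZMod 2) : sgn (p + 1) = -sgn p := by revert p; decide

theorem par_T (v : V) : M.par (M.T v) = M.T (M.par v) := by
  refine M.homogeneous_induction (C := fun v => M.par (M.T v) = M.T (M.par v))
    (fun p v hv => ?_) (fun v w hv hw => by simp only [map_add, hv, hw]) v
  rw [M.par_of_mem hv, M.par_of_mem (M.T_mem _ _ hv), map_zsmul]

theorem par_S (i : Fin N) (v : V) : M.par (M.S i v) = -M.S i (M.par v) := by
  refine M.homogeneous_induction (C := fun v => M.par (M.S i v) = -M.S i (M.par v))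
    (fun p v hv => ?_) (fun v w hv hw => by simp only [map_add, hv, hw, neg_add]) v
  rw [M.par_of_mem hv, M.par_of_mem (M.S_mem _ _ _ hv), map_zsmul, sgn_add_one, neg_smul]

theorem par_par (v : V) : M.par (M.par v) = v := by
  refine M.homogeneous_induction (C := fun v => M.par (M.par v) = v)
    (fun p v hv => ?_) (fun v w hv hw => by simp only [map_add, hv, hw]) v
  rw [M.par_of_mem hv, map_zsmul, M.par_of_mem hv, smul_smul]
  have : sgn p * sgn p = 1 := by clear hv; revert p; decide
  rw [this, one_smul]

end HWSupermodule

section Modules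

section Abstract

variable {F W : Type*} [Field F] [AddCommGroup W] [Module F W]

theorem commute_last {b d a : Module.End F W} (h1 : b * a = a * b) (h2 : d * a = a * d) :
    (-b - d) * a = a * (-b - d) := by
  rw [sub_mul, mul_sub, neg_mul, mul_neg, h1, h2]

theorem anticomm_last {b d a : Module.End F W} (h1 : a * b + b * a = 0) (h2 : a * d + d * a = 0) :
    a * (-b - d) + (-b - d) * a = 0 := by
  have e : a * (-b - d) + (-b - d) * a = -(a * b + b * a) - (a * d + d * a) := by noncomm_ring
  rw [e, h1, h2, neg_zero, sub_zero]

theorem neg_add_last (b d : Module.End F W) : -(b + (-b - d)) = d := by abel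

end Abstract

variable {K : Type*} [Field K] {N : ℕ} {V : Type*} [AddCommGroup V] [Module K V]

variable (K N V) in
/-- `V[Λ_k]_{k=1}^n = K[Λ_k]_{k=1}^n ⊗ V`. -/
abbrev VPoly (n : ℕ) : Type _ := SPoly K N n ⊗[K] V

variable {n m : ℕ}

/-- The left action of `K[Λ_k]_{k=1}^n` on `V[Λ_k]_{k=1}^n`. -/
def lmul : SPoly K N n →ₗ[K] VPoly K N V n →ₗ[K] VPoly K N V n :=
  LinearMap.rTensorHom V ∘ₗ LinearMap.mul K (SPoly K N n)

theorem lmul_tmul (a b : SPoly K N n) (v : V) : lmul a (b ⊗ₜ v) = (a * b) ⊗ₜ[K] v := rfl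

theorem lmul_mul (a b : SPoly K N n) (x : VPoly K N V n) : lmul (a * b) x = lmul a (lmul b x) := by
  induction x using TensorProduct.induction_on with
  | zero => simp
  | tmul c v => simp only [lmul_tmul, mul_assoc]
  | add x y hx hy => simp only [map_add, hx, hy]

variable (M : HWSupermodule K N V)

/-- `T` acting on `V[Λ_k]_{k=1}^n` by `T(a v) = a (T v)`. -/
def Tx (n : ℕ) : VPoly K N V n →ₗ[K] VPoly K N V n := TensorProduct.map LinearMap.id M.T

/-- `S^i` acting on `V[Λ_k]_{k=1}^n` by `S^i(a v) = (-1)^{p(a)} a (S^i v)`. -/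
def Sx (n : ℕ) (i : Fin N) : VPoly K N V n →ₗ[K] VPoly K N V n :=
  TensorProduct.map inv.toLinearMap (M.S i)

/-- The parity involution `a v ↦ (-1)^{p(a) + p(v)} a v` of `V[Λ_k]_{k=1}^n`. -/
def parx (n : ℕ) : VPoly K N V n →ₗ[K] VPoly K N V n := TensorProduct.map inv.toLinearMap M.par

/-- The relations `(a ⋅ T) ⊗ v = a ⊗ T v`, `(a ⋅ S^i) ⊗ v = a ⊗ S^i v`, where
`a ⋅ T = a (-∑_k λ_k)` and `a ⋅ S^i = a (-∑_k θ_k^i)`. -/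
def nablaRel (n : ℕ) : Submodule K (VPoly K N V n) :=
  Submodule.span K
    ({x | ∃ (a : SPoly K N n) (v : V), x = (a * -∑ k, lam k) ⊗ₜ[K] v - a ⊗ₜ[K] M.T v} ∪
      {x | ∃ (a : SPoly K N n) (v : V) (i : Fin N),
        x = (a * -∑ k, odd k i) ⊗ₜ[K] v - a ⊗ₜ[K] M.S i v})

/-- `V_∇[Λ_k]_{k=1}^n = K[Λ_k]_{k=1}^n ⊗_{H_W} V`; for `n = 0` this is `V / ∇V`. -/
abbrev VNabla (n : ℕ) : Type _ := VPoly K N V n ⧸ nablaRel M n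

theorem mem_nablaRel_T (a : SPoly K N n) (v : V) :
    (a * -∑ k, lam k) ⊗ₜ[K] v - a ⊗ₜ[K] M.T v ∈ nablaRel M n :=
  Submodule.subset_span (Or.inl ⟨a, v, rfl⟩)

theorem mem_nablaRel_S (a : SPoly K N n) (v : V) (i : Fin N) :
    (a * -∑ k, odd k i) ⊗ₜ[K] v - a ⊗ₜ[K] M.S i v ∈ nablaRel M n :=
  Submodule.subset_span (Or.inr ⟨a, v, i, rfl⟩)

theorem nablaRel_le {P : Submodule K (VPoly K N V n)}
    (hT : ∀ (a : SPoly K N n) (v : V), (a * -∑ k, lam k) ⊗ₜ[K] v - a ⊗ₜ[K] M.T v ∈ P)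
    (hS : ∀ (a : SPoly K N n) (v : V) (i : Fin N),
      (a * -∑ k, odd k i) ⊗ₜ[K] v - a ⊗ₜ[K] M.S i v ∈ P) : nablaRel M n ≤ P := by
  refine Submodule.span_le.mpr ?_
  rintro x (⟨a, v, rfl⟩ | ⟨a, v, i, rfl⟩)
  exacts [hT a v, hS a v i]

/-- The left action of `K[Λ_k]_{k=1}^n` on `V_∇[Λ_k]_{k=1}^n`. -/
def nMul (a : SPoly K N n) : VNabla M n →ₗ[K] VNabla M n :=
  (nablaRel M n).mapQ (nablaRel M n) (lmul a) <| nablaRel_le M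
    (fun b v => by
      simp only [Submodule.mem_comap, map_sub, lmul_tmul, ← mul_assoc]
      exact mem_nablaRel_T M _ _)
    (fun b v i => by
      simp only [Submodule.mem_comap, map_sub, lmul_tmul, ← mul_assoc]
      exact mem_nablaRel_S M _ _ _)

/-- The left action of `K[Λ_k]_{k=1}^n` on `V_∇[Λ_k]_{k=1}^n`, linear in both arguments. -/
def nMulₗ : SPoly K N n →ₗ[K] VNabla M n →ₗ[K] VNabla M n where
  toFun := nMul M
  map_add' a b := by ext x; simp [nMul]
  map_smul' c a := by ext x; simp [nMul]

/-- The parity involution of `V_∇[Λ_k]_{k=1}^n`. -/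
def nPar (n : ℕ) : VNabla M n →ₗ[K] VNabla M n :=
  (nablaRel M n).mapQ (nablaRel M n) (parx M n) <| nablaRel_le M
    (fun a v => by
      have h := mem_nablaRel_T M (inv a) (M.par v)
      simpa [parx, TensorProduct.map_tmul, lam, inv_evn, M.par_T] using h)
    (fun a v i => by
      have h := (nablaRel M n).neg_mem (mem_nablaRel_S M (inv a) (M.par v) i)
      simpa [parx, TensorProduct.map_tmul, inv_odd, M.par_S, TensorProduct.neg_tmul,
        TensorProduct.tmul_neg, sub_eq_add_neg, add_comm] using h)

theorem dlam_sum (k : Fin n) (a : SPoly K N n) :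
    dlam k (a * -∑ l, lam l) = dlam k a * -(∑ l, lam l) - a := by
  have h : dlam k (-∑ l, lam l : SPoly K N n) = -1 := by
    simp only [map_neg, map_sum, dlam, lam, dEven_evn]
    simp [MvPolynomial.pderiv_X, Pi.single_apply]
  have h' : dlam k (a * -∑ l, lam l) = dlam k a * -(∑ l, lam l) + a * dlam k (-∑ l, lam l) :=
    dEven_mul _ _ _
  rw [h', h, mul_neg_one, sub_eq_add_neg]

theorem dOdd_sum_lam (k : Fin n) (i : Fin N) (a : SPoly K N n) :
    dOdd k i (a * -∑ l, lam l) = dOdd k i a * -∑ l, lam l := by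
  rw [dOdd_mul]; simp [lam, dOdd_evn]

theorem dlam_sum_odd (k : Fin n) (i : Fin N) (a : SPoly K N n) :
    dlam k (a * -∑ l, odd l i) = dlam k a * -∑ l, odd l i := by
  rw [dlam, dEven_mul]; simp [dEven_odd]

theorem dOdd_sum_odd (k : Fin n) (i j : Fin N) (a : SPoly K N n) :
    dOdd k i (a * -∑ l, odd l j) = dOdd k i a * -(∑ l, odd l j) - if i = j then inv a else 0 := by
  rw [dOdd_mul]
  have h : dOdd k i (-∑ l, odd l j : SPoly K N n) = if i = j then -1 else 0 := by
    simp only [map_neg, map_sum, dOdd_odd, Prod.mk.injEq]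
    by_cases hij : i = j <;> simp [hij]
  rw [h]; split_ifs <;> simp [sub_eq_add_neg]

/-- The operator `∂/∂λ_k - ∂/∂λ_l` on `V_∇[Λ_k]_{k=1}^n`. -/
def nDlam (k l : Fin n) : VNabla M n →ₗ[K] VNabla M n :=
  (nablaRel M n).mapQ (nablaRel M n)
    (LinearMap.rTensor V (dlam k - dlam l : SPoly K N n →ₗ[K] SPoly K N n)) <| nablaRel_le M
    (fun a v => by
      have h := mem_nablaRel_T M (dlam k a - dlam l a) v
      rw [Submodule.mem_comap, map_sub, LinearMap.rTensor_tmul, LinearMap.rTensor_tmul,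
        LinearMap.sub_apply, LinearMap.sub_apply, dlam_sum, dlam_sum, sub_sub_sub_cancel_right,
        ← sub_mul]
      exact h)
    (fun a v i => by
      have h := mem_nablaRel_S M (dlam k a - dlam l a) v i
      rw [Submodule.mem_comap, map_sub, LinearMap.rTensor_tmul, LinearMap.rTensor_tmul,
        LinearMap.sub_apply, LinearMap.sub_apply, dlam_sum_odd, dlam_sum_odd, ← sub_mul]
      exact h)

/-- The operator `∂/∂θ_k^i - ∂/∂θ_l^i` on `V_∇[Λ_k]_{k=1}^n`. -/
def nDodd (k l : Fin n) (i : Fin N) : VNabla M n →ₗ[K] VNabla M n :=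
  (nablaRel M n).mapQ (nablaRel M n)
    (LinearMap.rTensor V (dOdd k i - dOdd l i : SPoly K N n →ₗ[K] SPoly K N n)) <| nablaRel_le M
    (fun a v => by
      have h := mem_nablaRel_T M (dOdd k i a - dOdd l i a) v
      rw [Submodule.mem_comap, map_sub, LinearMap.rTensor_tmul, LinearMap.rTensor_tmul,
        LinearMap.sub_apply, LinearMap.sub_apply, dOdd_sum_lam, dOdd_sum_lam, ← sub_mul]
      exact h)
    (fun a v j => by
      have h := mem_nablaRel_S M (dOdd k i a - dOdd l i a) v j
      rw [Submodule.mem_comap, map_sub, LinearMap.rTensor_tmul, LinearMap.rTensor_tmul,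
        LinearMap.sub_apply, LinearMap.sub_apply, dOdd_sum_odd, dOdd_sum_odd,
        sub_sub_sub_cancel_right, ← sub_mul]
      exact h)

/-- The substitution `Λ_j ↦ ∑_{k ∈ b⁻¹(j)} Λ_k` from `V_∇[Λ_j]_{j=1}^m` to `V_∇[Λ_k]_{k=1}^n`
along a map `b : [n] → [m]`. -/
def nSubst (b : Fin n → Fin m) : VNabla M m →ₗ[K] VNabla M n :=
  (nablaRel M m).mapQ (nablaRel M n)
    ((subst fun j k => if b k = j then 1 else 0).toLinearMap.rTensor V) <| nablaRel_le M
    (fun a v => by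
      have h := mem_nablaRel_T M (subst (fun j k => if b k = j then 1 else 0) a) v
      have e : ∑ j, subst (N := N) (K := K) (fun j k => if b k = j then 1 else 0) (lam j) =
          ∑ k, lam k := by
        simp_rw [subst_lam]; rw [Finset.sum_comm]; simp
      simpa [e] using h)
    (fun a v i => by
      have h := mem_nablaRel_S M (subst (fun j k => if b k = j then 1 else 0) a) v i
      have e : ∑ j, subst (N := N) (K := K) (fun j k => if b k = j then 1 else 0) (odd j i) =
          ∑ k, odd k i := by
        simp_rw [subst_odd]; rw [Finset.sum_comm]; simp
      simpa [e] using h)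

theorem Tx_lmul (a : SPoly K N n) (x : VPoly K N V n) : Tx M n (lmul a x) = lmul a (Tx M n x) := by
  induction x using TensorProduct.induction_on with
  | zero => simp
  | tmul c v => simp [Tx, lmul_tmul]
  | add x y hx hy => simp only [map_add, hx, hy]

theorem Sx_lmul (i : Fin N) (a : SPoly K N n) (x : VPoly K N V n) :
    Sx M n i (lmul a x) = lmul (inv a) (Sx M n i x) := by
  induction x using TensorProduct.induction_on with
  | zero => simp
  | tmul c v => simp [Sx, lmul_tmul]
  | add x y hx hy => simp only [map_add, hx, hy]

theorem Tx_Sx (i : Fin N) (x : VPoly K N V n) : Tx M n (Sx M n i x) = Sx M n i (Tx M n x) := by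
  induction x using TensorProduct.induction_on with
  | zero => simp
  | tmul c v => simp [Sx, Tx, M.T_S]
  | add x y hx hy => simp only [map_add, hx, hy]

theorem Sx_Sx (i j : Fin N) (x : VPoly K N V n) :
    Sx M n i (Sx M n j x) + Sx M n j (Sx M n i x) = 0 := by
  induction x using TensorProduct.induction_on with
  | zero => simp
  | tmul c v => simp [Sx, ← TensorProduct.tmul_add, M.S_S]
  | add x y hx hy =>
    simp only [map_add]
    rw [add_add_add_comm, hx, hy, add_zero]

theorem lmul_anticomm (k l : Fin n) (i j : Fin N) (x : VPoly K N V n) :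
    lmul (odd k i) (lmul (odd l j) x) + lmul (odd l j) (lmul (odd k i) x) = 0 := by
  rw [← lmul_mul, ← lmul_mul, ← LinearMap.add_apply, ← map_add, odd_mul_odd, map_zero,
    LinearMap.zero_apply]

theorem lmul_lam_comm (k : Fin n) (a : SPoly K N n) (x : VPoly K N V n) :
    lmul (lam k) (lmul a x) = lmul a (lmul (lam k) x) := by
  rw [← lmul_mul, ← lmul_mul, lam, evn_comm]

/-- The operators `λ_1, …, λ_n, -λ_1 - ⋯ - λ_n - T` on `V[Λ_k]_{k=1}^n`. -/
def lastEven (n : ℕ) : Fin (n + 1) → Module.End K (VPoly K N V n) :=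
  Fin.lastCases (-(∑ k, (lmul (lam k) : Module.End K (VPoly K N V n))) - Tx M n)
    (fun k => lmul (lam k))

/-- The operators `θ_1^i, …, θ_n^i, -θ_1^i - ⋯ - θ_n^i - S^i` on `V[Λ_k]_{k=1}^n`. -/
def lastOdd (n : ℕ) (p : Fin (n + 1) × Fin N) : Module.End K (VPoly K N V n) :=
  Fin.lastCases (motive := fun _ => Module.End K (VPoly K N V n))
    (-(∑ k, (lmul (odd k p.2) : Module.End K (VPoly K N V n))) - Sx M n p.2)
    (fun k => lmul (odd k p.2)) p.1

theorem lastEven_comm (A : Module.End K (VPoly K N V n))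
    (h1 : ∀ k, Commute (lmul (lam k) : Module.End K (VPoly K N V n)) A)
    (h2 : Commute (Tx M n : Module.End K (VPoly K N V n)) A) (k : Fin (n + 1)) :
    Commute (lastEven M n k) A := by
  refine Fin.lastCases ?_ (fun k => ?_) k
  · simp only [lastEven, Fin.lastCases_last]
    exact commute_last (F := K) (W := VPoly K N V n)
      (Commute.sum_left _ _ _ fun k _ => h1 k).eq h2.eq
  · simpa only [lastEven, Fin.lastCases_castSucc] using h1 k

theorem lastOdd_commute (A : Module.End K (VPoly K N V n))
    (h1 : ∀ k i, Commute A (lmul (odd k i) : Module.End K (VPoly K N V n)))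
    (h2 : ∀ i, Commute A (Sx M n i : Module.End K (VPoly K N V n))) (p : Fin (n + 1) × Fin N) :
    Commute A (lastOdd M n p) := by
  obtain ⟨k, i⟩ := p
  refine Fin.lastCases ?_ (fun k => ?_) k
  · simp only [lastOdd, Fin.lastCases_last]
    exact (commute_last (F := K) (W := VPoly K N V n)
      (Commute.sum_right _ _ _ fun k _ => h1 k i).symm.eq (h2 i).symm.eq).symm
  · simpa only [lastOdd, Fin.lastCases_castSucc] using h1 k i

theorem lastOdd_anticomm (A : Module.End K (VPoly K N V n))
    (h1 : ∀ k i, A * (lmul (odd k i) : Module.End K (VPoly K N V n)) + lmul (odd k i) * A = 0)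
    (h2 : ∀ i, A * (Sx M n i : Module.End K (VPoly K N V n)) + Sx M n i * A = 0)
    (p : Fin (n + 1) × Fin N) : A * lastOdd M n p + lastOdd M n p * A = 0 := by
  obtain ⟨k, i⟩ := p
  refine Fin.lastCases ?_ (fun k => ?_) k
  · simp only [lastOdd, Fin.lastCases_last]
    have h3 : A * (∑ k, (lmul (odd k i) : Module.End K (VPoly K N V n))) +
        (∑ k, (lmul (odd k i) : Module.End K (VPoly K N V n))) * A = 0 := by
      rw [Finset.mul_sum, Finset.sum_mul, ← Finset.sum_add_distrib]
      exact Finset.sum_eq_zero fun k _ => h1 k i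
    exact anticomm_last (F := K) (W := VPoly K N V n) h3 (h2 i)
  · simpa only [lastOdd, Fin.lastCases_castSucc] using h1 k i

theorem last_superCommute (n : ℕ) : SuperCommute (lastEven M n) (lastOdd M n) where
  tt k l := by
    refine lastEven_comm M _ (fun k => ?_) ?_ k
    · refine (lastEven_comm M _ (fun l => ?_) ?_ l).symm
      · exact LinearMap.ext fun x => lmul_lam_comm l _ x
      · exact LinearMap.ext fun x => Tx_lmul M _ x
    · refine (lastEven_comm M _ (fun l => ?_) ?_ l).symm
      · exact LinearMap.ext fun x => (Tx_lmul M _ x).symm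
      · exact LinearMap.ext fun x => rfl
  ts k p := by
    refine lastEven_comm M _ (fun k => ?_) ?_ k
    · refine lastOdd_commute M _ (fun l i => ?_) (fun i => ?_) p
      · exact LinearMap.ext fun x => lmul_lam_comm k _ x
      · refine LinearMap.ext fun x => ?_
        have := Sx_lmul M i (lam k) x
        rw [lam, inv_evn] at this
        exact this.symm
    · refine lastOdd_commute M _ (fun l i => ?_) (fun i => ?_) p
      · exact LinearMap.ext fun x => Tx_lmul M _ x
      · exact LinearMap.ext fun x => Tx_Sx M i x
  ss p q := by
    refine lastOdd_anticomm M _ (fun l j => ?_) (fun j => ?_) q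
    · rw [add_comm]
      refine lastOdd_anticomm M _ (fun k i => ?_) (fun i => ?_) p
      · exact LinearMap.ext fun x => lmul_anticomm _ _ _ _ x
      · refine LinearMap.ext fun x => ?_
        change lmul (odd l j) (Sx M n i x) + Sx M n i (lmul (odd l j) x) = 0
        rw [Sx_lmul, inv_odd, map_neg, LinearMap.neg_apply, add_neg_cancel]
    · rw [add_comm]
      refine lastOdd_anticomm M _ (fun k i => ?_) (fun i => ?_) p
      · refine LinearMap.ext fun x => ?_
        change Sx M n j (lmul (odd k i) x) + lmul (odd k i) (Sx M n j x) = 0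
        rw [Sx_lmul, inv_odd, map_neg, LinearMap.neg_apply, neg_add_cancel]
      · exact LinearMap.ext fun x => Sx_Sx M _ _ x

variable [CharZero K]

/-- `a(Λ_1, …, Λ_{n+1}) ⊗ v ↦ a(Λ_1, …, Λ_n, -Λ_1 - ⋯ - Λ_n - ∇) v` on
`V[Λ_k]_{k=1}^{n+1}`. -/
def elimPoly (n : ℕ) : VPoly K N V (n + 1) →ₗ[K] VPoly K N V n :=
  TensorProduct.lift
    ((evalHom (lastEven M n) (lastOdd M n) (last_superCommute M n)).toLinearMap.compl₂
      (TensorProduct.mk K (SPoly K N n) V 1))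

theorem elimPoly_tmul (a : SPoly K N (n + 1)) (v : V) :
    elimPoly M n (a ⊗ₜ v) =
      evalHom (lastEven M n) (lastOdd M n) (last_superCommute M n) a (1 ⊗ₜ v) := rfl

/-- The isomorphism `V_∇[Λ_k]_{k=1}^{n+1} → V[Λ_k]_{k=1}^n`,
`a(Λ_1, …, Λ_{n+1}) ⊗ v ↦ a(Λ_1, …, Λ_n, -Λ_1 - ⋯ - Λ_n - ∇) v`; the image of `X` is
written `X_{Λ_1, …, Λ_n, -Λ_1 - ⋯ - Λ_n - ∇}`. -/
def elim (n : ℕ) : VNabla M (n + 1) →ₗ[K] VPoly K N V n :=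
  (nablaRel M (n + 1)).liftQ (elimPoly M n) <| nablaRel_le M
    (fun a v => by
      have e : evalHom (lastEven M n) (lastOdd M n) (last_superCommute M n)
          (-∑ k, lam k : SPoly K N (n + 1)) = Tx M n := by
        simp only [map_neg, map_sum, lam, evalHom_evn]
        rw [Fin.sum_univ_castSucc]
        simp only [lastEven, Fin.lastCases_last, Fin.lastCases_castSucc, lam]
        exact neg_add_last (F := K) (W := VPoly K N V n) _ _
      rw [LinearMap.mem_ker, map_sub, elimPoly_tmul, elimPoly_tmul, map_mul, e]
      simp [Tx])
    (fun a v i => by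
      have e : evalHom (lastEven M n) (lastOdd M n) (last_superCommute M n)
          (-∑ k, odd k i : SPoly K N (n + 1)) = Sx M n i := by
        simp only [map_neg, map_sum, evalHom_odd]
        rw [Fin.sum_univ_castSucc]
        simp only [lastOdd, Fin.lastCases_last, Fin.lastCases_castSucc]
        exact neg_add_last (F := K) (W := VPoly K N V n) _ _
      rw [LinearMap.mem_ker, map_sub, elimPoly_tmul, elimPoly_tmul, map_mul, e]
      simp [Sx])

end Modules

section Functions

variable {K : Type*} [Field K] {N : ℕ} {n m n' m' : ℕ}

variable (K) in
/-- The multiplicative set generated by the `z_k - z_l` for `k`, `l` in distinct blocks of the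
partition of `[n]` into the fibres of `b`. -/
def poles (b : Fin n → Fin m) : Submonoid (MvPolynomial (Fin n) K) :=
  Submonoid.closure {p | ∃ k l, b k ≠ b l ∧ p = MvPolynomial.X k - MvPolynomial.X l}

variable (K) in
/-- `K[z_1, …, z_n]` with the `z_k - z_l`, `b k ≠ b l`, inverted. -/
abbrev Loc (b : Fin n → Fin m) : Type _ := Localization (poles K b)

/-- The coordinate `z_k`. -/
def zc (b : Fin n → Fin m) (k : Fin n) : Loc K b :=
  algebraMap (MvPolynomial (Fin n) K) (Loc K b) (MvPolynomial.X k)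

theorem zc_sub_isUnit {b : Fin n → Fin m} {k l : Fin n} (h : b k ≠ b l) :
    IsUnit (zc (K := K) b k - zc b l) := by
  rw [zc, zc, ← map_sub]
  exact IsLocalization.map_units (Loc K b)
    (⟨_, Submonoid.subset_closure ⟨k, l, h, rfl⟩⟩ : poles K b)

/-- The algebra map out of `Loc K b` with `z_k ↦ a_k`. -/
def locLift {A : Type*} [CommRing A] [Algebra K A] (b : Fin n → Fin m) (a : Fin n → A)
    (h : ∀ k l, b k ≠ b l → IsUnit (a k - a l)) : Loc K b →ₐ[K] A :=
  IsLocalization.liftAlgHom (M := poles K b) (f := MvPolynomial.aeval a) <| by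
    rintro ⟨p, hp⟩
    induction hp using Submonoid.closure_induction with
    | mem x hx =>
      obtain ⟨k, l, hkl, rfl⟩ := hx
      simpa using h k l hkl
    | one => simp
    | mul x y _ _ hx hy => simpa using hx.mul hy

theorem locLift_zc {A : Type*} [CommRing A] [Algebra K A] (b : Fin n → Fin m) (a : Fin n → A)
    (h : ∀ k l, b k ≠ b l → IsUnit (a k - a l)) (k : Fin n) : locLift (K := K) b a h (zc b k) = a k := by
  simp [locLift, zc]

theorem loc_hom_ext {A : Type*} [CommRing A] [Algebra K A] (b : Fin n → Fin m)
    {f g : Loc K b →ₐ[K] A} (h : ∀ k, f (zc b k) = g (zc b k)) : f = g := by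
  refine IsLocalization.algHom_ext (poles K b) ?_
  exact MvPolynomial.algHom_ext h

/-- The algebra map from `Loc K b` to its dual numbers with `z_l ↦ z_l + δ_{kl} ε`. -/
def locDual (b : Fin n → Fin m) (k : Fin n) : Loc K b →ₐ[K] DualNumber (Loc K b) :=
  locLift (A := DualNumber (Loc K b)) b
    (fun l => TrivSqZeroExt.inl (zc b l) + TrivSqZeroExt.inr (Pi.single k 1 l)) <| by
    intro i j hij
    refine TrivSqZeroExt.isUnit_iff_isUnit_fst.mpr ?_
    simpa using zc_sub_isUnit hij

theorem locDual_fst (b : Fin n → Fin m) (k : Fin n) (x : Loc K b) :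
    (locDual b k x).fst = x := by
  have h : (TrivSqZeroExt.fstHom K (Loc K b) (Loc K b)).comp (locDual b k) =
      AlgHom.id K (Loc K b) := loc_hom_ext b fun l => by simp [locDual, locLift_zc]
  exact DFunLike.congr_fun h x

/-- The derivation `∂/∂z_k` of `Loc K b`. -/
def pdLoc (b : Fin n → Fin m) (k : Fin n) : Derivation K (Loc K b) (Loc K b) :=
  Derivation.mk' (TrivSqZeroExt.sndHom (Loc K b) (Loc K b) |>.restrictScalars K |>.comp
      (locDual b k).toLinearMap) fun x y => by
    simp [locDual_fst, mul_comm]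

theorem pdLoc_zc (b : Fin n → Fin m) (k l : Fin n) :
    pdLoc (K := K) b k (zc b l) = if l = k then 1 else 0 := by
  by_cases h : l = k <;> simp [pdLoc, locDual, locLift_zc, Pi.single_apply, h]

theorem loc_derivation_ext (b : Fin n → Fin m) (D : Derivation K (Loc K b) (Loc K b))
    (h : ∀ k, D (zc b k) = 0) (x : Loc K b) : D x = 0 := by
  have h0 : ∀ p : MvPolynomial (Fin n) K, D (algebraMap _ (Loc K b) p) = 0 := fun p => by
    induction p using MvPolynomial.induction_on with
    | C c =>
      rw [← MvPolynomial.algebraMap_eq, ← IsScalarTower.algebraMap_apply, D.map_algebraMap]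
    | add p q hp hq => rw [map_add, map_add, hp, hq, add_zero]
    | mul_X p k hp => rw [map_mul, D.leibniz, hp, show D (algebraMap _ _ (MvPolynomial.X k)) = 0
        from h k, smul_zero, smul_zero, add_zero]
  obtain ⟨p, s, rfl⟩ := IsLocalization.exists_mk'_eq (poles K b) x
  have h1 : IsLocalization.mk' (Loc K b) p s * algebraMap _ (Loc K b) (s : MvPolynomial (Fin n) K) =
      algebraMap _ (Loc K b) p := IsLocalization.mk'_spec _ _ _
  have h2 := congrArg D h1
  rw [D.leibniz, h0, h0, smul_zero, zero_add, smul_eq_mul] at h2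
  exact (IsLocalization.map_units (Loc K b) s).mul_right_eq_zero.mp h2

theorem pdLoc_comm (b : Fin n → Fin m) (k l : Fin n) (x : Loc K b) :
    pdLoc b k (pdLoc b l x) = pdLoc b l (pdLoc b k x) := by
  have h := loc_derivation_ext b ⁅pdLoc (K := K) b k, pdLoc b l⁆ (fun j => by
    rw [Derivation.commutator_apply, pdLoc_zc, pdLoc_zc]
    split_ifs <;> simp) x
  rwa [Derivation.commutator_apply, sub_eq_zero] at h

variable (K N) in
/-- The superalgebra `K[Z_k]_{k=1}^n[(z_k - z_l)^{-1} : b k ≠ b l]` in the supervariables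
`Z_k = (z_k, ζ_k^1, …, ζ_k^N)`. For `b = id` this is `O_n^⋆`. -/
abbrev OB (b : Fin n → Fin m) : Type _ := SAlg K N (Loc K b) n

/-- `z_{k,l} = z_k - z_l`. -/
def zz (b : Fin n → Fin m) (k l : Fin n) : OB K N b := evn (zc b k - zc b l)

/-- `z_{k,l}^{-1}`, used only when `b k ≠ b l`. -/
def zi (b : Fin n → Fin m) (k l : Fin n) : OB K N b := evn (Ring.inverse (zc b k - zc b l))

/-- `ζ_{k,l}^i = ζ_k^i - ζ_l^i`. -/
def ze (b : Fin n → Fin m) (k l : Fin n) (i : Fin N) : OB K N b := odd k i - odd l i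

variable (K N) in
/-- The subalgebra of `OB K N b` generated by the `z_{k,l}`, the `ζ_{k,l}^i` and the
`z_{k,l}^{-1}` with `b k ≠ b l`. For `b = id` this is `O_n^{⋆T}`; in general it consists of the
elements of `O_n^{⋆T}` without poles at `z_k = z_l` for `b k = b l`. -/
def OBT (b : Fin n → Fin m) : Subalgebra K (OB K N b) :=
  Algebra.adjoin K ({x | ∃ k l, x = zz b k l} ∪ {x | ∃ k l, b k ≠ b l ∧ x = zi b k l} ∪
    {x | ∃ k l i, x = ze b k l i})

variable {b : Fin n → Fin m}

theorem zz_mem (k l : Fin n) : zz b k l ∈ OBT K N b :=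
  Algebra.subset_adjoin (Or.inl (Or.inl ⟨k, l, rfl⟩))

theorem zi_mem {k l : Fin n} (h : b k ≠ b l) : zi b k l ∈ OBT K N b :=
  Algebra.subset_adjoin (Or.inl (Or.inr ⟨k, l, h, rfl⟩))

theorem ze_mem (k l : Fin n) (i : Fin N) : ze b k l i ∈ OBT K N b :=
  Algebra.subset_adjoin (Or.inr ⟨k, l, i, rfl⟩)

theorem OBT_le {A : Subalgebra K (OB K N b)} (h1 : ∀ k l, zz b k l ∈ A)
    (h2 : ∀ k l, b k ≠ b l → zi b k l ∈ A) (h3 : ∀ k l i, ze b k l i ∈ A) : OBT K N b ≤ A := by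
  refine Algebra.adjoin_le ?_
  rintro x ((⟨k, l, rfl⟩ | ⟨k, l, h, rfl⟩) | ⟨k, l, i, rfl⟩)
  exacts [h1 k l, h2 k l h, h3 k l i]

theorem inv_mem {x : OB K N b} (hx : x ∈ OBT K N b) : inv x ∈ OBT K N b := by
  refine OBT_le (A := (OBT K N b).comap inv) (fun k l => ?_) (fun k l h => ?_) (fun k l i => ?_) hx
  · rw [Subalgebra.mem_comap, zz, inv_evn]; exact zz_mem k l
  · rw [Subalgebra.mem_comap, zi, inv_evn]; exact zi_mem h
  · rw [Subalgebra.mem_comap, ze, map_sub, inv_odd, inv_odd, ← neg_sub_neg, neg_neg, neg_neg]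
    exact ze_mem l k i

/-- `∂/∂z_k`. -/
def dz (k : Fin n) : OB K N b →ₗ[K] OB K N b := dEven (pdLoc b k).toLinearMap

theorem dz_mem (k : Fin n) {x : OB K N b} (hx : x ∈ OBT K N b) : dz k x ∈ OBT K N b := by
  induction hx using Algebra.adjoin_induction with
  | mem x hx =>
    obtain (⟨i, j, rfl⟩ | ⟨i, j, h, rfl⟩) | ⟨i, j, a, rfl⟩ := hx
    · rw [dz, zz, dEven_evn]
      change evn (pdLoc b k (zc b i - zc b j)) ∈ _
      rw [map_sub, pdLoc_zc, pdLoc_zc]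
      split_ifs <;> simp [one_mem]
    · have h1 : (zz b i j * zi b i j : OB K N b) = 1 := by
        rw [zz, zi, ← map_mul, Ring.mul_inverse_cancel _ (zc_sub_isUnit h), map_one]
      have h2 : dz k (zz b i j * zi b i j : OB K N b) = 0 := by
        rw [h1, ← map_one evn, dz, dEven_evn]; simp
      rw [dz, dEven_mul] at h2
      have h3 : dz k (zi b i j : OB K N b) = -(zi b i j * dz k (zz b i j) * zi b i j) := by
        have h4 := congrArg (fun x => zi b i j * x) h2
        simp only [mul_zero, mul_add, ← mul_assoc] at h4
        have h5 : (zi b i j * zz b i j : OB K N b) = 1 := by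
          rw [zz, zi, ← map_mul, Ring.inverse_mul_cancel _ (zc_sub_isUnit h), map_one]
        rw [h5, one_mul] at h4
        exact eq_neg_of_add_eq_zero_right h4
      rw [h3]
      refine neg_mem (mul_mem (mul_mem (zi_mem h) ?_) (zi_mem h))
      rw [dz, zz, dEven_evn]
      change evn (pdLoc b k (zc b i - zc b j)) ∈ _
      rw [map_sub, pdLoc_zc, pdLoc_zc]
      split_ifs <;> simp [one_mem]
    · rw [dz, ze, map_sub, dEven_odd, dEven_odd, sub_zero]; exact zero_mem _
  | algebraMap r =>
    rw [Algebra.algebraMap_eq_smul_one, map_smul, ← map_one evn, dz, dEven_evn]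
    simp
  | add x y _ _ hx hy => rw [map_add]; exact add_mem hx hy
  | mul x y hx hy hx' hy' =>
    rw [dz, dEven_mul]
    exact add_mem (mul_mem hx' hy) (mul_mem hx hy')

theorem dOdd_mem (k : Fin n) (i : Fin N) {x : OB K N b} (hx : x ∈ OBT K N b) :
    dOdd k i x ∈ OBT K N b := by
  induction hx using Algebra.adjoin_induction with
  | mem x hx =>
    obtain (⟨_, _, rfl⟩ | ⟨_, _, h, rfl⟩) | ⟨_, _, a, rfl⟩ := hx
    · rw [zz, dOdd_evn]; exact zero_mem _
    · rw [zi, dOdd_evn]; exact zero_mem _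
    · rw [ze, map_sub, dOdd_odd, dOdd_odd]
      split_ifs <;> simp [one_mem]
  | algebraMap r =>
    rw [Algebra.algebraMap_eq_smul_one, map_smul, ← map_one evn, dOdd_evn, smul_zero]
    exact zero_mem _
  | add x y _ _ hx hy => rw [map_add]; exact add_mem hx hy
  | mul x y hx hy hx' hy' =>
    rw [dOdd_mul]
    exact add_mem (mul_mem hx' hy) (mul_mem (inv_mem hx) hy')

/-- The algebra map `f(Z_1, …, Z_n) ↦ f(Z_{c 1}, …, Z_{c n})`. -/
def relabel (b : Fin n → Fin m) (b' : Fin n' → Fin m') (c : Fin n → Fin n')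
    (h : ∀ k l, b k ≠ b l → b' (c k) ≠ b' (c l)) : OB K N b →ₐ[K] OB K N b' :=
  Algebra.TensorProduct.map
    (locLift b (fun k => zc b' (c k)) fun k l hkl => zc_sub_isUnit (h k l hkl))
    (gmap fun k l => if c k = l then 1 else 0)

theorem relabel_evn (b : Fin n → Fin m) (b' : Fin n' → Fin m') (c : Fin n → Fin n')
    (h : ∀ k l, b k ≠ b l → b' (c k) ≠ b' (c l)) (x : Loc K b) :
    relabel (N := N) b b' c h (evn x) = evn
      (locLift b (fun k => zc b' (c k)) (fun k l hkl => zc_sub_isUnit (h k l hkl)) x) := by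
  simp [relabel, evn]

theorem relabel_odd (b : Fin n → Fin m) (b' : Fin n' → Fin m') (c : Fin n → Fin n')
    (h : ∀ k l, b k ≠ b l → b' (c k) ≠ b' (c l)) (k : Fin n) (i : Fin N) :
    relabel (K := K) b b' c h (odd k i) = odd (c k) i := by
  simp [relabel, odd, gmap_ι_single]

theorem relabel_mem (b : Fin n → Fin m) (b' : Fin n' → Fin m') (c : Fin n → Fin n')
    (h : ∀ k l, b k ≠ b l → b' (c k) ≠ b' (c l)) {x : OB K N b} (hx : x ∈ OBT K N b) :
    relabel b b' c h x ∈ OBT K N b' := by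
  refine OBT_le (A := (OBT K N b').comap (relabel b b' c h)) (fun k l => ?_) (fun k l hkl => ?_)
    (fun k l i => ?_) hx
  · rw [Subalgebra.mem_comap, zz, relabel_evn, map_sub, locLift_zc, locLift_zc]
    exact zz_mem _ _
  · rw [Subalgebra.mem_comap, zi, relabel_evn]
    have e : ∀ f : Loc K b →ₐ[K] Loc K b',
        f (Ring.inverse (zc b k - zc b l)) = Ring.inverse (f (zc b k - zc b l)) := fun f => by
      obtain ⟨u, hu⟩ := zc_sub_isUnit (K := K) hkl
      rw [← hu, Ring.inverse_unit]
      exact (Ring.inverse_unit (Units.map (f : Loc K b →* Loc K b') u)).symm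
    rw [e, map_sub, locLift_zc, locLift_zc]
    exact zi_mem (h k l hkl)
  · rw [Subalgebra.mem_comap, ze, map_sub, relabel_odd, relabel_odd]
    exact ze_mem _ _ _

/-- The restriction of `relabel` to translation invariant functions. -/
def relT (b : Fin n → Fin m) (b' : Fin n' → Fin m') (c : Fin n → Fin n')
    (h : ∀ k l, b k ≠ b l → b' (c k) ≠ b' (c l)) : OBT K N b →ₐ[K] OBT K N b' :=
  ((relabel b b' c h).comp (OBT K N b).val).codRestrict _ fun x => relabel_mem b b' c h x.2

/-- `∂/∂z_k` on translation invariant functions. -/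
def dzT (k : Fin n) : OBT K N b →ₗ[K] OBT K N b :=
  (dz k ∘ₗ (OBT K N b).val.toLinearMap).codRestrict (Subalgebra.toSubmodule (OBT K N b))
    fun x => dz_mem k x.2

/-- `∂/∂ζ_k^i` on translation invariant functions. -/
def dzeT (k : Fin n) (i : Fin N) : OBT K N b →ₗ[K] OBT K N b :=
  (dOdd k i ∘ₗ (OBT K N b).val.toLinearMap).codRestrict (Subalgebra.toSubmodule (OBT K N b))
    fun x => dOdd_mem k i x.2

theorem dzT_dzT (k l : Fin n) (x : OBT K N b) : dzT k (dzT l x) = dzT l (dzT k x) := by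
  refine Subtype.ext ?_
  change dz k (dz l (x : OB K N b)) = dz l (dz k (x : OB K N b))
  generalize (x : OB K N b) = y
  induction y using TensorProduct.induction_on with
  | zero => simp
  | add x y hx hy => simp only [map_add, hx, hy]
  | tmul r e => simp [dz, dEven, pdLoc_comm b k l r]

theorem dzT_dzeT (k l : Fin n) (i : Fin N) (x : OBT K N b) :
    dzT k (dzeT l i x) = dzeT l i (dzT k x) := by
  refine Subtype.ext ?_
  change dz k (dOdd l i (x : OB K N b)) = dOdd l i (dz k (x : OB K N b))
  generalize (x : OB K N b) = y
  induction y using TensorProduct.induction_on with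
  | zero => simp
  | add x y hx hy => simp only [map_add, hx, hy]
  | tmul r e => simp [dz, dEven, dOdd]

theorem dzeT_dzeT (k l : Fin n) (i j : Fin N) (x : OBT K N b) :
    dzeT k i (dzeT l j x) + dzeT l j (dzeT k i x) = 0 := by
  refine Subtype.ext ?_
  change dOdd k i (dOdd l j (x : OB K N b)) + dOdd l j (dOdd k i (x : OB K N b)) = 0
  generalize (x : OB K N b) = y
  induction y using TensorProduct.induction_on with
  | zero => simp
  | add x y hx hy =>
    simp only [map_add]
    rw [add_add_add_comm, hx, hy, add_zero]
  | tmul r e =>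
    simp only [dOdd, LinearMap.lTensor_tmul]
    rw [CliffordAlgebra.contractLeft_comm, ← TensorProduct.tmul_add, neg_add_cancel,
      TensorProduct.tmul_zero]

variable (K N) in
/-- `O_n^{⋆T}`. -/
abbrev OT (n : ℕ) : Type _ := OBT K N (id : Fin n → Fin n)

/-- `z_{k,l}` in `O_n^{⋆T}`. -/
def zT (k l : Fin n) : OT K N n := ⟨zz id k l, zz_mem k l⟩

/-- `z_{k,l}^{-1}` in `O_n^{⋆T}`, with the junk value `0` for `k = l`. -/
def ziT (k l : Fin n) : OT K N n :=
  if h : k ≠ l then ⟨zi id k l, zi_mem h⟩ else 0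

/-- `ζ_{k,l}^i` in `O_n^{⋆T}`. -/
def zeT (k l : Fin n) (i : Fin N) : OT K N n := ⟨ze id k l i, ze_mem k l i⟩

/-- `f ∈ O_n^{⋆T}` is homogeneous of parity `p`. -/
def IsPure (p : ZMod 2) (f : OT K N n) : Prop := inv (f : OB K N (id : Fin n → Fin n)) = sgn p • f

end Functions

section Operad

section Abstract

variable {K : Type*} [Field K] {N n : ℕ} {W U : Type*} [AddCommGroup W] [Module K W]
  [AddCommGroup U] [Module K U]

theorem tensor_superCommute (c : ℤ) (α : Fin n → Module.End K W) (β : Fin n × Fin N → Module.End K W)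
    (π : Module.End K W) (δ : Fin n → Module.End K U) (η : Fin n × Fin N → Module.End K U)
    (αα : ∀ k l x, α k (α l x) = α l (α k x)) (αβ : ∀ k p x, α k (β p x) = β p (α k x))
    (ββ : ∀ p q x, β p (β q x) + β q (β p x) = 0) (απ : ∀ k x, α k (π x) = π (α k x))
    (βπ : ∀ p x, π (β p x) = -β p (π x)) (δδ : ∀ k l x, δ k (δ l x) = δ l (δ k x))
    (δη : ∀ k p x, δ k (η p x) = η p (δ k x)) (ηη : ∀ p q x, η p (η q x) + η q (η p x) = 0) :
    SuperCommute (A := Module.End K (W ⊗[K] U))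
      (fun k => TensorProduct.map (α k) LinearMap.id - TensorProduct.map LinearMap.id (δ k))
      (fun p => TensorProduct.map (β p) LinearMap.id - c • TensorProduct.map π (η p)) where
  tt k l := by
    refine TensorProduct.ext' fun w u => ?_
    simp only [Module.End.mul_apply, LinearMap.sub_apply, map_sub, TensorProduct.map_tmul,
      LinearMap.id_apply, αα k l, δδ k l]
    abel
  ts k p := by
    refine TensorProduct.ext' fun w u => ?_
    simp only [Module.End.mul_apply, LinearMap.sub_apply, map_sub, TensorProduct.map_tmul,
      LinearMap.id_apply, αβ k p, δη k p, απ k, LinearMap.smul_apply, map_zsmul, smul_sub]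
    abel
  ss p q := by
    refine TensorProduct.ext' fun w u => ?_
    have h1 : β p (β q w) = -β q (β p w) := eq_neg_of_add_eq_zero_left (ββ p q w)
    have h2 : η p (η q u) = -η q (η p u) := eq_neg_of_add_eq_zero_left (ηη p q u)
    simp only [Module.End.mul_apply, LinearMap.sub_apply, map_sub, TensorProduct.map_tmul,
      LinearMap.id_apply, LinearMap.smul_apply, map_zsmul, smul_sub, LinearMap.add_apply, βπ,
      h1, h2, TensorProduct.neg_tmul, TensorProduct.tmul_neg, smul_neg, LinearMap.zero_apply]
    abel

end Abstract

variable {K : Type*} [Field K] {N : ℕ} {V : Type*} [AddCommGroup V] [Module K V]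
  (M : HWSupermodule K N V) {n m : ℕ}

/-- Linear maps `V^{⊗ n} ⊗ O_n^{⋆T} → V_∇[Λ_k]_{k=1}^n`, as multilinear maps in the `n` vectors
with values in linear maps on `O_n^{⋆T}`. -/
abbrev Op (n : ℕ) : Type _ :=
  MultilinearMap K (fun _ : Fin n => V) (OT K N n →ₗ[K] VNabla M n)

/-- The `D_n^T`-linear maps `V^{⊗ n} ⊗ O_n^{⋆T} → V_∇[Λ_k]_{k=1}^n`: the conditions express
compatibility with the right actions of the generators `z_{k,l}`, `ζ_{k,l}^i`, `∂_{z_k}`,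
`∂_{ζ_k^i}` of `D_n^T`. -/
structure IsChiral (X : Op M n) : Prop where
  mul_z : ∀ v f k l, X v (f * zT k l) = nDlam M l k (X v f)
  mul_ζ : ∀ v f k l i, X v (f * zeT k l i) = nDodd M k l i (nPar M n (X v f))
  d_z : ∀ v f k,
    X (Function.update v k (M.T (v k))) f - X v (dzT k f) = -nMul M (lam k) (X v f)
  d_ζ : ∀ (ε : Fin n → ZMod 2) (v : Fin n → V), (∀ j, v j ∈ M.deg (ε j)) →
    ∀ q f, IsPure q f → ∀ k i,
      sgn ((∑ j, ε j) + q) • sgn (∑ j ∈ Finset.univ.filter (· < k), ε j) •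
          X (Function.update v k (M.S i (v k))) f
        - sgn q • X v (dzeT k i f) = -nMul M (odd k i) (nPar M n (X v f))

variable (n) in
/-- The arity `n` component `P^{ch,W}_V(n)` of the chiral operad. -/
def Pch : Set (Op M n) := {X | IsChiral M X}

/-- `X` is homogeneous of parity `p` as a linear map of superspaces. -/
def HasParity (p : ZMod 2) (X : Op M n) : Prop :=
  ∀ (ε : Fin n → ZMod 2) (v : Fin n → V), (∀ j, v j ∈ M.deg (ε j)) → ∀ q f, IsPure q f →
    nPar M n (X v f) = sgn (p + (∑ j, ε j) + q) • X v f

/-- The right action `X ↦ X^σ` of the symmetric group,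
`X^σ(v_1 ⊗ ⋯ ⊗ v_n ⊗ f) = ± X_{σ(Λ_1, …, Λ_n)}(v_{σ⁻¹(1)} ⊗ ⋯ ⊗ v_{σ⁻¹(n)} ⊗ σ f)`, with the sign
`∏_{k < l, σ(k) > σ(l)} (-1)^{p(v_k) p(v_l)}`. The sum runs over the homogeneous components of the
vectors `v_k`. -/
def act (σ : Equiv.Perm (Fin n)) (X : Op M n) : Op M n :=
  ∑ ε : Fin n → ZMod 2,
    sgn (∑ q ∈ Finset.univ.filter (fun q : Fin n × Fin n => q.1 < q.2 ∧ σ q.2 < σ q.1),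
        ε q.1 * ε q.2) •
      ((LinearMap.lcomp K (VNabla M n) (relT id id σ fun _ _ h => σ.injective.ne h).toLinearMap ∘ₗ
          LinearMap.compRight K (nSubst M σ)).compMultilinearMap
        (X.compLinearMap fun j => M.proj (ε (σ⁻¹ j)))).domDomCongr σ⁻¹

/-- The map `[m + 1 + n] → [n + 1]` contracting the first `m + 1` points to the first point. -/
def block (m n : ℕ) : Fin (m + 1 + n) → Fin (n + 1) := Fin.addCases (fun _ => 0) Fin.succ

/-- The `k`-th of the first `m` among `m + 1 + n` points. -/
def pt (m n : ℕ) (k : Fin m) : Fin (m + 1 + n) := Fin.castAdd n k.castSucc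

variable (K N) in
/-- The superspace of translation invariant functions of `m + 1 + n` supervariables that are
regular at `z_k = z_l` for `k, l ≤ m + 1`. -/
def OReg (m n : ℕ) : Type _ := OBT K N (block m n)

instance (m n : ℕ) : AddCommGroup (OReg K N m n) := inferInstanceAs (AddCommGroup (OBT K N _))

instance (m n : ℕ) : Module K (OReg K N m n) := inferInstanceAs (Module K (OBT K N _))

/-- `∂/∂z_k` on `OReg K N m n`. -/
def dzR (m n : ℕ) (k : Fin (m + 1 + n)) : OReg K N m n →ₗ[K] OReg K N m n :=
  dzT (b := block m n) k

/-- `∂/∂ζ_k^i` on `OReg K N m n`. -/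
def dzeR (m n : ℕ) (k : Fin (m + 1 + n)) (i : Fin N) : OReg K N m n →ₗ[K] OReg K N m n :=
  dzeT (b := block m n) k i

variable (K N V) in
/-- `V[Λ_k]_{k=1}^m`, as a type of its own. -/
def VP (m : ℕ) : Type _ := VPoly K N V m

instance (m : ℕ) : AddCommGroup (VP K N V m) := inferInstanceAs (AddCommGroup (VPoly K N V m))

instance (m : ℕ) : Module K (VP K N V m) := inferInstanceAs (Module K (VPoly K N V m))

/-- The left multiplication by `a` on `V[Λ_k]_{k=1}^m`. -/
def lmulP (a : SPoly K N m) : VP K N V m →ₗ[K] VP K N V m := lmul (V := V) a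

/-- The parity involution of `V[Λ_k]_{k=1}^m`. -/
def parP (m : ℕ) : VP K N V m →ₗ[K] VP K N V m := parx M m

variable (K N V) in
/-- The superspace `V[Λ_k]_{k=1}^m ⊗ O` on which the operators `Λ_k - ∂_{Z_k}` act. -/
abbrev GSpace (m n : ℕ) : Type _ := VP K N V m ⊗[K] OReg K N m n

/-- The even parts `λ_k - ∂_{z_k}` of the operators `Γ_k = Λ_k - ∂_{Z_k}`, `k ∈ [m]`, on
`V[Λ_k]_{k=1}^m ⊗ O`. -/
def gamEven (m n : ℕ) (k : Fin m) :
    Module.End K (GSpace K N V m n) :=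
  TensorProduct.map (lmulP (lam k)) LinearMap.id -
    TensorProduct.map LinearMap.id (dzR m n (pt m n k))

/-- The odd parts `θ_k^i - ∂_{ζ_k^i}` of the operators `Γ_k = Λ_k - ∂_{Z_k}`, `k ∈ [m]`, on
`V[Λ_k]_{k=1}^m ⊗ O`. Here `∂_{ζ_k^i}` passes the element of `V[Λ_k]_{k=1}^m` and further vectors
of total parity `q` that stand between this element and the function, which gives the sign. -/
def gamOdd (m n : ℕ) (q : ZMod 2) (p : Fin m × Fin N) :
    Module.End K (GSpace K N V m n) :=
  TensorProduct.map (lmulP (odd p.1 p.2)) LinearMap.id -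
    sgn q • TensorProduct.map (parP M m) (dzeR m n (pt m n p.1) p.2)

theorem parx_lmul (a : SPoly K N m) (x : VPoly K N V m) :
    parx M m (lmul a x) = lmul (inv a) (parx M m x) := by
  induction x using TensorProduct.induction_on with
  | zero => simp
  | tmul c v => simp [parx, lmul_tmul]
  | add x y hx hy => simp only [map_add, hx, hy]

theorem gam_superCommute (m n : ℕ) (q : ZMod 2) :
    SuperCommute (gamEven (K := K) (N := N) (V := V) m n) (gamOdd M m n q) :=
  tensor_superCommute (sgn q) (fun k => lmulP (lam k)) (fun p => lmulP (odd p.1 p.2)) (parP M m)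
    (fun k => dzR m n (pt m n k)) (fun p => dzeR m n (pt m n p.1) p.2)
    (fun k l x => lmul_lam_comm (V := V) k _ x) (fun k p x => lmul_lam_comm (V := V) k _ x)
    (fun p q x => lmul_anticomm (V := V) _ _ _ _ x)
    (fun k x => by
      have h := parx_lmul M (lam k) x
      rw [lam, inv_evn] at h
      exact h.symm)
    (fun p x => by
      have h := parx_lmul M (odd p.1 p.2) x
      rw [inv_odd, map_neg, LinearMap.neg_apply] at h
      exact h)
    (fun k l x => dzT_dzT (b := block m n) _ _ x) (fun k p x => dzT_dzeT (b := block m n) _ _ _ x)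
    (fun p q x => dzeT_dzeT (b := block m n) _ _ _ _ x)

/-- `h ↦ (g ↦ h(g|)|_{Λ_j = Λ'_j})`, where `Λ'_1 = Λ_1 + ⋯ + Λ_{m+1}`, `Λ'_{j+1} = Λ_{m+1+j}` and
`g|` is the restriction of `g` to `Z_1 = ⋯ = Z_{m+1}`. -/
def pull (m n : ℕ) : (OT K N (n + 1) →ₗ[K] VNabla M (n + 1)) →ₗ[K]
    (OReg K N m n →ₗ[K] VNabla M (m + 1 + n)) :=
  LinearMap.lcomp K (VNabla M (m + 1 + n))
      ((relT (block m n) id (block m n) fun _ _ h => h).toLinearMap :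
        OReg K N m n →ₗ[K] OT K N (n + 1)) ∘ₗ
    LinearMap.compRight K (nSubst M (block m n))

/-- `a v ⊗ g ↦ ± a X_{Λ'_1, …, Λ'_{n+1}}(v ⊗ v_1 ⊗ ⋯ ⊗ v_n ⊗ g|)` for `X` of parity `p`, where
`Λ'_1 = Λ_1 + ⋯ + Λ_{m+1}`, `Λ'_{j+1} = Λ_{m+1+j}`, the function `g` is restricted to
`Z_1 = ⋯ = Z_{m+1}`, and the sign is `(-1)^{p(a) p}`. -/
def applyX (m : ℕ) (p : ZMod 2) (X : Op M (n + 1)) (v : Fin n → V) :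
    GSpace K N V m n →ₗ[K] VNabla M (m + 1 + n) :=
  TensorProduct.lift
    (TensorProduct.lift
      ((LinearMap.llcomp K (OReg K N m n) (VNabla M (m + 1 + n)) (VNabla M (m + 1 + n)) ∘ₗ
        nMulₗ M ∘ₗ (subst fun k l => if l = pt m n k then 1 else 0).toLinearMap ∘ₗ
          (invPow p).toLinearMap).compl₂ (pull M m n ∘ₗ X.toLinearMap (Fin.cons 0 v) 0)) :
      VPoly K N V m →ₗ[K] OReg K N m n →ₗ[K] VNabla M (m + 1 + n))

variable [CharZero K]

/-- `a(Λ_1, …, Λ_m) v ↦ a(Λ_1 - ∂_{Z_1}, …, Λ_m - ∂_{Z_m}) v ⊗ g`. -/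
def gamEval (m n : ℕ) (q : ZMod 2) (g : OReg K N m n) : VPoly K N V m →ₗ[K] GSpace K N V m n :=
  TensorProduct.lift
    ((evalHom (gamEven m n) (gamOdd M m n q) (gam_superCommute M m n q)).toLinearMap.compl₂
      ((TensorProduct.mk K (VP K N V m) (OReg K N m n)).flip g ∘ₗ
        (TensorProduct.mk K (SPoly K N m) V 1 : V →ₗ[K] VP K N V m)))

/-- `Z` is the partial composition `X ∘_1 Y = X ∘ (Y ⊙ id ⊙ ⋯ ⊙ id)`, where `X` has parity `p`:
for every function `f_0 f_1` with `f_0` regular at `z_k = z_l` for `k, l ≤ m + 1` and `f_1` a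
product of elements `z_{k,l}^{-1}` with `k < l ≤ m + 1`, the value `Z(w ⊗ v ⊗ f_0 f_1)` is obtained
by applying `X_{Λ'}` to `Y_{Γ_1, …, Γ_m}(w ⊗ f_1) ⊗ v ⊗ f_0|`. -/
def IsCompOne (p : ZMod 2) (X : Op M (n + 1)) (Y : Op M (m + 1)) (Z : Op M (m + 1 + n)) : Prop :=
  ∀ (w : Fin (m + 1) → V) (ε : Fin n → ZMod 2) (v : Fin n → V), (∀ j, v j ∈ M.deg (ε j)) →
    ∀ (f₀ : OBT K N (block m n)), ∀ f₁ ∈ Submonoid.closure {x : OT K N (m + 1) |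
        ∃ k l, k < l ∧ x = ziT k l},
      Z (Fin.append w v)
          (relT (block m n) id id (fun _ _ h h' => h (congrArg _ h')) f₀ *
            relT id id (Fin.castAdd n) (fun _ _ h => (Fin.castAdd_injective _ n).ne h) f₁) =
        applyX M m p X v (gamEval M m n (∑ j, ε j) f₀ (elim M m (Y w f₁)))

/-- The partial composition `X ∘_1 Y`, where `X` has parity `p`: the operation that
`IsCompOne` characterises. -/
def compOne (p : ZMod 2) (X : Op M (n + 1)) (Y : Op M (m + 1)) : Op M (m + 1 + n) :=
  Classical.epsilon (IsCompOne M p X Y)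

/-- The `(k, l)`-shuffles. -/
def shuffles (k l : ℕ) : Finset (Equiv.Perm (Fin (k + l))) :=
  Finset.univ.filter fun σ =>
    (∀ i j : Fin k, i < j → σ (Fin.castAdd l i) < σ (Fin.castAdd l j)) ∧
      ∀ i j : Fin l, i < j → σ (Fin.natAdd k i) < σ (Fin.natAdd k j)

/-- `X □ Y = ∑_σ (X ∘_1 Y)^{σ⁻¹}`, summed over the `(m + 1, n)`-shuffles, for `X` of parity `p`. -/
def box (p : ZMod 2) (X : Op M (n + 1)) (Y : Op M (m + 1)) : Op M (m + 1 + n) :=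
  ∑ σ ∈ shuffles (m + 1) n, act M σ⁻¹ (compOne M p X Y)

variable (n) in
/-- The degree `n` part `P(n + 1)^{S_{n+1}}` of the Lie superalgebra of the operad. -/
def LP : Set (Op M (n + 1)) := {X | X ∈ Pch M (n + 1) ∧ ∀ σ, act M σ X = X}

/-- The odd Maurer-Cartan elements. -/
def MCodd : Set (Op M 2) := {X | X ∈ LP M 1 ∧ HasParity M 1 X ∧ box M (n := 1) (m := 1) 1 X X = 0}

end Operad

section VertexAlgebra

variable {K : Type*} [Field K] {N : ℕ} {V W : Type*} [AddCommGroup V] [Module K V]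
  [AddCommGroup W] [Module K W]

variable (K N) in
/-- The coefficient of `θ^1 θ^2 ⋯ θ^N`, computed as `∂_{θ^N} ⋯ ∂_{θ^1}`. -/
def topCoeff : Grass K N 1 →ₗ[K] K :=
  ExteriorAlgebra.algebraMapInv.toLinearMap ∘ₗ
    ((List.ofFn fun i : Fin N => (CliffordAlgebra.contractLeft (LinearMap.proj (0, i)) :
      Module.End K (Grass K N 1))).reverse.prod : Module.End K (Grass K N 1))

/-- The linear map `V[Λ] → W` with `Λ^{m|I} v ↦ δ_{I,[N]} φ_m(v)`. -/
def coefMap (φ : ℕ → V →ₗ[K] W) : VPoly K N V 1 →ₗ[K] W :=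
  TensorProduct.lift (TensorProduct.lift
    ((LinearMap.lsmul K (V →ₗ[K] W) ∘ₗ topCoeff K N).flip ∘ₗ
      (MvPolynomial.basisMonomials (Fin 1) K).constr K fun s => φ (s 0)))

/-- `x ↦ Res_Λ(λ^{-1} x)`, that is, `Λ^{m|I} v ↦ δ_{m,0} δ_{I,[N]} v`. -/
def resInv : VPoly K N V 1 →ₗ[K] V := coefMap fun m => if m = 0 then LinearMap.id else 0

/-- `∫_F^G dΛ : V[Λ] → V`, `Λ^{m|I} v ↦ δ_{I,[N]} (G^{m+1} v - F^{m+1} v) / (m + 1)`. -/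
def integ (F G : Module.End K V) : VPoly K N V 1 →ₗ[K] V :=
  coefMap fun m => ((m : K) + 1)⁻¹ • (G ^ (m + 1) - F ^ (m + 1))

/-- `∫_F^G dΛ a : V[Λ] → V` with respect to a product `μ` on `V`,
`Λ^{m|I} v ↦ (∫_F^G dΛ Λ^{m|I} a) v`. -/
def integMul (μ : V →ₗ[K] V →ₗ[K] V) (F G : Module.End K V) (a : V) : VPoly K N V 1 →ₗ[K] V :=
  coefMap fun m => μ (((m : K) + 1)⁻¹ • ((G ^ (m + 1)) a - (F ^ (m + 1)) a))

/-- `∫_0^λ dΓ : V[Γ] → V[Λ]`, `Γ^{m|I} v ↦ δ_{I,[N]} λ^{m+1} v / (m + 1)`. -/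
def integLam : VPoly K N V 1 →ₗ[K] VPoly K N V 1 :=
  coefMap fun m => ((m : K) + 1)⁻¹ • TensorProduct.mk K (SPoly K N 1) V (lam 0 ^ (m + 1))

/-- The substitution `Λ ↦ A_1 Λ_1 + A_2 Λ_2` from `V[Λ]` to `V[Λ_1, Λ_2]`. -/
def substV (A : Fin 2 → K) : VPoly K N V 1 →ₗ[K] VPoly K N V 2 :=
  (subst fun _ => A).toLinearMap.rTensor V

/-- For `g : V → V[Λ]` the map `V[Λ] → V[Λ_1, Λ_2]`,
`γ(Λ) u ↦ (-1)^{p(γ) p} γ(B_1 Λ_1 + B_2 Λ_2) g(u)|_{Λ = A_1 Λ_1 + A_2 Λ_2}`. -/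
def nest (A B : Fin 2 → K) (p : ZMod 2) (g : V →ₗ[K] VPoly K N V 1) :
    VPoly K N V 1 →ₗ[K] VPoly K N V 2 :=
  TensorProduct.lift
    ((lmul ∘ₗ (subst fun _ => B).toLinearMap ∘ₗ (invPow p).toLinearMap).compl₂ (substV A ∘ₗ g))

/-- For a bracket `V ⊗ V → V[Γ]`, written `br`, and `c : V` the map `V[Λ] → V[Λ]`,
`x ↦ ∫_0^λ dΓ [x_Γ c]`. If `x = Λ^{m|I} u` and `[u_Γ c] = ∑ Γ^{k|J} d_{k,J}`, then
`[x_Γ c] = (-1)^{N #I} Λ^{m|I} [u_Γ c] = ∑ (-1)^{N #I + #I #J} Γ^{k|J} Λ^{m|I} d_{k,J}`;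
only `J = [N]` contributes, where the two signs cancel. -/
def integBr (br : V →ₗ[K] V →ₗ[K] VPoly K N V 1) (c : V) : VPoly K N V 1 →ₗ[K] VPoly K N V 1 :=
  TensorProduct.lift (lmul.compl₂ (integLam ∘ₗ br.flip c))

variable [CharZero K] (M : HWSupermodule K N V)

/-- `a(Λ) v ↦ a(-Λ-∇) v` on `V[Λ]`. -/
def negNabla : VPoly K N V 1 →ₗ[K] VPoly K N V 1 := elimPoly M 1 ∘ₗ substV ![0, 1]

/-- `[·_Λ ·]`, written `br`, makes `(V, ∇)` an `N_W = N` SUSY Lie conformal algebra. -/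
structure IsLCA (br : V →ₗ[K] V →ₗ[K] VPoly K N V 1) : Prop where
  parity : ∀ p q, ∀ a ∈ M.deg p, ∀ b ∈ M.deg q,
    parx M 1 (br a b) = sgn (p + q + N) • br a b
  T_left : ∀ a b, br (M.T a) b = -lmul (lam 0) (br a b)
  T_right : ∀ a b, br a (M.T b) = lmul (lam 0) (br a b) + Tx M 1 (br a b)
  S_left : ∀ i a b, br (M.S i a) b = -(sgn N • lmul (odd 0 i) (br a b))
  S_right : ∀ i p, ∀ a ∈ M.deg p, ∀ b,
    br a (M.S i b) = sgn (p + N) • (lmul (odd 0 i) (br a b) + Sx M 1 i (br a b))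
  skew : ∀ p q, ∀ a ∈ M.deg p, ∀ b ∈ M.deg q,
    br b a = -(sgn (p * q + N) • negNabla M (br a b))
  jacobi : ∀ p q, ∀ a ∈ M.deg p, ∀ b ∈ M.deg q, ∀ c,
    nest ![1, 0] ![0, 1] (p + N) (br a) (br b c) =
      sgn ((p + N) * N) • nest ![1, 1] ![1, 0] N (br.flip c) (br a b) +
        sgn ((p + N) * (q + N)) • nest ![0, 1] ![1, 0] (q + N) (br b) (br a c)

/-- `[·_Λ ·]` and `μ` make `(V, ∇)` a non-unital `N_W = N` SUSY vertex algebra. -/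
structure IsVA (br : V →ₗ[K] V →ₗ[K] VPoly K N V 1) (μ : V →ₗ[K] V →ₗ[K] V) : Prop extends
    IsLCA M br where
  even : ∀ p q, ∀ a ∈ M.deg p, ∀ b ∈ M.deg q, μ a b ∈ M.deg (p + q)
  T_mul : ∀ a b, M.T (μ a b) = μ (M.T a) b + μ a (M.T b)
  S_mul : ∀ i p, ∀ a ∈ M.deg p, ∀ b, M.S i (μ a b) = μ (M.S i a) b + sgn p • μ a (M.S i b)
  quasiComm : ∀ p q, ∀ a ∈ M.deg p, ∀ b ∈ M.deg q,
    μ a b - sgn (p * q) • μ b a = integ (-M.T) 0 (br a b)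
  quasiAssoc : ∀ p q, ∀ a ∈ M.deg p, ∀ b ∈ M.deg q, ∀ c,
    μ (μ a b) c - μ a (μ b c) =
      integMul μ 0 M.T a (br b c) + sgn (p * q) • integMul μ 0 M.T b (br a c)
  wick : ∀ p q, ∀ a ∈ M.deg p, ∀ b ∈ M.deg q, ∀ c,
    br a (μ b c) = (μ.flip c).lTensor (SPoly K N 1) (br a b) +
      sgn ((p + N) * q) • TensorProduct.map (invPow q).toLinearMap (μ b) (br a c) +
        integBr br c (br a b)

theorem update_pair {V : Type*} (a b x : V) : Function.update ![a, b] 1 x = ![a, x] := by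
  ext i; fin_cases i <;> simp

/-- `a ⊗ b ↦ (-1)^{p(a)(N+1)} X_{Λ,-Λ-∇}(a ⊗ b ⊗ f) ∈ V[Λ]`, where `p(a)` is the parity in `V`. -/
def evalTwo (X : Op (M.shift (N + 1)) 2) (f : OT K N 2) : V →ₗ[K] V →ₗ[K] VPoly K N V 1 :=
  LinearMap.mk₂ K (fun a b => elim (M.shift (N + 1)) 1 (X ![(M.par ^ (N + 1)) a, b] f))
    (fun a a' b => by
      rw [map_add]
      have h := X.cons_add ![b] ((M.par ^ (N + 1)) a) ((M.par ^ (N + 1)) a')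
      exact (congrArg (fun x => elim (M.shift (N + 1)) 1 (x f)) h).trans (by simp; rfl))
    (fun c a b => by
      rw [map_smul]
      have h := X.cons_smul ![b] c ((M.par ^ (N + 1)) a)
      exact (congrArg (fun x => elim (M.shift (N + 1)) 1 (x f)) h).trans (by simp; rfl))
    (fun a b b' => by
      have h := X.map_update_add ![(M.par ^ (N + 1)) a, 0] 1 b b'
      rw [update_pair, update_pair, update_pair] at h
      rw [h, LinearMap.add_apply, map_add])
    (fun c a b => by
      have h := X.map_update_smul ![(M.par ^ (N + 1)) a, 0] 1 c b
      rw [update_pair, update_pair] at h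
      rw [h, LinearMap.smul_apply, map_smul])

/-- `[a_Λ b]_X = (-1)^{p(a)(N+1)} X_{Λ,-Λ-∇}(a ⊗ b ⊗ 1)`. -/
def brOf (X : Op (M.shift (N + 1)) 2) : V →ₗ[K] V →ₗ[K] VPoly K N V 1 := evalTwo M X 1

/-- `μ_X(a ⊗ b) = (-1)^{p(a)(N+1)+1} Res_Λ(λ^{-1} X_{Λ,-Λ-∇}(a ⊗ b ⊗ z_{1,2}^{-1}))`. -/
def mulOf (X : Op (M.shift (N + 1)) 2) : V →ₗ[K] V →ₗ[K] V :=
  -(evalTwo M X (ziT 0 1)).compr₂ resInv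

end VertexAlgebra

end

end SUSY

open scoped TensorProduct
namespace SUSY
noncomputable section
set_option linter.unusedSectionVars false
variable {K : Type*} [Field K] {N : ℕ} {V : Type*} [AddCommGroup V] [Module K V]
  {M : HWSupermodule K N V}

section Induction

variable {W : Type*} [AddCommGroup W] [Module K W]

@[elab_as_elim]
theorem tensor_ind {P : V ⊗[K] W → Prop} (x : V ⊗[K] W) (tmul : ∀ a b, P (a ⊗ₜ b))
    (add : ∀ x y, P x → P y → P (x + y)) : P x :=
  x.induction_on (by simpa using tmul 0 0) tmul add

theorem tensor_ext {E : Type*} (x : V ⊗[K] W) {f g : V ⊗[K] W → E}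
    (tmul : ∀ a b, f (a ⊗ₜ b) = g (a ⊗ₜ b))
    (add : ∀ x y, f x = g x → f y = g y → f (x + y) = g (x + y) := by
      intro x y hx hy
      beta_reduce at hx hy ⊢
      simp only [map_add, smul_add, neg_add, TensorProduct.add_tmul, hx, hy] <;>
        (try split_ifs) <;> abel) : f x = g x :=
  tensor_ind x tmul add

end Induction

section SuperAlgebra

variable {R : Type*} [CommRing R] [Algebra K R] {n m : ℕ}

theorem salg_induction {P : SAlg K N R n → Prop} (evn : ∀ r : R, P (evn r))
    (add : ∀ a b, P a → P b → P (a + b)) (odd : ∀ k i a, P a → P (odd k i * a))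
    (smul : ∀ (c : K) a, P a → P (c • a)) (a : SAlg K N R n) : P a := by
  have zero : P 0 := by simpa using evn 0
  refine tensor_ind a (fun r e => ?_) add
  induction e using CliffordAlgebra.left_induction with
  | algebraMap c =>
    have h := smul c _ (evn r)
    rwa [SUSY.evn, Algebra.TensorProduct.includeLeft_apply, ← TensorProduct.tmul_smul,
      ← Algebra.algebraMap_eq_smul_one] at h
  | add x y hx hy => rw [TensorProduct.tmul_add]; exact add _ _ hx hy
  | ι_mul x w hx =>
    have hw : w = ∑ p, w p • (Pi.single p 1 : Fin n × Fin N → K) := by ext q; simp [Pi.single_apply]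
    have e : r ⊗ₜ[K] (CliffordAlgebra.ι (0 : QuadraticForm K (Fin n × Fin N → K)) w * x) =
        ∑ p : Fin n × Fin N, w p • ((SUSY.odd p.1 p.2 : SAlg K N R n) * (r ⊗ₜ[K] x)) := by
      conv_lhs => rw [hw]
      simp only [map_sum, map_smul, Finset.sum_mul, TensorProduct.tmul_sum, smul_mul_assoc,
        TensorProduct.tmul_smul, SUSY.odd, Algebra.TensorProduct.tmul_mul_tmul, one_mul]
    rw [e]
    exact Finset.sum_induction _ P add zero fun p _ => smul _ _ (odd _ _ _ hx)

theorem spoly_induction {P : SPoly K N n → Prop} (one : P 1)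
    (add : ∀ a b, P a → P b → P (a + b)) (smul : ∀ (c : K) a, P a → P (c • a))
    (lam : ∀ k a, P a → P (lam k * a)) (odd : ∀ k i a, P a → P (odd k i * a))
    (a : SPoly K N n) : P a := by
  refine salg_induction (fun r => ?_) add odd smul a
  induction r using MvPolynomial.induction_on with
  | C c =>
    have h := smul c _ one
    rwa [← Algebra.algebraMap_eq_smul_one, ← AlgHom.commutes evn] at h
  | add p q hp hq => rw [map_add]; exact add _ _ hp hq
  | mul_X p k hp => rw [mul_comm, map_mul]; exact lam k _ hp

theorem inv_lam (k : Fin n) : inv (lam k : SPoly K N n) = lam k := inv_evn _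

theorem lam_comm (k : Fin n) (a : SPoly K N n) : lam k * a = a * lam k := evn_comm _ _

theorem odd_swap (k l : Fin n) (i j : Fin N) :
    (odd k i : SAlg K N R n) * odd l j = -(odd l j * odd k i) :=
  eq_neg_of_add_eq_zero_left (odd_mul_odd _ _ _ _)

theorem mul_odd (a : SAlg K N R n) (k : Fin n) (i : Fin N) : a * odd k i = odd k i * inv a := by
  induction a using salg_induction with
  | evn r => rw [inv_evn, evn_comm]
  | add a b ha hb => rw [add_mul, ha, hb, map_add, mul_add]
  | odd l j a ha =>
    rw [mul_assoc, ha, map_mul, inv_odd, neg_mul, mul_neg, ← mul_assoc, ← mul_assoc, ← neg_mul,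
      odd_swap l k]
  | smul c a ha => rw [smul_mul_assoc, ha, map_smul, mul_smul_comm]

theorem dOdd_odd_mul (k l : Fin n) (i j : Fin N) (a : SAlg K N R n) :
    dOdd k i (odd l j * a) = (if k = l ∧ i = j then a else 0) - odd l j * dOdd k i a := by
  rw [dOdd_mul, dOdd_odd, inv_odd, neg_mul, ← sub_eq_add_neg]
  simp only [Prod.mk.injEq, ite_mul, one_mul, zero_mul]

theorem dOdd_evn_mul (k : Fin n) (i : Fin N) (r : R) (a : SAlg K N R n) :
    dOdd k i (evn r * a) = evn r * dOdd k i a := by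
  rw [dOdd_mul, dOdd_evn, inv_evn, zero_mul, zero_add]

theorem dEven_odd_mul (D : Derivation K R R) (k : Fin n) (i : Fin N) (a : SAlg K N R n) :
    dEven D.toLinearMap (odd k i * a) = odd k i * dEven D.toLinearMap a := by
  rw [dEven_mul, dEven_odd, zero_mul, zero_add]

theorem inv_dOdd (k : Fin n) (i : Fin N) (a : SAlg K N R n) :
    inv (dOdd k i a) = -dOdd k i (inv a) := by
  induction a using salg_induction with
  | evn r => rw [inv_evn, dOdd_evn, map_zero, neg_zero]
  | add a b ha hb => simp only [map_add, ha, hb, neg_add]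
  | odd l j a ha =>
    rw [map_mul inv, inv_odd, neg_mul, map_neg, dOdd_odd_mul, dOdd_odd_mul, map_sub, map_mul inv,
      inv_odd, ha]
    split_ifs <;> simp
  | smul c a ha => simp only [map_smul, ha, smul_neg]

theorem inv_dEven (D : R →ₗ[K] R) (a : SAlg K N R n) : inv (dEven D a) = dEven D (inv a) := by
  apply tensor_ext a; intro r e
  simp [inv, dEven]

theorem dOdd_dEven (D : R →ₗ[K] R) (k : Fin n) (i : Fin N) (a : SAlg K N R n) :
    dOdd k i (dEven D a) = dEven D (dOdd k i a) := by
  apply tensor_ext a; intro r e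
  simp [dOdd, dEven]

theorem dOdd_dOdd (k l : Fin n) (i j : Fin N) (a : SAlg K N R n) :
    dOdd k i (dOdd l j a) = -dOdd l j (dOdd k i a) := by
  apply tensor_ext a; intro r e
  simp only [dOdd, LinearMap.lTensor_tmul]
  rw [CliffordAlgebra.contractLeft_comm, TensorProduct.tmul_neg]

end SuperAlgebra

section SuperPoly

variable {n m l : ℕ}

theorem dlam_lam_mul (k j : Fin n) (a : SPoly K N n) :
    dlam k (lam j * a) = lam j * dlam k a + if k = j then a else 0 := by
  have h : dlam k (lam j * a) = dlam k (lam j) * a + lam j * dlam k a := dEven_mul _ _ _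
  have h' : dlam k (lam j : SPoly K N n) = if k = j then 1 else 0 := by
    simp only [dlam, lam, dEven_evn, Derivation.coeFn_coe,
      MvPolynomial.pderiv_X, Pi.single_apply]
    by_cases h : k = j
    · simp [h]
    · simp [h, Ne.symm h]
  rw [h, h', add_comm]
  split_ifs <;> simp

theorem dlam_odd_mul (k j : Fin n) (i : Fin N) (a : SPoly K N n) :
    dlam k (odd j i * a) = odd j i * dlam k a := dEven_odd_mul _ _ _ _

theorem dOdd_lam_mul (k j : Fin n) (i : Fin N) (a : SPoly K N n) :
    dOdd k i (lam j * a) = lam j * dOdd k i a := dOdd_evn_mul _ _ _ _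

theorem dlam_one (k : Fin n) : dlam k (1 : SPoly K N n) = 0 := by
  rw [← map_one evn, dlam, dEven_evn]; simp

theorem dOdd_one {R : Type*} [CommRing R] [Algebra K R] (k : Fin n) (i : Fin N) :
    dOdd k i (1 : SAlg K N R n) = 0 := by
  rw [← map_one evn, dOdd_evn]

theorem inv_subst (A : Fin n → Fin m → K) (a : SPoly K N n) :
    inv (subst A a) = subst A (inv a) := by
  induction a using spoly_induction with
  | one => simp
  | add a b ha hb => simp only [map_add, ha, hb]
  | smul c a ha => simp only [map_smul, ha]
  | lam k a ha => simp only [map_mul, ha, subst_lam, map_sum, map_smul, inv_lam]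
  | odd k i a ha =>
    simp only [map_mul, ha, subst_odd, map_sum, map_smul, inv_odd, map_neg, smul_neg,
      Finset.sum_neg_distrib]

theorem dlam_subst (A : Fin n → Fin m → K) (j : Fin m) (a : SPoly K N n) :
    dlam j (subst A a) = ∑ k, A k j • subst A (dlam k a) := by
  induction a using spoly_induction with
  | one => simp [dlam_one]
  | add a b ha hb => simp only [map_add, ha, hb, smul_add, Finset.sum_add_distrib]
  | smul c a ha => simp only [map_smul, ha, Finset.smul_sum, smul_comm c]
  | lam k a ha =>
    simp only [map_mul, subst_lam, Finset.sum_mul, map_sum, smul_mul_assoc, map_smul, dlam_lam_mul,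
      ha, smul_add, Finset.sum_add_distrib, map_add, Finset.mul_sum, Finset.smul_sum,
      mul_smul_comm]
    congr 1
    · rw [Finset.sum_comm]
      simp only [smul_comm (A k _)]
    · simp [apply_ite]
  | odd k i a ha =>
    simp only [map_mul, subst_odd, Finset.sum_mul, map_sum, smul_mul_assoc, map_smul, dlam_odd_mul,
      ha, Finset.mul_sum, Finset.smul_sum, mul_smul_comm]
    rw [Finset.sum_comm]
    simp only [smul_comm (A k _)]

theorem dOdd_subst (A : Fin n → Fin m → K) (j : Fin m) (i : Fin N) (a : SPoly K N n) :
    dOdd j i (subst A a) = ∑ k, A k j • subst A (dOdd k i a) := by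
  induction a using spoly_induction with
  | one => simp [dOdd_one]
  | add a b ha hb => simp only [map_add, ha, hb, smul_add, Finset.sum_add_distrib]
  | smul c a ha => simp only [map_smul, ha, Finset.smul_sum, smul_comm c]
  | lam k a ha =>
    simp only [map_mul, subst_lam, Finset.sum_mul, map_sum, smul_mul_assoc, map_smul, dOdd_lam_mul,
      ha, Finset.mul_sum, Finset.smul_sum, mul_smul_comm]
    rw [Finset.sum_comm]
    simp only [smul_comm (A k _)]
  | odd k i' a ha =>
    simp only [map_mul, subst_odd, Finset.sum_mul, map_sum, smul_mul_assoc, map_smul, dOdd_odd_mul,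
      ha, Finset.mul_sum, Finset.smul_sum, mul_smul_comm, map_sub, smul_sub,
      Finset.sum_sub_distrib]
    congr 1
    · by_cases h : i = i' <;> simp [h, apply_ite]
    · rw [Finset.sum_comm]
      simp only [smul_comm (A k _)]

theorem subst_subst (A : Fin n → Fin m → K) (A' : Fin m → Fin l → K) (a : SPoly K N n) :
    subst A' (subst A a) = subst (fun k j => ∑ p, A k p * A' p j) a := by
  induction a using spoly_induction with
  | one => simp
  | add a b ha hb => simp only [map_add, ha, hb]
  | smul c a ha => simp only [map_smul, ha]
  | lam k a ha =>
    rw [map_mul, map_mul, map_mul, ha, subst_lam, subst_lam]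
    simp only [map_sum, map_smul, subst_lam, Finset.smul_sum, smul_smul, Finset.sum_smul]
    rw [Finset.sum_comm]
  | odd k i a ha =>
    rw [map_mul, map_mul, map_mul, ha, subst_odd, subst_odd]
    simp only [map_sum, map_smul, subst_odd, Finset.smul_sum, smul_smul, Finset.sum_smul]
    rw [Finset.sum_comm]

theorem subst_id (a : SPoly K N n) : subst (fun k j => if j = k then (1 : K) else 0) a = a := by
  induction a using spoly_induction with
  | one => simp
  | add a b ha hb => simp only [map_add, ha, hb]
  | smul c a ha => simp only [map_smul, ha]
  | lam k a ha => rw [map_mul, ha, subst_lam]; simp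
  | odd k i a ha => rw [map_mul, ha, subst_odd]; simp

end SuperPoly

section Nabla

variable {n m l : ℕ}

variable (M) in
/-- The class of `a ⊗ v` in `V_∇[Λ_k]`. -/
def cls (a : SPoly K N n) (v : V) : VNabla M n := (nablaRel M n).mkQ (a ⊗ₜ v)

@[elab_as_elim]
theorem nabla_ind {P : VNabla M n → Prop} (x : VNabla M n) (cls : ∀ a v, P (cls M a v))
    (add : ∀ x y, P x → P y → P (x + y)) : P x := by
  obtain ⟨y, rfl⟩ := (nablaRel M n).mkQ_surjective x
  exact tensor_ind y cls fun x y hx hy => by rw [map_add]; exact add _ _ hx hy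

theorem nabla_ext {E : Type*} (x : VNabla M n) {f g : VNabla M n → E}
    (cls : ∀ a v, f (cls M a v) = g (cls M a v))
    (add : ∀ x y, f x = g x → f y = g y → f (x + y) = g (x + y) := by
      intro x y hx hy
      beta_reduce at hx hy ⊢
      simp only [map_add, hx, hy] <;> (try split_ifs) <;> abel) : f x = g x :=
  nabla_ind x cls add

theorem cls_add (a b : SPoly K N n) (v : V) : cls M (a + b) v = cls M a v + cls M b v := by
  simp [cls, TensorProduct.add_tmul]

theorem cls_sub (a b : SPoly K N n) (v : V) : cls M (a - b) v = cls M a v - cls M b v := by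
  simp [cls, TensorProduct.sub_tmul]

theorem cls_zero (v : V) : cls M (0 : SPoly K N n) v = 0 := by simp [cls]

theorem cls_smul (c : K) (a : SPoly K N n) (v : V) : cls M (c • a) v = c • cls M a v := by
  rw [cls, ← TensorProduct.smul_tmul', map_smul, cls]

theorem cls_T (a : SPoly K N n) (v : V) : cls M (a * -∑ k, lam k) v = cls M a (M.T v) :=
  sub_eq_zero.mp (by
    rw [cls, cls, ← map_sub]; exact (Submodule.Quotient.mk_eq_zero _).mpr (mem_nablaRel_T M a v))

theorem cls_S (a : SPoly K N n) (v : V) (i : Fin N) :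
    cls M (a * -∑ k, odd k i) v = cls M a (M.S i v) :=
  sub_eq_zero.mp (by
    rw [cls, cls, ← map_sub]
    exact (Submodule.Quotient.mk_eq_zero _).mpr (mem_nablaRel_S M a v i))

theorem nMul_cls (a b : SPoly K N n) (v : V) : nMul M a (cls M b v) = cls M (a * b) v := rfl

theorem nPar_cls (a : SPoly K N n) (v : V) : nPar M n (cls M a v) = cls M (inv a) (M.par v) := rfl

theorem nDlam_cls (k j : Fin n) (a : SPoly K N n) (v : V) :
    nDlam M k j (cls M a v) = cls M (dlam k a - dlam j a) v := rfl

theorem nDodd_cls (k j : Fin n) (i : Fin N) (a : SPoly K N n) (v : V) :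
    nDodd M k j i (cls M a v) = cls M (dOdd k i a - dOdd j i a) v := rfl

theorem nSubst_cls (b : Fin n → Fin m) (a : SPoly K N m) (v : V) :
    nSubst M b (cls M a v) = cls M (subst (fun j k => if b k = j then 1 else 0) a) v := rfl

theorem nMul_mul (a b : SPoly K N n) (x : VNabla M n) :
    nMul M (a * b) x = nMul M a (nMul M b x) := by
  apply nabla_ext x; intro c v
  simp only [nMul_cls, mul_assoc]

theorem nMul_neg (a : SPoly K N n) (x : VNabla M n) : nMul M (-a) x = -nMul M a x :=
  LinearMap.congr_fun ((nMulₗ M).map_neg a) x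

theorem nMul_smul (c : K) (a : SPoly K N n) (x : VNabla M n) : nMul M (c • a) x = c • nMul M a x :=
  LinearMap.congr_fun ((nMulₗ M).map_smul c a) x

theorem nMul_sum {ι : Type*} (s : Finset ι) (f : ι → SPoly K N n) (x : VNabla M n) :
    nMul M (∑ j ∈ s, f j) x = ∑ j ∈ s, nMul M (f j) x := by
  have := LinearMap.congr_fun (map_sum (nMulₗ M) f s) x
  rwa [LinearMap.sum_apply] at this

theorem nMul_one (x : VNabla M n) : nMul M 1 x = x := by
  apply nabla_ext x; intro c v
  rw [nMul_cls, one_mul]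

theorem nMul_odd_odd (k j : Fin n) (i i' : Fin N) (x : VNabla M n) :
    nMul M (odd k i) (nMul M (odd j i') x) = -nMul M (odd j i') (nMul M (odd k i) x) := by
  rw [← nMul_mul, ← nMul_mul, odd_swap, nMul_neg]

theorem nMul_lam_comm (k : Fin n) (a : SPoly K N n) (x : VNabla M n) :
    nMul M (lam k) (nMul M a x) = nMul M a (nMul M (lam k) x) := by
  rw [← nMul_mul, ← nMul_mul, lam_comm]

theorem nPar_nMul (a : SPoly K N n) (x : VNabla M n) :
    nPar M n (nMul M a x) = nMul M (inv a) (nPar M n x) := by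
  apply nabla_ext x; intro c v
  simp only [nMul_cls, nPar_cls, map_mul]

theorem nDlam_nMul_lam (k j p : Fin n) (x : VNabla M n) : nDlam M k j (nMul M (lam p) x) =
      nMul M (lam p) (nDlam M k j x) + ((if k = p then x else 0) - if j = p then x else 0) := by
  apply nabla_ext x; intro c v
  simp only [nMul_cls, nDlam_cls, dlam_lam_mul, cls_sub, cls_add, map_sub]
  split_ifs <;> (try simp only [cls_zero]) <;> abel

theorem nDlam_nMul_odd (k j p : Fin n) (i : Fin N) (x : VNabla M n) :
    nDlam M k j (nMul M (odd p i) x) = nMul M (odd p i) (nDlam M k j x) := by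
  apply nabla_ext x; intro c v
  simp only [nMul_cls, nDlam_cls, dlam_odd_mul, mul_sub]

theorem nDodd_nMul_lam (k j p : Fin n) (i : Fin N) (x : VNabla M n) :
    nDodd M k j i (nMul M (lam p) x) = nMul M (lam p) (nDodd M k j i x) := by
  apply nabla_ext x; intro c v
  simp only [nMul_cls, nDodd_cls, dOdd_lam_mul, mul_sub]

theorem nDodd_nMul_odd (k j p : Fin n) (i i' : Fin N) (x : VNabla M n) :
    nDodd M k j i (nMul M (odd p i') x) = -nMul M (odd p i') (nDodd M k j i x) +
      ((if k = p ∧ i = i' then x else 0) - if j = p ∧ i = i' then x else 0) := by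
  apply nabla_ext x; intro c v
  simp only [nMul_cls, nDodd_cls, dOdd_odd_mul, cls_sub, map_sub]
  split_ifs <;> (try simp only [cls_zero]) <;> abel

theorem nDlam_self (k : Fin n) (x : VNabla M n) : nDlam M k k x = 0 := by
  apply nabla_ext x; intro c v
  rw [nDlam_cls, sub_self, cls_zero]

theorem nDodd_self (k : Fin n) (i : Fin N) (x : VNabla M n) : nDodd M k k i x = 0 := by
  apply nabla_ext x; intro c v
  rw [nDodd_cls, sub_self, cls_zero]

theorem nDlam_add_nDlam (k j p : Fin n) (x : VNabla M n) :
    nDlam M k j x + nDlam M j p x = nDlam M k p x := by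
  refine nabla_ind x (fun c v => ?_)
    fun x y hx hy => by rw [map_add, map_add, map_add, ← hx, ← hy]; abel
  rw [nDlam_cls, nDlam_cls, nDlam_cls, ← cls_add, sub_add_sub_cancel]

theorem nDodd_add_nDodd (k j p : Fin n) (i : Fin N) (x : VNabla M n) :
    nDodd M k j i x + nDodd M j p i x = nDodd M k p i x := by
  refine nabla_ind x (fun c v => ?_)
    fun x y hx hy => by rw [map_add, map_add, map_add, ← hx, ← hy]; abel
  rw [nDodd_cls, nDodd_cls, nDodd_cls, ← cls_add, sub_add_sub_cancel]

theorem nDlam_swap (k j : Fin n) (x : VNabla M n) : nDlam M k j x = -nDlam M j k x :=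
  eq_neg_of_add_eq_zero_left (by rw [nDlam_add_nDlam, nDlam_self])

theorem nDodd_swap (k j : Fin n) (i : Fin N) (x : VNabla M n) :
    nDodd M k j i x = -nDodd M j k i x :=
  eq_neg_of_add_eq_zero_left (by rw [nDodd_add_nDodd, nDodd_self])

theorem nSubst_nMul (b : Fin n → Fin m) (a : SPoly K N m) (x : VNabla M m) :
    nSubst M b (nMul M a x) =
      nMul M (subst (fun j k => if b k = j then 1 else 0) a) (nSubst M b x) := by
  apply nabla_ext x; intro c v
  simp only [nMul_cls, nSubst_cls, map_mul]

theorem nSubst_nMul_lam (b : Fin n → Fin m) (j : Fin m) (x : VNabla M m) :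
    nSubst M b (nMul M (lam j) x) =
      ∑ k ∈ Finset.univ.filter (b · = j), nMul M (lam k) (nSubst M b x) := by
  simp only [nSubst_nMul, subst_lam, nMul_sum, Finset.sum_filter, nMul_smul]
  refine Finset.sum_congr rfl fun k _ => ?_
  split_ifs <;> simp

theorem nSubst_nMul_odd (b : Fin n → Fin m) (j : Fin m) (i : Fin N) (x : VNabla M m) :
    nSubst M b (nMul M (odd j i) x) =
      ∑ k ∈ Finset.univ.filter (b · = j), nMul M (odd k i) (nSubst M b x) := by
  simp only [nSubst_nMul, subst_odd, nMul_sum, Finset.sum_filter, nMul_smul]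
  refine Finset.sum_congr rfl fun k _ => ?_
  split_ifs <;> simp

theorem nSubst_nPar (b : Fin n → Fin m) (x : VNabla M m) :
    nSubst M b (nPar M m x) = nPar M n (nSubst M b x) := by
  apply nabla_ext x; intro c v
  simp only [nPar_cls, nSubst_cls, inv_subst]

theorem nDlam_nSubst (b : Fin n → Fin m) (k j : Fin n) (x : VNabla M m) :
    nDlam M k j (nSubst M b x) = nSubst M b (nDlam M (b k) (b j) x) := by
  apply nabla_ext x; intro c v
  simp [nDlam_cls, nSubst_cls, dlam_subst, ite_smul]

theorem nDodd_nSubst (b : Fin n → Fin m) (k j : Fin n) (i : Fin N) (x : VNabla M m) :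
    nDodd M k j i (nSubst M b x) = nSubst M b (nDodd M (b k) (b j) i x) := by
  apply nabla_ext x; intro c v
  simp [nDodd_cls, nSubst_cls, dOdd_subst, ite_smul]

theorem nSubst_nSubst (b : Fin n → Fin m) (b' : Fin l → Fin n) (x : VNabla M m) :
    nSubst M b' (nSubst M b x) = nSubst M (b ∘ b') x := by
  apply nabla_ext x; intro c v
  rw [nSubst_cls, nSubst_cls, nSubst_cls, subst_subst]
  congr 3
  funext k j
  simp

theorem nSubst_id (x : VNabla M n) : nSubst M id x = x := by
  apply nabla_ext x; intro c v
  rw [nSubst_cls]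
  exact congrArg (fun a => cls M a v) (subst_id c)

end Nabla

section Elim

variable {n m : ℕ}

theorem vpoly_induction {P : VPoly K N V n → Prop} (one : ∀ v, P (1 ⊗ₜ v))
    (add : ∀ x y, P x → P y → P (x + y)) (smul : ∀ (c : K) x, P x → P (c • x))
    (lam : ∀ k x, P x → P (lmul (lam k) x)) (odd : ∀ k i x, P x → P (lmul (odd k i) x))
    (x : VPoly K N V n) : P x := by
  refine tensor_ind x (fun a v => ?_) add
  induction a using spoly_induction with
  | one => exact one v
  | add a b ha hb => rw [TensorProduct.add_tmul]; exact add _ _ ha hb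
  | smul c a ha => rw [← TensorProduct.smul_tmul']; exact smul _ _ ha
  | lam k a ha => exact lam k _ ha
  | odd k i a ha => exact odd k i _ ha

theorem vpoly_one_induction {P : VPoly K N V 1 → Prop} (one : ∀ v, P (1 ⊗ₜ v))
    (add : ∀ x y, P x → P y → P (x + y)) (smul : ∀ (c : K) x, P x → P (c • x))
    (lam : ∀ x, P x → P (lmul (lam 0) x)) (odd : ∀ i x, P x → P (lmul (odd 0 i) x))
    (x : VPoly K N V 1) : P x :=
  vpoly_induction one add smul (fun k => Subsingleton.elim 0 k ▸ lam)
    (fun k => Subsingleton.elim 0 k ▸ odd) x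

/-- `∂/∂λ_k` on `V[Λ_k]`. -/
def Dlam (k : Fin n) : VPoly K N V n →ₗ[K] VPoly K N V n := (dlam k).rTensor V

/-- `∂/∂θ_k^i` on `V[Λ_k]`. -/
def Dodd (k : Fin n) (i : Fin N) : VPoly K N V n →ₗ[K] VPoly K N V n := (dOdd k i).rTensor V

theorem Dlam_one (k : Fin n) (v : V) : Dlam k ((1 : SPoly K N n) ⊗ₜ[K] v) = 0 := by
  simp [Dlam, dlam_one]

theorem Dodd_one (k : Fin n) (i : Fin N) (v : V) : Dodd k i ((1 : SPoly K N n) ⊗ₜ[K] v) = 0 := by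
  simp [Dodd, dOdd_one]

theorem Dlam_lmul_lam (k j : Fin n) (x : VPoly K N V n) :
    Dlam k (lmul (lam j) x) = lmul (lam j) (Dlam k x) + if k = j then x else 0 := by
  apply tensor_ext x; intro c v
  simp only [lmul_tmul, Dlam, LinearMap.rTensor_tmul, dlam_lam_mul, TensorProduct.add_tmul]
  split_ifs <;> simp

theorem Dlam_lmul_odd (k j : Fin n) (i : Fin N) (x : VPoly K N V n) :
    Dlam k (lmul (odd j i) x) = lmul (odd j i) (Dlam k x) := by
  apply tensor_ext x; intro c v
  simp only [lmul_tmul, Dlam, LinearMap.rTensor_tmul, dlam_odd_mul]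

theorem Dodd_lmul_lam (k j : Fin n) (i : Fin N) (x : VPoly K N V n) :
    Dodd k i (lmul (lam j) x) = lmul (lam j) (Dodd k i x) := by
  apply tensor_ext x; intro c v
  simp only [lmul_tmul, Dodd, LinearMap.rTensor_tmul, dOdd_lam_mul]

theorem Dodd_lmul_odd (k j : Fin n) (i i' : Fin N) (x : VPoly K N V n) :
    Dodd k i (lmul (odd j i') x) =
      (if k = j ∧ i = i' then x else 0) - lmul (odd j i') (Dodd k i x) := by
  apply tensor_ext x; intro c v
  simp only [lmul_tmul, Dodd, LinearMap.rTensor_tmul, dOdd_odd_mul, TensorProduct.sub_tmul]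
  split_ifs <;> simp

theorem Dodd_Dodd (k j : Fin n) (i i' : Fin N) (x : VPoly K N V n) :
    Dodd k i (Dodd j i' x) = -Dodd j i' (Dodd k i x) := by
  apply tensor_ext x; intro c v
  simp only [Dodd, LinearMap.rTensor_tmul, dOdd_dOdd k j, TensorProduct.neg_tmul]

theorem Dodd_Dlam (k j : Fin n) (i : Fin N) (x : VPoly K N V n) :
    Dodd k i (Dlam j x) = Dlam j (Dodd k i x) := by
  apply tensor_ext x; intro c v
  simp only [Dodd, Dlam, LinearMap.rTensor_tmul, dlam, dOdd_dEven]

theorem Dlam_Tx (k : Fin n) (x : VPoly K N V n) : Dlam k (Tx M n x) = Tx M n (Dlam k x) := by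
  apply tensor_ext x; intro c v
  simp [Dlam, Tx]

theorem Dodd_Tx (k : Fin n) (i : Fin N) (x : VPoly K N V n) :
    Dodd k i (Tx M n x) = Tx M n (Dodd k i x) := by
  apply tensor_ext x; intro c v
  simp [Dodd, Tx]

theorem Dlam_Sx (k : Fin n) (i : Fin N) (x : VPoly K N V n) :
    Dlam k (Sx M n i x) = Sx M n i (Dlam k x) := by
  apply tensor_ext x; intro c v
  simp [Dlam, Sx, dlam, inv_dEven]

theorem Dodd_Sx (k : Fin n) (i i' : Fin N) (x : VPoly K N V n) :
    Dodd k i (Sx M n i' x) = -Sx M n i' (Dodd k i x) := by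
  apply tensor_ext x; intro c v
  simp [Dodd, Sx, inv_dOdd, TensorProduct.neg_tmul]

theorem parx_Dlam (k : Fin n) (x : VPoly K N V n) : parx M n (Dlam k x) = Dlam k (parx M n x) := by
  apply tensor_ext x; intro c v
  simp [Dlam, parx, dlam, inv_dEven]

theorem parx_Dodd (k : Fin n) (i : Fin N) (x : VPoly K N V n) :
    parx M n (Dodd k i x) = -Dodd k i (parx M n x) := by
  apply tensor_ext x; intro c v
  simp [Dodd, parx, inv_dOdd, TensorProduct.neg_tmul]

theorem parx_parx (x : VPoly K N V n) : parx M n (parx M n x) = x := by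
  apply tensor_ext x; intro c v
  simp [parx, inv_inv, M.par_par]

theorem parx_Tx (x : VPoly K N V n) : parx M n (Tx M n x) = Tx M n (parx M n x) := by
  apply tensor_ext x; intro c v
  simp [parx, Tx, M.par_T]

theorem parx_Sx (i : Fin N) (x : VPoly K N V n) :
    parx M n (Sx M n i x) = -Sx M n i (parx M n x) := by
  apply tensor_ext x; intro c v
  simp [parx, Sx, M.par_S, TensorProduct.tmul_neg]

theorem parx_lmul_odd (k : Fin n) (i : Fin N) (x : VPoly K N V n) :
    parx M n (lmul (odd k i) x) = -lmul (odd k i) (parx M n x) := by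
  rw [parx_lmul, inv_odd, map_neg, LinearMap.neg_apply]

theorem parx_lmul_lam (k : Fin n) (x : VPoly K N V n) :
    parx M n (lmul (lam k) x) = lmul (lam k) (parx M n x) := by
  rw [parx_lmul, inv_lam]

theorem Sx_lmul_odd (k : Fin n) (i j : Fin N) (x : VPoly K N V n) :
    Sx M n i (lmul (odd k j) x) = -lmul (odd k j) (Sx M n i x) := by
  rw [Sx_lmul, inv_odd, map_neg, LinearMap.neg_apply]

theorem Sx_lmul_lam (k : Fin n) (i : Fin N) (x : VPoly K N V n) :
    Sx M n i (lmul (lam k) x) = lmul (lam k) (Sx M n i x) := by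
  rw [Sx_lmul, inv_lam]

theorem lmul_odd_odd (k l : Fin n) (i j : Fin N) (x : VPoly K N V n) :
    lmul (odd k i) (lmul (odd l j) x) = -lmul (odd l j) (lmul (odd k i) x) :=
  eq_neg_of_add_eq_zero_left (lmul_anticomm _ _ _ _ _)

theorem lmul_one (x : VPoly K N V n) : lmul 1 x = x := by
  apply tensor_ext x; intro c v
  rw [lmul_tmul, one_mul]

variable (M) in
/-- The map `V[Λ_k]_{k=1}^n → V_∇[Λ_k]_{k=1}^{n+1}` inverse to `elim`. -/
def unelim (n : ℕ) : VPoly K N V n →ₗ[K] VNabla M (n + 1) :=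
  (nablaRel M (n + 1)).mkQ ∘ₗ
    (subst fun k l => if l = Fin.castSucc k then 1 else 0).toLinearMap.rTensor V

theorem unelim_tmul (a : SPoly K N n) (v : V) :
    unelim M n (a ⊗ₜ v) = cls M (subst (fun k l => if l = Fin.castSucc k then 1 else 0) a) v := rfl

theorem unelim_one (v : V) : unelim M n (1 ⊗ₜ v) = cls M 1 v := by rw [unelim_tmul, map_one]

theorem unelim_lmul (a : SPoly K N n) (x : VPoly K N V n) : unelim M n (lmul a x) =
      nMul M (subst (fun k l => if l = Fin.castSucc k then 1 else 0) a) (unelim M n x) := by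
  apply tensor_ext x; intro c v
  rw [lmul_tmul, unelim_tmul, unelim_tmul, nMul_cls, map_mul]

theorem unelim_lmul_lam (k : Fin n) (x : VPoly K N V n) :
    unelim M n (lmul (lam k) x) = nMul M (lam k.castSucc) (unelim M n x) := by
  rw [unelim_lmul, subst_lam]; simp

theorem unelim_lmul_odd (k : Fin n) (i : Fin N) (x : VPoly K N V n) :
    unelim M n (lmul (odd k i) x) = nMul M (odd k.castSucc i) (unelim M n x) := by
  rw [unelim_lmul, subst_odd]; simp

theorem unelim_Tx (x : VPoly K N V n) :
    unelim M n (Tx M n x) = -∑ k, nMul M (lam k) (unelim M n x) := by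
  rw [← nMul_sum, ← nMul_neg]
  apply tensor_ext x; intro c v
  simp only [Tx, TensorProduct.map_tmul, LinearMap.id_apply]
  rw [unelim_tmul, unelim_tmul, ← cls_T, nMul_cls, neg_mul, mul_neg, Finset.sum_mul,
    Finset.mul_sum]
  simp only [lam_comm]

theorem unelim_Sx (i : Fin N) (x : VPoly K N V n) :
    unelim M n (Sx M n i x) = -∑ k, nMul M (odd k i) (unelim M n x) := by
  rw [← nMul_sum, ← nMul_neg]
  apply tensor_ext x; intro c v
  simp only [Sx, TensorProduct.map_tmul, AlgHom.toLinearMap_apply]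
  rw [unelim_tmul, unelim_tmul, ← cls_S, nMul_cls, neg_mul, mul_neg, Finset.sum_mul,
    Finset.mul_sum]
  simp only [mul_odd, inv_subst, inv_inv]

/-- Induction on `V_∇[Λ_k]` by left multiplication with the generators. -/
theorem nabla_gen_induction {P : VNabla M n → Prop} (one : ∀ v, P (cls M 1 v))
    (add : ∀ x y, P x → P y → P (x + y)) (smul : ∀ (c : K) x, P x → P (c • x))
    (lam : ∀ k x, P x → P (nMul M (lam k) x)) (odd : ∀ k i x, P x → P (nMul M (odd k i) x))
    (x : VNabla M n) : P x := by
  refine nabla_ind x (fun a v => ?_) add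
  induction a using spoly_induction with
  | one => exact one v
  | add a b ha hb => rw [cls_add]; exact add _ _ ha hb
  | smul c a ha => rw [cls_smul]; exact smul _ _ ha
  | lam k a ha => exact lam k _ ha
  | odd k i a ha => exact odd k i _ ha

variable [CharZero K]

theorem elim_cls (a : SPoly K N (n + 1)) (v : V) : elim M n (cls M a v) =
      evalHom (lastEven M n) (lastOdd M n) (last_superCommute M n) a (1 ⊗ₜ v) := rfl

theorem elim_nMul (a : SPoly K N (n + 1)) (x : VNabla M (n + 1)) : elim M n (nMul M a x) =
      evalHom (lastEven M n) (lastOdd M n) (last_superCommute M n) a (elim M n x) := by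
  apply nabla_ext x; intro c v
  rw [nMul_cls, elim_cls, elim_cls, map_mul]; rfl

theorem elim_lam_castSucc (k : Fin n) (x : VNabla M (n + 1)) :
    elim M n (nMul M (lam k.castSucc) x) = lmul (lam k) (elim M n x) := by
  rw [elim_nMul, lam, evalHom_evn, lastEven, Fin.lastCases_castSucc]

theorem elim_lam_last (x : VNabla M (n + 1)) : elim M n (nMul M (lam (Fin.last n)) x) =
      -(∑ k, lmul (lam k) (elim M n x)) - Tx M n (elim M n x) := by
  rw [elim_nMul, lam, evalHom_evn, lastEven, Fin.lastCases_last]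
  simp [LinearMap.sum_apply]

theorem elim_odd_castSucc (k : Fin n) (i : Fin N) (x : VNabla M (n + 1)) :
    elim M n (nMul M (odd k.castSucc i) x) = lmul (odd k i) (elim M n x) := by
  rw [elim_nMul, evalHom_odd, lastOdd, Fin.lastCases_castSucc]

theorem elim_odd_last (i : Fin N) (x : VNabla M (n + 1)) :
    elim M n (nMul M (odd (Fin.last n) i) x) =
      -(∑ k, lmul (odd k i) (elim M n x)) - Sx M n i (elim M n x) := by
  rw [elim_nMul, evalHom_odd, lastOdd, Fin.lastCases_last]
  simp [LinearMap.sum_apply]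

theorem elim_one (v : V) : elim M n (cls M 1 v) = 1 ⊗ₜ v := by rw [elim_cls, map_one]; rfl

theorem elim_unelim (x : VPoly K N V n) : elim M n (unelim M n x) = x := by
  induction x using vpoly_induction with
  | one v => rw [unelim_one, elim_one]
  | add x y hx hy => simp only [map_add, hx, hy]
  | smul c x hx => simp only [map_smul, hx]
  | lam k x hx => rw [unelim_lmul_lam, elim_lam_castSucc, hx]
  | odd k i x hx => rw [unelim_lmul_odd, elim_odd_castSucc, hx]

theorem unelim_elim (x : VNabla M (n + 1)) : unelim M n (elim M n x) = x := by
  induction x using nabla_gen_induction with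
  | one v => rw [elim_one, unelim_one]
  | add x y hx hy => simp only [map_add, hx, hy]
  | smul c x hx => simp only [map_smul, hx]
  | lam k x hx =>
    refine Fin.lastCases ?_ (fun k => ?_) k
    · rw [elim_lam_last, map_sub, map_neg, map_sum, unelim_Tx]
      simp only [unelim_lmul_lam, hx]
      rw [Fin.sum_univ_castSucc]
      abel
    · rw [elim_lam_castSucc, unelim_lmul_lam, hx]
  | odd k i x hx =>
    refine Fin.lastCases ?_ (fun k => ?_) k
    · rw [elim_odd_last, map_sub, map_neg, map_sum, unelim_Sx]
      simp only [unelim_lmul_odd, hx]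
      rw [Fin.sum_univ_castSucc]
      abel
    · rw [elim_odd_castSucc, unelim_lmul_odd, hx]

theorem elim_injective : Function.Injective (elim M n) := Function.LeftInverse.injective unelim_elim

theorem elim_nDlam (k : Fin n) (x : VNabla M (n + 1)) :
    elim M n (nDlam M k.castSucc (Fin.last n) x) = Dlam k (elim M n x) := by
  induction x using nabla_gen_induction with
  | one v => simp [nDlam_cls, dlam_one, cls_zero, elim_one, Dlam_one]
  | add x y hx hy => simp only [map_add, hx, hy]
  | smul c x hx => simp only [map_smul, hx]
  | lam j x hx =>
    rw [nDlam_nMul_lam, map_add, map_sub]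
    refine Fin.lastCases ?_ (fun j => ?_) j
    · rw [elim_lam_last, elim_lam_last, map_sub, map_neg, map_sum, hx, Dlam_Tx]
      simp only [Dlam_lmul_lam, Finset.sum_add_distrib]
      simp [Fin.castSucc_ne_last]
      abel
    · rw [elim_lam_castSucc, elim_lam_castSucc, hx, Dlam_lmul_lam]
      simp only [Fin.castSucc_inj, (Fin.castSucc_ne_last _).symm, if_false]
      split_ifs <;> simp
  | odd j i x hx =>
    rw [nDlam_nMul_odd]
    refine Fin.lastCases ?_ (fun j => ?_) j
    · rw [elim_odd_last, elim_odd_last, map_sub, map_neg, map_sum, hx, Dlam_Sx]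
      simp only [Dlam_lmul_odd]
    · rw [elim_odd_castSucc, elim_odd_castSucc, hx, Dlam_lmul_odd]

theorem elim_nDodd (k : Fin n) (i : Fin N) (x : VNabla M (n + 1)) :
    elim M n (nDodd M k.castSucc (Fin.last n) i x) = Dodd k i (elim M n x) := by
  induction x using nabla_gen_induction with
  | one v => simp [nDodd_cls, dOdd_one, cls_zero, elim_one, Dodd_one]
  | add x y hx hy => simp only [map_add, hx, hy]
  | smul c x hx => simp only [map_smul, hx]
  | lam j x hx =>
    rw [nDodd_nMul_lam]
    refine Fin.lastCases ?_ (fun j => ?_) j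
    · rw [elim_lam_last, elim_lam_last, map_sub, map_neg, map_sum, hx, Dodd_Tx]
      simp only [Dodd_lmul_lam]
    · rw [elim_lam_castSucc, elim_lam_castSucc, hx, Dodd_lmul_lam]
  | odd j i' x hx =>
    rw [nDodd_nMul_odd, map_add, map_neg, map_sub]
    refine Fin.lastCases ?_ (fun j => ?_) j
    · rw [elim_odd_last, elim_odd_last, map_sub, map_neg, map_sum, hx, Dodd_Sx]
      simp only [Dodd_lmul_odd, Finset.sum_sub_distrib]
      by_cases h : i = i' <;> simp [Fin.castSucc_ne_last, h] <;> abel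
    · rw [elim_odd_castSucc, elim_odd_castSucc, hx, Dodd_lmul_odd]
      simp only [Fin.castSucc_inj, (Fin.castSucc_ne_last _).symm, if_false, false_and]
      split_ifs <;> simp; abel

theorem elim_nPar (x : VNabla M (n + 1)) : elim M n (nPar M (n + 1) x) = parx M n (elim M n x) := by
  induction x using nabla_gen_induction with
  | one v => simp [nPar_cls, elim_one, parx]
  | add x y hx hy => simp only [map_add, hx, hy]
  | smul c x hx => simp only [map_smul, hx]
  | lam j x hx =>
    rw [nPar_nMul, inv_lam]
    refine Fin.lastCases ?_ (fun j => ?_) j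
    · simp only [elim_lam_last, map_sub, map_neg, map_sum, hx, parx_lmul_lam, parx_Tx]
    · rw [elim_lam_castSucc, elim_lam_castSucc, hx, parx_lmul_lam]
  | odd j i x hx =>
    rw [nPar_nMul, inv_odd, nMul_neg]
    refine Fin.lastCases ?_ (fun j => ?_) j
    · simp only [elim_odd_last, map_sub, map_neg, map_sum, hx, parx_lmul_odd, parx_Sx,
        Finset.sum_neg_distrib]
      abel
    · rw [map_neg, elim_odd_castSucc, elim_odd_castSucc, hx, parx_lmul_odd]

end Elim

section Antiderivative

variable {n : ℕ}

/-- The antiderivative `∫_0^{λ_k}` on polynomials. -/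
def intg (k : Fin n) : MvPolynomial (Fin n) K →ₗ[K] MvPolynomial (Fin n) K :=
  (MvPolynomial.basisMonomials (Fin n) K).constr K fun s =>
    MvPolynomial.monomial (s + Finsupp.single k 1) ((s k : K) + 1)⁻¹

theorem intg_monomial (k : Fin n) (s : Fin n →₀ ℕ) (c : K) : intg k (MvPolynomial.monomial s c) =
      MvPolynomial.monomial (s + Finsupp.single k 1) (c * ((s k : K) + 1)⁻¹) := by
  have h : MvPolynomial.monomial s c = c • MvPolynomial.basisMonomials (Fin n) K s := by
    simp [MvPolynomial.coe_basisMonomials, MvPolynomial.smul_monomial]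
  rw [h, map_smul, intg, Module.Basis.constr_basis, MvPolynomial.smul_monomial, smul_eq_mul]

theorem intg_X_mul {k j : Fin n} (h : j ≠ k) (p : MvPolynomial (Fin n) K) :
    intg k (MvPolynomial.X j * p) = MvPolynomial.X j * intg k p := by
  induction p using MvPolynomial.induction_on' with
  | monomial s c =>
    rw [MvPolynomial.X, MvPolynomial.monomial_mul, intg_monomial, intg_monomial,
      MvPolynomial.monomial_mul]
    simp [h, add_assoc]
  | add p q hp hq => simp only [mul_add, map_add, hp, hq]

theorem pderiv_intg [CharZero K] (k : Fin n) (p : MvPolynomial (Fin n) K) :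
    MvPolynomial.pderiv k (intg k p) = p := by
  induction p using MvPolynomial.induction_on' with
  | monomial s c =>
    rw [intg_monomial, MvPolynomial.pderiv_monomial]
    have : ((s k : K) + 1) ≠ 0 := Nat.cast_add_one_ne_zero _
    simp [this]
  | add p q hp hq => simp only [map_add, hp, hq]

theorem intg_pderiv_X_mul [CharZero K] (k : Fin n) (p : MvPolynomial (Fin n) K) :
    intg k (MvPolynomial.pderiv k (MvPolynomial.X k * p)) = MvPolynomial.X k * p := by
  induction p using MvPolynomial.induction_on' with
  | monomial s c =>
    rw [MvPolynomial.X, MvPolynomial.monomial_mul, MvPolynomial.pderiv_monomial, intg_monomial]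
    have : (1 + (s k : K)) ≠ 0 := by rw [add_comm]; exact Nat.cast_add_one_ne_zero _
    simp [add_comm, this]
  | add p q hp hq => simp only [mul_add, map_add, hp, hq]

/-- `∫_0^{λ_k}` on `V[Λ_k]`. -/
def Ilam (k : Fin n) : VPoly K N V n →ₗ[K] VPoly K N V n := (dEven (intg k)).rTensor V

theorem Dlam_Ilam [CharZero K] (k : Fin n) (x : VPoly K N V n) : Dlam k (Ilam k x) = x := by
  apply tensor_ext x; intro a v
  apply tensor_ext a; intro p e
  simp only [Dlam, Ilam, dlam, dEven, LinearMap.rTensor_tmul]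
  exact congrArg (fun p => (p ⊗ₜ[K] e) ⊗ₜ[K] v) (pderiv_intg k p)

theorem Ilam_lmul_odd (k j : Fin n) (i : Fin N) (x : VPoly K N V n) :
    Ilam k (lmul (odd j i) x) = lmul (odd j i) (Ilam k x) := by
  apply tensor_ext x; intro a v
  apply tensor_ext a; intro p e
  simp [Ilam, dEven, lmul_tmul, odd]

theorem Ilam_lmul_lam {k j : Fin n} (h : j ≠ k) (x : VPoly K N V n) :
    Ilam k (lmul (lam j) x) = lmul (lam j) (Ilam k x) := by
  apply tensor_ext x; intro a v
  apply tensor_ext a; intro p e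
  simp [Ilam, dEven, lmul_tmul, lam, evn, intg_X_mul h]

theorem Ilam_Dlam_lmul_lam [CharZero K] (k : Fin n) (x : VPoly K N V n) :
    Ilam k (Dlam k (lmul (lam k) x)) = lmul (lam k) x := by
  apply tensor_ext x; intro a v
  apply tensor_ext a; intro p e
  simp only [Ilam, Dlam, dlam, dEven, lmul_tmul, lam, evn,
    Algebra.TensorProduct.includeLeft_apply, Algebra.TensorProduct.tmul_mul_tmul,
    LinearMap.rTensor_tmul, one_mul]
  exact congrArg (fun p => (p ⊗ₜ[K] e) ⊗ₜ[K] v) (intg_pderiv_X_mul k p)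

theorem Ilam_Tx {M : HWSupermodule K N V} (k : Fin n) (x : VPoly K N V n) :
    Ilam k (Tx M n x) = Tx M n (Ilam k x) := by
  apply tensor_ext x; intro c v
  simp [Ilam, Tx]

theorem Ilam_Sx {M : HWSupermodule K N V} (k : Fin n) (i : Fin N) (x : VPoly K N V n) :
    Ilam k (Sx M n i x) = Sx M n i (Ilam k x) := by
  apply tensor_ext x; intro c v
  simp [Ilam, Sx, inv_dEven]

theorem Ilam_parx {M : HWSupermodule K N V} (k : Fin n) (x : VPoly K N V n) :
    Ilam k (parx M n x) = parx M n (Ilam k x) := by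
  apply tensor_ext x; intro c v
  simp [Ilam, parx, inv_dEven]

theorem Ilam_Dodd (k j : Fin n) (i : Fin N) (x : VPoly K N V n) :
    Ilam k (Dodd j i x) = Dodd j i (Ilam k x) := by
  apply tensor_ext x; intro c v
  simp [Ilam, Dodd, dOdd_dEven]

end Antiderivative

section OddLists

variable {n m : ℕ}

theorem smul_neg_eq_neg_smul {E : Type*} [AddCommGroup E] [Module K E] (c : K) (x : E) :
    c • -x = (-c) • x := by rw [smul_neg, neg_smul]

/-- The product of the operators `∂/∂θ_k^i` over a list of indices `i`. -/
def DL (k : Fin n) (L : List (Fin N)) : Module.End K (VPoly K N V n) := (L.map (Dodd k)).prod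

variable (K N V) in
/-- `∂_{θ_k^N} ⋯ ∂_{θ_k^1}`. -/
def Dtop (k : Fin n) : Module.End K (VPoly K N V n) := DL k (List.finRange N).reverse

theorem DL_cons (k : Fin n) (i : Fin N) (L : List (Fin N)) (x : VPoly K N V n) :
    DL k (i :: L) x = Dodd k i (DL k L x) := by
  simp only [DL, List.map_cons, List.prod_cons, Module.End.mul_apply]

theorem DL_nil (k : Fin n) (x : VPoly K N V n) : DL k [] x = x := rfl

theorem dOdd_iterate_inv {k : Fin n} {a : SPoly K N n} (ha : ∀ i, dOdd k i a = 0) (r : ℕ)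
    (i : Fin N) : dOdd k i (inv^[r] a) = 0 := by
  induction r with
  | zero => exact ha i
  | succ r ih => rw [Function.iterate_succ_apply', ← neg_inj, ← inv_dOdd, ih, map_zero, neg_zero]

theorem Dodd_lmul {k : Fin n} {i : Fin N} {a : SPoly K N n} (ha : dOdd k i a = 0)
    (x : VPoly K N V n) : Dodd k i (lmul a x) = lmul (inv a) (Dodd k i x) := by
  apply tensor_ext x; intro c v
  simp [Dodd, lmul_tmul, dOdd_mul, ha]

theorem DL_lmul {k : Fin n} {a : SPoly K N n} (ha : ∀ i, dOdd k i a = 0) (L : List (Fin N))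
    (x : VPoly K N V n) : DL k L (lmul a x) = lmul (inv^[L.length] a) (DL k L x) := by
  induction L with
  | nil => rfl
  | cons i L ih =>
    rw [DL_cons, ih, Dodd_lmul (dOdd_iterate_inv ha _ i), DL_cons, List.length_cons,
      Function.iterate_succ_apply']

theorem DL_lmul_odd {k : Fin n} {i : Fin N} {L : List (Fin N)} (hi : i ∉ L) (x : VPoly K N V n) :
    DL k L (lmul (odd k i) x) = (-1 : K) ^ L.length • lmul (odd k i) (DL k L x) := by
  induction L with
  | nil => simp [DL_nil]
  | cons j L ih =>
    rw [List.mem_cons, not_or] at hi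
    rw [DL_cons, ih hi.2, map_smul, Dodd_lmul_odd, if_neg (fun h => hi.1 h.2.symm), zero_sub,
      DL_cons, List.length_cons, pow_succ, mul_neg_one]
    exact smul_neg_eq_neg_smul _ _

theorem eq_zero_of_DL {k : Fin n} {U : Set (VPoly K N V n)}
    (hU : ∀ x ∈ U, ∀ i, lmul (odd k i) x ∈ U) {L : List (Fin N)} (hL : L.Nodup)
    (h : ∀ x ∈ U, DL k L x = 0) : ∀ x ∈ U, x = 0 := by
  induction L with
  | nil => exact h
  | cons i L ih =>
    refine ih hL.of_cons fun x hx => ?_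
    have h1 := h _ (hU x hx i)
    have h2 := h x hx
    rw [DL_cons] at h1 h2
    rw [DL_lmul_odd (List.nodup_cons.mp hL).1, map_smul, Dodd_lmul_odd, h2, map_zero, sub_zero,
      if_pos ⟨rfl, rfl⟩] at h1
    obtain h3 | h3 := neg_one_pow_eq_or K L.length
    · simpa [h3] using h1
    · simpa [h3] using h1

theorem eq_zero_of_Dtop {k : Fin n} {U : Set (VPoly K N V n)}
    (hU : ∀ x ∈ U, ∀ i, lmul (odd k i) x ∈ U) (h : ∀ x ∈ U, Dtop K N V k x = 0) : ∀ x ∈ U, x = 0 :=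
  eq_zero_of_DL hU (List.nodup_reverse.mpr (List.nodup_finRange N)) h

theorem Dodd_Dodd_self (k : Fin n) (i : Fin N) (x : VPoly K N V n) : Dodd k i (Dodd k i x) = 0 := by
  refine tensor_ind x (fun a v => ?_)
    fun x y hx hy => by simp only [map_add, hx, hy, add_zero]
  refine tensor_ind a (fun p e => ?_)
    fun x y hx hy => by simp only [TensorProduct.add_tmul, map_add, hx, hy, add_zero]
  simp only [Dodd, dOdd, LinearMap.rTensor_tmul, LinearMap.lTensor_tmul,
    CliffordAlgebra.contractLeft_contractLeft, TensorProduct.tmul_zero,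
    TensorProduct.zero_tmul]

theorem Dodd_DL {k : Fin n} {i : Fin N} {L : List (Fin N)} (hi : i ∈ L) (x : VPoly K N V n) :
    Dodd k i (DL k L x) = 0 := by
  induction L with
  | nil => simp at hi
  | cons j L ih =>
    rw [DL_cons]
    by_cases h : i = j
    · subst h
      exact Dodd_Dodd_self _ _ _
    · rw [Dodd_Dodd, ih (by simpa [h] using hi), map_zero, neg_zero]

theorem Dodd_Dtop (k : Fin n) (i : Fin N) (x : VPoly K N V n) : Dodd k i (Dtop K N V k x) = 0 :=
  Dodd_DL (by simp) x

theorem DL_comm {k : Fin n} {L : List (Fin N)} (A : VPoly K N V n →ₗ[K] VPoly K N V m)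
    {j : Fin m} (h : ∀ i x, Dodd j i (A x) = A (Dodd k i x)) (x : VPoly K N V n) :
    DL j L (A x) = A (DL k L x) := by
  induction L with
  | nil => rfl
  | cons i L ih => rw [DL_cons, DL_cons, ih, h]

theorem DL_anticomm {k : Fin n} {L : List (Fin N)} (A : VPoly K N V n →ₗ[K] VPoly K N V m)
    {j : Fin m} (h : ∀ i x, Dodd j i (A x) = -A (Dodd k i x)) (x : VPoly K N V n) :
    DL j L (A x) = (-1 : K) ^ L.length • A (DL k L x) := by
  induction L with
  | nil => simp [DL_nil]
  | cons i L ih =>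
    rw [DL_cons, DL_cons, ih, map_smul, h, List.length_cons, pow_succ, mul_neg_one]
    exact smul_neg_eq_neg_smul _ _

theorem length_top : (List.finRange N).reverse.length = N := by simp

/-- The product of the operators `∂_{θ_k^i} θ_k^i` over a list of indices `i`. -/
def EL (k : Fin n) (L : List (Fin N)) : Module.End K (VPoly K N V n) :=
  (L.map fun i => (Dodd k i * lmul (odd k i) : Module.End K (VPoly K N V n))).prod

theorem EL_cons (k : Fin n) (i : Fin N) (L : List (Fin N)) (x : VPoly K N V n) :
    EL k (i :: L) x = Dodd k i (lmul (odd k i) (EL k L x)) := by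
  simp only [EL, List.map_cons, List.prod_cons, Module.End.mul_apply]

theorem EL_eq_self {k : Fin n} {x : VPoly K N V n} (h : ∀ i, Dodd k i x = 0)
    (L : List (Fin N)) : EL k L x = x := by
  induction L with
  | nil => rfl
  | cons i L ih => rw [EL_cons, ih, Dodd_lmul_odd, h, map_zero, sub_zero, if_pos ⟨rfl, rfl⟩]

theorem EL_one (k : Fin n) (v : V) (L : List (Fin N)) :
    EL k L ((1 : SPoly K N n) ⊗ₜ[K] v) = 1 ⊗ₜ v :=
  EL_eq_self (fun i => Dodd_one k i v) L

theorem EL_lmul_lam (k j : Fin n) (L : List (Fin N)) (x : VPoly K N V n) :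
    EL k L (lmul (lam j) x) = lmul (lam j) (EL k L x) := by
  induction L with
  | nil => rfl
  | cons i L ih => rw [EL_cons, ih, EL_cons, ← lmul_lam_comm, Dodd_lmul_lam]

theorem EL_lmul_odd {k j : Fin n} {i : Fin N} {L : List (Fin N)} (h : j ≠ k ∨ i ∉ L)
    (x : VPoly K N V n) : EL k L (lmul (odd j i) x) = lmul (odd j i) (EL k L x) := by
  induction L with
  | nil => rfl
  | cons i' L ih =>
    have h' : ¬(k = j ∧ i' = i) := by rintro ⟨rfl, rfl⟩; simp at h
    rw [EL_cons, ih (h.imp_right fun h => fun h1 => h (List.mem_cons_of_mem _ h1)), EL_cons,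
      lmul_odd_odd, map_neg, Dodd_lmul_odd, if_neg h', zero_sub, neg_neg]

theorem EL_lmul_odd_self {k : Fin n} {i : Fin N} {L : List (Fin N)} (hi : i ∈ L)
    (x : VPoly K N V n) : EL k L (lmul (odd k i) x) = 0 := by
  induction L with
  | nil => simp at hi
  | cons j L ih =>
    rw [EL_cons]
    by_cases h : i ∈ L
    · rw [ih h, map_zero, map_zero]
    · obtain rfl : i = j := by simpa [h] using hi
      have h1 : lmul (odd k i) (lmul (odd k i) (EL k L x)) = 0 := by
        rw [← lmul_mul, odd, Algebra.TensorProduct.tmul_mul_tmul, ExteriorAlgebra.ι_sq_zero,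
          TensorProduct.tmul_zero, map_zero, LinearMap.zero_apply]
      rw [EL_lmul_odd (Or.inr h), h1, map_zero]

variable (V) in
/-- The substitution `Λ_j ↦ ∑_l A j l Λ_l` on `V[Λ]`. -/
def substW (A : Fin n → Fin m → K) : VPoly K N V n →ₗ[K] VPoly K N V m :=
  (subst A).toLinearMap.rTensor V

theorem substW_tmul (A : Fin n → Fin m → K) (a : SPoly K N n) (v : V) :
    substW V A (a ⊗ₜ v) = subst A a ⊗ₜ v := rfl

theorem substW_lmul (A : Fin n → Fin m → K) (a : SPoly K N n) (x : VPoly K N V n) :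
    substW V A (lmul a x) = lmul (subst A a) (substW V A x) := by
  apply tensor_ext x; intro c v
  simp [lmul_tmul, substW_tmul]

theorem substW_substW {l : ℕ} (A : Fin n → Fin m → K) (A' : Fin m → Fin l → K) (x : VPoly K N V n) :
    substW V A' (substW V A x) = substW V (fun k j => ∑ p, A k p * A' p j) x := by
  apply tensor_ext x; intro c v
  simp only [substW_tmul, subst_subst]

theorem Dodd_substW (A : Fin n → Fin m → K) (j : Fin m) (i : Fin N) (x : VPoly K N V n) :
    Dodd j i (substW V A x) = ∑ k, A k j • substW V A (Dodd k i x) := by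
  refine tensor_ind x (fun c v => ?_)
    fun x y hx hy => by simp only [map_add, hx, hy, smul_add, Finset.sum_add_distrib]
  simp [substW_tmul, Dodd, dOdd_subst, TensorProduct.sum_tmul,
      TensorProduct.smul_tmul']

theorem Dlam_substW (A : Fin n → Fin m → K) (j : Fin m) (x : VPoly K N V n) :
    Dlam j (substW V A x) = ∑ k, A k j • substW V A (Dlam k x) := by
  refine tensor_ind x (fun c v => ?_)
    fun x y hx hy => by simp only [map_add, hx, hy, smul_add, Finset.sum_add_distrib]
  simp [substW_tmul, Dlam, dlam_subst, TensorProduct.sum_tmul,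
      TensorProduct.smul_tmul']

variable (K) in
/-- The matrix of the substitution `Λ_k ↦ 0`. -/
def killMat (k : Fin n) : Fin n → Fin n → K := fun j l => if j = k then 0 else if l = j then 1 else 0

theorem EL_sub_Ilam [CharZero K] (k : Fin n) (x : VPoly K N V n) :
    EL k (List.finRange N) x - Ilam k (Dlam k (EL k (List.finRange N) x)) =
      substW V (killMat K k) x := by
  induction x using vpoly_induction with
  | one v => rw [EL_one, Dlam_one, map_zero, sub_zero, substW_tmul, map_one]
  | add x y hx hy => rw [map_add (substW V _), ← hx, ← hy]; simp only [map_add]; abel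
  | smul c x hx => rw [map_smul (substW V _), ← hx]; simp only [map_smul, smul_sub]
  | lam j x hx =>
    rw [substW_lmul, subst_lam, ← hx, EL_lmul_lam]
    by_cases h : j = k
    · subst h
      rw [Ilam_Dlam_lmul_lam, sub_self]
      simp [killMat]
    · rw [Dlam_lmul_lam, if_neg (Ne.symm h), add_zero, Ilam_lmul_lam h, ← map_sub]
      simp [killMat, h]
  | odd j i x hx =>
    rw [substW_lmul, subst_odd, ← hx]
    by_cases h : j = k
    · subst h
      rw [EL_lmul_odd_self (List.mem_finRange i), map_zero, map_zero, sub_zero]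
      simp [killMat]
    · rw [EL_lmul_odd (Or.inl h), Dlam_lmul_odd, Ilam_lmul_odd, ← map_sub]
      simp [killMat, h]

theorem substW_kill_eq_self [CharZero K] {k : Fin n} {x : VPoly K N V n} (h : Dlam k x = 0)
    (h' : ∀ i, Dodd k i x = 0) : substW V (killMat K k) x = x := by
  rw [← EL_sub_Ilam, EL_eq_self h', h, map_zero, sub_zero]

end OddLists

section ConstantTerm

variable {n : ℕ}

variable (K N) in
/-- The constant term of a polynomial. -/
def cst (n : ℕ) : SPoly K N n →ₐ[K] K :=
  Algebra.TensorProduct.lift (MvPolynomial.aeval 0) ExteriorAlgebra.algebraMapInv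
    fun _ _ => Commute.all _ _

theorem cst_lam (k : Fin n) : cst K N n (lam k) = 0 := by simp [cst, lam, evn]

theorem cst_odd (k : Fin n) (i : Fin N) : cst K N n (odd k i) = 0 := by
  simp [cst, odd, ExteriorAlgebra.algebraMapInv]

variable (K N V) in
/-- The constant term on `V[Λ_k]`. -/
def cstV (n : ℕ) : VPoly K N V n →ₗ[K] V :=
  (TensorProduct.lid K V).toLinearMap ∘ₗ (cst K N n).toLinearMap.rTensor V

theorem cstV_tmul (a : SPoly K N n) (v : V) : cstV K N V n (a ⊗ₜ v) = cst K N n a • v := by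
  simp [cstV]

theorem cstV_lmul (a : SPoly K N n) (x : VPoly K N V n) :
    cstV K N V n (lmul a x) = cst K N n a • cstV K N V n x := by
  apply tensor_ext x; intro c v
  simp [lmul_tmul, cstV_tmul, mul_smul]

theorem substW_kill_one (x : VPoly K N V 1) : substW V (killMat K 0) x = 1 ⊗ₜ cstV K N V 1 x := by
  induction x using vpoly_induction with
  | one v => rw [substW_tmul, map_one, cstV_tmul, map_one, one_smul]
  | add x y hx hy => simp only [map_add, hx, hy, TensorProduct.tmul_add]
  | smul c x hx => simp only [map_smul, hx, TensorProduct.tmul_smul]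
  | lam j x hx => simp [substW_lmul, subst_lam, cstV_lmul, cst_lam, killMat, Subsingleton.elim j 0]
  | odd j i x hx =>
    simp [substW_lmul, subst_odd, cstV_lmul, cst_odd, killMat, Subsingleton.elim j 0]

variable (K N V) in
/-- `Res_{Λ_2} λ_2^{-1}`, from `V[Λ_1, Λ_2]` to `V[Λ_1]`. -/
def resTwo : VPoly K N V 2 →ₗ[K] VPoly K N V 1 := substW V ![![1], ![0]] ∘ₗ Dtop K N V 1

theorem eq_zero_of_resTwo [CharZero K] {U : Set (VPoly K N V 2)}
    (hU : ∀ x ∈ U, ∀ i, lmul (odd 1 i) x ∈ U) (hD : ∀ x ∈ U, Dlam 1 x = 0)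
    (hR : ∀ x ∈ U, resTwo K N V x = 0) : ∀ x ∈ U, x = 0 := by
  refine eq_zero_of_Dtop hU fun x hx => ?_
  have h1 : Dlam 1 (Dtop K N V 1 x) = 0 := by
    rw [Dtop, ← DL_comm (Dlam 1) (fun i x => Dodd_Dlam 1 1 i x), hD x hx, map_zero]
  rw [← substW_kill_eq_self h1 (fun i => Dodd_Dtop 1 i x)]
  have h2 := congrArg (substW V (fun _ : Fin 1 => ![(1 : K), 0])) (hR x hx)
  rw [resTwo, LinearMap.comp_apply, substW_substW, map_zero] at h2
  rw [← h2]
  congr 2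
  funext k j
  fin_cases k <;> fin_cases j <;> simp [killMat]

theorem eq_zero_of_cstV_Dtop [CharZero K] {U : Set (VPoly K N V 1)}
    (hU : ∀ x ∈ U, ∀ i, lmul (odd 0 i) x ∈ U) (hD : ∀ x ∈ U, Dlam 0 x = 0)
    (hR : ∀ x ∈ U, cstV K N V 1 (Dtop K N V 0 x) = 0) : ∀ x ∈ U, x = 0 := by
  refine eq_zero_of_Dtop hU fun x hx => ?_
  have h1 : Dlam 0 (Dtop K N V 0 x) = 0 := by
    rw [Dtop, ← DL_comm (Dlam 0) (fun i x => Dodd_Dlam 0 0 i x), hD x hx, map_zero]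
  rw [← substW_kill_eq_self h1 (fun i => Dodd_Dtop 0 i x), substW_kill_one, hR x hx,
    TensorProduct.tmul_zero]

end ConstantTerm

section Coefficients

variable {W : Type*} [AddCommGroup W] [Module K W]

variable (K N V) in
/-- The coefficients of `λ^m θ^1 ⋯ θ^N` of an element of `V[Λ]`. -/
def tops : VPoly K N V 1 →ₗ[K] (ℕ →₀ V) := coefMap fun m => Finsupp.lsingle m

theorem coefMap_monomial (φ : ℕ → V →ₗ[K] W) (s : Fin 1 →₀ ℕ) (e : Grass K N 1) (v : V) :
    coefMap φ ((MvPolynomial.monomial s 1 ⊗ₜ[K] e) ⊗ₜ[K] v) = topCoeff K N e • φ (s 0) v := by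
  have h : (MvPolynomial.basisMonomials (Fin 1) K).constr K (fun s => φ (s 0))
      (MvPolynomial.monomial s 1) = φ (s 0) := by
    have := (MvPolynomial.basisMonomials (Fin 1) K).constr_basis K (fun s => φ (s 0)) s
    rwa [MvPolynomial.coe_basisMonomials] at this
  simp [coefMap, h]

theorem vpoly_mon_ext {E : Type*} (x : VPoly K N V 1) {f g : VPoly K N V 1 → E}
    (mon : ∀ s e v, f ((MvPolynomial.monomial s 1 ⊗ₜ[K] e) ⊗ₜ[K] v) =
      g ((MvPolynomial.monomial s 1 ⊗ₜ[K] e) ⊗ₜ[K] v))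
    (add : ∀ x y, f x = g x → f y = g y → f (x + y) = g (x + y) := by
      intro x y hx hy
      beta_reduce at hx hy ⊢
      simp only [map_add, smul_add, hx, hy] <;> abel) : f x = g x := by
  refine tensor_ind x (fun a v => tensor_ind a (fun p e => ?_) fun x y hx hy => ?_) add
  · induction p using MvPolynomial.induction_on' with
    | monomial s c =>
      have h := mon s e (c • v)
      rwa [TensorProduct.tmul_smul, TensorProduct.smul_tmul', TensorProduct.smul_tmul',
        MvPolynomial.smul_monomial, smul_eq_mul, mul_one] at h
    | add p q hp hq => rw [TensorProduct.add_tmul, TensorProduct.add_tmul]; exact add _ _ hp hq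
  · rw [TensorProduct.add_tmul]; exact add _ _ hx hy

theorem coefMap_eq (φ : ℕ → V →ₗ[K] W) (x : VPoly K N V 1) :
    coefMap φ x = Finsupp.lsum K φ (tops K N V x) := by
  apply vpoly_mon_ext x; intro s e v
  rw [tops, coefMap_monomial, coefMap_monomial, map_smul]; simp

theorem contract_eq_algebraMap {e : Grass K N 1}
    (h : ∀ i, CliffordAlgebra.contractLeft (LinearMap.proj (0, i)) e = 0) [CharZero K] :
    e = algebraMap K _ (ExteriorAlgebra.algebraMapInv e) := by
  have h1 := substW_kill_eq_self (K := K) (N := N) (V := K) (k := (0 : Fin 1))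
    (x := ((1 : MvPolynomial (Fin 1) K) ⊗ₜ[K] e) ⊗ₜ[K] (1 : K))
    (by simp [Dlam, dlam, dEven]) (fun i => by simp [Dodd, dOdd, h])
  rw [substW_kill_one, cstV_tmul] at h1
  have h2 := congrArg (TensorProduct.lift (LinearMap.lsmul K (Grass K N 1)).flip ∘ₗ
    ((TensorProduct.lid K (Grass K N 1)).toLinearMap ∘ₗ
    (MvPolynomial.aeval (0 : Fin 1 → K)).toLinearMap.rTensor _).rTensor K) h1
  simp [Algebra.TensorProduct.one_def, cst] at h2
  rw [Algebra.algebraMap_eq_smul_one, h2]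

theorem Dtop_monomial [CharZero K] (p : MvPolynomial (Fin 1) K) (e : Grass K N 1) (v : V) :
    Dtop K N V 0 ((p ⊗ₜ[K] e) ⊗ₜ[K] v) = topCoeff K N e • (p ⊗ₜ[K] 1) ⊗ₜ[K] v := by
  have h : ∀ L : List (Fin N), DL 0 L ((p ⊗ₜ[K] e) ⊗ₜ[K] v) =
      (p ⊗ₜ[K] ((L.map fun i => (CliffordAlgebra.contractLeft (LinearMap.proj (0, i)) :
      Module.End K (Grass K N 1))).prod e)) ⊗ₜ[K] v := fun L => by
    induction L with
    | nil => simp [DL_nil]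
    | cons i L ih => rw [DL_cons, ih]; simp [Dodd, dOdd]
  have hi : ∀ i, CliffordAlgebra.contractLeft (LinearMap.proj (0, i))
      (((List.finRange N).reverse.map fun i =>
        (CliffordAlgebra.contractLeft (LinearMap.proj (0, i)) :
          Module.End K (Grass K N 1))).prod e) = 0 := fun i => by
    have hL : i ∈ (List.finRange N).reverse := by simp
    generalize (List.finRange N).reverse = L at hL
    induction L with
    | nil => simp at hL
    | cons j L ih =>
      simp only [List.map_cons, List.prod_cons, Module.End.mul_apply]
      by_cases hij : i = j
      · rw [hij, CliffordAlgebra.contractLeft_contractLeft]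
      · rw [CliffordAlgebra.contractLeft_comm, ih (by simpa [hij] using hL), map_zero, neg_zero]
  rw [Dtop, h, contract_eq_algebraMap hi, Algebra.algebraMap_eq_smul_one, TensorProduct.tmul_smul,
    ← TensorProduct.smul_tmul', topCoeff, List.ofFn_eq_map, ← List.map_reverse]
  rfl

theorem Dtop_eq [CharZero K] (x : VPoly K N V 1) : Dtop K N V 0 x =
      Finsupp.lsum K (fun m => TensorProduct.mk K (SPoly K N 1) V (lam 0 ^ m)) (tops K N V x) := by
  apply vpoly_mon_ext x; intro s e v
  have hs : Finsupp.single 0 (s 0) = s := by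
    ext
    simp
  have h : (lam 0 ^ s 0 : SPoly K N 1) = MvPolynomial.monomial s 1 ⊗ₜ[K] 1 := by
    rw [lam, ← map_pow, MvPolynomial.X_pow_eq_monomial, evn,
      Algebra.TensorProduct.includeLeft_apply, hs]
  rw [Dtop_monomial, tops, coefMap_monomial, map_smul, Finsupp.lsingle_apply,
    Finsupp.lsum_single, TensorProduct.mk_apply, h]

theorem resInv_eq [CharZero K] (x : VPoly K N V 1) : resInv x = cstV K N V 1 (Dtop K N V 0 x) := by
  rw [Dtop_eq, resInv, coefMap_eq]
  induction tops K N V x using Finsupp.induction_linear with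
  | zero => simp
  | add f g hf hg => simp only [map_add, hf, hg]
  | single m v =>
    rw [Finsupp.lsum_single, Finsupp.lsum_single, TensorProduct.mk_apply, cstV_tmul, map_pow,
      cst_lam]
    by_cases h : m = 0 <;> simp [h]

end Coefficients

section Functions

variable {n m n' m' n'' m'' : ℕ} {b : Fin n → Fin m} {b' : Fin n' → Fin m'}

instance (b : Fin n → Fin m) : Semiring (OBT K N b) := Subalgebra.toSemiring _

instance (b : Fin n → Fin m) : Ring (OBT K N b) := Subalgebra.toRing _

instance (b : Fin n → Fin m) : Algebra K (OBT K N b) := Subalgebra.algebra _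

instance (b : Fin n → Fin m) : NonUnitalNonAssocSemiring (OBT K N b) :=
  (OBT K N b).toSemiring.toNonUnitalNonAssocSemiring

instance (b : Fin n → Fin m) : AddCommMonoid (OBT K N b) := (OBT K N b).toSemiring.toAddCommMonoid

instance (b : Fin n → Fin m) : AddCommGroup (OBT K N b) := (OBT K N b).toRing.toAddCommGroup

instance (b : Fin n → Fin m) : Module K (OBT K N b) := (OBT K N b).instModuleSubtypeMem

instance (b : Fin n → Fin m) : Mul (OBT K N b) := inferInstance

instance (b : Fin n → Fin m) : Add (OBT K N b) := inferInstance

instance (b : Fin n → Fin m) : Zero (OBT K N b) := inferInstance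

instance (b : Fin n → Fin m) : One (OBT K N b) := inferInstance

variable (b) in
/-- `z_{k,l}` as a translation invariant function. -/
def zB (k l : Fin n) : OBT K N b := ⟨zz b k l, zz_mem k l⟩

/-- `z_{k,l}^{-1}` as a translation invariant function. -/
def ziB {k l : Fin n} (h : b k ≠ b l) : OBT K N b := ⟨zi b k l, zi_mem h⟩

variable (b) in
/-- `ζ_{k,l}^i` as a translation invariant function. -/
def zeB (k l : Fin n) (i : Fin N) : OBT K N b := ⟨ze b k l i, ze_mem k l i⟩

/-- The parity involution on translation invariant functions. -/
def invT : OBT K N b →ₐ[K] OBT K N b :=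
  (inv.comp (OBT K N b).val).codRestrict _ fun x => inv_mem x.2

theorem coe_dzT (k : Fin n) (f : OBT K N b) : (dzT k f : OB K N b) = dz k (f : OB K N b) := rfl

theorem zB_comm (k l : Fin n) (f : OBT K N b) : zB b k l * f = f * zB b k l :=
  Subtype.ext (evn_comm _ _)

theorem ziB_comm {k l : Fin n} (h : b k ≠ b l) (f : OBT K N b) : ziB h * f = f * ziB h :=
  Subtype.ext (evn_comm _ _)

theorem zB_mul_ziB {k l : Fin n} (h : b k ≠ b l) : zB b k l * ziB h = (1 : OBT K N b) := by
  refine Subtype.ext ?_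
  change zz b k l * zi b k l = 1
  rw [zz, zi, ← map_mul, Ring.mul_inverse_cancel _ (zc_sub_isUnit h), map_one]

theorem ziB_mul_zB {k l : Fin n} (h : b k ≠ b l) : ziB h * zB b k l = (1 : OBT K N b) := by
  rw [ziB_comm, zB_mul_ziB]

theorem zB_self (k : Fin n) : zB b k k = (0 : OBT K N b) := by
  refine Subtype.ext ?_
  change zz b k k = 0
  rw [zz, sub_self, map_zero]

theorem zeB_self (k : Fin n) (i : Fin N) : zeB b k k i = (0 : OBT K N b) := by
  refine Subtype.ext ?_
  change ze b k k i = 0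
  rw [ze, sub_self]

theorem zB_add (k l p : Fin n) : zB b k l + zB b l p = (zB b k p : OBT K N b) := by
  refine Subtype.ext ?_
  change zz b k l + zz b l p = zz b k p
  rw [zz, zz, zz, ← map_add, sub_add_sub_cancel]

theorem zeB_add (k l p : Fin n) (i : Fin N) :
    zeB b k l i + zeB b l p i = (zeB b k p i : OBT K N b) := by
  refine Subtype.ext ?_
  change ze b k l i + ze b l p i = ze b k p i
  rw [ze, ze, ze, sub_add_sub_cancel]

theorem zB_swap (k l : Fin n) : zB b k l = -(zB b l k : OBT K N b) :=
  eq_neg_of_add_eq_zero_left (by rw [zB_add, zB_self])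

theorem invT_invT (f : OBT K N b) : invT (invT f) = f := Subtype.ext (inv_inv _)

theorem invT_zB (k l : Fin n) : invT (zB b k l) = (zB b k l : OBT K N b) := Subtype.ext (inv_evn _)

theorem invT_ziB {k l : Fin n} (h : b k ≠ b l) : invT (ziB h) = (ziB h : OBT K N b) :=
  Subtype.ext (inv_evn _)

theorem invT_zeB (k l : Fin n) (i : Fin N) : invT (zeB b k l i) = -(zeB b k l i : OBT K N b) := by
  refine Subtype.ext ?_
  change inv (odd k i - odd l i) = -(odd k i - odd l i : OB K N b)
  rw [map_sub, inv_odd, inv_odd]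
  abel

theorem dzT_mul (k : Fin n) (f g : OBT K N b) : dzT k (f * g) = dzT k f * g + f * dzT k g :=
  Subtype.ext (dEven_mul _ _ _)

theorem dzeT_mul (k : Fin n) (i : Fin N) (f g : OBT K N b) :
    dzeT k i (f * g) = dzeT k i f * g + invT f * dzeT k i g :=
  Subtype.ext (dOdd_mul _ _ _ _)

theorem dzT_one (k : Fin n) : dzT k (1 : OBT K N b) = 0 := by
  have h := dzT_mul k (1 : OBT K N b) 1
  rw [mul_one, one_mul, mul_one] at h
  exact left_eq_add.mp h

theorem dzeT_one (k : Fin n) (i : Fin N) : dzeT k i (1 : OBT K N b) = 0 :=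
  Subtype.ext (dOdd_one k i)

theorem invT_dzT (k : Fin n) (f : OBT K N b) : invT (dzT k f) = dzT k (invT f) :=
  Subtype.ext (inv_dEven _ _)

theorem invT_dzeT (k : Fin n) (i : Fin N) (f : OBT K N b) :
    invT (dzeT k i f) = -dzeT k i (invT f) :=
  Subtype.ext (inv_dOdd _ _ _)

theorem dzT_zB (k p q : Fin n) :
    dzT k (zB b p q) = ((if p = k then 1 else 0) - if q = k then 1 else 0 : OBT K N b) := by
  refine Subtype.ext ?_
  rw [coe_dzT]
  change dEven _ (evn _) = _
  rw [dEven_evn]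
  change evn (pdLoc b k (zc b p - zc b q)) = _
  rw [map_sub, pdLoc_zc, pdLoc_zc]
  split_ifs <;> simp

theorem dzT_zeB (k p q : Fin n) (i : Fin N) : dzT k (zeB b p q i) = (0 : OBT K N b) := by
  refine Subtype.ext ?_
  change dEven _ (odd p i - odd q i) = 0
  rw [map_sub, dEven_odd, dEven_odd, sub_zero]

theorem dzeT_zB (k p q : Fin n) (i : Fin N) : dzeT k i (zB b p q) = (0 : OBT K N b) :=
  Subtype.ext (dOdd_evn _ _ _)

theorem dzeT_ziB {p q : Fin n} (h : b p ≠ b q) (k : Fin n) (i : Fin N) :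
    dzeT k i (ziB h) = (0 : OBT K N b) :=
  Subtype.ext (dOdd_evn _ _ _)

theorem dzeT_zeB (k p q : Fin n) (i j : Fin N) : dzeT k i (zeB b p q j) =
      ((if k = p ∧ i = j then 1 else 0) - if k = q ∧ i = j then 1 else 0 : OBT K N b) := by
  refine Subtype.ext ?_
  change dOdd k i (odd p j - odd q j) = _
  rw [map_sub, dOdd_odd, dOdd_odd]
  simp only [Prod.mk.injEq]
  split_ifs <;> simp

theorem dzT_ziB {p q : Fin n} (h : b p ≠ b q) (k : Fin n) : dzT k (ziB h) =
      (((if q = k then 1 else 0) - if p = k then 1 else 0) * (ziB h * ziB h) : OBT K N b) := by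
  have h1 : dzT k (ziB h * zB b p q) = (0 : OBT K N b) := by rw [ziB_mul_zB, dzT_one]
  rw [dzT_mul, dzT_zB] at h1
  have h2 := congrArg (· * (ziB h : OBT K N b)) h1
  simp only [add_mul, mul_assoc, zB_mul_ziB, mul_one, zero_mul] at h2
  rw [eq_neg_of_add_eq_zero_left h2, ← mul_assoc, ziB_comm h (_ - _), mul_assoc, ← neg_mul, neg_sub]

/-- A twisted derivation that vanishes on the `z_{k,l}` and the `ζ_{k,l}^i` is zero. -/
theorem twisted_derivation_eq_zero {A : Type*} [Ring A] [Module K A] (h h' : OBT K N b → A)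
    (hh : h 1 = 1) (hh' : h' 1 = 1) (hz : ∀ k l (hkl : b k ≠ b l), h' (ziB hkl) * h' (zB b k l) = 1)
    (D : OBT K N b →ₗ[K] A) (hD : ∀ x y, D (x * y) = D x * h y + h' x * D y)
    (h1 : ∀ k l, D (zB b k l) = 0) (h2 : ∀ k l i, D (zeB b k l i) = 0) (f : OBT K N b) :
    D f = 0 := by
  have h0 : D 1 = 0 := by
    have := hD 1 1
    rw [mul_one, hh, hh', mul_one, one_mul] at this
    exact left_eq_add.mp this
  obtain ⟨f, hf⟩ := f
  induction hf using Algebra.adjoin_induction with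
  | mem x hx =>
    obtain (⟨k, l, rfl⟩ | ⟨k, l, hkl, rfl⟩) | ⟨k, l, i, rfl⟩ := hx
    · exact h1 k l
    · have h3 : D (zB b k l * ziB hkl) = 0 := by rw [zB_mul_ziB, h0]
      rw [hD, h1, zero_mul, zero_add] at h3
      have h4 := congrArg (h' (ziB hkl) * ·) h3
      simp only [← mul_assoc, hz, one_mul, mul_zero] at h4
      exact h4
    · exact h2 k l i
  | algebraMap r =>
    have : (⟨algebraMap K _ r, (OBT K N b).algebraMap_mem r⟩ : OBT K N b) = r • 1 :=
      Subtype.ext (Algebra.algebraMap_eq_smul_one _)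
    rw [this, map_smul, h0, smul_zero]
  | add x y hx hy hx' hy' =>
    have : (⟨x + y, add_mem hx hy⟩ : OBT K N b) = ⟨x, hx⟩ + ⟨y, hy⟩ := rfl
    rw [this, map_add, hx', hy', add_zero]
  | mul x y hx hy hx' hy' =>
    have : (⟨x * y, mul_mem hx hy⟩ : OBT K N b) = ⟨x, hx⟩ * ⟨y, hy⟩ := rfl
    rw [this, hD, hx', hy', zero_mul, mul_zero, add_zero]

theorem sum_leibniz {ι A B : Type*} [Mul A] [NonUnitalNonAssocSemiring B] (s : Finset ι)
    {D : ι → A → B} {h h' : A → B} (hD : ∀ k x y, D k (x * y) = D k x * h y + h' x * D k y)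
    (x y : A) : ∑ k ∈ s, D k (x * y) = (∑ k ∈ s, D k x) * h y + h' x * ∑ k ∈ s, D k y := by
  simp only [hD, Finset.sum_add_distrib, Finset.sum_mul, Finset.mul_sum]

theorem twisted_derivation_ext {A : Type*} [Ring A] [Module K A] (h h' : OBT K N b → A)
    (hh : h 1 = 1) (hh' : h' 1 = 1)
    (hz : ∀ k l (hkl : b k ≠ b l), h' (ziB hkl) * h' (zB b k l) = 1) (D D' : OBT K N b →ₗ[K] A)
    (hD : ∀ x y, D (x * y) = D x * h y + h' x * D y)
    (hD' : ∀ x y, D' (x * y) = D' x * h y + h' x * D' y) (h1 : ∀ k l, D (zB b k l) = D' (zB b k l))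
    (h2 : ∀ k l i, D (zeB b k l i) = D' (zeB b k l i)) (f : OBT K N b) : D f = D' f :=
  sub_eq_zero.mp (twisted_derivation_eq_zero h h' hh hh' hz (D - D')
    (fun x y => by
      rw [LinearMap.sub_apply, LinearMap.sub_apply, LinearMap.sub_apply, hD, hD', sub_mul, mul_sub]
      abel)
    (fun k l => sub_eq_zero.mpr (h1 k l)) (fun k l i => sub_eq_zero.mpr (h2 k l i)) f)

theorem sum_ite_sub_ite {ι A : Type*} [Fintype ι] [DecidableEq ι] [Ring A] (p q : ι) :
    ∑ k, ((if p = k then 1 else 0) - if q = k then 1 else 0 : A) = 0 := by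
  rw [Finset.sum_sub_distrib]; simp

theorem sum_dzT (f : OBT K N b) : ∑ k, dzT k f = 0 := by
  have h := twisted_derivation_eq_zero (K := K) (N := N) (b := b) (A := OBT K N b) (fun f => f)
    (fun f => f) rfl rfl (fun k l hkl => ziB_mul_zB hkl) (∑ k, dzT k)
    (fun x y => by
      rw [LinearMap.sum_apply, LinearMap.sum_apply, LinearMap.sum_apply]
      exact sum_leibniz (A := OBT K N b) (B := OBT K N b) _ (D := fun k x => dzT k x)
        (h := fun x => x) (h' := fun x => x) (fun k => dzT_mul k) x y)
    (fun k l => by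
      rw [LinearMap.sum_apply]
      exact (Finset.sum_congr rfl fun j _ => dzT_zB j k l).trans (sum_ite_sub_ite k l))
    (fun k l i => by
      rw [LinearMap.sum_apply]; exact Finset.sum_eq_zero fun j _ => dzT_zeB j k l i) f
  rwa [LinearMap.sum_apply] at h

theorem sum_dzeT (i : Fin N) (f : OBT K N b) : ∑ k, dzeT k i f = 0 := by
  have h := twisted_derivation_eq_zero (K := K) (N := N) (b := b) (A := OBT K N b) (fun f => f)
    (fun f => invT f) rfl (map_one invT)
    (fun k l hkl => by rw [invT_ziB, invT_zB]; exact ziB_mul_zB hkl) (∑ k, dzeT k i)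
    (fun x y => by
      rw [LinearMap.sum_apply, LinearMap.sum_apply, LinearMap.sum_apply]
      exact sum_leibniz (A := OBT K N b) (B := OBT K N b) _ (D := fun k x => dzeT k i x)
        (h := fun x => x) (h' := fun x => invT x) (fun k => dzeT_mul k i) x y)
    (fun k l => by rw [LinearMap.sum_apply]; exact Finset.sum_eq_zero fun j _ => dzeT_zB j k l i)
    (fun k l j => by
      rw [LinearMap.sum_apply]
      refine (Finset.sum_congr rfl fun p _ => dzeT_zeB p k l i j).trans ?_
      by_cases h : i = j
      · simp only [h, and_true, eq_comm (b := k), eq_comm (b := l)]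
        exact sum_ite_sub_ite k l
      · simp only [h, and_false, if_false, sub_zero, Finset.sum_const_zero]) f
  rwa [LinearMap.sum_apply] at h

section Relabel

variable {c : Fin n → Fin n'} (h : ∀ k l, b k ≠ b l → b' (c k) ≠ b' (c l))

theorem relT_zB (k l : Fin n) : relT b b' c h (zB b k l) = (zB b' (c k) (c l) : OBT K N b') := by
  refine Subtype.ext ?_
  change relabel b b' c h (evn (zc b k - zc b l)) = evn (zc b' (c k) - zc b' (c l))
  rw [relabel_evn, map_sub, locLift_zc, locLift_zc]

theorem relT_zeB (k l : Fin n) (i : Fin N) :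
    relT b b' c h (zeB b k l i) = (zeB b' (c k) (c l) i : OBT K N b') := by
  refine Subtype.ext ?_
  change relabel b b' c h (odd k i - odd l i) = odd (c k) i - odd (c l) i
  rw [map_sub, relabel_odd, relabel_odd]

theorem relT_ziB {k l : Fin n} (hkl : b k ≠ b l) :
    relT b b' c h (ziB hkl) = (ziB (h k l hkl) : OBT K N b') := by
  have h1 : relT b b' c h (ziB hkl) * zB b' (c k) (c l) = (1 : OBT K N b') := by
    rw [← relT_zB h, ← map_mul, ziB_mul_zB, map_one]
  have h2 := congrArg (· * (ziB (h k l hkl) : OBT K N b')) h1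
  simpa only [mul_assoc, zB_mul_ziB, mul_one, one_mul] using h2

theorem OBT_hom_ext {A : Type*} [Ring A] [Algebra K A] {f g : OBT K N b →ₐ[K] A}
    (h1 : ∀ k l, f (zB b k l) = g (zB b k l)) (h2 : ∀ k l i, f (zeB b k l i) = g (zeB b k l i)) :
    f = g := by
  refine AlgHom.ext fun x => sub_eq_zero.mp ?_
  exact twisted_derivation_eq_zero (K := K) (N := N) (b := b) (A := A) (fun x => f x)
    (fun x => g x) (map_one f) (map_one g)
    (fun k l hkl => by rw [← map_mul, ziB_mul_zB, map_one]) (f.toLinearMap - g.toLinearMap)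
    (fun x y => by
      simp only [LinearMap.sub_apply, AlgHom.toLinearMap_apply]
      rw [map_mul, map_mul, sub_mul, mul_sub]; abel)
    (fun k l => sub_eq_zero.mpr (h1 k l)) (fun k l i => sub_eq_zero.mpr (h2 k l i)) x

theorem invT_relT (f : OBT K N b) : invT (relT b b' c h f) = relT b b' c h (invT f) := by
  have : invT.comp (relT b b' c h) = (relT b b' c h).comp (invT : OBT K N b →ₐ[K] _) :=
    OBT_hom_ext (fun k l => by simp [relT_zB, invT_zB])
      (fun k l i => by simp [relT_zeB, invT_zeB])
  exact DFunLike.congr_fun this f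

theorem relT_relT {b'' : Fin n'' → Fin m''} {c' : Fin n' → Fin n''}
    (h' : ∀ k l, b' k ≠ b' l → b'' (c' k) ≠ b'' (c' l)) (f : OBT K N b) :
    relT b' b'' c' h' (relT b b' c h f) =
      relT b b'' (c' ∘ c) (fun k l hkl => h' _ _ (h k l hkl)) f := by
  have : (relT b' b'' c' h').comp (relT b b' c h) =
      relT (K := K) (N := N) b b'' (c' ∘ c) (fun k l hkl => h' _ _ (h k l hkl)) :=
    OBT_hom_ext (fun k l => by simp [relT_zB]) (fun k l i => by simp [relT_zeB])
  exact DFunLike.congr_fun this f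

theorem relT_id (f : OBT K N b) : relT b b id (fun _ _ h => h) f = f := by
  have : relT b b id (fun _ _ h => h) = AlgHom.id K (OBT K N b) :=
    OBT_hom_ext (fun k l => by simp [relT_zB]) (fun k l i => by simp [relT_zeB])
  exact DFunLike.congr_fun this f

theorem sum_filter_ite_eq {ι κ B : Type*} [Fintype ι] [DecidableEq ι] [DecidableEq κ] [Ring B]
    (c : ι → κ) (j : κ) (p : ι) : ∑ k ∈ Finset.univ.filter (c · = j), (if p = k then 1 else 0 : B) =
      if c p = j then 1 else 0 := by
  simp

set_option maxHeartbeats 1000000 in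
theorem dzT_relT (j : Fin n') (f : OBT K N b) : dzT j (relT b b' c h f) =
      ∑ k ∈ Finset.univ.filter (c · = j), relT b b' c h (dzT k f) := by
  have key := twisted_derivation_ext (K := K) (N := N) (b := b) (A := OBT K N b')
    (fun f => relT b b' c h f) (fun f => relT b b' c h f) (map_one _) (map_one _)
    (fun k l hkl => by rw [← map_mul, ziB_mul_zB, map_one])
    (dzT j ∘ₗ (relT b b' c h).toLinearMap)
    (∑ k ∈ Finset.univ.filter (c · = j), (relT b b' c h).toLinearMap ∘ₗ dzT k)
    (fun x y => (congrArg (dzT j) (map_mul (relT b b' c h) x y)).trans (dzT_mul ..))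
    (fun x y => by
      simp only [LinearMap.sum_apply]
      exact sum_leibniz (A := OBT K N b) (B := OBT K N b') (D := fun k x => relT b b' c h (dzT k x))
        (h := fun x => relT b b' c h x) (h' := fun x => relT b b' c h x) _ (fun k x y => by
        rw [dzT_mul, map_add, map_mul, map_mul]) x y)
    (fun k l => by
      simp only [LinearMap.comp_apply, LinearMap.sum_apply, AlgHom.toLinearMap_apply, relT_zB,
        dzT_zB, map_sub, apply_ite (relT b b' c h), map_one, map_zero]
      rw [Finset.sum_sub_distrib, sum_filter_ite_eq, sum_filter_ite_eq])
    (fun k l i => by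
      simp only [LinearMap.comp_apply, LinearMap.sum_apply, AlgHom.toLinearMap_apply, relT_zeB,
        dzT_zeB, map_zero, Finset.sum_const_zero]) f
  rwa [LinearMap.sum_apply] at key

theorem dzeT_relT (j : Fin n') (i : Fin N) (f : OBT K N b) : dzeT j i (relT b b' c h f) =
      ∑ k ∈ Finset.univ.filter (c · = j), relT b b' c h (dzeT k i f) := by
  have key := twisted_derivation_ext (K := K) (N := N) (b := b) (A := OBT K N b')
    (fun f => relT b b' c h f) (fun f => relT b b' c h (invT f)) (map_one _)
    (by rw [map_one, map_one])
    (fun k l hkl => by rw [invT_ziB, invT_zB, ← map_mul, ziB_mul_zB, map_one])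
    (dzeT j i ∘ₗ (relT b b' c h).toLinearMap)
    (∑ k ∈ Finset.univ.filter (c · = j), (relT b b' c h).toLinearMap ∘ₗ dzeT k i)
    (fun x y => by
      simp only [LinearMap.comp_apply, AlgHom.toLinearMap_apply]
      rw [map_mul, dzeT_mul, invT_relT])
    (fun x y => by
      simp only [LinearMap.sum_apply]
      exact sum_leibniz (A := OBT K N b) (B := OBT K N b')
        (D := fun k x => relT b b' c h (dzeT k i x)) (h := fun x => relT b b' c h x)
        (h' := fun x => relT b b' c h (invT x)) _ (fun k x y => by
        rw [dzeT_mul, map_add, map_mul, map_mul]) x y)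
    (fun k l => by
      simp only [LinearMap.comp_apply, LinearMap.sum_apply, AlgHom.toLinearMap_apply, relT_zB,
        dzeT_zB, map_zero, Finset.sum_const_zero])
    (fun k l i' => by
      simp only [LinearMap.comp_apply, LinearMap.sum_apply, AlgHom.toLinearMap_apply, relT_zeB,
        dzeT_zeB, map_sub, apply_ite (relT b b' c h), map_one, map_zero]
      by_cases hi : i = i'
      · simp only [hi, and_true, eq_comm (b := k), eq_comm (b := l), eq_comm (a := j)]
        rw [Finset.sum_sub_distrib, sum_filter_ite_eq, sum_filter_ite_eq]
      · simp only [hi, and_false, if_false, sub_zero, Finset.sum_const_zero]) f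
  rwa [LinearMap.sum_apply] at key

end Relabel

end Functions

section Spanning

variable {n m : ℕ}

theorem ziT_of_ne {k l : Fin n} (h : k ≠ l) : (ziT k l : OT K N n) = ziB (b := id) h := dif_pos h

theorem zT_eq (k l : Fin n) : (zT k l : OT K N n) = zB id k l := rfl

theorem zeT_eq (k l : Fin n) (i : Fin N) : (zeT k l i : OT K N n) = zeB id k l i := rfl

variable (K N n) in
/-- The monoid generated by the `z_{k,l}^{-1}`. -/
def poleMonoid : Submonoid (OT K N n) := Submonoid.closure {x | ∃ k l, k ≠ l ∧ x = ziT k l}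

variable (K N n) in
/-- The algebra generated by the `z_{k,l}` and the `ζ_{k,l}^i`. -/
def polyAlg : Subalgebra K (OT K N n) :=
  Algebra.adjoin K ({x | ∃ k l, x = zT k l} ∪ {x | ∃ k l i, x = zeT k l i})

theorem poleMonoid_comm {u : OT K N n} (hu : u ∈ poleMonoid K N n) (f : OT K N n) :
    u * f = f * u := by
  induction hu using Submonoid.closure_induction with
  | mem x hx => obtain ⟨k, l, h, rfl⟩ := hx; rw [ziT_of_ne h, ziB_comm]
  | one => rw [one_mul, mul_one]
  | mul x y _ _ hx hy => rw [mul_assoc, hy, ← mul_assoc, hx, mul_assoc]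

theorem exists_mul_eq_one {u : OT K N n} (hu : u ∈ poleMonoid K N n) :
    ∃ w ∈ polyAlg K N n, u * w = 1 := by
  induction hu using Submonoid.closure_induction with
  | mem x hx =>
    obtain ⟨k, l, h, rfl⟩ := hx
    exact ⟨zT k l, Algebra.subset_adjoin (Or.inl ⟨k, l, rfl⟩), by
      rw [ziT_of_ne h, zT_eq, ziB_mul_zB]⟩
  | one => exact ⟨1, one_mem _, one_mul 1⟩
  | mul x y hx hy ihx ihy =>
    obtain ⟨w, hw, e⟩ := ihx
    obtain ⟨w', hw', e'⟩ := ihy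
    refine ⟨w' * w, mul_mem hw' hw, ?_⟩
    rw [mul_assoc, ← mul_assoc y, e', one_mul, e]

theorem exists_pole_mul_poly (f : OT K N n) :
    ∃ u ∈ poleMonoid K N n, ∃ p ∈ polyAlg K N n, f = u * p := by
  obtain ⟨f, hf⟩ := f
  induction hf using Algebra.adjoin_induction with
  | mem x hx =>
    obtain (⟨k, l, rfl⟩ | ⟨k, l, h, rfl⟩) | ⟨k, l, i, rfl⟩ := hx
    · exact ⟨1, one_mem _, zT k l, Algebra.subset_adjoin (Or.inl ⟨k, l, rfl⟩), (one_mul _).symm⟩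
    · refine ⟨ziT k l, Submonoid.subset_closure ⟨k, l, h, rfl⟩, 1, one_mem _, ?_⟩
      rw [mul_one]
      exact (ziT_of_ne (K := K) (N := N) (k := k) (l := l) h).symm
    · exact ⟨1, one_mem _, zeT k l i, Algebra.subset_adjoin (Or.inr ⟨k, l, i, rfl⟩),
        (one_mul _).symm⟩
  | algebraMap r =>
    exact ⟨1, one_mem _, algebraMap K _ r, Subalgebra.algebraMap_mem _ r, (one_mul _).symm⟩
  | add x y hx hy ihx ihy =>
    obtain ⟨u, hu, p, hp, e⟩ := ihx
    obtain ⟨u', hu', p', hp', e'⟩ := ihy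
    obtain ⟨w, hw, h1⟩ := exists_mul_eq_one hu
    obtain ⟨w', hw', h1'⟩ := exists_mul_eq_one hu'
    refine ⟨u * u', mul_mem hu hu', w' * p + w * p', add_mem (mul_mem hw' hp) (mul_mem hw hp'), ?_⟩
    have e1 : (⟨x + y, add_mem hx hy⟩ : OT K N n) = u * p + u' * p' := by rw [← e, ← e']; rfl
    rw [e1, mul_add]
    congr 1
    · rw [mul_assoc, ← mul_assoc u', h1', one_mul]
    · rw [poleMonoid_comm hu, mul_assoc, ← mul_assoc u, h1, one_mul]
  | mul x y hx hy ihx ihy =>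
    obtain ⟨u, hu, p, hp, e⟩ := ihx
    obtain ⟨u', hu', p', hp', e'⟩ := ihy
    refine ⟨u * u', mul_mem hu hu', p * p', mul_mem hp hp', ?_⟩
    have e1 : (⟨x * y, mul_mem hx hy⟩ : OT K N n) = u * p * (u' * p') := by rw [← e, ← e']; rfl
    rw [e1, mul_assoc, ← mul_assoc p, ← poleMonoid_comm hu' p]
    simp only [mul_assoc]

theorem mem_of_poles {A : Submodule K (OT K N n)} (h1 : ∀ f ∈ A, ∀ k l, f * zT k l ∈ A)
    (h2 : ∀ f ∈ A, ∀ k l i, f * zeT k l i ∈ A) (h3 : ∀ u ∈ poleMonoid K N n, u ∈ A)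
    (f : OT K N n) : f ∈ A := by
  obtain ⟨u, hu, p, hp, rfl⟩ := exists_pole_mul_poly f
  have hu' := h3 u hu
  clear hu
  revert u
  induction hp using Algebra.adjoin_induction with
  | mem x hx =>
    intro u hu
    obtain ⟨k, l, rfl⟩ | ⟨k, l, i, rfl⟩ := hx
    exacts [h1 u hu k l, h2 u hu k l i]
  | algebraMap r =>
    intro u hu
    rw [Algebra.algebraMap_eq_smul_one, mul_smul_comm, mul_one]
    exact A.smul_mem r hu
  | add x y _ _ hx hy => intro u hu; rw [mul_add]; exact A.add_mem (hx u hu) (hy u hu)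
  | mul x y _ _ hx hy => intro u hu; rw [← mul_assoc]; exact hy _ (hx u hu)

end Spanning

section Regular

variable {n m : ℕ}

theorem poles_le (b : Fin n → Fin m) : poles K b ≤ nonZeroDivisors (MvPolynomial (Fin n) K) := by
  refine Submonoid.closure_le.mpr ?_
  rintro p ⟨k, l, h, rfl⟩
  refine mem_nonZeroDivisors_of_ne_zero (sub_ne_zero.mpr fun e => h ?_)
  rw [MvPolynomial.X_injective e]

theorem locLift_injective (b : Fin n → Fin m) {m' : ℕ} (b' : Fin n → Fin m')
    (h : ∀ k l, b k ≠ b l → IsUnit (zc (K := K) b' k - zc b' l)) :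
    Function.Injective (locLift (K := K) b (zc b') h) := by
  rw [injective_iff_map_eq_zero]
  intro x hx
  have h3 : ∀ p : MvPolynomial (Fin n) K,
      locLift b (zc b') h (algebraMap _ (Loc K b) p) = algebraMap _ (Loc K b') p := fun p => by
    have : (locLift b (zc b') h).comp (IsScalarTower.toAlgHom K _ (Loc K b)) =
        IsScalarTower.toAlgHom K (MvPolynomial (Fin n) K) (Loc K b') :=
      MvPolynomial.algHom_ext fun k => locLift_zc b (zc b') h k
    exact DFunLike.congr_fun this p
  obtain ⟨p, s, rfl⟩ := IsLocalization.exists_mk'_eq (poles K b) x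
  have h1 : IsLocalization.mk' (Loc K b) p s * algebraMap _ (Loc K b) (s : MvPolynomial (Fin n) K) =
      algebraMap _ (Loc K b) p := IsLocalization.mk'_spec _ _ _
  have h2 := congrArg (locLift b (zc b') h) h1
  rw [map_mul, hx, zero_mul, h3] at h2
  have h4 : p = 0 :=
    (IsLocalization.injective (Loc K b') (poles_le b')) (h2.symm.trans (map_zero _).symm)
  rw [h4, IsLocalization.mk'_zero]

theorem gmap_id : gmap (K := K) (N := N) (fun k l : Fin n => if k = l then 1 else 0) =
    AlgHom.id K _ := by
  refine ExteriorAlgebra.hom_ext (LinearMap.pi_ext' fun p => LinearMap.ext_ring ?_)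
  have := gmap_ι_single (K := K) (N := N) (fun k l : Fin n => if k = l then 1 else 0) p.1 p.2
  simpa using this

theorem relT_id_injective (b : Fin n → Fin m) {m' : ℕ} (b' : Fin n → Fin m')
    (h : ∀ k l, b k ≠ b l → b' (id k) ≠ b' (id l)) :
    Function.Injective (relT (K := K) (N := N) b b' id h) := by
  have h1 : Function.Injective (relabel (K := K) (N := N) b b' id h) := by
    have e : ⇑(relabel (K := K) (N := N) b b' id h) = (locLift b (zc b')
        (fun k l hkl => zc_sub_isUnit (h k l hkl))).toLinearMap.rTensor (Grass K N n) := by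
      funext x
      change Algebra.TensorProduct.map _ (gmap fun k l : Fin n => if k = l then 1 else 0) x = _
      rw [gmap_id]
      rfl
    rw [e]
    exact Module.Flat.rTensor_preserves_injective_linearMap _ (locLift_injective b b'
      fun k l hkl => zc_sub_isUnit (h k l hkl))
  intro x y hxy
  exact Subtype.ext (h1 (congrArg Subtype.val hxy))

end Regular

section Homogeneous

theorem sgn_add (p q : ZMod 2) : sgn (p + q) = sgn p * sgn q := by revert p q; decide

theorem sgn_mul_self (p : ZMod 2) : sgn p * sgn p = 1 := by revert p; decide

theorem sgn_smul_sgn_smul {E : Type*} [AddCommGroup E] (p : ZMod 2) (x : E) :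
    sgn p • sgn p • x = x := by
  rw [smul_smul, sgn_mul_self, one_smul]

theorem sgn_zero_smul {E : Type*} [AddCommGroup E] (x : E) : sgn 0 • x = x := one_smul ℤ x

theorem sgn_one_smul {E : Type*} [AddCommGroup E] (x : E) : sgn 1 • x = -x := neg_one_zsmul x

theorem sgn_sum {ι : Type*} (s : Finset ι) (ε : ι → ZMod 2) :
    sgn (∑ j ∈ s, ε j) = ∏ j ∈ s, sgn (ε j) := by
  classical
  induction s using Finset.induction_on with
  | empty => rfl
  | insert a s ha ih => rw [Finset.sum_insert ha, Finset.prod_insert ha, sgn_add, ih]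

variable (M) {n : ℕ}

theorem HWSupermodule.proj_mem (q : ZMod 2) (v : V) : M.proj q v ∈ M.deg q :=
  Submodule.projection_apply_mem _ _

theorem HWSupermodule.proj_of_mem {q : ZMod 2} {v : V} (hv : v ∈ M.deg q) : M.proj q v = v :=
  Submodule.projection_apply_of_mem_left _ hv

theorem HWSupermodule.proj_of_mem_add_one {q : ZMod 2} {v : V} (hv : v ∈ M.deg (q + 1)) :
    M.proj q v = 0 :=
  Submodule.projection_apply_of_mem_right _ hv

theorem zmod_two_cases (p q : ZMod 2) : q = p ∨ q = p + 1 := by revert p q; decide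

theorem HWSupermodule.sum_proj (v : V) : ∑ q : ZMod 2, M.proj q v = v := by
  refine M.homogeneous_induction (C := fun v => ∑ q : ZMod 2, M.proj q v = v) (fun p v hv => ?_)
    (fun v w hv hw => ?_) v
  · rw [Finset.sum_eq_single p, M.proj_of_mem hv]
    · intro q _ hq
      refine M.proj_of_mem_add_one ?_
      obtain rfl | rfl := zmod_two_cases q p
      exacts [absurd rfl hq, hv]
    · simp
  · simp only [map_add, Finset.sum_add_distrib, hv, hw]

theorem multilinear_ext_homogeneous {W : Type*} [AddCommGroup W] [Module K W]
    {F G : MultilinearMap K (fun _ : Fin n => V) W}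
    (h : ∀ (ε : Fin n → ZMod 2) (v : Fin n → V), (∀ j, v j ∈ M.deg (ε j)) → F v = G v) : F = G := by
  refine MultilinearMap.ext fun v => ?_
  have e : v = fun j => ∑ q : ZMod 2, M.proj q (v j) := funext fun j => (M.sum_proj _).symm
  rw [e, F.map_sum, G.map_sum]
  exact Finset.sum_congr rfl fun ε _ => h ε _ fun j => M.proj_mem _ _

theorem map_par_of_homogeneous {W : Type*} [AddCommGroup W] [Module K W]
    (F : MultilinearMap K (fun _ : Fin n => V) W) {ε : Fin n → ZMod 2} {v : Fin n → V}
    (hv : ∀ j, v j ∈ M.deg (ε j)) (P : Fin n → Prop) [DecidablePred P] :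
    F (fun j => if P j then M.par (v j) else v j) =
      sgn (∑ j ∈ Finset.univ.filter P, ε j) • F v := by
  have e : (fun j => if P j then M.par (v j) else v j) =
      fun j => (if P j then ((sgn (ε j) : ℤ) : K) else 1) • v j := by
    funext j
    split_ifs
    · rw [M.par_of_mem (hv j), Int.cast_smul_eq_zsmul]
    · rw [one_smul]
  rw [e, F.map_smul_univ, sgn_sum, ← Int.cast_smul_eq_zsmul K, Finset.prod_filter]
  congr 1
  push_cast
  exact Finset.prod_congr rfl fun j _ => by split_ifs <;> simp

theorem linear_ext_pure [CharZero K] {W : Type*} [AddCommGroup W] [Module K W]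
    {F G : OT K N n →ₗ[K] W} (h : ∀ q f, IsPure q f → F f = G f) (f : OT K N n) : F f = G f := by
  have h0 : F (f + invT f) = G (f + invT f) := h 0 _ (by
    refine congrArg Subtype.val (?_ : invT (f + invT f) = sgn 0 • (f + invT f))
    rw [map_add, invT_invT, add_comm, sgn_zero_smul])
  have h1 : F (f - invT f) = G (f - invT f) := h 1 _ (by
    refine congrArg Subtype.val (?_ : invT (f - invT f) = sgn 1 • (f - invT f))
    rw [map_sub, invT_invT, sgn_one_smul, neg_sub])
  rw [map_add, map_add] at h0
  rw [map_sub, map_sub] at h1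
  have h2 : (2 : K) • F f = (2 : K) • G f := by
    rw [two_smul, two_smul]
    have := congrArg₂ (· + ·) h0 h1
    simpa only [add_add_sub_cancel] using this
  exact smul_right_injective W two_ne_zero h2

theorem IsPure.invT_eq {q : ZMod 2} {f : OT K N n} (h : IsPure q f) : invT f = sgn q • f :=
  Subtype.ext h

end Homogeneous

section ChiralOf

variable (M) {n : ℕ}

/-- `X` is a `D_n^T`-linear map of parity `p`. The parities of the arguments are expressed through
the parity involutions. -/
structure IsChiralOf (p : ZMod 2) (X : Op M n) : Prop where
  mul_z : ∀ v f k l, X v (f * zT k l) = nDlam M l k (X v f)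
  mul_ζ : ∀ v f k l i, X v (f * zeT k l i) = nDodd M k l i (nPar M n (X v f))
  d_z : ∀ v f k,
    X (Function.update v k (M.T (v k))) f = X v (dzT k f) - nMul M (lam k) (X v f)
  parity : ∀ v f, nPar M n (X v f) = sgn p • X (fun j => M.par (v j)) (invT f)
  d_ζ : ∀ v f k i, X (Function.update v k (M.S i (v k))) f =
    X (fun j => if k ≤ j then M.par (v j) else v j) (dzeT k i f) -
      sgn p • nMul M (odd k i) (X (fun j => if j < k then M.par (v j) else v j) f)

variable {M} {p : ZMod 2} {X : Op M n}

theorem smul_sub_smul_eq_iff {E : Type*} [AddCommGroup E] {q s t p : ZMod 2} {x y z : E} :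
    sgn (s + t + q) • sgn s • x - sgn q • y = -(sgn (p + (s + t) + q) • z) ↔
      x = sgn t • y - sgn p • sgn s • z := by
  have key : sgn (s + t + q) • sgn s • x - sgn q • y + (sgn (p + (s + t) + q) • z) =
      sgn (t + q) • (x - (sgn t • y - sgn p • sgn s • z)) := by
    simp only [smul_sub, smul_smul, sgn_add]
    have h1 : sgn s * sgn t * sgn q * sgn s = sgn t * sgn q := by
      linear_combination sgn t * sgn q * sgn_mul_self s
    have h2 : sgn t * sgn q * sgn t = sgn q := by linear_combination sgn q * sgn_mul_self t
    have h3 : sgn p * (sgn s * sgn t) * sgn q = sgn t * sgn q * (sgn p * sgn s) := by ring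
    rw [h1, h2, h3]
    abel
  rw [eq_neg_iff_add_eq_zero, key, ← sub_eq_zero (a := x)]
  constructor
  · intro h
    have := congrArg (sgn (t + q) • ·) h
    simpa only [sgn_smul_sgn_smul, smul_zero] using this
  · intro h
    rw [h, smul_zero]

theorem sum_lt_add_sum_le (ε : Fin n → ZMod 2) (k : Fin n) :
    ∑ j ∈ Finset.univ.filter (· < k), ε j + ∑ j ∈ Finset.univ.filter (k ≤ ·), ε j = ∑ j, ε j := by
  rw [← Finset.sum_filter_add_sum_filter_not Finset.univ (· < k) ε]
  simp only [not_lt]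

theorem apply_par_homogeneous {ε : Fin n → ZMod 2} {v : Fin n → V} (hv : ∀ j, v j ∈ M.deg (ε j))
    (P : Fin n → Prop) [DecidablePred P] (f : OT K N n) :
    X (fun j => if P j then M.par (v j) else v j) f =
      sgn (∑ j ∈ Finset.univ.filter P, ε j) • X v f := by
  rw [map_par_of_homogeneous M X hv P]
  rfl

theorem apply_par_homogeneous_univ {ε : Fin n → ZMod 2} {v : Fin n → V}
    (hv : ∀ j, v j ∈ M.deg (ε j)) (f : OT K N n) :
    X (fun j => M.par (v j)) f = sgn (∑ j, ε j) • X v f := by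
  simpa using apply_par_homogeneous (X := X) hv (fun _ => True) f

theorem isChiralOf_iff [CharZero K] : IsChiralOf M p X ↔ IsChiral M X ∧ HasParity M p X := by
  constructor
  · intro h
    have hP : HasParity M p X := fun ε v hv q f hf => by
      rw [h.parity, apply_par_homogeneous_univ hv, hf.invT_eq, map_zsmul, smul_smul, smul_smul,
        sgn_add, sgn_add]
    refine ⟨⟨h.mul_z, h.mul_ζ, fun v f k => ?_, fun ε v hv q f hf k i => ?_⟩, hP⟩
    · rw [h.d_z]; abel
    · rw [hP ε v hv q f hf, map_zsmul, ← sum_lt_add_sum_le ε k, smul_sub_smul_eq_iff, h.d_ζ,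
        apply_par_homogeneous hv, apply_par_homogeneous hv, map_zsmul]
  · rintro ⟨h, hP⟩
    refine ⟨h.mul_z, h.mul_ζ, fun v f k => ?_, fun v f => ?_, fun v f k i => ?_⟩
    · have := h.d_z v f k
      rw [sub_eq_iff_eq_add] at this
      rw [this]; abel
    · refine linear_ext_pure (F := nPar M n ∘ₗ X v)
        (G := sgn p • X (fun j => M.par (v j)) ∘ₗ invT.toLinearMap) (fun q f hf => ?_) f
      refine DFunLike.congr_fun (multilinear_ext_homogeneous M
        (F := (nPar M n ∘ₗ LinearMap.applyₗ f).compMultilinearMap X)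
        (G := sgn p • (LinearMap.applyₗ (invT f)).compMultilinearMap
          (X.compLinearMap fun _ => M.par)) fun ε v hv => ?_) v
      change nPar M n (X v f) = sgn p • X (fun j => M.par (v j)) (invT f)
      rw [hP ε v hv q f hf, apply_par_homogeneous_univ hv, hf.invT_eq, map_zsmul, smul_smul,
        smul_smul, sgn_add, sgn_add]
    · refine linear_ext_pure (F := X (Function.update v k (M.S i (v k))))
        (G := X (fun j => if k ≤ j then M.par (v j) else v j) ∘ₗ dzeT k i -
          sgn p • nMul M (odd k i) ∘ₗ X (fun j => if j < k then M.par (v j) else v j))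
        (fun q f hf => ?_) f
      have h2 : ∀ (c : Fin n → Prop) [DecidablePred c] (v : Fin n → V), (fun j => (if c j then M.par
          else LinearMap.id) (v j)) = fun j => if c j then M.par (v j) else v j := fun c _ v => by
        funext j; split_ifs <;> rfl
      let F := (LinearMap.applyₗ f).compMultilinearMap
        (X.compLinearMap fun j => if j = k then M.S i else LinearMap.id)
      let G := (LinearMap.applyₗ (dzeT k i f)).compMultilinearMap
        (X.compLinearMap fun j => if k ≤ j then M.par else LinearMap.id) -
        sgn p • (nMul M (odd k i) ∘ₗ LinearMap.applyₗ f).compMultilinearMap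
        (X.compLinearMap fun j => if j < k then M.par else LinearMap.id)
      have e : ∀ v, F v = G v ↔ X (Function.update v k (M.S i (v k))) f =
          X (fun j => if k ≤ j then M.par (v j) else v j) (dzeT k i f) -
          sgn p • nMul M (odd k i) (X (fun j => if j < k then M.par (v j) else v j) f) := fun v => by
        change X (fun j => (if j = k then M.S i else LinearMap.id) (v j)) f =
          X (fun j => (if k ≤ j then M.par else LinearMap.id) (v j)) (dzeT k i f) -
          sgn p • nMul M (odd k i) (X (fun j => (if j < k then M.par else LinearMap.id) (v j)) f) ↔ _
        have h1 : (fun j => (if j = k then M.S i else LinearMap.id) (v j)) =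
            Function.update v k (M.S i (v k)) := by
          funext j; obtain rfl | hj := eq_or_ne j k <;> simp [*]
        rw [h1, h2, h2]
      refine (e v).mp (DFunLike.congr_fun (multilinear_ext_homogeneous M fun ε v hv => ?_) v)
      rw [e, apply_par_homogeneous hv, apply_par_homogeneous hv, map_zsmul]
      have := h.d_ζ ε v hv q f hf k i
      rwa [hP ε v hv q f hf, map_zsmul, ← sum_lt_add_sum_le ε k, smul_sub_smul_eq_iff] at this

end ChiralOf

section Nested

variable (M) {n : ℕ}

theorem vpoly_par_induction {P : VPoly K N V 1 → Prop} (one : ∀ v, P (1 ⊗ₜ v))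
    (add : ∀ x y, P x → P y → P (x + y)) (smul : ∀ (c : K) x, P x → P (c • x))
    (lam : ∀ x, P x → P (lmul (lam 0) x))
    (odd : ∀ i x, P x → P (parx M 1 x) → P (lmul (odd 0 i) x)) (x : VPoly K N V 1) : P x := by
  suffices h : P x ∧ P (parx M 1 x) from h.1
  induction x using vpoly_one_induction with
  | one v => exact ⟨one v, by simpa [parx] using one (M.par v)⟩
  | add x y hx hy => rw [map_add]; exact ⟨add _ _ hx.1 hy.1, add _ _ hx.2 hy.2⟩
  | smul c x hx => rw [map_smul]; exact ⟨smul _ _ hx.1, smul _ _ hx.2⟩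
  | lam x hx => rw [parx_lmul_lam]; exact ⟨lam _ hx.1, lam _ hx.2⟩
  | odd i x hx =>
    refine ⟨odd _ _ hx.1 hx.2, ?_⟩
    have h := smul (-1) _ (odd i (parx M 1 x) hx.2 (by rw [parx_parx]; exact hx.1))
    rwa [parx_lmul_odd, ← neg_one_smul K]

variable [CharZero K]

/-- `γ(Λ) u ↦ ± γ(Λ_1 - ∂_{Z_1}) X_{Λ_1 + Λ_2, Λ_3}(u ⊗ c ⊗ f|_{Z_1 = Z_2})`, where the vector `c`
contributes to the sign as one of parity `q`. -/
def applyGam (X : Op M 2) (q : ZMod 2) (c : V) (f : OBT K N (block 1 1)) :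
    VPoly K N V 1 →ₗ[K] VNabla M 3 :=
  applyX M 1 1 X ![c] ∘ₗ gamEval M 1 1 q f

/-- The restriction of a function of three supervariables to `Z_1 = Z_2`. -/
def restr : OBT K N (block 1 1) →ₐ[K] OT K N 2 := relT (block 1 1) id (block 1 1) fun _ _ h => h

/-- The constant `u` as an element of `V[Λ]`. -/
def constV (u : V) : VP K N V 1 := ((1 : SPoly K N 1) ⊗ₜ[K] u : VPoly K N V 1)

variable {M} {X : Op M 2} {q : ZMod 2} {c : V}

theorem gamEval_lmul (f : OReg K N 1 1) (a : SPoly K N 1) (y : VPoly K N V 1) :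
    gamEval M 1 1 q f (lmul a y) =
      evalHom (gamEven 1 1) (gamOdd M 1 1 q) (gam_superCommute M 1 1 q) a
        (gamEval M 1 1 q f y) := by
  apply tensor_ext y; intro b v
  change evalHom (gamEven 1 1) (gamOdd M 1 1 q) (gam_superCommute M 1 1 q) (a * b) _ = _
  rw [map_mul]
  rfl

theorem gamEval_lam (f : OReg K N 1 1) (y : VPoly K N V 1) :
    gamEval M 1 1 q f (lmul (lam 0) y) = gamEven 1 1 0 (gamEval M 1 1 q f y) := by
  rw [gamEval_lmul, lam, evalHom_evn]

theorem gamEval_odd (f : OReg K N 1 1) (i : Fin N) (y : VPoly K N V 1) :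
    gamEval M 1 1 q f (lmul (odd 0 i) y) = gamOdd M 1 1 q (0, i) (gamEval M 1 1 q f y) := by
  rw [gamEval_lmul, evalHom_odd]

theorem gamEval_one (f : OReg K N 1 1) (u : V) : gamEval M 1 1 q f (1 ⊗ₜ u) =
      (constV u : VP K N V 1) ⊗ₜ[K] f := by
  change evalHom (gamEven 1 1) (gamOdd M 1 1 q) (gam_superCommute M 1 1 q) 1 _ = _
  rw [map_one]
  rfl

section Abstract

variable {W U : Type*} [AddCommGroup W] [Module K W] [AddCommGroup U] [Module K U]

theorem map_sub_comm_apply (α : Module.End K W) (δ η : Module.End K U)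
    (h : ∀ x, η (δ x) = δ (η x)) (w : W ⊗[K] U) : TensorProduct.map LinearMap.id η
        ((TensorProduct.map α LinearMap.id - TensorProduct.map LinearMap.id δ :
          Module.End K (W ⊗[K] U)) w) =
      (TensorProduct.map α LinearMap.id - TensorProduct.map LinearMap.id δ :
        Module.End K (W ⊗[K] U)) (TensorProduct.map LinearMap.id η w) := by
  apply tensor_ext w; intro x u
  simp only [LinearMap.sub_apply, TensorProduct.map_tmul, LinearMap.id_apply, map_sub, h]

theorem map_par_sub_comm_apply (α π : Module.End K W) (δ η : Module.End K U)
    (hα : ∀ x, π (α x) = α (π x)) (h : ∀ x, η (δ x) = δ (η x)) (w : W ⊗[K] U) :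
    TensorProduct.map π η ((TensorProduct.map α LinearMap.id - TensorProduct.map LinearMap.id δ :
          Module.End K (W ⊗[K] U)) w) =
      (TensorProduct.map α LinearMap.id - TensorProduct.map LinearMap.id δ :
        Module.End K (W ⊗[K] U)) (TensorProduct.map π η w) := by
  apply tensor_ext w; intro x u
  simp only [LinearMap.sub_apply, TensorProduct.map_tmul, LinearMap.id_apply, map_sub, h, hα]

theorem map_sub_smul_comm_apply (s : ℤ) (β π : Module.End K W) (δ η : Module.End K U)
    (h : ∀ x, η (δ x) = δ (η x)) (w : W ⊗[K] U) : TensorProduct.map LinearMap.id η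
        ((TensorProduct.map β LinearMap.id - s • TensorProduct.map π δ :
          Module.End K (W ⊗[K] U)) w) =
      (TensorProduct.map β LinearMap.id - s • TensorProduct.map π δ : Module.End K (W ⊗[K] U))
        (TensorProduct.map LinearMap.id η w) := by
  apply tensor_ext w; intro x u
  simp only [LinearMap.sub_apply, LinearMap.smul_apply, TensorProduct.map_tmul,
    LinearMap.id_apply, map_sub, map_zsmul, h]

theorem map_par_sub_smul_anticomm_apply (s : ℤ) (β π : Module.End K W) (δ η : Module.End K U)
    (hβ : ∀ x, π (β x) = -β (π x)) (h : ∀ x, η (δ x) = -δ (η x)) (w : W ⊗[K] U) :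
    TensorProduct.map π η ((TensorProduct.map β LinearMap.id - s • TensorProduct.map π δ :
          Module.End K (W ⊗[K] U)) w) =
      -(TensorProduct.map β LinearMap.id - s • TensorProduct.map π δ : Module.End K (W ⊗[K] U))
        (TensorProduct.map π η w) := by
  apply tensor_ext w; intro x u
  simp only [LinearMap.sub_apply, LinearMap.smul_apply, TensorProduct.map_tmul,
    LinearMap.id_apply, map_sub, map_zsmul, h, hβ, TensorProduct.neg_tmul, TensorProduct.tmul_neg,
    smul_neg]
  abel

end Abstract

theorem dzR_dzR (k l : Fin 3) (x : OReg K N 1 1) :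
    dzR 1 1 k (dzR 1 1 l x) = dzR 1 1 l (dzR 1 1 k x) := dzT_dzT (b := block 1 1) k l x

theorem dzR_dzeR (k l : Fin 3) (i : Fin N) (x : OReg K N 1 1) :
    dzR 1 1 k (dzeR 1 1 l i x) = dzeR 1 1 l i (dzR 1 1 k x) := dzT_dzeT (b := block 1 1) k l i x

theorem dzeR_dzeR (k l : Fin 3) (i j : Fin N) (x : OReg K N 1 1) :
    dzeR 1 1 k i (dzeR 1 1 l j x) = -dzeR 1 1 l j (dzeR 1 1 k i x) :=
  eq_neg_of_add_eq_zero_left (dzeT_dzeT (b := block 1 1) k l i j x)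

theorem map_dz_gamEval (k : Fin 3) (f : OReg K N 1 1) (y : VPoly K N V 1) :
    TensorProduct.map LinearMap.id (dzR 1 1 k) (gamEval M 1 1 q f y) =
      gamEval M 1 1 q (dzR 1 1 k f) y := by
  induction y using vpoly_one_induction with
  | one u => rw [gamEval_one, gamEval_one]; rfl
  | add x y hx hy => simp only [map_add, hx, hy]
  | smul c x hx => simp only [map_smul, hx]
  | lam x hx =>
    rw [gamEval_lam, gamEval_lam, ← hx]
    exact map_sub_comm_apply _ _ _ (fun x => dzR_dzR _ _ x) _
  | odd i x hx =>
    rw [gamEval_odd, gamEval_odd, ← hx]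
    exact map_sub_smul_comm_apply _ _ _ _ _ (fun x => dzR_dzeR _ _ _ x) _

theorem map_dze_gamEval (k : Fin 3) (i : Fin N) (f : OReg K N 1 1) (y : VPoly K N V 1) :
    TensorProduct.map (parP M 1) (dzeR 1 1 k i) (gamEval M 1 1 q f y) =
      gamEval M 1 1 q (dzeR 1 1 k i f) (parx M 1 y) := by
  induction y using vpoly_one_induction with
  | one u =>
    have e : parx M 1 ((1 : SPoly K N 1) ⊗ₜ[K] u) = 1 ⊗ₜ M.par u := by simp [parx]
    rw [gamEval_one, e, gamEval_one, TensorProduct.map_tmul]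
    exact congrArg (fun x : VP K N V 1 => x ⊗ₜ[K] dzeR 1 1 k i f) e
  | add x y hx hy => simp only [map_add, hx, hy]
  | smul c x hx => simp only [map_smul, hx]
  | lam x hx =>
    rw [gamEval_lam, parx_lmul_lam, gamEval_lam, ← hx]
    exact map_par_sub_comm_apply _ _ _ _ (fun x => parx_lmul_lam (M := M) 0 x)
      (fun x => (dzR_dzeR _ _ _ x).symm) _
  | odd j x hx =>
    rw [gamEval_odd, parx_lmul_odd, map_neg, gamEval_odd, ← hx]
    exact map_par_sub_smul_anticomm_apply _ _ _ _ _ (fun x => parx_lmul_odd (M := M) 0 j x)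
      (fun x => dzeR_dzeR _ _ _ _ x) _

theorem applyX_tmul (a : SPoly K N 1) (u : V) (g : OReg K N 1 1) (w : Fin 1 → V) :
    applyX M 1 1 X w (((a ⊗ₜ[K] u : VPoly K N V 1) : VP K N V 1) ⊗ₜ[K] g) =
      nMul M (subst (fun k l => if l = pt 1 1 k then 1 else 0) (invPow 1 a))
        (nSubst M (block 1 1) (X (Function.update (Fin.cons 0 w) 0 u) (restr g))) := rfl

theorem invPow_one (a : SPoly K N n) : invPow 1 a = inv a := rfl

theorem gspace_induction {P : GSpace K N V 1 1 → Prop} (zero : P 0)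
    (tmul : ∀ (a : SPoly K N 1) (u : V) (g : OReg K N 1 1),
      P (((a ⊗ₜ[K] u : VPoly K N V 1) : VP K N V 1) ⊗ₜ[K] g))
    (add : ∀ x y, P x → P y → P (x + y)) (x : GSpace K N V 1 1) : P x := by
  refine tensor_ind x (fun y g => ?_) add
  have h : ∀ y : VPoly K N V 1, P ((y : VP K N V 1) ⊗ₜ[K] g) := fun y => by
    induction y using TensorProduct.induction_on with
    | zero =>
      have := TensorProduct.zero_tmul (R := K) (VP K N V 1) g
      rw [← this] at zero
      exact zero
    | tmul a u => exact tmul a u g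
    | add x y hx hy =>
      have := TensorProduct.add_tmul (R := K) (M := VP K N V 1) x y g
      have h2 := add _ _ hx hy
      rw [← this] at h2
      exact h2
  exact h y

theorem map_lmulP_tmul (a b : SPoly K N 1) (u : V) (g : OReg K N 1 1) :
    TensorProduct.map (lmulP a) LinearMap.id (((b ⊗ₜ[K] u : VPoly K N V 1) : VP K N V 1) ⊗ₜ[K] g) =
      (((a * b) ⊗ₜ[K] u : VPoly K N V 1) : VP K N V 1) ⊗ₜ[K] g :=
  TensorProduct.map_tmul (R := K) (M := VP K N V 1) (N := OReg K N 1 1) (lmulP a) LinearMap.id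
    ((b ⊗ₜ[K] u : VPoly K N V 1) : VP K N V 1) g

theorem sum_ite_smul_pt {E : Type*} [AddCommGroup E] [Module K E] (g : Fin 3 → E) :
    ∑ l : Fin 3, (if l = pt 1 1 0 then (1 : K) else 0) • g l = g 0 := by
  rw [Finset.sum_eq_single (pt 1 1 0)]
  · rw [if_pos rfl, one_smul]; rfl
  · intro l _ hl
    rw [if_neg hl, zero_smul]
  · simp

theorem applyX_lam (w : Fin 1 → V) (x : GSpace K N V 1 1) :
    applyX M 1 1 X w (TensorProduct.map (lmulP (lam 0)) LinearMap.id x) =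
      nMul M (lam 0) (applyX M 1 1 X w x) := by
  induction x using gspace_induction with
  | zero => simp
  | add x y hx hy => simp only [map_add, hx, hy]
  | tmul a u g =>
    rw [applyX_tmul, ← nMul_mul]
    refine (congrArg (applyX M 1 1 X w) (map_lmulP_tmul (lam 0) a u g)).trans
      ((applyX_tmul (X := X) (lam 0 * a) u g w).trans ?_)
    rw [map_mul, map_mul, invPow_one, inv_lam, subst_lam]
    exact congrArg (fun b => nMul M (b * _) _) (sum_ite_smul_pt (K := K) fun l => lam l)

theorem applyX_odd (w : Fin 1 → V) (i : Fin N) (x : GSpace K N V 1 1) :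
    applyX M 1 1 X w (TensorProduct.map (lmulP (odd 0 i)) LinearMap.id x) =
      -nMul M (odd 0 i) (applyX M 1 1 X w x) := by
  induction x using gspace_induction with
  | zero => simp
  | add x y hx hy => simp only [map_add, hx, hy, neg_add]
  | tmul a u g =>
    rw [applyX_tmul, ← nMul_mul, ← nMul_neg, ← neg_mul]
    refine (congrArg (applyX M 1 1 X w) (map_lmulP_tmul (odd 0 i) a u g)).trans
      ((applyX_tmul (X := X) (odd 0 i * a) u g w).trans ?_)
    rw [map_mul, map_mul, invPow_one, inv_odd, map_neg, subst_odd]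
    exact congrArg (fun b => nMul M (-b * _) _) (sum_ite_smul_pt (K := K) fun l => odd l i)

theorem applyX_gamEval_lam (f : OReg K N 1 1) (y : VPoly K N V 1) (w : Fin 1 → V) :
    applyX M 1 1 X w (gamEval M 1 1 q f (lmul (lam 0) y)) =
      nMul M (lam 0) (applyX M 1 1 X w (gamEval M 1 1 q f y)) -
        applyX M 1 1 X w (gamEval M 1 1 q (dzR 1 1 0 f) y) := by
  rw [gamEval_lam, gamEven, LinearMap.sub_apply, map_sub, applyX_lam]
  exact congrArg (fun x => _ - applyX M 1 1 X w x) (map_dz_gamEval 0 f y)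

theorem applyX_gamEval_odd (f : OReg K N 1 1) (i : Fin N) (y : VPoly K N V 1) (w : Fin 1 → V) :
    applyX M 1 1 X w (gamEval M 1 1 q f (lmul (odd 0 i) y)) =
      -nMul M (odd 0 i) (applyX M 1 1 X w (gamEval M 1 1 q f y)) -
        sgn q • applyX M 1 1 X w (gamEval M 1 1 q (dzeR 1 1 0 i f) (parx M 1 y)) := by
  rw [gamEval_odd, gamOdd, LinearMap.sub_apply, map_sub, applyX_odd, LinearMap.smul_apply,
    map_zsmul]
  exact congrArg (fun x => _ - sgn q • applyX M 1 1 X w x) (map_dze_gamEval 0 i f y)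

theorem applyGam_one (f : OBT K N (block 1 1)) (u : V) :
    applyGam M X q c f (1 ⊗ₜ u) = nSubst M (block 1 1) (X ![u, c] (restr f)) := by
  refine (congrArg (applyX M 1 1 X ![c]) (gamEval_one (M := M) (q := q) f u)).trans ?_
  refine (applyX_tmul (X := X) 1 u f ![c]).trans ?_
  rw [map_one, map_one, nMul_one]
  have e : Function.update (Fin.cons 0 ![c] : Fin 2 → V) 0 u = ![u, c] := by
    funext j
    fin_cases j <;> rfl
  exact congrArg (fun w => nSubst M (block 1 1) (X w (restr f))) e

theorem applyGam_lam (f : OBT K N (block 1 1)) (y : VPoly K N V 1) :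
    applyGam M X q c f (lmul (lam 0) y) =
      nMul M (lam 0) (applyGam M X q c f y) - applyGam M X q c (dzT 0 f) y :=
  applyX_gamEval_lam f y ![c]

theorem applyGam_odd (f : OBT K N (block 1 1)) (i : Fin N) (y : VPoly K N V 1) :
    applyGam M X q c f (lmul (odd 0 i) y) = -nMul M (odd 0 i) (applyGam M X q c f y) -
        sgn q • applyGam M X q c (dzeT 0 i f) (parx M 1 y) :=
  applyX_gamEval_odd f i y ![c]

theorem applyGam_zsmul (s : ℤ) (f : OBT K N (block 1 1)) (y : VPoly K N V 1) :
    applyGam M X q (s • c) f y = s • applyGam M X q c f y := by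
  induction y using vpoly_par_induction M generalizing f with
  | one u =>
    have h := X.map_update_smul ![u, 0] 1 (s : K) c
    rw [update_pair, update_pair, Int.cast_smul_eq_zsmul, Int.cast_smul_eq_zsmul] at h
    rw [applyGam_one, applyGam_one, h]
    exact map_zsmul (nSubst M (block 1 1)) s (X ![u, c] (restr f))
  | add x y hx hy => simp only [map_add, hx, hy, zsmul_add]
  | smul r x hx => rw [map_smul, map_smul, hx, smul_comm]
  | lam x hx => rw [applyGam_lam, applyGam_lam, hx, hx, map_zsmul, zsmul_sub]
  | odd i x hx hx' =>
    rw [applyGam_odd, applyGam_odd, hx, hx', map_zsmul, zsmul_sub, zsmul_neg, smul_comm]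

end Nested

section NestedSum

variable [CharZero K] (M)

theorem HWSupermodule.proj_par (q : ZMod 2) (v : V) : M.proj q (M.par v) = sgn q • M.proj q v := by
  refine M.homogeneous_induction (C := fun v => M.proj q (M.par v) = sgn q • M.proj q v)
    (fun p v hv => ?_) (fun v w hv hw => by simp only [map_add, hv, hw, smul_add]) v
  rw [M.par_of_mem hv, map_zsmul]
  obtain rfl | rfl := zmod_two_cases q p
  · rfl
  · rw [M.proj_of_mem_add_one hv, smul_zero, smul_zero]

/-- `γ(Λ) u ↦ ± γ(Λ_1 - ∂_{Z_1}) X_{Λ_1 + Λ_2, Λ_3}(u ⊗ c ⊗ f|_{Z_1 = Z_2})`. -/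
def bcomp (X : Op M 2) (c : V) (f : OBT K N (block 1 1)) : VPoly K N V 1 →ₗ[K] VNabla M 3 :=
  ∑ q, applyGam M X q (M.proj q c) f

variable {M} (X : Op M 2) (c : V)

theorem bcomp_of_mem {q : ZMod 2} {c : V} (hc : c ∈ M.deg q) (f : OBT K N (block 1 1))
    (y : VPoly K N V 1) : bcomp M X c f y = applyGam M X q c f y := by
  rw [bcomp, LinearMap.sum_apply, Finset.sum_eq_single q, M.proj_of_mem hc]
  · intro p _ hp
    obtain rfl | rfl := zmod_two_cases p q
    · exact absurd rfl hp
    · have := applyGam_zsmul (X := X) (q := p) (c := (0 : V)) 0 f y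
      rw [M.proj_of_mem_add_one hc, ← zero_smul ℤ (0 : V), this, zero_smul]
  · simp

theorem sum_apply_proj (u : V) : ∑ q : ZMod 2, X ![u, M.proj q c] = X ![u, c] := by
  conv_rhs => rw [← M.sum_proj c]
  rw [← update_pair u 0 (∑ q : ZMod 2, M.proj q c), X.map_update_sum]
  exact Finset.sum_congr rfl fun q _ => by rw [update_pair]

theorem bcomp_one (f : OBT K N (block 1 1)) (u : V) :
    bcomp M X c f (1 ⊗ₜ u) = nSubst M (block 1 1) (X ![u, c] (restr f)) := by
  rw [bcomp, LinearMap.sum_apply, ← sum_apply_proj, LinearMap.sum_apply, map_sum]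
  exact Finset.sum_congr rfl fun q _ => applyGam_one f u

theorem bcomp_lam (f : OBT K N (block 1 1)) (y : VPoly K N V 1) : bcomp M X c f (lmul (lam 0) y) =
      nMul M (lam 0) (bcomp M X c f y) - bcomp M X c (dzT 0 f) y := by
  simp only [bcomp, LinearMap.sum_apply, map_sum]
  rw [← Finset.sum_sub_distrib]
  exact Finset.sum_congr rfl fun q _ => applyGam_lam f y

theorem bcomp_odd (f : OBT K N (block 1 1)) (i : Fin N) (y : VPoly K N V 1) :
    bcomp M X c f (lmul (odd 0 i) y) =
      -nMul M (odd 0 i) (bcomp M X c f y) - bcomp M X (M.par c) (dzeT 0 i f) (parx M 1 y) := by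
  simp only [bcomp, LinearMap.sum_apply, map_sum]
  rw [← Finset.sum_neg_distrib, ← Finset.sum_sub_distrib]
  exact Finset.sum_congr rfl fun q _ => by rw [applyGam_odd, M.proj_par, applyGam_zsmul]

end NestedSum

section TwoPoint

variable [CharZero K] {X : Op M 2} (hX : IsChiralOf M 1 X)

theorem sub_sgn_one_smul {E : Type*} [AddCommGroup E] (x y : E) : x - sgn 1 • y = x + y := by
  rw [sgn_one_smul, sub_neg_eq_add]

include hX

theorem IsChiralOf.T_left (a b : V) (f : OT K N 2) :
    X ![M.T a, b] f = X ![a, b] (dzT 0 f) - nMul M (lam 0) (X ![a, b] f) := by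
  rw [← hX.d_z]
  congr 2
  funext j
  fin_cases j <;> rfl

theorem IsChiralOf.T_right (a b : V) (f : OT K N 2) :
    X ![a, M.T b] f = X ![a, b] (dzT 1 f) - nMul M (lam 1) (X ![a, b] f) := by
  rw [← hX.d_z]
  congr 2
  funext j
  fin_cases j <;> rfl

theorem IsChiralOf.nPar_apply (a b : V) (f : OT K N 2) :
    nPar M 2 (X ![a, b] f) = -X ![M.par a, M.par b] (invT f) := by
  have e : (fun j => M.par (![a, b] j)) = ![M.par a, M.par b] := by
    funext j
    fin_cases j <;> rfl
  rw [hX.parity, e]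
  exact sgn_one_smul _

theorem IsChiralOf.S_left (i : Fin N) (a b : V) (f : OT K N 2) : X ![M.S i a, b] f =
      X ![M.par a, M.par b] (dzeT 0 i f) + nMul M (odd 0 i) (X ![a, b] f) := by
  have h := hX.d_ζ ![a, b] f 0 i
  have e1 : Function.update ![a, b] 0 (M.S i (![a, b] 0)) = ![M.S i a, b] := by
    funext j
    fin_cases j <;> rfl
  have e2 : (fun j : Fin 2 => if 0 ≤ j then M.par (![a, b] j) else ![a, b] j) =
      ![M.par a, M.par b] := by
    funext j
    fin_cases j <;> rfl
  have e3 : (fun j : Fin 2 => if j < 0 then M.par (![a, b] j) else ![a, b] j) = ![a, b] := by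
    funext j
    fin_cases j <;> rfl
  rw [e1, e2, e3] at h
  exact h.trans (sub_sgn_one_smul _ _)

theorem IsChiralOf.S_right (i : Fin N) (a b : V) (f : OT K N 2) :
    X ![a, M.S i b] f = X ![a, M.par b] (dzeT 1 i f) + nMul M (odd 1 i) (X ![M.par a, b] f) := by
  have h := hX.d_ζ ![a, b] f 1 i
  have e1 : Function.update ![a, b] 1 (M.S i (![a, b] 1)) = ![a, M.S i b] := by
    funext j
    fin_cases j <;> rfl
  have e2 : (fun j : Fin 2 => if 1 ≤ j then M.par (![a, b] j) else ![a, b] j) =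
      ![a, M.par b] := by
    funext j
    fin_cases j <;> rfl
  have e3 : (fun j : Fin 2 => if j < 1 then M.par (![a, b] j) else ![a, b] j) = ![M.par a, b] := by
    funext j
    fin_cases j <;> rfl
  rw [e1, e2, e3] at h
  exact h.trans (sub_sgn_one_smul _ _)

end TwoPoint

section Restriction

variable [CharZero K]

theorem filter_block_zero : Finset.univ.filter (fun k : Fin 3 => block 1 1 k = 0) = {0, 1} := by
  decide

theorem filter_block_one : Finset.univ.filter (fun k : Fin 3 => block 1 1 k = 1) = {2} := by decide

theorem dzT_zero_restr (f : OBT K N (block 1 1)) :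
    dzT 0 (restr f) = restr (dzT 0 f) + restr (dzT 1 f) := by
  refine (dzT_relT (b := block 1 1) (b' := id) (c := block 1 1) (fun _ _ h => h) 0 f).trans ?_
  exact (congrArg (fun s => ∑ k ∈ s, restr (dzT k f)) filter_block_zero).trans
    (Finset.sum_pair (by decide))

theorem dzT_one_restr (f : OBT K N (block 1 1)) : dzT 1 (restr f) = restr (dzT 2 f) := by
  refine (dzT_relT (b := block 1 1) (b' := id) (c := block 1 1) (fun _ _ h => h) 1 f).trans ?_
  exact (congrArg (fun s => ∑ k ∈ s, restr (dzT k f)) filter_block_one).trans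
    (Finset.sum_singleton _ _)

theorem dzeT_zero_restr (i : Fin N) (f : OBT K N (block 1 1)) :
    dzeT 0 i (restr f) = restr (dzeT 0 i f) + restr (dzeT 1 i f) := by
  refine (dzeT_relT (b := block 1 1) (b' := id) (c := block 1 1) (fun _ _ h => h) 0 i f).trans ?_
  exact (congrArg (fun s => ∑ k ∈ s, restr (dzeT k i f)) filter_block_zero).trans
    (Finset.sum_pair (by decide))

theorem dzeT_one_restr (i : Fin N) (f : OBT K N (block 1 1)) :
    dzeT 1 i (restr f) = restr (dzeT 2 i f) := by
  refine (dzeT_relT (b := block 1 1) (b' := id) (c := block 1 1) (fun _ _ h => h) 1 i f).trans ?_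
  exact (congrArg (fun s => ∑ k ∈ s, restr (dzeT k i f)) filter_block_one).trans
    (Finset.sum_singleton _ _)

theorem invT_restr (f : OBT K N (block 1 1)) : invT (restr f) = restr (invT f) := invT_relT _ f

theorem restr_mul_zB (f : OBT K N (block 1 1)) (k l : Fin 3) :
    restr (f * zB (block 1 1) k l) = restr f * zT (block 1 1 k) (block 1 1 l) := by
  rw [map_mul]
  exact congrArg (restr f * ·) (relT_zB _ k l)

theorem restr_mul_zeB (f : OBT K N (block 1 1)) (k l : Fin 3) (i : Fin N) :
    restr (f * zeB (block 1 1) k l i) = restr f * zeT (block 1 1 k) (block 1 1 l) i := by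
  rw [map_mul]
  exact congrArg (restr f * ·) (relT_zeB _ k l i)

end Restriction

section NestedRules

variable [CharZero K] {X : Op M 2}

theorem apply_add_right (a b b' : V) : X ![a, b + b'] = X ![a, b] + X ![a, b'] := by
  have h := X.map_update_add ![a, 0] 1 b b'
  rwa [update_pair, update_pair, update_pair] at h

theorem apply_smul_right (r : K) (a b : V) : X ![a, r • b] = r • X ![a, b] := by
  have h := X.map_update_smul ![a, 0] 1 r b
  rwa [update_pair, update_pair] at h

theorem apply_add_left (a a' b : V) : X ![a + a', b] = X ![a, b] + X ![a', b] :=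
  X.cons_add ![b] a a'

theorem apply_smul_left (r : K) (a b : V) : X ![r • a, b] = r • X ![a, b] := X.cons_smul ![b] r a

theorem bcomp_add_vec (c c' : V) (f : OBT K N (block 1 1)) (y : VPoly K N V 1) :
    bcomp M X (c + c') f y = bcomp M X c f y + bcomp M X c' f y := by
  induction y using vpoly_par_induction M generalizing f c c' with
  | one u => rw [bcomp_one, bcomp_one, bcomp_one, apply_add_right, LinearMap.add_apply, map_add]
  | add x y hx hy => simp only [map_add, hx, hy]; abel
  | smul r x hx => simp only [map_smul, hx, smul_add]
  | lam x hx => rw [bcomp_lam, bcomp_lam, bcomp_lam, hx, hx, map_add]; abel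
  | odd i x hx hx' => rw [bcomp_odd, bcomp_odd, bcomp_odd, hx, map_add, map_add, hx']; abel

theorem bcomp_smul_vec (r : K) (c : V) (f : OBT K N (block 1 1)) (y : VPoly K N V 1) :
    bcomp M X (r • c) f y = r • bcomp M X c f y := by
  induction y using vpoly_par_induction M generalizing f c with
  | one u => rw [bcomp_one, bcomp_one, apply_smul_right, LinearMap.smul_apply, map_smul]
  | add x y hx hy => simp only [map_add, hx, hy, smul_add]
  | smul r x hx => rw [map_smul, map_smul, hx, smul_comm]
  | lam x hx => rw [bcomp_lam, bcomp_lam, hx, hx, map_smul, smul_sub]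
  | odd i x hx hx' => rw [bcomp_odd, bcomp_odd, hx, map_smul, map_smul, hx', smul_sub, smul_neg]

theorem bcomp_add_fun (c : V) (f g : OBT K N (block 1 1)) (y : VPoly K N V 1) :
    bcomp M X c (f + g) y = bcomp M X c f y + bcomp M X c g y := by
  induction y using vpoly_par_induction M generalizing f g c with
  | one u => rw [bcomp_one, bcomp_one, bcomp_one, map_add, map_add, map_add]
  | add x y hx hy => simp only [map_add, hx, hy]; abel
  | smul r x hx => simp only [map_smul, hx, smul_add]
  | lam x hx => rw [bcomp_lam, bcomp_lam, bcomp_lam, map_add, hx, hx, map_add]; abel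
  | odd i x hx hx' => rw [bcomp_odd, bcomp_odd, bcomp_odd, hx, map_add, map_add, hx']; abel

theorem bcomp_smul_fun (r : K) (c : V) (f : OBT K N (block 1 1)) (y : VPoly K N V 1) :
    bcomp M X c (r • f) y = r • bcomp M X c f y := by
  induction y using vpoly_par_induction M generalizing f c with
  | one u => rw [bcomp_one, bcomp_one, map_smul, map_smul, map_smul]
  | add x y hx hy => simp only [map_add, hx, hy, smul_add]
  | smul r x hx => rw [map_smul, map_smul, hx, smul_comm]
  | lam x hx => rw [bcomp_lam, bcomp_lam, map_smul, hx, hx, map_smul, smul_sub]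
  | odd i x hx hx' => rw [bcomp_odd, bcomp_odd, hx, map_smul, map_smul, hx', smul_sub, smul_neg]

variable (X) in
/-- `bcomp` as a linear map in the function. -/
def bcompFun (c : V) (y : VPoly K N V 1) : OBT K N (block 1 1) →ₗ[K] VNabla M 3 where
  toFun f := bcomp M X c f y
  map_add' f g := bcomp_add_fun c f g y
  map_smul' r f := bcomp_smul_fun r c f y

theorem bcomp_neg_fun (c : V) (f : OBT K N (block 1 1)) (y : VPoly K N V 1) :
    bcomp M X c (-f) y = -bcomp M X c f y := map_neg (bcompFun X c y) f

theorem bcomp_zero_fun (c : V) (y : VPoly K N V 1) :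
    bcomp M X c (0 : OBT K N (block 1 1)) y = 0 := map_zero (bcompFun X c y)

end NestedRules

section NestedAbstract

variable {O W : Type*} [AddCommGroup O] [Module K O] [AddCommGroup W] [Module K W]

/-- The rules by which a family `B` of maps `V[Λ] → W` is computed from its values on `V`. -/
structure IsNested (M : HWSupermodule K N V) (B : V → O → VPoly K N V 1 →ₗ[K] W)
    (L : Module.End K W) (Θ : Fin N → Module.End K W) (d : Module.End K O)
    (δ : Fin N → Module.End K O) : Prop where
  smul_vec : ∀ (r : K) c f y, B (r • c) f y = r • B c f y
  add_fun : ∀ c f g y, B c (f + g) y = B c f y + B c g y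
  smul_fun : ∀ (r : K) c f y, B c (r • f) y = r • B c f y
  lam : ∀ c f y, B c f (lmul (lam 0) y) = L (B c f y) - B c (d f) y
  odd : ∀ c f i y, B c f (lmul (odd 0 i) y) =
    -Θ i (B c f y) - B (M.par c) (δ i f) (parx M 1 y)

namespace IsNested

variable {B : V → O → VPoly K N V 1 →ₗ[K] W} {L : Module.End K W} {Θ : Fin N → Module.End K W}
  {d : Module.End K O} {δ : Fin N → Module.End K O} (h : IsNested M B L Θ d δ)
include h

theorem neg_fun (c : V) (f : O) (y : VPoly K N V 1) : B c (-f) y = -B c f y := by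
  rw [← neg_one_smul K f, h.smul_fun, neg_one_smul]

theorem neg_vec (c : V) (f : O) (y : VPoly K N V 1) : B (-c) f y = -B c f y := by
  rw [← neg_one_smul K c, h.smul_vec, neg_one_smul]

theorem zero_fun (c : V) (y : VPoly K N V 1) : B c 0 y = 0 := by
  rw [← zero_smul K (0 : O), h.smul_fun, zero_smul]

theorem mul_z {μ : Module.End K O} {D : Module.End K W} (e : K)
    (hd : ∀ f, d (μ f) = μ (d f) + e • f) (hδ : ∀ i f, δ i (μ f) = μ (δ i f))
    (hL : ∀ w, D (L w) = L (D w) - e • w) (hΘ : ∀ i w, D (Θ i w) = Θ i (D w))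
    (one : ∀ c f u, B c (μ f) (1 ⊗ₜ u) = D (B c f (1 ⊗ₜ u))) (c : V) (f : O)
    (y : VPoly K N V 1) : B c (μ f) y = D (B c f y) := by
  induction y using vpoly_par_induction M generalizing f c with
  | one u => exact one c f u
  | add x y hx hy => simp only [map_add, hx, hy]
  | smul r x hx => simp only [map_smul, hx]
  | lam x hx =>
    rw [h.lam, hd, h.add_fun, h.smul_fun, hx, hx, h.lam, map_sub, hL]
    abel
  | odd i x hx hx' => rw [h.odd, hδ, hx, hx', h.odd, map_sub, map_neg, hΘ]

theorem mul_z_eq_Dlam {μ : Module.End K O}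
    (hd : ∀ f, d (μ f) = μ (d f) + f) (hδ : ∀ i f, δ i (μ f) = μ (δ i f))
    (one : ∀ c f u, B c (μ f) (1 ⊗ₜ u) = 0) (c : V) (f : O)
    (y : VPoly K N V 1) : B c (μ f) y = -B c f (Dlam 0 y) := by
  induction y using vpoly_par_induction M generalizing f c with
  | one u => rw [one, Dlam_one, map_zero, neg_zero]
  | add x y hx hy => simp only [map_add, hx, hy]; abel
  | smul r x hx => simp only [map_smul, hx, smul_neg]
  | lam x hx =>
    rw [h.lam, hd, h.add_fun, hx, hx, Dlam_lmul_lam, if_pos rfl, map_add, h.lam, map_neg]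
    abel
  | odd i x hx hx' =>
    rw [h.odd, hδ, hx, hx', Dlam_lmul_odd, h.odd, parx_Dlam, map_neg]
    abel

theorem parity {P : Module.End K W} {ι : Module.End K O} (hL : ∀ w, P (L w) = L (P w))
    (hΘ : ∀ i w, P (Θ i w) = -Θ i (P w)) (hd : ∀ f, ι (d f) = d (ι f))
    (hδ : ∀ i f, ι (δ i f) = -δ i (ι f))
    (one : ∀ c f u, P (B c f (1 ⊗ₜ u)) = -B (M.par c) (ι f) (1 ⊗ₜ M.par u)) (c : V) (f : O)
    (y : VPoly K N V 1) : P (B c f y) = -B (M.par c) (ι f) (parx M 1 y) := by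
  induction y using vpoly_par_induction M generalizing f c with
  | one u =>
    have e : parx M 1 ((1 : SPoly K N 1) ⊗ₜ[K] u) = 1 ⊗ₜ M.par u := by simp [parx]
    rw [e, one]
  | add x y hx hy => simp only [map_add, hx, hy]; abel
  | smul r x hx => simp only [map_smul, hx, smul_neg]
  | lam x hx =>
    rw [h.lam, map_sub, hL, hx, hx, parx_lmul_lam, h.lam, hd, map_neg]
    abel
  | odd i x hx hx' =>
    rw [h.odd, map_sub, map_neg, hΘ, hx, hx', parx_lmul_odd, map_neg (B (M.par c) (ι f)), h.odd,
      hδ, h.neg_fun, map_neg]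
    abel

theorem mul_ζ {μ ι : Module.End K O} {D P : Module.End K W} (j : Fin N) (e : K)
    (hP : ∀ c f y, P (B c f y) = -B (M.par c) (ι f) (parx M 1 y)) (hd : ∀ f, d (μ f) = μ (d f))
    (hδ : ∀ i f, δ i (μ f) = μ (δ i f) + if i = j then e • ι f else 0) (hL : ∀ w, D (L w) = L (D w))
    (hΘ : ∀ i w, D (Θ i w) = Θ i (D w) - if i = j then e • P w else 0)
    (one : ∀ c f u, B c (μ f) (1 ⊗ₜ u) = D (B c f (1 ⊗ₜ u))) (c : V) (f : O)
    (y : VPoly K N V 1) : B c (μ f) y = D (B c f y) := by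
  induction y using vpoly_par_induction M generalizing f c with
  | one u => exact one c f u
  | add x y hx hy => simp only [map_add, hx, hy]
  | smul r x hx => simp only [map_smul, hx]
  | lam x hx => rw [h.lam, hd, hx, hx, h.lam, map_sub, hL]
  | odd i x hx hx' =>
    rw [h.odd, hδ, h.add_fun, hx, hx', h.odd, map_sub, map_neg, hΘ]
    split_ifs with hi
    · rw [h.smul_fun, hP, smul_neg]; abel
    · rw [h.zero_fun]; abel

theorem apply_Tx {d' : Module.End K O} {L' : Module.End K W} (hd : ∀ f, d' (d f) = d (d' f))
    (hδ : ∀ i f, d' (δ i f) = δ i (d' f)) (hL : ∀ w, L' (L w) = L (L' w))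
    (hΘ : ∀ i w, L' (Θ i w) = Θ i (L' w))
    (one : ∀ c f u, B c f (1 ⊗ₜ M.T u) = B c (d' f) (1 ⊗ₜ u) - L' (B c f (1 ⊗ₜ u)))
    (c : V) (f : O) (y : VPoly K N V 1) : B c f (Tx M 1 y) = B c (d' f) y - L' (B c f y) := by
  induction y using vpoly_par_induction M generalizing f c with
  | one u =>
    have e : Tx M 1 ((1 : SPoly K N 1) ⊗ₜ[K] u) = 1 ⊗ₜ M.T u := by simp [Tx]
    rw [e, one]
  | add x y hx hy => simp only [map_add, hx, hy]; abel
  | smul r x hx => simp only [map_smul, hx, smul_sub]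
  | lam x hx =>
    rw [Tx_lmul, h.lam, h.lam, h.lam, hx, hx, hd]
    simp only [map_sub, hL]
    abel
  | odd i x hx hx' =>
    rw [Tx_lmul, h.odd, h.odd, h.odd, hx, parx_Tx, hx', hδ]
    simp only [map_sub, map_neg, hΘ]
    abel

theorem apply_Sx {δ' : Module.End K O} {Θ' : Module.End K W} (j : Fin N)
    (hd : ∀ f, δ' (d f) = d (δ' f)) (hδ : ∀ i f, δ' (δ i f) = -δ i (δ' f))
    (hL : ∀ w, Θ' (L w) = L (Θ' w)) (hΘ : ∀ i w, Θ' (Θ i w) = -Θ i (Θ' w))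
    (one : ∀ c f u, B c f (1 ⊗ₜ M.S j u) = B (M.par c) (δ' f) (1 ⊗ₜ M.par u) + Θ' (B c f (1 ⊗ₜ u)))
    (c : V) (f : O) (y : VPoly K N V 1) :
    B c f (Sx M 1 j y) = B (M.par c) (δ' f) (parx M 1 y) + Θ' (B c f y) := by
  induction y using vpoly_par_induction M generalizing f c with
  | one u =>
    have e : Sx M 1 j ((1 : SPoly K N 1) ⊗ₜ[K] u) = 1 ⊗ₜ M.S j u := by simp [Sx]
    have e' : parx M 1 ((1 : SPoly K N 1) ⊗ₜ[K] u) = 1 ⊗ₜ M.par u := by simp [parx]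
    rw [e, e', one]
  | add x y hx hy => simp only [map_add, hx, hy]; abel
  | smul r x hx => simp only [map_smul, hx, smul_add]
  | lam x hx =>
    rw [Sx_lmul_lam, parx_lmul_lam, h.lam, h.lam, h.lam, hx, hx, hd]
    simp only [map_add, map_sub, hL]
    abel
  | odd i x hx hx' =>
    rw [Sx_lmul_odd, parx_lmul_odd, map_neg, map_neg, h.odd, h.odd, h.odd, hx, parx_Sx, map_neg,
      hx', parx_parx, M.par_par, hδ, h.neg_fun]
    simp only [map_add, map_sub, map_neg, hΘ]
    abel

theorem lam_add_Tx {d' : Module.End K O} {L' : Module.End K W} {c : V} {f : O}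
    {y : VPoly K N V 1} (hT : B c f (Tx M 1 y) = B c ((d + d') f) y - (L + L') (B c f y)) :
    B c f (lmul (SUSY.lam 0) y) + B c f (Tx M 1 y) = B c (d' f) y - L' (B c f y) := by
  rw [hT, h.lam, LinearMap.add_apply, LinearMap.add_apply, h.add_fun]
  abel

theorem odd_add_Sx {δ' : Module.End K O} {Θ' : Module.End K W} {c : V} {f : O}
    {y : VPoly K N V 1} (j : Fin N) (hS : B c f (Sx M 1 j y) =
      B (M.par c) ((δ j + δ') f) (parx M 1 y) + (Θ j + Θ') (B c f y)) :
    B c f (lmul (SUSY.odd 0 j) y) + B c f (Sx M 1 j y) =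
      B (M.par c) (δ' f) (parx M 1 y) + Θ' (B c f y) := by
  rw [hS, h.odd, LinearMap.add_apply, LinearMap.add_apply, h.add_fun]
  abel

theorem vec_T {d' : Module.End K O} {L' : Module.End K W} (hd : ∀ f, d' (d f) = d (d' f))
    (hδ : ∀ i f, d' (δ i f) = δ i (d' f)) (hL : ∀ w, L' (L w) = L (L' w))
    (hΘ : ∀ i w, L' (Θ i w) = Θ i (L' w))
    (one : ∀ c f u, B (M.T c) f (1 ⊗ₜ u) = B c (d' f) (1 ⊗ₜ u) - L' (B c f (1 ⊗ₜ u)))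
    (c : V) (f : O) (y : VPoly K N V 1) : B (M.T c) f y = B c (d' f) y - L' (B c f y) := by
  induction y using vpoly_par_induction M generalizing f c with
  | one u => exact one c f u
  | add x y hx hy => simp only [map_add, hx, hy]; abel
  | smul r x hx => simp only [map_smul, hx, smul_sub]
  | lam x hx =>
    rw [h.lam, h.lam, h.lam, hx, hx, hd]
    simp only [map_sub, hL]
    abel
  | odd i x hx hx' =>
    rw [h.odd, h.odd, h.odd, hx, M.par_T, hx', hδ]
    simp only [map_sub, map_neg, hΘ]
    abel

theorem vec_S {δ' : Module.End K O} {Θ' : Module.End K W} (j : Fin N)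
    (hd : ∀ f, δ' (d f) = d (δ' f)) (hδ : ∀ i f, δ' (δ i f) = -δ i (δ' f))
    (hL : ∀ w, Θ' (L w) = L (Θ' w)) (hΘ : ∀ i w, Θ' (Θ i w) = -Θ i (Θ' w))
    (one : ∀ c f u, B (M.S j c) f (1 ⊗ₜ u) =
      B (M.par c) (δ' f) (1 ⊗ₜ u) + Θ' (B c f (1 ⊗ₜ M.par u))) (c : V) (f : O) (y : VPoly K N V 1) :
    B (M.S j c) f y = B (M.par c) (δ' f) y + Θ' (B c f (parx M 1 y)) := by
  induction y using vpoly_par_induction M generalizing f c with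
  | one u =>
    have e' : parx M 1 ((1 : SPoly K N 1) ⊗ₜ[K] u) = 1 ⊗ₜ M.par u := by simp [parx]
    rw [e', one]
  | add x y hx hy => simp only [map_add, hx, hy]; abel
  | smul r x hx => simp only [map_smul, hx, smul_add]
  | lam x hx =>
    rw [parx_lmul_lam, h.lam, h.lam, h.lam, hx, hx, hd]
    simp only [map_add, map_sub, hL]
    abel
  | odd i x hx hx' =>
    rw [parx_lmul_odd, map_neg, h.odd, h.odd, h.odd, hx, M.par_S, h.neg_vec, hx', parx_parx,
      M.par_par, hδ, h.neg_fun]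
    simp only [map_add, map_sub, map_neg, hΘ]
    abel

end IsNested

section Flip

variable [CharZero K]

theorem negNabla_tmul (a : SPoly K N 1) (v : V) :
    negNabla M (a ⊗ₜ v) = elim M 1 (cls M (subst (fun _ => ![0, 1]) a) v) := rfl

theorem negNabla_one (v : V) : negNabla M ((1 : SPoly K N 1) ⊗ₜ[K] v) = 1 ⊗ₜ v := by
  rw [negNabla_tmul, map_one, elim_one]

theorem negNabla_lam (y : VPoly K N V 1) :
    negNabla M (lmul (lam 0) y) = -lmul (lam 0) (negNabla M y) - Tx M 1 (negNabla M y) := by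
  apply tensor_ext y; intro a v
  have e : subst (K := K) (N := N) (fun _ : Fin 1 => ![(0 : K), 1]) (lam 0) = lam (Fin.last 1) := by
    rw [subst_lam]; simp
  rw [lmul_tmul, negNabla_tmul, negNabla_tmul, map_mul, e, ← nMul_cls, elim_lam_last]
  simp

theorem negNabla_odd (i : Fin N) (y : VPoly K N V 1) : negNabla M (lmul (odd 0 i) y) =
      -lmul (odd 0 i) (negNabla M y) - Sx M 1 i (negNabla M y) := by
  apply tensor_ext y; intro a v
  have e : subst (K := K) (N := N) (fun _ : Fin 1 => ![(0 : K), 1]) (odd 0 i) =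
      odd (Fin.last 1) i := by
    rw [subst_odd]; simp
  rw [lmul_tmul, negNabla_tmul, negNabla_tmul, map_mul, e, ← nMul_cls, elim_odd_last]
  simp

theorem negNabla_parx (y : VPoly K N V 1) : negNabla M (parx M 1 y) = parx M 1 (negNabla M y) := by
  induction y using vpoly_one_induction with
  | one u =>
    have e' : ∀ u, parx M 1 ((1 : SPoly K N 1) ⊗ₜ[K] u) = 1 ⊗ₜ M.par u := by simp [parx]
    rw [e', negNabla_one, negNabla_one, e']
  | add x y hx hy => simp only [map_add, hx, hy]
  | smul r x hx => simp only [map_smul, hx]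
  | lam x hx =>
    rw [parx_lmul_lam, negNabla_lam, negNabla_lam, hx, map_sub, map_neg, parx_lmul_lam, parx_Tx]
  | odd i x hx =>
    rw [parx_lmul_odd, map_neg, negNabla_odd, negNabla_odd, hx, map_sub, map_neg, parx_lmul_odd,
      parx_Sx]
    abel

theorem IsNested.flip {B : V → O → VPoly K N V 1 →ₗ[K] W}
    {L L' : Module.End K W} {Θ Θ' : Fin N → Module.End K W} {d d' : Module.End K O}
    {δ δ' : Fin N → Module.End K O} (h : IsNested M B L Θ d δ) {R : Module.End K W}
    {ρ : Module.End K O} (hd : ∀ f, d (ρ f) = ρ (d' f)) (hδ : ∀ i f, δ i (ρ f) = ρ (δ' i f))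
    (hL : ∀ w, R (L w) = L' (R w)) (hΘ : ∀ i w, R (Θ i w) = Θ' i (R w))
    (hT : ∀ c f y, B c f (Tx M 1 y) = B c ((d + d') f) y - (L + L') (B c f y))
    (hS : ∀ c f i y, B c f (Sx M 1 i y) = B (M.par c) ((δ i + δ' i) f) (parx M 1 y) +
      (Θ i + Θ' i) (B c f y))
    (one : ∀ c f u, R (B c (ρ f) (1 ⊗ₜ u)) = B c f (1 ⊗ₜ u)) (c : V) (f : O)
    (y : VPoly K N V 1) : R (B c (ρ f) y) = B c f (negNabla M y) := by
  induction y using vpoly_par_induction M generalizing f c with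
  | one u => rw [negNabla_one, one]
  | add x y hx hy => simp only [map_add, hx, hy]
  | smul r x hx => simp only [map_smul, hx]
  | lam x hx =>
    rw [h.lam, map_sub, hL, hx, hd, hx, negNabla_lam, map_sub, map_neg, h.lam, hT,
      LinearMap.add_apply, LinearMap.add_apply, h.add_fun]
    abel
  | odd i x hx hx' =>
    rw [h.odd, map_sub, map_neg, hΘ, hx, hδ, hx', negNabla_odd, map_sub, map_neg, h.odd, hS,
      LinearMap.add_apply, LinearMap.add_apply, h.add_fun, negNabla_parx]
    abel

end Flip

end NestedAbstract

section NestedLinear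

variable [CharZero K] {X : Op M 2}

theorem dzT_mul_zB_zero_one (f : OBT K N (block 1 1)) :
    dzT 0 (f * zB (block 1 1) 0 1) = dzT 0 f * zB (block 1 1) 0 1 + f := by
  rw [dzT_mul, dzT_zB, if_pos rfl, if_neg (by decide), sub_zero, mul_one]

theorem dzT_mul_zB_one_two (f : OBT K N (block 1 1)) :
    dzT 0 (f * zB (block 1 1) 1 2) = dzT 0 f * zB (block 1 1) 1 2 := by
  rw [dzT_mul, dzT_zB, if_neg (by decide), if_neg (by decide), sub_zero, mul_zero, add_zero]

theorem dzeT_mul_zB (f : OBT K N (block 1 1)) (j k l : Fin 3) (i : Fin N) :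
    dzeT j i (f * zB (block 1 1) k l) = dzeT j i f * zB (block 1 1) k l := by
  rw [dzeT_mul, dzeT_zB, mul_zero, add_zero]

theorem dzT_mul_zeB (f : OBT K N (block 1 1)) (j k l : Fin 3) (i : Fin N) :
    dzT j (f * zeB (block 1 1) k l i) = dzT j f * zeB (block 1 1) k l i := by
  rw [dzT_mul, dzT_zeB, mul_zero, add_zero]

theorem dzeT_mul_zeB_zero_one (f : OBT K N (block 1 1)) (i j : Fin N) :
    dzeT 0 j (f * zeB (block 1 1) 0 1 i) =
      dzeT 0 j f * zeB (block 1 1) 0 1 i + if j = i then invT f else 0 := by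
  rw [dzeT_mul, dzeT_zeB, if_neg (c := (0 : Fin 3) = 1 ∧ j = i) (by simp), sub_zero]
  by_cases h : j = i
  · rw [if_pos ⟨rfl, h⟩, if_pos h, mul_one]
  · rw [if_neg (fun h' => h h'.2), if_neg h, mul_zero]

theorem dzeT_mul_zeB_one_two (f : OBT K N (block 1 1)) (i j : Fin N) :
    dzeT 0 j (f * zeB (block 1 1) 1 2 i) = dzeT 0 j f * zeB (block 1 1) 1 2 i := by
  rw [dzeT_mul, dzeT_zeB, if_neg (by simp), if_neg (by simp), sub_zero, mul_zero, add_zero]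

theorem restr_mul_zB_zero_one (f : OBT K N (block 1 1)) : restr (f * zB (block 1 1) 0 1) = 0 :=
  (restr_mul_zB f 0 1).trans ((congrArg (restr f * ·) (zB_self (b := id) (0 : Fin 2))).trans
    (mul_zero _))

theorem restr_mul_zeB_zero_one (f : OBT K N (block 1 1)) (i : Fin N) :
    restr (f * zeB (block 1 1) 0 1 i) = 0 :=
  (restr_mul_zeB f 0 1 i).trans
    ((congrArg (restr f * ·) (zeB_self (b := id) (0 : Fin 2) i)).trans (mul_zero _))

/-- Multiplication by a function from the right. -/
def rmul {n m : ℕ} {b : Fin n → Fin m} (g : OBT K N b) : Module.End K (OBT K N b) :=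
  LinearMap.mulRight K g

variable (X) in
theorem bcomp_isNested : IsNested (O := OBT K N (block 1 1)) (W := VNabla M 3) M (bcomp M X)
    (nMul M (lam 0)) (fun i => nMul M (odd 0 i)) (dzT 0) (fun i => dzeT 0 i) where
  smul_vec := bcomp_smul_vec
  add_fun := bcomp_add_fun
  smul_fun := bcomp_smul_fun
  lam := bcomp_lam X
  odd := bcomp_odd X

variable (X) in
theorem bcomp_mul_z_eq_Dlam (c : V) (f : OBT K N (block 1 1)) (y : VPoly K N V 1) :
    bcomp M X c (f * zB (block 1 1) 0 1) y = -bcomp M X c f (Dlam 0 y) :=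
  (bcomp_isNested X).mul_z_eq_Dlam (μ := rmul (zB (block 1 1) 0 1)) dzT_mul_zB_zero_one
    (fun i f => dzeT_mul_zB f 0 0 1 i)
    (fun c f u => by
      refine (bcomp_one X c _ u).trans ?_
      refine (congrArg (fun g => nSubst M (block 1 1) (X ![u, c] g))
        (restr_mul_zB_zero_one f)).trans ?_
      rw [map_zero, map_zero]) c f y

variable (X) in
theorem bcomp_mul_z_zero_one (c : V) (f : OBT K N (block 1 1)) (y : VPoly K N V 1) :
    bcomp M X c (f * zB (block 1 1) 0 1) y = nDlam M 1 0 (bcomp M X c f y) :=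
  (bcomp_isNested X).mul_z (μ := rmul (zB (block 1 1) 0 1)) (D := nDlam M 1 0) 1
    (fun f => (dzT_mul_zB_zero_one f).trans (by rw [one_smul]; rfl))
    (fun i f => dzeT_mul_zB f 0 0 1 i)
    (fun w => by
      rw [nDlam_nMul_lam, if_neg (by decide), if_pos rfl, zero_sub, one_smul]
      exact (sub_eq_add_neg _ _).symm)
    (fun i w => nDlam_nMul_odd 1 0 0 i w)
    (fun c f u => by
      refine (bcomp_one X c _ u).trans ?_
      refine (congrArg (fun g => nSubst M (block 1 1) (X ![u, c] g))
        (restr_mul_zB_zero_one f)).trans ?_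
      rw [map_zero, map_zero, bcomp_one, nDlam_nSubst]
      exact ((congrArg (nSubst M (block 1 1)) (nDlam_self 0 _)).trans (map_zero _)).symm) c f y

theorem nSubst_block_lam_zero (w : VNabla M 2) : nSubst M (block 1 1) (nMul M (lam 0) w) =
      (nMul M (lam 0) + nMul M (lam 1) : Module.End K (VNabla M 3)) (nSubst M (block 1 1) w) :=
  (nSubst_nMul_lam (block 1 1) 0 w).trans
    ((congrArg (fun s => ∑ k ∈ s, nMul M (lam k) _) filter_block_zero).trans
      (Finset.sum_pair (by decide)))

theorem nSubst_block_lam_one (w : VNabla M 2) :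
    nSubst M (block 1 1) (nMul M (lam 1) w) = nMul M (lam 2) (nSubst M (block 1 1) w) :=
  (nSubst_nMul_lam (block 1 1) 1 w).trans
    ((congrArg (fun s => ∑ k ∈ s, nMul M (lam k) _) filter_block_one).trans
      (Finset.sum_singleton _ _))

theorem nSubst_block_odd_zero (i : Fin N) (w : VNabla M 2) :
    nSubst M (block 1 1) (nMul M (odd 0 i) w) =
      (nMul M (odd 0 i) + nMul M (odd 1 i) : Module.End K (VNabla M 3)) (nSubst M (block 1 1) w) :=
  (nSubst_nMul_odd (block 1 1) 0 i w).trans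
    ((congrArg (fun s => ∑ k ∈ s, nMul M (odd k i) _) filter_block_zero).trans
      (Finset.sum_pair (by decide)))

theorem nSubst_block_odd_one (i : Fin N) (w : VNabla M 2) :
    nSubst M (block 1 1) (nMul M (odd 1 i) w) = nMul M (odd 2 i) (nSubst M (block 1 1) w) :=
  (nSubst_nMul_odd (block 1 1) 1 i w).trans
    ((congrArg (fun s => ∑ k ∈ s, nMul M (odd k i) _) filter_block_one).trans
      (Finset.sum_singleton _ _))

theorem add_comm_apply {E : Type*} [AddCommGroup E] [Module K E] {A B C : Module.End K E}
    (h1 : ∀ x, A (C x) = C (A x)) (h2 : ∀ x, B (C x) = C (B x)) (x : E) :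
    (A + B) (C x) = C ((A + B) x) := by
  rw [LinearMap.add_apply, LinearMap.add_apply, h1, h2, map_add]

theorem add_anticomm_apply {E : Type*} [AddCommGroup E] [Module K E] {A B C : Module.End K E}
    (h1 : ∀ x, A (C x) = -C (A x)) (h2 : ∀ x, B (C x) = -C (B x)) (x : E) :
    (A + B) (C x) = -C ((A + B) x) := by
  rw [LinearMap.add_apply, LinearMap.add_apply, h1, h2, map_add, neg_add]

theorem nMul_odd_anticomm (k l : Fin 3) (i j : Fin N) (w : VNabla M 3) :
    nMul M (odd k i) (nMul M (odd l j) w) = -nMul M (odd l j) (nMul M (odd k i) w) :=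
  nMul_odd_odd k l i j w

theorem dzeT_anticomm (k l : Fin 3) (i j : Fin N) (f : OBT K N (block 1 1)) :
    dzeT k i (dzeT l j f) = -dzeT l j (dzeT k i f) :=
  eq_neg_of_add_eq_zero_left (dzeT_dzeT k l i j f)

variable (K N) in
/-- The exchange of the first two points on functions that are regular at `z_1 = z_2`. -/
def flipB : OBT K N (block 1 1) →ₐ[K] OBT K N (block 1 1) :=
  relT (block 1 1) (block 1 1) (Equiv.swap (0 : Fin 3) 1) (by decide)

theorem dzT_flipB (f : OBT K N (block 1 1)) : dzT 0 (flipB K N f) = flipB K N (dzT 1 f) :=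
  (dzT_relT (b := block 1 1) (b' := block 1 1) (c := Equiv.swap (0 : Fin 3) 1) (by decide) 0 f).trans
    ((congrArg (fun s => ∑ k ∈ s, flipB K N (dzT k f))
      (show Finset.univ.filter (fun k : Fin 3 => Equiv.swap (0 : Fin 3) 1 k = 0) = {1} by decide)).trans
      (Finset.sum_singleton _ _))

theorem dzeT_flipB (i : Fin N) (f : OBT K N (block 1 1)) :
    dzeT 0 i (flipB K N f) = flipB K N (dzeT 1 i f) :=
  (dzeT_relT (b := block 1 1) (b' := block 1 1) (c := Equiv.swap (0 : Fin 3) 1) (by decide) 0 i f).trans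
    ((congrArg (fun s => ∑ k ∈ s, flipB K N (dzeT k i f))
      (show Finset.univ.filter (fun k : Fin 3 => Equiv.swap (0 : Fin 3) 1 k = 0) = {1} by decide)).trans
      (Finset.sum_singleton _ _))

theorem nSubst_flip_lam (w : VNabla M 3) : nSubst M (Equiv.swap (0 : Fin 3) 1) (nMul M (lam 0) w) =
      nMul M (lam 1) (nSubst M (Equiv.swap (0 : Fin 3) 1) w) :=
  (nSubst_nMul_lam (Equiv.swap (0 : Fin 3) 1) 0 w).trans
    ((congrArg (fun s => ∑ k ∈ s, nMul M (lam k) _)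
      (show Finset.univ.filter (fun k : Fin 3 => Equiv.swap (0 : Fin 3) 1 k = 0) = {1} by decide)).trans
      (Finset.sum_singleton _ _))

theorem nSubst_flip_odd (i : Fin N) (w : VNabla M 3) :
    nSubst M (Equiv.swap (0 : Fin 3) 1) (nMul M (odd 0 i) w) =
      nMul M (odd 1 i) (nSubst M (Equiv.swap (0 : Fin 3) 1) w) :=
  (nSubst_nMul_odd (Equiv.swap (0 : Fin 3) 1) 0 i w).trans
    ((congrArg (fun s => ∑ k ∈ s, nMul M (odd k i) _)
      (show Finset.univ.filter (fun k : Fin 3 => Equiv.swap (0 : Fin 3) 1 k = 0) = {1} by decide)).trans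
      (Finset.sum_singleton _ _))

theorem relT_congr {n m n' m' : ℕ} {b : Fin n → Fin m} {b' : Fin n' → Fin m'} {c c' : Fin n → Fin n'}
    (e : c = c') (h : ∀ k l, b k ≠ b l → b' (c k) ≠ b' (c l)) (f : OBT K N b) :
    relT b b' c h f = relT b b' c' (e ▸ h) f := by
  subst e; rfl

theorem restr_flipB (f : OBT K N (block 1 1)) : restr (flipB K N f) = restr f := by
  have e : block 1 1 ∘ Equiv.swap (0 : Fin 3) 1 = block 1 1 := by decide
  refine (relT_relT (b := block 1 1) (b' := block 1 1) (b'' := id) (c := Equiv.swap (0 : Fin 3) 1)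
    (c' := block 1 1) (by decide) (fun _ _ h => h) f).trans ?_
  exact relT_congr e _ f

theorem nSubst_flip_block (w : VNabla M 2) :
    nSubst M (Equiv.swap (0 : Fin 3) 1) (nSubst M (block 1 1) w) = nSubst M (block 1 1) w := by
  have e : block 1 1 ∘ Equiv.swap (0 : Fin 3) 1 = block 1 1 := by decide
  exact (nSubst_nSubst (block 1 1) (Equiv.swap (0 : Fin 3) 1) w).trans
    (congrArg (fun b => nSubst M b w) e)

variable (hX : IsChiralOf M 1 X)
include hX

theorem bcomp_mul_z_one_two (c : V) (f : OBT K N (block 1 1)) (y : VPoly K N V 1) :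
    bcomp M X c (f * zB (block 1 1) 1 2) y = nDlam M 2 1 (bcomp M X c f y) :=
  (bcomp_isNested X).mul_z (μ := rmul (zB (block 1 1) 1 2)) (D := nDlam M 2 1) 0
    (fun f => (dzT_mul_zB_one_two f).trans (by rw [zero_smul, add_zero]; rfl))
    (fun i f => dzeT_mul_zB f 0 1 2 i)
    (fun w => by
      rw [nDlam_nMul_lam, if_neg (by decide), if_neg (by decide), sub_zero, add_zero, zero_smul,
        sub_zero])
    (fun i w => nDlam_nMul_odd 2 1 0 i w)
    (fun c f u => by
      refine (bcomp_one X c _ u).trans ?_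
      refine (congrArg (fun g => nSubst M (block 1 1) (X ![u, c] g)) (restr_mul_zB f 1 2)).trans ?_
      rw [hX.mul_z, bcomp_one, nDlam_nSubst]) c f y

theorem bcomp_nPar (c : V) (f : OBT K N (block 1 1)) (y : VPoly K N V 1) :
    nPar M 3 (bcomp M X c f y) = -bcomp M X (M.par c) (invT f) (parx M 1 y) :=
  (bcomp_isNested X).parity (P := nPar M 3) (ι := invT.toLinearMap)
    (fun w => by rw [nPar_nMul, inv_lam])
    (fun i w => by rw [nPar_nMul, inv_odd, nMul_neg])
    (fun f => invT_dzT 0 f) (fun i f => invT_dzeT 0 i f)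
    (fun c f u => by
      rw [bcomp_one, ← nSubst_nPar, hX.nPar_apply, map_neg, invT_restr]
      exact congrArg Neg.neg (bcomp_one X (M.par c) (invT f) (M.par u)).symm) c f y

theorem bcomp_mul_ζ_zero_one (c : V) (f : OBT K N (block 1 1)) (i : Fin N) (y : VPoly K N V 1) :
    bcomp M X c (f * zeB (block 1 1) 0 1 i) y = nDodd M 0 1 i (nPar M 3 (bcomp M X c f y)) :=
  (bcomp_isNested X).mul_ζ (μ := rmul (zeB (block 1 1) 0 1 i)) (ι := invT.toLinearMap)
    (D := nDodd M 0 1 i ∘ₗ nPar M 3) (P := nPar M 3) i 1 (fun c f y => bcomp_nPar hX c f y)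
    (fun f => dzT_mul_zeB f 0 0 1 i)
    (fun j f => (dzeT_mul_zeB_zero_one f i j).trans (by rw [one_smul]; rfl))
    (fun w => by
      rw [LinearMap.comp_apply, nPar_nMul, inv_lam, nDodd_nMul_lam, LinearMap.comp_apply])
    (fun j w => by
      rw [LinearMap.comp_apply, nPar_nMul, inv_odd, nMul_neg, map_neg, nDodd_nMul_odd,
        if_neg (c := (1 : Fin 3) = 0 ∧ i = j) (by simp), sub_zero, LinearMap.comp_apply,
        neg_add, neg_neg, ← sub_eq_add_neg]
      by_cases h : j = i
      · rw [if_pos h, if_pos ⟨rfl, h.symm⟩, one_smul]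
      · rw [if_neg h, if_neg (fun h' => h h'.2.symm)])
    (fun c f u => by
      refine (bcomp_one X c _ u).trans ?_
      refine (congrArg (fun g => nSubst M (block 1 1) (X ![u, c] g))
        (restr_mul_zeB_zero_one f i)).trans ?_
      rw [map_zero, map_zero, LinearMap.comp_apply, bcomp_one, ← nSubst_nPar, nDodd_nSubst]
      exact ((congrArg (nSubst M (block 1 1)) (nDodd_self 0 i _)).trans (map_zero _)).symm) c f y

theorem bcomp_mul_ζ_one_two (c : V) (f : OBT K N (block 1 1)) (i : Fin N) (y : VPoly K N V 1) :
    bcomp M X c (f * zeB (block 1 1) 1 2 i) y = nDodd M 1 2 i (nPar M 3 (bcomp M X c f y)) :=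
  (bcomp_isNested X).mul_ζ (μ := rmul (zeB (block 1 1) 1 2 i)) (ι := invT.toLinearMap)
    (D := nDodd M 1 2 i ∘ₗ nPar M 3) (P := nPar M 3) i 0 (fun c f y => bcomp_nPar hX c f y)
    (fun f => dzT_mul_zeB f 0 1 2 i)
    (fun j f => (dzeT_mul_zeB_one_two f i j).trans (by rw [zero_smul, ite_self, add_zero]; rfl))
    (fun w => by
      rw [LinearMap.comp_apply, nPar_nMul, inv_lam, nDodd_nMul_lam, LinearMap.comp_apply])
    (fun j w => by
      rw [LinearMap.comp_apply, nPar_nMul, inv_odd, nMul_neg, map_neg, nDodd_nMul_odd,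
        if_neg (c := (1 : Fin 3) = 0 ∧ i = j) (by simp),
        if_neg (c := (2 : Fin 3) = 0 ∧ i = j) (by simp), sub_zero, add_zero,
        LinearMap.comp_apply, neg_neg, zero_smul, ite_self, sub_zero])
    (fun c f u => by
      refine (bcomp_one X c _ u).trans ?_
      refine (congrArg (fun g => nSubst M (block 1 1) (X ![u, c] g))
        (restr_mul_zeB f 1 2 i)).trans ?_
      rw [hX.mul_ζ, LinearMap.comp_apply, bcomp_one, ← nSubst_nPar, nDodd_nSubst]) c f y

theorem bcomp_Tx (c : V) (f : OBT K N (block 1 1)) (y : VPoly K N V 1) :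
    bcomp M X c f (Tx M 1 y) = bcomp M X c ((dzT 0 + dzT 1 : Module.End K (OBT K N (block 1 1))) f) y -
      (nMul M (lam 0) + nMul M (lam 1) : Module.End K (VNabla M 3)) (bcomp M X c f y) :=
  (bcomp_isNested X).apply_Tx (d' := dzT 0 + dzT 1) (L' := nMul M (lam 0) + nMul M (lam 1))
    (add_comm_apply (fun x => rfl) (fun x => dzT_dzT 1 0 x))
    (fun i => add_comm_apply (fun x => dzT_dzeT 0 0 i x) (fun x => dzT_dzeT 1 0 i x))
    (add_comm_apply (fun x => rfl) (fun x => nMul_lam_comm 1 (lam 0) x))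
    (fun i => add_comm_apply (fun x => nMul_lam_comm 0 (odd 0 i) x)
      (fun x => nMul_lam_comm 1 (odd 0 i) x))
    (fun c f u => by
      have e : restr ((dzT 0 + dzT 1 : Module.End K (OBT K N (block 1 1))) f) =
          dzT 0 (restr f) := (map_add (restr (K := K) (N := N)) _ _).trans (dzT_zero_restr f).symm
      rw [bcomp_one X c f (M.T u), bcomp_one X c f u, hX.T_left, map_sub, nSubst_block_lam_zero]
      exact congrArg (· - _) ((bcomp_one X c _ u).trans
        (congrArg (fun g => nSubst M (block 1 1) (X ![u, c] g)) e)).symm) c f y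

theorem bcomp_Sx (c : V) (f : OBT K N (block 1 1)) (i : Fin N) (y : VPoly K N V 1) :
    bcomp M X c f (Sx M 1 i y) = bcomp M X (M.par c)
        ((dzeT 0 i + dzeT 1 i : Module.End K (OBT K N (block 1 1))) f) (parx M 1 y) +
      (nMul M (odd 0 i) + nMul M (odd 1 i) : Module.End K (VNabla M 3)) (bcomp M X c f y) :=
  (bcomp_isNested X).apply_Sx (δ' := dzeT 0 i + dzeT 1 i)
    (Θ' := nMul M (odd 0 i) + nMul M (odd 1 i)) i
    (add_comm_apply (fun x => (dzT_dzeT 0 0 i x).symm) (fun x => (dzT_dzeT 0 1 i x).symm))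
    (fun j => add_anticomm_apply (fun x => dzeT_anticomm 0 0 i j x)
      (fun x => dzeT_anticomm 1 0 i j x))
    (add_comm_apply (fun x => (nMul_lam_comm 0 (odd 0 i) x).symm)
      (fun x => (nMul_lam_comm 0 (odd 1 i) x).symm))
    (fun j => add_anticomm_apply (fun x => nMul_odd_anticomm 0 0 i j x)
      (fun x => nMul_odd_anticomm 1 0 i j x))
    (fun c f u => by
      have e : restr ((dzeT 0 i + dzeT 1 i : Module.End K (OBT K N (block 1 1))) f) =
          dzeT 0 i (restr f) := (map_add (restr (K := K) (N := N)) _ _).trans (dzeT_zero_restr i f).symm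
      rw [bcomp_one X c f (M.S i u), bcomp_one X c f u, hX.S_left, map_add, nSubst_block_odd_zero]
      exact congrArg (· + _) ((bcomp_one X (M.par c) _ (M.par u)).trans
        (congrArg (fun g => nSubst M (block 1 1) (X ![M.par u, M.par c] g)) e)).symm) c f y

theorem bcomp_T_vec (c : V) (f : OBT K N (block 1 1)) (y : VPoly K N V 1) :
    bcomp M X (M.T c) f y = bcomp M X c (dzT 2 f) y - nMul M (lam 2) (bcomp M X c f y) :=
  (bcomp_isNested X).vec_T (d' := dzT 2) (L' := nMul M (lam 2)) (fun x => dzT_dzT 2 0 x)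
    (fun i x => dzT_dzeT 2 0 i x) (fun x => nMul_lam_comm 2 (lam 0) x)
    (fun i x => nMul_lam_comm 2 (odd 0 i) x)
    (fun c f u => by
      rw [bcomp_one X (M.T c) f u, bcomp_one X c f u, bcomp_one X c (dzT 2 f) u, hX.T_right, map_sub,
        nSubst_block_lam_one, dzT_one_restr]) c f y

theorem bcomp_S_vec (c : V) (f : OBT K N (block 1 1)) (i : Fin N) (y : VPoly K N V 1) :
    bcomp M X (M.S i c) f y =
      bcomp M X (M.par c) (dzeT 2 i f) y + nMul M (odd 2 i) (bcomp M X c f (parx M 1 y)) :=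
  (bcomp_isNested X).vec_S (δ' := dzeT 2 i) (Θ' := nMul M (odd 2 i)) i
    (fun x => (dzT_dzeT 0 2 i x).symm) (fun j x => dzeT_anticomm 2 0 i j x)
    (fun x => (nMul_lam_comm 0 (odd 2 i) x).symm) (fun j x => nMul_odd_anticomm 2 0 i j x)
    (fun c f u => by
      rw [bcomp_one X (M.S i c) f u, bcomp_one X c f (M.par u), bcomp_one X (M.par c) (dzeT 2 i f) u,
        hX.S_right, map_add, nSubst_block_odd_one, dzeT_one_restr]) c f y

set_option maxHeartbeats 1000000 in
theorem bcomp_flip (c : V) (f : OBT K N (block 1 1)) (y : VPoly K N V 1) :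
    nSubst M (Equiv.swap (0 : Fin 3) 1) (bcomp M X c (flipB K N f) y) =
      bcomp M X c f (negNabla M y) := by
  have one : ∀ c f u, nSubst M (Equiv.swap (0 : Fin 3) 1) (bcomp M X c (flipB K N f) (1 ⊗ₜ u)) =
      bcomp M X c f (1 ⊗ₜ u) := fun c f u => by
    refine (congrArg _ (bcomp_one X c (flipB K N f) u)).trans ?_
    refine (nSubst_flip_block _).trans ?_
    refine Eq.trans ?_ (bcomp_one X c f u).symm
    exact congrArg (fun g => nSubst M (block 1 1) (X ![u, c] g)) (restr_flipB f)
  have hT : ∀ c f y, bcomp M X c f (Tx M 1 y) =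
      bcomp M X c ((dzT 0 + dzT 1 : Module.End K (OBT K N (block 1 1))) f) y -
      (nMul M (lam 0) + nMul M (lam 1) : Module.End K (VNabla M 3)) (bcomp M X c f y) :=
    fun c f y => bcomp_Tx hX c f y
  have hS := bcomp_Sx hX
  exact (bcomp_isNested X).flip (L' := nMul M (lam 1)) (Θ' := fun i => nMul M (odd 1 i))
    (d' := dzT 1) (δ' := fun i => dzeT 1 i) (R := (nSubst M (Equiv.swap (0 : Fin 3) 1) : VNabla M 3 →ₗ[K] VNabla M 3))
    (ρ := (flipB K N).toLinearMap)
    (fun f => dzT_flipB f) (fun i f => dzeT_flipB i f) (fun w => nSubst_flip_lam w)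
    (fun i w => nSubst_flip_odd i w) hT hS one c f y

end NestedLinear

section Extend

variable {O P W : Type*} [Ring O] [Algebra K O] [Ring P] [Algebra K P] [AddCommGroup W] [Module K W]

theorem pow_leibniz {u : P} (D : P → P) (hD : ∀ x y, D (x * y) = D x * y + x * D y)
    (h1 : D 1 = 0) (e : K) (hu : D u = e • (u * u)) (k : ℕ) :
    D (u ^ k) = ((k : K) * e) • u ^ (k + 1) := by
  induction k with
  | zero => rw [pow_zero, h1, Nat.cast_zero, zero_mul, zero_smul]
  | succ k ih =>
    rw [pow_succ, hD, ih, hu, smul_mul_assoc, mul_smul_comm, ← pow_succ, ← mul_assoc, ← pow_succ,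
      ← pow_succ, ← add_smul, Nat.cast_succ, add_mul, one_mul]

theorem pow_comm_of_comm {u : P} (comm : ∀ f, u * f = f * u) (k : ℕ) (f : P) :
    u ^ k * f = f * u ^ k := by
  induction k with
  | zero => rw [pow_zero, one_mul, mul_one]
  | succ k ih => rw [pow_succ, mul_assoc, comm, ← mul_assoc, ih, mul_assoc]

theorem map_mul_pow_mul_pow {R : O →ₐ[K] P} {z : O} {u : P} (mul : R z * u = 1) (k : ℕ) (f : O) :
    R (f * z ^ k) * u ^ k = R f := by
  induction k with
  | zero => rw [pow_zero, pow_zero, mul_one, mul_one]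
  | succ k ih =>
    rw [pow_succ, pow_succ', ← mul_assoc f, map_mul, ← mul_assoc, mul_assoc _ (R z), mul, mul_one,
      ih]

variable (K) in
/-- `P` is obtained from `O` by inverting the central element `z`, with inverse `u` in `P`. -/
structure IsInverting (R : O →ₐ[K] P) (z : O) (u : P) : Prop where
  inj : Function.Injective R
  comm : ∀ f, u * f = f * u
  mul : R z * u = 1
  gen : ∀ p, ∃ k f, p = R f * u ^ k

namespace IsInverting

variable {R : O →ₐ[K] P} {z : O} {u : P} (h : IsInverting K R z u)
include h

theorem pow_comm (k : ℕ) (f : P) : u ^ k * f = f * u ^ k := pow_comm_of_comm h.comm k f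

theorem map_mul_pow (k : ℕ) (f : O) : R (f * z ^ k) * u ^ k = R f := map_mul_pow_mul_pow h.mul k f

theorem exists_common (p q : P) : ∃ k f g, p = R f * u ^ k ∧ q = R g * u ^ k := by
  obtain ⟨k, f, rfl⟩ := h.gen p
  obtain ⟨l, g, rfl⟩ := h.gen q
  refine ⟨k + l, f * z ^ l, g * z ^ k, ?_, ?_⟩
  · rw [add_comm, pow_add, ← mul_assoc, h.map_mul_pow]
  · rw [pow_add, ← mul_assoc, h.map_mul_pow]

theorem apply_mul_pow {φ : ℕ → O →ₗ[K] W} (hφ : ∀ k f, φ (k + 1) (f * z) = φ k f) (k l : ℕ)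
    (f : O) : φ (k + l) (f * z ^ l) = φ k f := by
  induction l with
  | zero => rw [pow_zero, mul_one, add_zero]
  | succ l ih => rw [pow_succ, ← mul_assoc, ← add_assoc, hφ, ih]

theorem apply_eq {φ : ℕ → O →ₗ[K] W} (hφ : ∀ k f, φ (k + 1) (f * z) = φ k f) {k l : ℕ} {f g : O}
    (e : R f * u ^ k = R g * u ^ l) : φ k f = φ l g := by
  rw [← h.apply_mul_pow hφ k l f, ← h.apply_mul_pow hφ l k g, add_comm l k]
  congr 1
  refine h.inj ?_
  have hz : ∀ n, R z ^ n * u ^ n = 1 := fun n => by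
    have := h.map_mul_pow n 1
    rwa [one_mul, map_one, map_pow] at this
  have hz' : ∀ n, u ^ n * R z ^ n = 1 := fun n => by rw [h.pow_comm, hz]
  have e' := congrArg (· * (R z ^ k * R z ^ l)) e
  rw [map_mul, map_mul, map_pow, map_pow]
  rw [mul_assoc, ← mul_assoc (u ^ k), hz', one_mul, mul_assoc, ← pow_add, add_comm k l, pow_add,
    ← mul_assoc (u ^ l), hz', one_mul] at e'
  exact e'

/-- The extension of a compatible family of linear maps `f u^k ↦ φ_k(f)`. -/
def extend (φ : ℕ → O →ₗ[K] W) (hφ : ∀ k f, φ (k + 1) (f * z) = φ k f) : P →ₗ[K] W where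
  toFun p := φ (h.gen p).choose (h.gen p).choose_spec.choose
  map_add' p q := by
    obtain ⟨k, f, g, e1, e2⟩ := h.exists_common p q
    have e3 : p + q = R (f + g) * u ^ k := by rw [map_add, add_mul, e1, e2]
    rw [h.apply_eq hφ ((h.gen p).choose_spec.choose_spec.symm.trans e1),
      h.apply_eq hφ ((h.gen q).choose_spec.choose_spec.symm.trans e2),
      h.apply_eq hφ ((h.gen (p + q)).choose_spec.choose_spec.symm.trans e3), map_add]
  map_smul' r p := by
    obtain ⟨k, f, e1⟩ := h.gen p
    have e3 : r • p = R (r • f) * u ^ k := by rw [map_smul, smul_mul_assoc, e1]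
    rw [h.apply_eq hφ ((h.gen p).choose_spec.choose_spec.symm.trans e1),
      h.apply_eq hφ ((h.gen (r • p)).choose_spec.choose_spec.symm.trans e3), map_smul,
      RingHom.id_apply]

theorem extend_apply (φ : ℕ → O →ₗ[K] W) (hφ : ∀ k f, φ (k + 1) (f * z) = φ k f) (k : ℕ) (f : O) :
    h.extend φ hφ (R f * u ^ k) = φ k f :=
  h.apply_eq hφ (h.gen (R f * u ^ k)).choose_spec.choose_spec.symm

end IsInverting

end Extend

section Inclusion

instance {n m : ℕ} (b : Fin n → Fin m) : Monoid (OBT K N b) := (OBT K N b).toSemiring.toMonoid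

instance {n m : ℕ} (b : Fin n → Fin m) : Pow (OBT K N b) ℕ := inferInstance

variable (K N) in
/-- The inclusion of the functions that are regular at `z_1 = z_2`. -/
def incl : OBT K N (block 1 1) →ₐ[K] OT K N 3 :=
  relT (block 1 1) id id fun _ _ h h' => h (congrArg _ h')

theorem ziT_mul_zT {n : ℕ} {k l : Fin n} (h : k ≠ l) : ziT k l * zT k l = (1 : OT K N n) := by
  rw [ziT_of_ne h]; exact ziB_mul_zB (b := id) h

theorem zT_mul_ziT {n : ℕ} {k l : Fin n} (h : k ≠ l) : zT k l * ziT k l = (1 : OT K N n) := by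
  rw [ziT_of_ne h]; exact zB_mul_ziB (b := id) h

theorem ziT_comm {n : ℕ} (k l : Fin n) (f : OT K N n) : ziT k l * f = f * ziT k l := by
  by_cases h : k ≠ l
  · rw [ziT_of_ne h]; exact ziB_comm (b := id) h f
  · rw [ziT, dif_neg h, zero_mul, mul_zero]

theorem ite_sub_ite_mul {A : Type*} [Ring A] [Algebra K A] (p q : Prop) [Decidable p] [Decidable q]
    (x : A) : ((if p then 1 else 0) - if q then 1 else 0) * x =
      ((if p then 1 else 0) - if q then 1 else 0 : K) • x := by
  split_ifs <;> simp

theorem dzT_ziT_pow {n : ℕ} {p q : Fin n} (h : p ≠ q) (j : Fin n) (k : ℕ) :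
    dzT j (ziT p q ^ k : OT K N n) =
      ((k : K) * ((if q = j then 1 else 0) - if p = j then 1 else 0)) • ziT p q ^ (k + 1) :=
  pow_leibniz (K := K) (P := OT K N n) (u := ziT p q) (fun f => dzT j f) (dzT_mul j) (dzT_one j) _
    (by
      rw [ziT_of_ne h]
      exact (dzT_ziB (b := id) h j).trans (ite_sub_ite_mul (K := K) _ _ _)) k

theorem dzeT_pow_eq_zero {P : Type*} [Ring P] {D ι : P → P} {u : P}
    (hD : ∀ x y, D (x * y) = D x * y + ι x * D y) (h1 : D 1 = 0) (hu : D u = 0) (k : ℕ) :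
    D (u ^ k) = 0 := by
  induction k with
  | zero => rw [pow_zero, h1]
  | succ k ih => rw [pow_succ, hD, ih, hu, zero_mul, mul_zero, add_zero]

theorem dzeT_ziT_pow {n : ℕ} {p q : Fin n} (h : p ≠ q) (j : Fin n) (i : Fin N) (k : ℕ) :
    dzeT j i (ziT p q ^ k : OT K N n) = 0 :=
  dzeT_pow_eq_zero (P := OT K N n) (u := ziT p q) (D := fun f => dzeT j i f) (ι := fun f => invT f) (dzeT_mul j i)
    (dzeT_one j i) (by rw [ziT_of_ne h]; exact dzeT_ziB (b := id) h j i) k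

theorem invT_ziT {n : ℕ} {p q : Fin n} (h : p ≠ q) : invT (ziT p q) = (ziT p q : OT K N n) := by
  rw [ziT_of_ne h]; exact invT_ziB (b := id) h

theorem incl_zB (k l : Fin 3) : incl K N (zB (block 1 1) k l) = zT k l := relT_zB _ k l

theorem incl_zeB (k l : Fin 3) (i : Fin N) : incl K N (zeB (block 1 1) k l i) = zeT k l i :=
  relT_zeB _ k l i

theorem isInverting_of_adjoin {O P : Type*} [Ring O] [Algebra K O] [Ring P] [Algebra K P]
    {R : O →ₐ[K] P} {z : O} {u : P} (inj : Function.Injective R) (comm : ∀ f, u * f = f * u)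
    (mul : R z * u = 1) {s : Set P} (hs : Algebra.adjoin K s = ⊤)
    (h : ∀ x ∈ s, ∃ k f, x = R f * u ^ k) : IsInverting K R z u := by
  refine ⟨inj, comm, mul, fun p => ?_⟩
  have hc := pow_comm_of_comm comm
  have hm := map_mul_pow_mul_pow mul
  have hp : p ∈ Algebra.adjoin K s := hs ▸ Algebra.mem_top
  induction hp using Algebra.adjoin_induction with
  | mem x hx => exact h x hx
  | algebraMap r => exact ⟨0, algebraMap K O r, by rw [pow_zero, mul_one, AlgHom.commutes]⟩
  | add x y _ _ hx hy =>
    obtain ⟨k, f, rfl⟩ := hx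
    obtain ⟨l, g, rfl⟩ := hy
    refine ⟨k + l, f * z ^ l + g * z ^ k, ?_⟩
    rw [map_add, add_mul]
    congr 1
    · rw [add_comm, pow_add, ← mul_assoc, hm]
    · rw [pow_add, ← mul_assoc, hm]
  | mul x y _ _ hx hy =>
    obtain ⟨k, f, rfl⟩ := hx
    obtain ⟨l, g, rfl⟩ := hy
    refine ⟨k + l, f * g, ?_⟩
    rw [map_mul, mul_assoc, ← mul_assoc _ (R g), hc, pow_add, mul_assoc, mul_assoc]

theorem ziT_swap {n : ℕ} (k l : Fin n) : ziT k l = -(ziT l k : OT K N n) := by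
  by_cases h : k ≠ l
  · have h1 : zT l k * (ziT k l : OT K N n) = -1 := by
      refine (congrArg (· * (ziT k l : OT K N n)) (zB_swap (b := id) l k)).trans ?_
      rw [neg_mul]
      exact congrArg Neg.neg (zT_mul_ziT h)
    have h2 := congrArg ((ziT l k : OT K N n) * ·) h1
    simp only [← mul_assoc, ziT_mul_zT h.symm, one_mul, mul_neg, mul_one] at h2
    exact h2
  · rw [ziT, ziT, dif_neg h, dif_neg (fun h' => h (Ne.symm h')), neg_zero]

theorem incl_ziB {k l : Fin 3} (h : block 1 1 k ≠ block 1 1 l) : incl K N (ziB h) = ziT k l := by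
  rw [ziT_of_ne (fun e => h (congrArg _ e))]
  exact relT_ziB _ h

theorem adjoin_OBT {n m : ℕ} (b : Fin n → Fin m) : Algebra.adjoin K {x : OBT K N b |
    (x : OB K N b) ∈ {x : OB K N b | ∃ k l, x = zz b k l} ∪
      {x | ∃ k l, b k ≠ b l ∧ x = zi b k l} ∪ {x | ∃ k l i, x = ze b k l i}} = ⊤ :=
  Algebra.adjoin_adjoin_coe_preimage

variable (K N) in
theorem incl_isInverting : IsInverting (O := OBT K N (block 1 1)) (P := OT K N 3) K (incl K N)
    (zB (block 1 1) 0 1) (ziT 0 1) :=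
  isInverting_of_adjoin (O := OBT K N (block 1 1)) (P := OT K N 3) (relT_id_injective _ _ _)
    (ziT_comm 0 1) ((congrArg (· * (ziT 0 1 : OT K N 3)) (incl_zB 0 1)).trans
      (zT_mul_ziT (by decide))) (adjoin_OBT id) (by
      rintro ⟨x, hx⟩ ((⟨k, l, h⟩ | ⟨k, l, hkl, h⟩) | ⟨k, l, i, h⟩)
      · refine ⟨0, zB (block 1 1) k l, ?_⟩
        rw [pow_zero, mul_one, incl_zB]
        exact Subtype.ext h
      · have e : (⟨x, hx⟩ : OT K N 3) = ziT k l := by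
          rw [ziT_of_ne (show k ≠ l from hkl)]
          exact Subtype.ext h
        rw [e]
        by_cases hb : block 1 1 k ≠ block 1 1 l
        · refine ⟨0, ziB hb, ?_⟩
          rw [pow_zero, mul_one, incl_ziB]
        · obtain ⟨rfl, rfl⟩ | ⟨rfl, rfl⟩ : (k = 0 ∧ l = 1) ∨ (k = 1 ∧ l = 0) := by
            have key : ∀ k l : Fin 3, k ≠ l → ¬block 1 1 k ≠ block 1 1 l →
                (k = 0 ∧ l = 1) ∨ (k = 1 ∧ l = 0) := by decide
            exact key k l hkl hb
          · exact ⟨1, 1, by rw [map_one, one_mul, pow_one]⟩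
          · exact ⟨1, -1, by rw [map_neg, map_one, neg_one_mul, pow_one, ← ziT_swap]⟩
      · refine ⟨0, zeB (block 1 1) k l i, ?_⟩
        rw [pow_zero, mul_one, incl_zeB]
        exact Subtype.ext h)

end Inclusion

section PoleValues

variable [CharZero K]

/-- `X_{Λ,-Λ-∇}(a ⊗ b ⊗ z_{1,2}^{-k})`. -/
def poleVal (X : Op M 2) (k : ℕ) (a b : V) : VPoly K N V 1 := elim M 1 (X ![a, b] (ziT 0 1 ^ k))

variable {X : Op M 2}

theorem poleVal_add_left (k : ℕ) (a a' b : V) :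
    poleVal X k (a + a') b = poleVal X k a b + poleVal X k a' b := by
  rw [poleVal, apply_add_left, LinearMap.add_apply, map_add]; rfl

theorem poleVal_smul_left (k : ℕ) (r : K) (a b : V) :
    poleVal X k (r • a) b = r • poleVal X k a b := by
  rw [poleVal, apply_smul_left, LinearMap.smul_apply, map_smul]; rfl

theorem poleVal_add_right (k : ℕ) (a b b' : V) :
    poleVal X k a (b + b') = poleVal X k a b + poleVal X k a b' := by
  rw [poleVal, apply_add_right, LinearMap.add_apply, map_add]; rfl

theorem poleVal_smul_right (k : ℕ) (r : K) (a b : V) :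
    poleVal X k a (r • b) = r • poleVal X k a b := by
  rw [poleVal, apply_smul_right, LinearMap.smul_apply, map_smul]; rfl

theorem elim_lam_zero (w : VNabla M 2) : elim M 1 (nMul M (lam 0) w) = lmul (lam 0) (elim M 1 w) :=
  elim_lam_castSucc 0 w

theorem elim_lam_one (w : VNabla M 2) :
    elim M 1 (nMul M (lam 1) w) = -lmul (lam 0) (elim M 1 w) - Tx M 1 (elim M 1 w) := by
  have h := elim_lam_last (n := 1) w
  rwa [Fin.sum_univ_one] at h

theorem elim_odd_zero (i : Fin N) (w : VNabla M 2) :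
    elim M 1 (nMul M (odd 0 i) w) = lmul (odd 0 i) (elim M 1 w) :=
  elim_odd_castSucc 0 i w

theorem elim_odd_one (i : Fin N) (w : VNabla M 2) :
    elim M 1 (nMul M (odd 1 i) w) = -lmul (odd 0 i) (elim M 1 w) - Sx M 1 i (elim M 1 w) := by
  have h := elim_odd_last (n := 1) i w
  rwa [Fin.sum_univ_one] at h

theorem elim_nDlam_zero_one (w : VNabla M 2) : elim M 1 (nDlam M 0 1 w) = Dlam 0 (elim M 1 w) :=
  elim_nDlam 0 w

theorem negNabla_Tx (y : VPoly K N V 1) : negNabla M (Tx M 1 y) = Tx M 1 (negNabla M y) := by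
  induction y using vpoly_one_induction with
  | one u =>
    have e : ∀ u, Tx M 1 ((1 : SPoly K N 1) ⊗ₜ[K] u) = 1 ⊗ₜ M.T u := by simp [Tx]
    rw [e, negNabla_one, negNabla_one, e]
  | add x y hx hy => simp only [map_add, hx, hy]
  | smul r x hx => simp only [map_smul, hx]
  | lam x hx => rw [Tx_lmul, negNabla_lam, negNabla_lam, hx, map_sub, map_neg, Tx_lmul]
  | odd i x hx => rw [Tx_lmul, negNabla_odd, negNabla_odd, hx, map_sub, map_neg, Tx_lmul, Tx_Sx]

theorem negNabla_Sx (i : Fin N) (y : VPoly K N V 1) :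
    negNabla M (Sx M 1 i y) = Sx M 1 i (negNabla M y) := by
  induction y using vpoly_one_induction with
  | one u =>
    have e : ∀ u, Sx M 1 i ((1 : SPoly K N 1) ⊗ₜ[K] u) = 1 ⊗ₜ M.S i u := by simp [Sx]
    rw [e, negNabla_one, negNabla_one, e]
  | add x y hx hy => simp only [map_add, hx, hy]
  | smul r x hx => simp only [map_smul, hx]
  | lam x hx =>
    rw [Sx_lmul_lam, negNabla_lam, negNabla_lam, hx, map_sub, map_neg, Sx_lmul_lam, Tx_Sx]
  | odd j x hx =>
    rw [Sx_lmul_odd, map_neg, negNabla_odd, negNabla_odd, hx, map_sub, map_neg, Sx_lmul_odd,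
      eq_neg_of_add_eq_zero_left (Sx_Sx M i j _)]
    abel

theorem nSubst_perm_lam {n : ℕ} (σ : Equiv.Perm (Fin n)) (j : Fin n) (w : VNabla M n) :
    nSubst M σ (nMul M (lam (σ j)) w) = nMul M (lam j) (nSubst M σ w) := by
  refine (nSubst_nMul_lam σ (σ j) w).trans ?_
  have e : Finset.univ.filter (fun k => σ k = σ j) = {j} := by ext k; simp
  rw [e, Finset.sum_singleton]

theorem nSubst_perm_odd {n : ℕ} (σ : Equiv.Perm (Fin n)) (j : Fin n) (i : Fin N) (w : VNabla M n) :
    nSubst M σ (nMul M (odd (σ j) i) w) = nMul M (odd j i) (nSubst M σ w) := by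
  refine (nSubst_nMul_odd σ (σ j) i w).trans ?_
  have e : Finset.univ.filter (fun k => σ k = σ j) = {j} := by ext k; simp
  rw [e, Finset.sum_singleton]

theorem elim_nSubst_swap (w : VNabla M 2) :
    elim M 1 (nSubst M (Equiv.swap (0 : Fin 2) 1) w) = negNabla M (elim M 1 w) := by
  induction w using nabla_gen_induction with
  | one v => rw [nSubst_cls, map_one, elim_one, negNabla_one]
  | add x y hx hy => simp only [map_add, hx, hy]
  | smul c x hx => simp only [map_smul, hx]
  | lam k x hx =>
    obtain rfl | rfl : k = 0 ∨ k = 1 := by omega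
    · refine (congrArg (elim M 1) (nSubst_perm_lam (Equiv.swap (0 : Fin 2) 1) 1 x)).trans ?_
      refine (elim_lam_one _).trans ?_
      rw [hx, ← negNabla_lam]
      exact congrArg (negNabla M) (elim_lam_zero x).symm
    · refine (congrArg (elim M 1) (nSubst_perm_lam (Equiv.swap (0 : Fin 2) 1) 0 x)).trans ?_
      refine (elim_lam_zero _).trans ?_
      rw [hx]
      refine Eq.trans ?_ (congrArg (negNabla M) (elim_lam_one x).symm)
      rw [map_sub, map_neg, negNabla_lam, negNabla_Tx]
      abel
  | odd k i x hx =>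
    obtain rfl | rfl : k = 0 ∨ k = 1 := by omega
    · refine (congrArg (elim M 1) (nSubst_perm_odd (Equiv.swap (0 : Fin 2) 1) 1 i x)).trans ?_
      refine (elim_odd_one i _).trans ?_
      rw [hx, ← negNabla_odd]
      exact congrArg (negNabla M) (elim_odd_zero i x).symm
    · refine (congrArg (elim M 1) (nSubst_perm_odd (Equiv.swap (0 : Fin 2) 1) 0 i x)).trans ?_
      refine (elim_odd_zero i _).trans ?_
      rw [hx]
      refine Eq.trans ?_ (congrArg (negNabla M) (elim_odd_one i x).symm)
      rw [map_sub, map_neg, negNabla_odd, negNabla_Sx]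
      abel

theorem dzT_zero_pow (k : ℕ) : dzT 0 (ziT 0 1 ^ k : OT K N 2) = -((k : K) • ziT 0 1 ^ (k + 1)) := by
  refine (dzT_ziT_pow (by decide) 0 k).trans ?_
  rw [if_neg (by decide), if_pos rfl, zero_sub, mul_neg_one, neg_smul]

theorem dzT_one_pow (k : ℕ) : dzT 1 (ziT 0 1 ^ k : OT K N 2) = (k : K) • ziT 0 1 ^ (k + 1) := by
  refine (dzT_ziT_pow (by decide) 1 k).trans ?_
  rw [if_pos rfl, if_neg (by decide), sub_zero, mul_one]

variable (hX : IsChiralOf M 1 X)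
include hX

theorem Dlam_poleVal (k : ℕ) (a b : V) : Dlam 0 (poleVal X (k + 1) a b) = -poleVal X k a b := by
  have h := hX.mul_z ![a, b] (ziT 0 1 ^ (k + 1)) 0 1
  rw [pow_succ, mul_assoc, ziT_mul_zT (by decide), mul_one, nDlam_swap, ← pow_succ] at h
  rw [poleVal, ← elim_nDlam_zero_one, poleVal, h, map_neg, neg_neg]

theorem poleVal_T_left (k : ℕ) (a b : V) : poleVal X k (M.T a) b =
    -lmul (lam 0) (poleVal X k a b) - (k : K) • poleVal X (k + 1) a b := by
  rw [poleVal, hX.T_left, dzT_zero_pow, map_sub, elim_lam_zero, map_neg, map_smul, map_neg,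
    map_smul, neg_sub_comm]
  rfl

theorem poleVal_T_right (k : ℕ) (a b : V) : poleVal X k a (M.T b) =
    lmul (lam 0) (poleVal X k a b) + Tx M 1 (poleVal X k a b) + (k : K) • poleVal X (k + 1) a b := by
  rw [poleVal, hX.T_right, dzT_one_pow, map_sub, elim_lam_one, map_smul, map_smul]
  simp only [poleVal]
  abel

theorem poleVal_S_left (k : ℕ) (i : Fin N) (a b : V) :
    poleVal X k (M.S i a) b = lmul (odd 0 i) (poleVal X k a b) := by
  rw [poleVal, hX.S_left, dzeT_ziT_pow (by decide), map_zero, zero_add, elim_odd_zero]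
  rfl

theorem poleVal_S_right (k : ℕ) (i : Fin N) (a b : V) : poleVal X k a (M.S i b) =
    -lmul (odd 0 i) (poleVal X k (M.par a) b) - Sx M 1 i (poleVal X k (M.par a) b) := by
  rw [poleVal, hX.S_right, dzeT_ziT_pow (by decide), map_zero, zero_add, elim_odd_one]
  rfl

theorem parx_poleVal (k : ℕ) (a b : V) :
    parx M 1 (poleVal X k a b) = -poleVal X k (M.par a) (M.par b) := by
  rw [poleVal, ← elim_nPar, hX.nPar_apply, map_neg, map_pow, invT_ziT (by decide)]
  rfl

end PoleValues

section Composition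

variable [CharZero K] {X : Op M 2}

theorem bcompFun_mul_z (hX : IsChiralOf M 1 X) (a b c : V) (k : ℕ) (f : OBT K N (block 1 1)) :
    bcompFun X c (poleVal X (k + 1) a b) (f * zB (block 1 1) 0 1) =
      bcompFun X c (poleVal X k a b) f := by
  refine (bcomp_mul_z_eq_Dlam X c f _).trans ?_
  rw [Dlam_poleVal hX, map_neg, neg_neg]
  rfl

/-- The value of `X ∘_1 X` at `a ⊗ b ⊗ c`. -/
def compVal (hX : IsChiralOf M 1 X) (a b c : V) : OT K N 3 →ₗ[K] VNabla M 3 :=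
  (incl_isInverting K N).extend (O := OBT K N (block 1 1)) (P := OT K N 3)
    (fun k => bcompFun X c (poleVal X k a b)) (bcompFun_mul_z hX a b c)

theorem compVal_apply (hX : IsChiralOf M 1 X) (a b c : V) (k : ℕ) (f : OBT K N (block 1 1)) :
    compVal hX a b c (incl K N f * ziT 0 1 ^ k) = bcomp M X c f (poleVal X k a b) :=
  (incl_isInverting K N).extend_apply (O := OBT K N (block 1 1)) (P := OT K N 3) _
    (bcompFun_mul_z hX a b c) k f

theorem linear_ext_incl {W : Type*} [AddCommGroup W] [Module K W] {F G : OT K N 3 →ₗ[K] W}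
    (h : ∀ k f, F (incl K N f * ziT 0 1 ^ k) = G (incl K N f * ziT 0 1 ^ k)) : F = G := by
  refine LinearMap.ext fun p => ?_
  obtain ⟨k, f, rfl⟩ := (incl_isInverting K N).gen p
  exact h k f

/-- A multilinear map in three vectors. -/
def trilin {W : Type*} [AddCommGroup W] [Module K W] (φ : V → V → V → W)
    (h1 : ∀ a a' b c, φ (a + a') b c = φ a b c + φ a' b c)
    (h1' : ∀ (r : K) a b c, φ (r • a) b c = r • φ a b c)
    (h2 : ∀ a b b' c, φ a (b + b') c = φ a b c + φ a b' c)
    (h2' : ∀ (r : K) a b c, φ a (r • b) c = r • φ a b c)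
    (h3 : ∀ a b c c', φ a b (c + c') = φ a b c + φ a b c')
    (h3' : ∀ (r : K) a b c, φ a b (r • c) = r • φ a b c) :
    MultilinearMap K (fun _ : Fin 3 => V) W where
  toFun v := φ (v 0) (v 1) (v 2)
  map_update_add' v i x y := by
    cases Subsingleton.elim ‹DecidableEq (Fin 3)› (instDecidableEqFin 3)
    fin_cases i <;> simp +decide [Function.update, h1, h2, h3]
  map_update_smul' v i r x := by
    cases Subsingleton.elim ‹DecidableEq (Fin 3)› (instDecidableEqFin 3)
    fin_cases i <;> simp +decide [Function.update, h1', h2', h3']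

/-- The partial composition `X ∘_1 X`. -/
def compOp (hX : IsChiralOf M 1 X) : Op M 3 :=
  trilin (compVal hX)
    (fun a a' b c => linear_ext_incl fun k f => by
      rw [LinearMap.add_apply, compVal_apply, compVal_apply, compVal_apply, poleVal_add_left,
        map_add])
    (fun r a b c => linear_ext_incl fun k f => by
      rw [LinearMap.smul_apply, compVal_apply, compVal_apply, poleVal_smul_left, map_smul])
    (fun a b b' c => linear_ext_incl fun k f => by
      rw [LinearMap.add_apply, compVal_apply, compVal_apply, compVal_apply, poleVal_add_right,
        map_add])
    (fun r a b c => linear_ext_incl fun k f => by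
      rw [LinearMap.smul_apply, compVal_apply, compVal_apply, poleVal_smul_right, map_smul])
    (fun a b c c' => linear_ext_incl fun k f => by
      rw [LinearMap.add_apply, compVal_apply, compVal_apply, compVal_apply, bcomp_add_vec])
    (fun r a b c => linear_ext_incl fun k f => by
      rw [LinearMap.smul_apply, compVal_apply, compVal_apply, bcomp_smul_vec])

theorem compOp_apply (hX : IsChiralOf M 1 X) (v : Fin 3 → V) (k : ℕ) (f : OBT K N (block 1 1)) :
    compOp hX v (incl K N f * ziT 0 1 ^ k) = bcomp M X (v 2) f (poleVal X k (v 0) (v 1)) :=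
  compVal_apply hX _ _ _ k f

end Composition

section CompositionChiral

theorem IsInverting.mul_map {O P : Type*} [Ring O] [Algebra K O] [Ring P]
    [Algebra K P] {R : O →ₐ[K] P} {z : O} {u : P} (h : IsInverting K R z u) (f g : O) (k : ℕ) :
    R f * u ^ k * R g = R (f * g) * u ^ k := by
  rw [mul_assoc, h.pow_comm, ← mul_assoc, map_mul]

theorem incl_mul_zT (f : OBT K N (block 1 1)) (n : ℕ) (k l : Fin 3) :
    incl K N f * ziT 0 1 ^ n * zT k l = incl K N (f * zB (block 1 1) k l) * ziT 0 1 ^ n :=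
  (congrArg (incl K N f * ziT 0 1 ^ n * ·) (incl_zB k l).symm).trans
    ((incl_isInverting K N).mul_map f (zB (block 1 1) k l) n)

theorem incl_mul_zeT (f : OBT K N (block 1 1)) (n : ℕ) (k l : Fin 3) (i : Fin N) :
    incl K N f * ziT 0 1 ^ n * zeT k l i = incl K N (f * zeB (block 1 1) k l i) * ziT 0 1 ^ n :=
  (congrArg (incl K N f * ziT 0 1 ^ n * ·) (incl_zeB k l i).symm).trans
    ((incl_isInverting K N).mul_map f (zeB (block 1 1) k l i) n)

theorem dzT_incl (k : Fin 3) (f : OBT K N (block 1 1)) : dzT k (incl K N f) = incl K N (dzT k f) :=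
  (dzT_relT (b := block 1 1) (b' := id) (c := id) _ k f).trans
    ((congrArg (fun s => ∑ j ∈ s, incl K N (dzT j f))
      (show Finset.univ.filter (fun j : Fin 3 => id j = k) = {k} by revert k; decide)).trans
      (Finset.sum_singleton _ _))

theorem dzeT_incl (k : Fin 3) (i : Fin N) (f : OBT K N (block 1 1)) :
    dzeT k i (incl K N f) = incl K N (dzeT k i f) :=
  (dzeT_relT (b := block 1 1) (b' := id) (c := id) _ k i f).trans
    ((congrArg (fun s => ∑ j ∈ s, incl K N (dzeT j i f))
      (show Finset.univ.filter (fun j : Fin 3 => id j = k) = {k} by revert k; decide)).trans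
      (Finset.sum_singleton _ _))

theorem dzT_incl_mul (j : Fin 3) (f : OBT K N (block 1 1)) (k : ℕ) :
    dzT j (incl K N f * ziT 0 1 ^ k) = incl K N (dzT j f) * ziT 0 1 ^ k +
      ((k : K) * ((if 1 = j then 1 else 0) - if 0 = j then 1 else 0)) •
        (incl K N f * ziT 0 1 ^ (k + 1)) := by
  rw [dzT_mul, dzT_incl]
  exact congrArg (incl K N (dzT j f) * ziT 0 1 ^ k + ·)
    ((congrArg (incl K N f * ·) (dzT_ziT_pow (by decide) j k)).trans (mul_smul_comm _ _ _))

theorem dzeT_incl_mul (j : Fin 3) (i : Fin N) (f : OBT K N (block 1 1)) (k : ℕ) :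
    dzeT j i (incl K N f * ziT 0 1 ^ k) = incl K N (dzeT j i f) * ziT 0 1 ^ k := by
  rw [dzeT_mul, dzeT_incl, dzeT_ziT_pow (by decide), mul_zero, add_zero]

theorem invT_incl_mul (f : OBT K N (block 1 1)) (k : ℕ) :
    invT (incl K N f * ziT 0 1 ^ k) = incl K N (invT f) * ziT 0 1 ^ k := by
  rw [map_mul, map_pow, invT_ziT (by decide)]
  exact congrArg (· * (ziT 0 1 : OT K N 3) ^ k) (invT_relT _ f)

theorem eq_zero_of_cocycle {A : Type*} [AddCommGroup A] {χ : Fin 3 → Fin 3 → A}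
    (h : ∀ k l m, χ k l + χ l m = χ k m) (h01 : χ 0 1 = 0) (h12 : χ 1 2 = 0) (k l : Fin 3) :
    χ k l = 0 := by
  have h0 : ∀ j, χ 0 j = 0 := fun j => by
    obtain rfl | rfl | rfl : j = 0 ∨ j = 1 ∨ j = 2 := by omega
    · exact left_eq_add.mp (h 0 0 0).symm
    · exact h01
    · rw [← h 0 1 2, h01, h12, add_zero]
  have := h 0 k l
  rwa [h0, h0, zero_add] at this

theorem eq_of_cocycle {A : Type*} [AddCommGroup A] {χ ψ : Fin 3 → Fin 3 → A}
    (h : ∀ k l m, χ k l + χ l m = χ k m) (h' : ∀ k l m, ψ k l + ψ l m = ψ k m)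
    (h01 : χ 0 1 = ψ 0 1) (h12 : χ 1 2 = ψ 1 2) (k l : Fin 3) : χ k l = ψ k l :=
  sub_eq_zero.mp (eq_zero_of_cocycle (χ := fun k l => χ k l - ψ k l)
    (fun k l m => by rw [← h k l m, ← h' k l m]; abel) (sub_eq_zero.mpr h01) (sub_eq_zero.mpr h12)
    k l)

theorem neg_sub_sub_eq {E : Type*} [AddCommGroup E] (a b c : E) :
    -(a - b) - c = b + -c - a := by abel

theorem exists_eq_ziT_pow {f : OT K N 2}
    (hf : f ∈ Submonoid.closure {x : OT K N 2 | ∃ k l, k < l ∧ x = ziT k l}) :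
    ∃ k : ℕ, f = ziT 0 1 ^ k := by
  have h : f ∈ Submonoid.closure {(ziT 0 1 : OT K N 2)} := by
    refine Submonoid.closure_mono ?_ hf
    rintro x ⟨k, l, h, rfl⟩
    obtain ⟨rfl, rfl⟩ : k = 0 ∧ l = 1 := by omega
    rfl
  exact (Submonoid.mem_closure_singleton.mp h).imp fun k h => h.symm

theorem relT_castAdd_pow (k : ℕ) :
    relT id id (Fin.castAdd 1) (fun _ _ h => (Fin.castAdd_injective 2 1).ne h)
      (ziT 0 1 ^ k : OT K N 2) = (ziT 0 1 ^ k : OT K N 3) := by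
  rw [map_pow]
  refine congrArg (· ^ k) ?_
  rw [ziT_of_ne (by decide), ziT_of_ne (by decide)]
  exact relT_ziB (b := id) (b' := id) (c := Fin.castAdd 1) _ _

variable [CharZero K] {X : Op M 2} (hX : IsChiralOf M 1 X)
include hX

theorem bcomp_lam_add_Tx (c : V) (f : OBT K N (block 1 1)) (y : VPoly K N V 1) :
    bcomp M X c f (lmul (lam 0) y) + bcomp M X c f (Tx M 1 y) =
      bcomp M X c (dzT 1 f) y - nMul M (lam 1) (bcomp M X c f y) :=
  (bcomp_isNested X).lam_add_Tx (d' := dzT 1) (L' := nMul M (lam 1)) (bcomp_Tx hX c f y)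

theorem bcomp_odd_add_Sx (c : V) (f : OBT K N (block 1 1)) (i : Fin N) (y : VPoly K N V 1) :
    bcomp M X c f (lmul (odd 0 i) y) + bcomp M X c f (Sx M 1 i y) =
      bcomp M X (M.par c) (dzeT 1 i f) (parx M 1 y) + nMul M (odd 1 i) (bcomp M X c f y) :=
  (bcomp_isNested X).odd_add_Sx (δ' := dzeT 1 i) (Θ' := nMul M (odd 1 i)) i (bcomp_Sx hX c f i y)

theorem compOp_mul_z (v : Fin 3 → V) (f : OT K N 3) (k l : Fin 3) :
    compOp hX v (f * zT k l) = nDlam M l k (compOp hX v f) := by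
  refine eq_of_cocycle (χ := fun k l => compOp hX v (f * zT k l))
    (ψ := fun k l => nDlam M l k (compOp hX v f)) (fun k l m => ?_) (fun k l m => ?_) ?_ ?_ k l
  · rw [← map_add, ← mul_add]
    exact congrArg (fun g => compOp hX v (f * g)) (zB_add (b := id) k l m)
  · rw [add_comm, nDlam_add_nDlam]
  · obtain ⟨n, f, rfl⟩ := (incl_isInverting K N).gen f
    refine (congrArg (compOp hX v) (incl_mul_zT f n 0 1)).trans ?_
    rw [compOp_apply, compOp_apply]
    exact bcomp_mul_z_zero_one X _ _ _
  · obtain ⟨n, f, rfl⟩ := (incl_isInverting K N).gen f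
    refine (congrArg (compOp hX v) (incl_mul_zT f n 1 2)).trans ?_
    rw [compOp_apply, compOp_apply]
    exact bcomp_mul_z_one_two hX _ _ _

theorem compOp_mul_ζ (v : Fin 3 → V) (f : OT K N 3) (k l : Fin 3) (i : Fin N) :
    compOp hX v (f * zeT k l i) = nDodd M k l i (nPar M 3 (compOp hX v f)) := by
  refine eq_of_cocycle (χ := fun k l => compOp hX v (f * zeT k l i))
    (ψ := fun k l => nDodd M k l i (nPar M 3 (compOp hX v f))) (fun k l m => ?_) (fun k l m => ?_)
    ?_ ?_ k l
  · rw [← map_add, ← mul_add]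
    exact congrArg (fun g => compOp hX v (f * g)) (zeB_add (b := id) k l m i)
  · rw [nDodd_add_nDodd]
  · obtain ⟨n, f, rfl⟩ := (incl_isInverting K N).gen f
    refine (congrArg (compOp hX v) (incl_mul_zeT f n 0 1 i)).trans ?_
    rw [compOp_apply, compOp_apply]
    exact bcomp_mul_ζ_zero_one hX _ _ i _
  · obtain ⟨n, f, rfl⟩ := (incl_isInverting K N).gen f
    refine (congrArg (compOp hX v) (incl_mul_zeT f n 1 2 i)).trans ?_
    rw [compOp_apply, compOp_apply]
    exact bcomp_mul_ζ_one_two hX _ _ i _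

theorem compOp_parity (v : Fin 3 → V) (f : OT K N 3) :
    nPar M 3 (compOp hX v f) = compOp hX (fun j => M.par (v j)) (invT f) := by
  obtain ⟨n, f, rfl⟩ := (incl_isInverting K N).gen f
  rw [invT_incl_mul, compOp_apply, compOp_apply, bcomp_nPar hX, parx_poleVal hX, map_neg, neg_neg]

theorem compOp_d_z (v : Fin 3 → V) (f : OT K N 3) (k : Fin 3) :
    compOp hX (Function.update v k (M.T (v k))) f =
      compOp hX v (dzT k f) - nMul M (lam k) (compOp hX v f) := by
  obtain ⟨n, f, rfl⟩ := (incl_isInverting K N).gen f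
  rw [dzT_incl_mul, map_add, map_smul, compOp_apply, compOp_apply, compOp_apply, compOp_apply]
  obtain rfl | rfl | rfl : k = 0 ∨ k = 1 ∨ k = 2 := by omega
  · rw [if_neg (by decide), if_pos rfl, zero_sub, mul_neg_one, neg_smul]
    refine (congrArg (bcomp M X (v 2) f) (poleVal_T_left hX n (v 0) (v 1))).trans ?_
    rw [map_sub, map_neg, map_smul, bcomp_lam]
    exact neg_sub_sub_eq _ _ _
  · rw [if_pos rfl, if_neg (by decide), sub_zero, mul_one]
    refine (congrArg (bcomp M X (v 2) f) (poleVal_T_right hX n (v 0) (v 1))).trans ?_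
    rw [map_add, map_add, map_smul]
    refine (congrArg (· + (n : K) • bcomp M X (v 2) f (poleVal X (n + 1) (v 0) (v 1)))
      (bcomp_lam_add_Tx hX (v 2) f (poleVal X n (v 0) (v 1)))).trans ?_
    exact sub_add_eq_add_sub _ _ _
  · rw [if_neg (by decide), if_neg (by decide), sub_zero, mul_zero, zero_smul, add_zero]
    exact bcomp_T_vec hX _ _ _

theorem compOp_d_ζ (v : Fin 3 → V) (f : OT K N 3) (k : Fin 3) (i : Fin N) :
    compOp hX (Function.update v k (M.S i (v k))) f =
      compOp hX (fun j => if k ≤ j then M.par (v j) else v j) (dzeT k i f) -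
        nMul M (odd k i) (compOp hX (fun j => if j < k then M.par (v j) else v j) f) := by
  obtain ⟨n, f, rfl⟩ := (incl_isInverting K N).gen f
  rw [dzeT_incl_mul, compOp_apply, compOp_apply, compOp_apply]
  obtain rfl | rfl | rfl : k = 0 ∨ k = 1 ∨ k = 2 := by omega
  · refine (congrArg (bcomp M X (v 2) f) (poleVal_S_left hX n i (v 0) (v 1))).trans ?_
    rw [bcomp_odd, parx_poleVal hX, map_neg, sub_neg_eq_add, neg_add_eq_sub]
    rfl
  · refine (congrArg (bcomp M X (v 2) f) (poleVal_S_right hX n i (v 0) (v 1))).trans ?_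
    rw [← neg_add', map_neg, map_add, bcomp_odd_add_Sx hX, parx_poleVal hX, M.par_par, map_neg,
      neg_add, neg_neg, ← sub_eq_add_neg]
    rfl
  · refine (bcomp_S_vec hX (v 2) f i _).trans ?_
    rw [parx_poleVal hX, map_neg, map_neg, ← sub_eq_add_neg]
    rfl

theorem compOp_isChiralOf : IsChiralOf M 0 (compOp hX) where
  mul_z := compOp_mul_z hX
  mul_ζ := compOp_mul_ζ hX
  d_z := compOp_d_z hX
  parity v f := (compOp_parity hX v f).trans (sgn_zero_smul _).symm
  d_ζ v f k i := (compOp_d_ζ hX v f k i).trans (congrArg (_ - ·) (sgn_zero_smul _).symm)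

theorem compOp_isCompOne : IsCompOne M (n := 1) (m := 1) 1 X X (compOp hX) := by
  intro w ε v hv f₀ f₁ hf₁
  obtain ⟨k, rfl⟩ := exists_eq_ziT_pow hf₁
  refine (congrArg (fun g => compOp hX (Fin.append w v) (incl K N f₀ * g))
    (relT_castAdd_pow k)).trans ?_
  refine (compOp_apply hX (Fin.append w v) k f₀).trans ?_
  refine (bcomp_of_mem X (hv 0) f₀ _).trans ?_
  have e : (![v 0] : Fin 1 → V) = v := by
    funext j
    obtain rfl := Subsingleton.elim j 0
    rfl
  have e' : ![w 0, w 1] = w := by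
    funext j
    fin_cases j <;> rfl
  have e'' : ∑ j, ε j = ε 0 := Fin.sum_univ_one ε
  rw [e'']
  change applyX M 1 1 X ![v 0] (gamEval M 1 1 (ε 0) f₀ (elim M 1 (X ![w 0, w 1] (ziT 0 1 ^ k)))) = _
  rw [e, e']

theorem eq_compOp {Z : Op M 3} (hZ : IsCompOne M (n := 1) (m := 1) 1 X X Z) : Z = compOp hX := by
  refine multilinear_ext_homogeneous M fun ε v hv => linear_ext_incl fun k f => ?_
  have hu : (ziT 0 1 : OT K N 2) ∈ {x : OT K N 2 | ∃ k l, k < l ∧ x = ziT k l} :=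
    ⟨0, 1, by decide, rfl⟩
  have hf : (ziT 0 1 ^ k : OT K N 2) ∈
      Submonoid.closure {x : OT K N 2 | ∃ k l, k < l ∧ x = ziT k l} :=
    Submonoid.pow_mem _ (Submonoid.subset_closure hu) k
  have h1 := hZ ![v 0, v 1] ![ε 2] ![v 2] (fun j => by
    obtain rfl := Subsingleton.elim j 0
    exact hv 2) f _ hf
  have h2 := compOp_isCompOne hX ![v 0, v 1] ![ε 2] ![v 2] (fun j => by
    obtain rfl := Subsingleton.elim j 0
    exact hv 2) f _ hf
  have e : Fin.append ![v 0, v 1] ![v 2] = v := by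
    funext j
    fin_cases j <;> rfl
  have h3 := h1.trans h2.symm
  rw [e] at h3
  refine Eq.trans ?_ (h3.trans ?_)
  · exact congrArg (fun g => Z v (incl K N f * g)) (relT_castAdd_pow k).symm
  · exact congrArg (fun g => compOp hX v (incl K N f * g)) (relT_castAdd_pow k)

theorem compOne_eq : compOne M (n := 1) (m := 1) 1 X X = compOp hX :=
  eq_compOp hX (Classical.epsilon_spec (p := IsCompOne M (n := 1) (m := 1) 1 X X)
    ⟨_, compOp_isCompOne hX⟩)

end CompositionChiral

section Crossing

variable {n : ℕ}

/-- The exponent of the sign by which `σ` acts on vectors of parities `ε`. -/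
def crossing (σ : Equiv.Perm (Fin n)) (ε : Fin n → ZMod 2) : ZMod 2 :=
  ∑ q ∈ Finset.univ.filter (fun q : Fin n × Fin n => q.1 < q.2 ∧ σ q.2 < σ q.1), ε q.1 * ε q.2

/-- The behaviour of `crossing` under a change of one parity. -/
def CrossingShift (σ : Equiv.Perm (Fin n)) : Prop :=
  ∀ (ε : Fin n → ZMod 2) (k : Fin n), crossing σ (Function.update ε k (ε k + 1)) =
    crossing σ ε + ∑ j ∈ Finset.univ.filter (k ≤ ·), ε j +
      ∑ j ∈ Finset.univ.filter (fun j => σ k ≤ σ j), ε j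

set_option maxRecDepth 10000 in
theorem crossing_mul (σ τ : Equiv.Perm (Fin 3)) (ε : Fin 3 → ZMod 2) :
    crossing (σ * τ) ε = crossing τ ε + crossing σ (fun j => ε (τ⁻¹ j)) := by
  revert σ τ ε; unfold crossing; decide +kernel

set_option maxRecDepth 10000 in
theorem crossingShift_three (σ : Equiv.Perm (Fin 3)) : CrossingShift σ := by
  revert σ; unfold CrossingShift crossing; decide +kernel

theorem crossingShift_two (σ : Equiv.Perm (Fin 2)) : CrossingShift σ := by
  revert σ; unfold CrossingShift crossing; decide +kernel

end Crossing

section Homogeneous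

variable [CharZero K] {n : ℕ} {X : Op M n} {p : ZMod 2}

theorem apply_ext_homogeneous {W : Type*} [AddCommGroup W] [Module K W]
    {F G : MultilinearMap K (fun _ : Fin n => V) W}
    (h : ∀ (ε : Fin n → ZMod 2) (v : Fin n → V), (∀ j, v j ∈ M.deg (ε j)) → F v = G v)
    (v : Fin n → V) : F v = G v :=
  congrArg (fun F : MultilinearMap K (fun _ : Fin n => V) W => F v) (multilinear_ext_homogeneous M h)

theorem update_apply_eq (A : V →ₗ[K] V) (v : Fin n → V) (k : Fin n) :
    Function.update v k (A (v k)) = fun j => (if j = k then A else LinearMap.id) (v j) := by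
  funext j
  by_cases h : j = k
  · subst h; rw [Function.update_self, if_pos rfl]
  · rw [Function.update_of_ne h, if_neg h, LinearMap.id_apply]

theorem ite_par_eq (v : Fin n → V) (P : Fin n → Prop) [DecidablePred P] :
    (fun j => if P j then M.par (v j) else v j) =
      fun j => (if P j then M.par else LinearMap.id) (v j) := by
  funext j
  split_ifs <;> rfl

variable (M p X) in
/-- The conditions of `IsChiralOf` on homogeneous vectors. -/
structure IsChiralHom : Prop where
  mul_z : ∀ (ε : Fin n → ZMod 2) v, (∀ j, v j ∈ M.deg (ε j)) → ∀ f k l,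
    X v (f * zT k l) = nDlam M l k (X v f)
  mul_ζ : ∀ (ε : Fin n → ZMod 2) v, (∀ j, v j ∈ M.deg (ε j)) → ∀ f k l i,
    X v (f * zeT k l i) = nDodd M k l i (nPar M n (X v f))
  d_z : ∀ (ε : Fin n → ZMod 2) v, (∀ j, v j ∈ M.deg (ε j)) → ∀ f k,
    X (Function.update v k (M.T (v k))) f = X v (dzT k f) - nMul M (lam k) (X v f)
  parity : ∀ (ε : Fin n → ZMod 2) v, (∀ j, v j ∈ M.deg (ε j)) → ∀ f,
    nPar M n (X v f) = sgn p • sgn (∑ j, ε j) • X v (invT f)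
  d_ζ : ∀ (ε : Fin n → ZMod 2) v, (∀ j, v j ∈ M.deg (ε j)) → ∀ f k i,
    X (Function.update v k (M.S i (v k))) f =
      sgn (∑ j ∈ Finset.univ.filter (k ≤ ·), ε j) • X v (dzeT k i f) -
        sgn p • sgn (∑ j ∈ Finset.univ.filter (· < k), ε j) • nMul M (odd k i) (X v f)

theorem IsChiralOf.isChiralHom (h : IsChiralOf M p X) : IsChiralHom M X p where
  mul_z _ v _ f k l := h.mul_z v f k l
  mul_ζ _ v _ f k l i := h.mul_ζ v f k l i
  d_z _ v _ f k := h.d_z v f k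
  parity ε v hv f := by rw [h.parity, apply_par_homogeneous_univ hv]
  d_ζ ε v hv f k i := by rw [h.d_ζ, apply_par_homogeneous hv, apply_par_homogeneous hv, map_zsmul]

theorem IsChiralHom.isChiralOf (h : IsChiralHom M X p) : IsChiralOf M p X where
  mul_z v f k l := apply_ext_homogeneous
    (F := (LinearMap.applyₗ (f * zT k l)).compMultilinearMap X)
    (G := (nDlam M l k ∘ₗ LinearMap.applyₗ f).compMultilinearMap X)
    (fun ε v hv => h.mul_z ε v hv f k l) v
  mul_ζ v f k l i := apply_ext_homogeneous
    (F := (LinearMap.applyₗ (f * zeT k l i)).compMultilinearMap X)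
    (G := (nDodd M k l i ∘ₗ nPar M n ∘ₗ LinearMap.applyₗ f).compMultilinearMap X)
    (fun ε v hv => h.mul_ζ ε v hv f k l i) v
  d_z v f k := by
    have key := apply_ext_homogeneous (M := M)
      (F := (LinearMap.applyₗ f).compMultilinearMap
        (X.compLinearMap fun j => if j = k then M.T else LinearMap.id))
      (G := (LinearMap.applyₗ (dzT k f) - nMul M (lam k) ∘ₗ LinearMap.applyₗ f).compMultilinearMap X)
      (fun ε v hv => by
        refine Eq.trans ?_ (h.d_z ε v hv f k)
        rw [update_apply_eq]
        rfl) v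
    rw [update_apply_eq]
    exact key
  parity v f := apply_ext_homogeneous
    (F := (nPar M n ∘ₗ LinearMap.applyₗ f).compMultilinearMap X)
    (G := sgn p • (LinearMap.applyₗ (invT f)).compMultilinearMap (X.compLinearMap fun _ => M.par))
    (fun ε v hv => by
      refine (h.parity ε v hv f).trans ?_
      rw [← apply_par_homogeneous_univ hv]
      rfl) v
  d_ζ v f k i := by
    have key := apply_ext_homogeneous (M := M)
      (F := (LinearMap.applyₗ f).compMultilinearMap
        (X.compLinearMap fun j => if j = k then M.S i else LinearMap.id))
      (G := (LinearMap.applyₗ (dzeT k i f)).compMultilinearMap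
          (X.compLinearMap fun j => if k ≤ j then M.par else LinearMap.id) -
        sgn p • (nMul M (odd k i) ∘ₗ LinearMap.applyₗ f).compMultilinearMap
          (X.compLinearMap fun j => if j < k then M.par else LinearMap.id))
      (fun ε v hv => by
        refine Eq.trans ?_ ((h.d_ζ ε v hv f k i).trans ?_)
        · rw [update_apply_eq]
          rfl
        · rw [← map_zsmul (nMul M (odd k i)), ← apply_par_homogeneous hv,
            ← apply_par_homogeneous hv, ite_par_eq, ite_par_eq]
          rfl) v
    rw [update_apply_eq, ite_par_eq, ite_par_eq]
    exact key

end Homogeneous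

section Action

variable [CharZero K] {n : ℕ} {X : Op M n} {p : ZMod 2}

variable (K N) in
/-- The action of a permutation on functions, `f ↦ f(Z_{σ(1)}, …, Z_{σ(n)})`. -/
def permT (σ : Equiv.Perm (Fin n)) : OT K N n →ₐ[K] OT K N n :=
  relT id id σ fun _ _ h => σ.injective.ne h

theorem perm_inv_apply {α : Type*} (σ : Equiv.Perm α) (k : α) : σ⁻¹ (σ k) = k :=
  σ.symm_apply_apply k

theorem perm_apply_inv {α : Type*} (σ : Equiv.Perm α) (k : α) : σ (σ⁻¹ k) = k :=
  σ.apply_symm_apply k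

theorem act_apply (σ : Equiv.Perm (Fin n)) {ε : Fin n → ZMod 2} {v : Fin n → V}
    (hv : ∀ j, v j ∈ M.deg (ε j)) (f : OT K N n) : act M σ X v f =
      sgn (crossing σ ε) • nSubst M σ (X (fun j => v (σ⁻¹ j)) (permT K N σ f)) := by
  have key : ∀ δ : Fin n → ZMod 2, X (fun j => M.proj (δ (σ⁻¹ j)) (v (σ⁻¹ j))) =
      if δ = ε then X (fun j => v (σ⁻¹ j)) else 0 := fun δ => by
    split_ifs with h
    · subst h
      exact congrArg X (funext fun j => M.proj_of_mem (hv _))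
    · obtain ⟨k, hk⟩ := Function.ne_iff.mp h
      refine X.map_coord_zero (σ k) ?_
      rw [perm_inv_apply]
      refine M.proj_of_mem_add_one ?_
      obtain h' | h' := zmod_two_cases (δ k) (ε k)
      · exact absurd h'.symm hk
      · rw [← h']; exact hv k
  have h1 : act M σ X v f = ∑ δ : Fin n → ZMod 2, sgn (crossing σ δ) •
      nSubst M σ (X (fun j => M.proj (δ (σ⁻¹ j)) (v (σ⁻¹ j))) (permT K N σ f)) := by
    rw [act, _root_.sum_apply, LinearMap.sum_apply]
    rfl
  rw [h1, Finset.sum_eq_single ε]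
  · rw [key, if_pos rfl]
  · intro δ _ hδ
    rw [key, if_neg hδ, LinearMap.zero_apply, map_zero, zsmul_zero]
  · simp

theorem permT_zT (σ : Equiv.Perm (Fin n)) (k l : Fin n) :
    permT K N σ (zT k l) = zT (σ k) (σ l) := relT_zB (b := id) (b' := id) (c := σ) _ k l

theorem permT_zeT (σ : Equiv.Perm (Fin n)) (k l : Fin n) (i : Fin N) :
    permT K N σ (zeT k l i) = zeT (σ k) (σ l) i := relT_zeB (b := id) (b' := id) (c := σ) _ k l i

theorem permT_ziT (σ : Equiv.Perm (Fin n)) (k l : Fin n) :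
    permT K N σ (ziT k l) = ziT (σ k) (σ l) := by
  by_cases h : k ≠ l
  · rw [ziT_of_ne h, ziT_of_ne (σ.injective.ne h)]
    exact relT_ziB (b := id) (b' := id) (c := σ) _ h
  · rw [ziT, dif_neg h, map_zero, ziT, dif_neg (by simpa using h)]

theorem permT_permT (σ τ : Equiv.Perm (Fin n)) (f : OT K N n) :
    permT K N σ (permT K N τ f) = permT K N (σ * τ) f :=
  relT_relT (b := id) (b' := id) (b'' := id) (c := τ) (c' := σ) _ _ f

theorem permT_one (f : OT K N n) : permT K N 1 f = f := relT_id (b := id) f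

theorem filter_perm_eq (σ : Equiv.Perm (Fin n)) (j : Fin n) :
    Finset.univ.filter (fun k => σ k = σ j) = {j} := by ext k; simp

theorem dzT_permT (σ : Equiv.Perm (Fin n)) (k : Fin n) (f : OT K N n) :
    dzT (σ k) (permT K N σ f) = permT K N σ (dzT k f) :=
  (dzT_relT (b := id) (b' := id) (c := σ) _ (σ k) f).trans
    ((congrArg (fun s => ∑ j ∈ s, permT K N σ (dzT j f)) (filter_perm_eq σ k)).trans
      (Finset.sum_singleton _ _))

theorem dzeT_permT (σ : Equiv.Perm (Fin n)) (k : Fin n) (i : Fin N) (f : OT K N n) :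
    dzeT (σ k) i (permT K N σ f) = permT K N σ (dzeT k i f) :=
  (dzeT_relT (b := id) (b' := id) (c := σ) _ (σ k) i f).trans
    ((congrArg (fun s => ∑ j ∈ s, permT K N σ (dzeT j i f)) (filter_perm_eq σ k)).trans
      (Finset.sum_singleton _ _))

theorem update_perm (σ : Equiv.Perm (Fin n)) {A : Type*} (v : Fin n → A) (k : Fin n) (x : A) :
    (fun j => Function.update v k x (σ⁻¹ j)) = Function.update (fun j => v (σ⁻¹ j)) (σ k) x := by
  funext j
  by_cases h : j = σ k
  · subst h; simp
  · rw [Function.update_of_ne h, Function.update_of_ne]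
    intro e
    exact h (by rw [← e, perm_apply_inv])

theorem sum_perm_filter (σ : Equiv.Perm (Fin n)) (ε : Fin n → ZMod 2) (P : Fin n → Prop)
    [DecidablePred P] : ∑ j ∈ Finset.univ.filter P, ε (σ⁻¹ j) =
      ∑ j ∈ Finset.univ.filter (fun j => P (σ j)), ε j := by
  refine (Finset.sum_nbij' (fun j => σ j) (fun j => σ⁻¹ j) ?_ ?_ ?_ ?_ ?_).symm <;> simp

theorem zsmul_sub_zsmul_eq {E : Type*} [AddCommGroup E] {s t r q d p : ZMod 2} (h : q + r = d + t)
    (x y : E) : sgn (s + t + r) • (sgn r • x - sgn p • sgn q • y) =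
      sgn t • sgn s • x - sgn p • sgn d • sgn s • y := by
  have h1 : sgn (s + t + r) * sgn r = sgn t * sgn s := by clear h; revert s t r; decide
  have h2 : sgn (s + t + r) * sgn p * sgn q = sgn p * sgn d * sgn s := by revert s t r q d p; decide
  rw [zsmul_sub, smul_smul, smul_smul, smul_smul, smul_smul, smul_smul, smul_smul, h1, h2]

theorem sum_filter_lt_add (ε : Fin n → ZMod 2) (σ : Equiv.Perm (Fin n)) (k : Fin n) :
    ∑ j ∈ Finset.univ.filter (fun j => σ j < σ k), ε j +
      ∑ j ∈ Finset.univ.filter (fun j => σ k ≤ σ j), ε j =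
    ∑ j ∈ Finset.univ.filter (· < k), ε j + ∑ j ∈ Finset.univ.filter (k ≤ ·), ε j := by
  have h1 := Finset.sum_filter_add_sum_filter_not Finset.univ (fun j => σ j < σ k) ε
  simp only [not_lt] at h1
  rw [h1, sum_lt_add_sum_le]

theorem mem_update {ε : Fin n → ZMod 2} {v : Fin n → V} (hv : ∀ j, v j ∈ M.deg (ε j)) (k : Fin n)
    {x : V} {q : ZMod 2} (hx : x ∈ M.deg q) (j : Fin n) :
    Function.update v k x j ∈ M.deg (Function.update ε k q j) := by
  by_cases h : j = k
  · subst h; rwa [Function.update_self, Function.update_self]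
  · rw [Function.update_of_ne h, Function.update_of_ne h]; exact hv j

theorem act_isChiralOf (hX : IsChiralOf M p X) {σ : Equiv.Perm (Fin n)} (hσ : CrossingShift σ) :
    IsChiralOf M p (act M σ X) := by
  have hX' := hX.isChiralHom
  refine IsChiralHom.isChiralOf ⟨fun ε v hv f k l => ?_, fun ε v hv f k l i => ?_,
    fun ε v hv f k => ?_, fun ε v hv f => ?_, fun ε v hv f k i => ?_⟩
  · rw [act_apply σ hv, act_apply σ hv, map_mul, permT_zT, hX.mul_z, map_zsmul, nDlam_nSubst]
  · rw [act_apply σ hv, act_apply σ hv, map_mul, permT_zeT, hX.mul_ζ, map_zsmul, map_zsmul,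
      ← nSubst_nPar, nDodd_nSubst]
  · have hv' := mem_update hv k (M.T_mem _ _ (hv k))
    rw [Function.update_eq_self] at hv'
    have e := hX.d_z (fun j => v (σ⁻¹ j)) (permT K N σ f) (σ k)
    rw [perm_inv_apply, ← update_perm, dzT_permT] at e
    rw [act_apply σ hv', act_apply σ hv, act_apply σ hv, map_zsmul, e, map_sub, zsmul_sub,
      nSubst_perm_lam]
  · have e := hX'.parity (fun j => ε (σ⁻¹ j)) (fun j => v (σ⁻¹ j)) (fun j => hv _) (permT K N σ f)
    have e' : invT (permT K N σ f) = permT K N σ (invT f) := invT_relT _ f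
    rw [Equiv.sum_comp σ⁻¹ ε, e'] at e
    rw [act_apply σ hv, act_apply σ hv, map_zsmul, ← nSubst_nPar, e, map_zsmul, map_zsmul,
      smul_comm (sgn (crossing σ ε)), smul_comm (sgn (crossing σ ε))]
  · have hv' := mem_update hv k (M.S_mem i _ _ (hv k))
    have e := hX'.d_ζ (fun j => ε (σ⁻¹ j)) (fun j => v (σ⁻¹ j)) (fun j => hv _) (permT K N σ f)
      (σ k) i
    rw [perm_inv_apply, ← update_perm, dzeT_permT, sum_perm_filter, sum_perm_filter] at e
    rw [act_apply σ hv', act_apply σ hv, act_apply σ hv, map_zsmul, e, map_sub, map_zsmul,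
      map_zsmul, map_zsmul, nSubst_perm_odd, hσ ε k]
    exact zsmul_sub_zsmul_eq (sum_filter_lt_add ε σ k) _ _

theorem op_ext_homogeneous {X Y : Op M n}
    (h : ∀ (ε : Fin n → ZMod 2) (v : Fin n → V), (∀ j, v j ∈ M.deg (ε j)) → ∀ f, X v f = Y v f) :
    X = Y :=
  multilinear_ext_homogeneous M fun ε v hv => LinearMap.ext fun f => h ε v hv f

theorem act_add (σ : Equiv.Perm (Fin n)) (X Y : Op M n) : act M σ (X + Y) = act M σ X + act M σ Y :=
  op_ext_homogeneous fun ε v hv f => by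
    rw [_root_.add_apply, LinearMap.add_apply, act_apply σ hv, act_apply σ hv,
      act_apply σ hv, _root_.add_apply, LinearMap.add_apply, map_add, zsmul_add]

theorem act_one (X : Op M n) : act M 1 X = X :=
  op_ext_homogeneous fun ε v hv f => by
    have h : crossing (1 : Equiv.Perm (Fin n)) ε = 0 := by
      refine Finset.sum_eq_zero fun q hq => ?_
      rw [Finset.mem_filter] at hq
      exact absurd hq.2.1 hq.2.2.le.not_gt
    rw [act_apply 1 hv, h, sgn_zero_smul, permT_one]
    exact nSubst_id _

theorem act_act (σ τ : Equiv.Perm (Fin 3)) (X : Op M 3) : act M τ (act M σ X) = act M (σ * τ) X :=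
  op_ext_homogeneous fun ε v hv f => by
    rw [act_apply τ hv, act_apply σ (ε := fun j => ε (τ⁻¹ j)) fun j => hv _, act_apply (σ * τ) hv,
      map_zsmul, smul_smul, ← sgn_add, crossing_mul, permT_permT]
    exact congrArg (sgn _ • ·) (nSubst_nSubst σ τ _)

theorem IsChiralOf.add {Y : Op M n} (hX : IsChiralOf M p X) (hY : IsChiralOf M p Y) :
    IsChiralOf M p (X + Y) where
  mul_z v f k l := by simp only [_root_.add_apply, LinearMap.add_apply, hX.mul_z, hY.mul_z, map_add]
  mul_ζ v f k l i := by
    simp only [_root_.add_apply, LinearMap.add_apply, hX.mul_ζ, hY.mul_ζ, map_add]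
  d_z v f k := by
    simp only [_root_.add_apply, LinearMap.add_apply, hX.d_z, hY.d_z, map_add]
    abel
  parity v f := by
    simp only [_root_.add_apply, LinearMap.add_apply, hX.parity, hY.parity, map_add,
      zsmul_add]
  d_ζ v f k i := by
    simp only [_root_.add_apply, LinearMap.add_apply, hX.d_ζ, hY.d_ζ, map_add, zsmul_add]
    abel

theorem IsChiralOf.neg (hX : IsChiralOf M p X) : IsChiralOf M p (-X) where
  mul_z v f k l := by simp only [_root_.neg_apply, LinearMap.neg_apply, hX.mul_z, map_neg]
  mul_ζ v f k l i := by simp only [_root_.neg_apply, LinearMap.neg_apply, hX.mul_ζ, map_neg]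
  d_z v f k := by
    simp only [_root_.neg_apply, LinearMap.neg_apply, hX.d_z, map_neg]
    abel
  parity v f := by simp only [_root_.neg_apply, LinearMap.neg_apply, hX.parity, map_neg, zsmul_neg]
  d_ζ v f k i := by
    simp only [_root_.neg_apply, LinearMap.neg_apply, hX.d_ζ, map_neg, zsmul_neg]
    abel

end Action

section Box

variable [CharZero K] {X : Op M 2}

theorem mem_pair {p q : ZMod 2} {a b : V} (ha : a ∈ M.deg p) (hb : b ∈ M.deg q) (j : Fin 2) :
    ![a, b] j ∈ M.deg (![p, q] j) := by
  fin_cases j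
  exacts [ha, hb]

theorem mem_triple {p q r : ZMod 2} {a b c : V} (ha : a ∈ M.deg p) (hb : b ∈ M.deg q)
    (hc : c ∈ M.deg r) (j : Fin 3) : ![a, b, c] j ∈ M.deg (![p, q, r] j) := by
  fin_cases j
  exacts [ha, hb, hc]

theorem act_swap_apply {p q : ZMod 2} {a b : V} (ha : a ∈ M.deg p) (hb : b ∈ M.deg q)
    (f : OT K N 2) : act M (Equiv.swap 0 1) X ![a, b] f =
      sgn (p * q) • nSubst M (Equiv.swap (0 : Fin 2) 1)
        (X ![b, a] (permT K N (Equiv.swap 0 1) f)) := by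
  rw [act_apply _ (mem_pair ha hb)]
  have e1 : crossing (Equiv.swap 0 1) ![p, q] = p * q := by
    clear ha hb; revert p q; unfold crossing; decide
  have e2 : (fun j => ![a, b] ((Equiv.swap (0 : Fin 2) 1)⁻¹ j)) = ![b, a] := by
    funext j
    fin_cases j <;> rfl
  rw [e1, e2]

theorem permT_swap_pow {n : ℕ} (k l : Fin n) (j : ℕ) :
    permT K N (Equiv.swap k l) (ziT k l ^ j) = (-1 : K) ^ j • ziT k l ^ j := by
  rw [map_pow, permT_ziT, Equiv.swap_apply_left, Equiv.swap_apply_right, ziT_swap, ← smul_pow,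
    neg_one_smul]

theorem poleVal_act_swap {p q : ZMod 2} {a b : V} (ha : a ∈ M.deg p) (hb : b ∈ M.deg q) (k : ℕ) :
    poleVal (act M (Equiv.swap 0 1) X) k a b =
      sgn (p * q) • (-1 : K) ^ k • negNabla M (poleVal X k b a) := by
  rw [poleVal, act_swap_apply ha hb, map_zsmul, elim_nSubst_swap, permT_swap_pow, map_smul,
    map_smul, map_smul]
  rfl

theorem poleVal_swap (hs : act M (Equiv.swap 0 1) X = X) {p q : ZMod 2} {a b : V}
    (ha : a ∈ M.deg p) (hb : b ∈ M.deg q) (k : ℕ) : poleVal X k a b =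
      sgn (p * q) • (-1 : K) ^ k • negNabla M (poleVal X k b a) :=
  (congrArg (poleVal · k a b) hs.symm).trans (poleVal_act_swap ha hb k)

theorem permT_incl (f : OBT K N (block 1 1)) :
    permT K N (Equiv.swap (0 : Fin 3) 1) (incl K N f) = incl K N (flipB K N f) := by
  refine (relT_relT (b := block 1 1) (b' := id) (b'' := id) (c := id)
    (c' := Equiv.swap (0 : Fin 3) 1) _ _ f).trans (Eq.trans ?_ (relT_relT (b := block 1 1)
    (b' := block 1 1) (b'' := id) (c := Equiv.swap (0 : Fin 3) 1) (c' := id) _ _ f).symm)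
  rfl

theorem act_compOp (hX : IsChiralOf M 1 X) (hs : act M (Equiv.swap 0 1) X = X) :
    act M (Equiv.swap 0 1) (compOp hX) = compOp hX :=
  multilinear_ext_homogeneous M fun ε v hv => linear_ext_incl fun k f => by
    rw [act_apply _ hv]
    have e1 : crossing (Equiv.swap 0 1) ε = ε 0 * ε 1 := by
      clear hv; revert ε; unfold crossing; decide
    have e2 : permT K N (Equiv.swap (0 : Fin 3) 1) (incl K N f * ziT 0 1 ^ k) =
        (-1 : K) ^ k • (incl K N (flipB K N f) * ziT 0 1 ^ k) := by
      rw [map_mul, permT_swap_pow, permT_incl]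
      exact mul_smul_comm _ _ _
    rw [e1, e2, map_smul, map_smul, compOp_apply, compOp_apply]
    refine (congrArg (fun w => sgn (ε 0 * ε 1) • (-1 : K) ^ k • w)
      (bcomp_flip hX (v 2) f (poleVal X k (v 1) (v 0)))).trans ?_
    rw [poleVal_swap hs (hv 0) (hv 1) k, map_zsmul, map_smul]

theorem shuffles_two_one : shuffles 2 1 =
    {1, Equiv.swap (1 : Fin 3) 2, Equiv.swap (0 : Fin 3) 1 * Equiv.swap (1 : Fin 3) 2} := by
  unfold shuffles
  decide +kernel

/-- `X □ X` for a symmetric odd operation `X`. -/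
def boxOp (hX : IsChiralOf M 1 X) : Op M 3 :=
  compOp hX + act M (Equiv.swap 1 2) (compOp hX) +
    act M (Equiv.swap 1 2 * Equiv.swap 0 1) (compOp hX)

theorem box_eq (hX : IsChiralOf M 1 X) : box M (n := 1) (m := 1) 1 X X = boxOp hX := by
  have e : box M (n := 1) (m := 1) 1 X X = ∑ σ ∈ shuffles 2 1, act M (n := 3) σ⁻¹ (compOp hX) := by
    rw [box, compOne_eq hX]
  rw [e, shuffles_two_one, Finset.sum_insert (by decide), Finset.sum_insert (by decide),
    Finset.sum_singleton, inv_one, act_one, ← add_assoc, mul_inv_rev, Equiv.swap_inv,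
    Equiv.swap_inv]
  rfl

theorem boxOp_isChiralOf (hX : IsChiralOf M 1 X) : IsChiralOf M 0 (boxOp hX) :=
  ((compOp_isChiralOf hX).add (act_isChiralOf (compOp_isChiralOf hX) (crossingShift_three _))).add
    (act_isChiralOf (compOp_isChiralOf hX) (crossingShift_three _))

theorem act_swap_zero_one_boxOp (hX : IsChiralOf M 1 X) (hs : act M (Equiv.swap 0 1) X = X) :
    act M (Equiv.swap 0 1) (boxOp hX) = boxOp hX := by
  rw [boxOp, act_add, act_add, act_compOp hX hs, act_act, act_act, mul_assoc, Equiv.swap_mul_self,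
    mul_one]
  exact add_right_comm _ _ _

theorem act_swap_one_two_boxOp (hX : IsChiralOf M 1 X) (hs : act M (Equiv.swap 0 1) X = X) :
    act M (Equiv.swap 1 2) (boxOp hX) = boxOp hX := by
  have e : Equiv.swap (1 : Fin 3) 2 * Equiv.swap 0 1 * Equiv.swap 1 2 =
      Equiv.swap 0 1 * (Equiv.swap 1 2 * Equiv.swap 0 1) := by decide
  rw [boxOp, act_add, act_add, act_act, act_act, Equiv.swap_mul_self, act_one, e, ← act_act,
    act_compOp hX hs]
  exact congrArg (· + _) (add_comm _ _)

end Box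

section Abstract

variable {P : Type*} [Ring P] [Module K P] {A : Submodule K P} {a b c : P}

theorem mem_of_partial_fractions (hab : Commute a b) (hac : Commute a c) (hbc : Commute b c)
    (h : a * b = c * (a + b)) (h1 : ∀ j k, b ^ j * c ^ k ∈ A) (h2 : ∀ i k, a ^ i * c ^ k ∈ A)
    (i j k : ℕ) : a ^ i * b ^ j * c ^ k ∈ A := by
  induction hs : i + j generalizing i j k with
  | zero =>
    obtain ⟨rfl, rfl⟩ : i = 0 ∧ j = 0 := by omega
    simpa using h1 0 k
  | succ s ih =>
    obtain _ | i := i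
    · simpa using h1 j k
    obtain _ | j := j
    · simpa using h2 (i + 1) k
    have e : a ^ (i + 1) * b ^ (j + 1) * c ^ k =
        a ^ (i + 1) * b ^ j * c ^ (k + 1) + a ^ i * b ^ (j + 1) * c ^ (k + 1) := by
      have e1 : a ^ (i + 1) * b ^ (j + 1) = a ^ i * b ^ j * (a * b) := by
        rw [pow_succ, pow_succ, mul_assoc, mul_assoc, ← mul_assoc a, ← mul_assoc (b ^ j),
          (hab.pow_right j).eq]
      have e2 : a ^ i * b ^ j * a = a ^ (i + 1) * b ^ j := by
        rw [mul_assoc, (hab.symm.pow_left j).eq, ← mul_assoc, pow_succ]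
      rw [e1, h, (hac.symm.add_right hbc.symm).eq, mul_assoc, mul_assoc (a + b), ← pow_succ',
        ← mul_assoc, mul_add, add_mul, e2, mul_assoc (a ^ i) (b ^ j) b, ← pow_succ]
    rw [e]
    exact A.add_mem (ih _ _ _ (by omega)) (ih _ _ _ (by omega))

theorem eq_pow_of_mem_closure {S : Set P} (hS : ∀ x ∈ S, x = a ∨ x = -a) {u : P}
    (hu : u ∈ Submonoid.closure S) : ∃ k : ℕ, u = a ^ k ∨ u = -a ^ k := by
  induction hu using Submonoid.closure_induction with
  | mem x hx => exact ⟨1, by simpa using hS x hx⟩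
  | one => exact ⟨0, by simp⟩
  | mul x y _ _ hx hy =>
    obtain ⟨k, hk⟩ := hx
    obtain ⟨l, hl⟩ := hy
    refine ⟨k + l, ?_⟩
    obtain rfl | rfl := hk <;> obtain rfl | rfl := hl <;> simp [pow_add]

theorem eq_pow_mul_pow_of_mem_closure {S : Set P} (hab : Commute a b) (hac : Commute a c)
    (hbc : Commute b c) (hS : ∀ x ∈ S, (x = a ∨ x = -a) ∨ (x = b ∨ x = -b) ∨ x = c ∨ x = -c)
    {u : P} (hu : u ∈ Submonoid.closure S) :
    ∃ i j k : ℕ, u = a ^ i * b ^ j * c ^ k ∨ u = -(a ^ i * b ^ j * c ^ k) := by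
  induction hu using Submonoid.closure_induction with
  | mem x hx =>
    obtain h | h | h := hS x hx
    · exact ⟨1, 0, 0, by simpa using h⟩
    · exact ⟨0, 1, 0, by simpa using h⟩
    · exact ⟨0, 0, 1, by simpa using h⟩
  | one => exact ⟨0, 0, 0, by simp⟩
  | mul x y _ _ hx hy =>
    obtain ⟨i, j, k, hk⟩ := hx
    obtain ⟨i', j', k', hl⟩ := hy
    have e : a ^ i * b ^ j * c ^ k * (a ^ i' * b ^ j' * c ^ k') =
        a ^ (i + i') * b ^ (j + j') * c ^ (k + k') := by
      rw [mul_assoc (a ^ i * b ^ j), ← mul_assoc (c ^ k),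
        (((hac.pow_pow i' k).symm).mul_right (hbc.pow_pow j' k).symm).eq, mul_assoc _ (c ^ k),
        ← pow_add, ← mul_assoc, mul_assoc (a ^ i), ← mul_assoc (b ^ j),
        (hab.pow_pow i' j).symm.eq, mul_assoc (a ^ i'), ← pow_add, ← mul_assoc, ← pow_add]
    refine ⟨i + i', j + j', k + k', ?_⟩
    obtain rfl | rfl := hk <;> obtain rfl | rfl := hl <;>
      simp only [neg_mul, mul_neg, neg_neg, e, true_or, or_true]

end Abstract

section Abstract

variable [CharZero K] {P : Type*} [Ring P] [Algebra K P] {A : Submodule K P} {a b : P}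

theorem pow_mul_mem {D : P →ₗ[K] P} (hA : ∀ f ∈ A, D f ∈ A)
    (hD : ∀ x y, D (x * y) = D x * y + x * D y) {e : K} (he : e ≠ 0) (ha : D a = e • (a * a))
    {x : P} (hx : D x = 0) (h0 : x ∈ A) (h1 : a * x ∈ A) (k : ℕ) : a ^ k * x ∈ A := by
  have hD1 : D 1 = 0 := by simpa using hD 1 1
  obtain _ | k := k
  · simpa using h0
  induction k with
  | zero => simpa using h1
  | succ k ih =>
    have h := hA _ ih
    rw [hD, hx, mul_zero, add_zero, pow_leibniz D hD hD1 e ha, smul_mul_assoc] at h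
    have hne : ((k + 1 : ℕ) : K) * e ≠ 0 :=
      mul_ne_zero (Nat.cast_ne_zero.mpr (Nat.succ_ne_zero k)) he
    have h' := A.smul_mem (((k + 1 : ℕ) : K) * e)⁻¹ h
    rwa [inv_smul_smul₀ hne] at h'

theorem pow_mul_pow_mem {D D' : P →ₗ[K] P} (hA : ∀ f ∈ A, D f ∈ A) (hA' : ∀ f ∈ A, D' f ∈ A)
    (hD : ∀ x y, D (x * y) = D x * y + x * D y) (hD' : ∀ x y, D' (x * y) = D' x * y + x * D' y)
    {e e' : K} (he : e ≠ 0) (he' : e' ≠ 0) (ha : D a = e • (a * a)) (hb : D' b = e' • (b * b))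
    (hab : Commute a b) (ha' : D' a = 0) (hb' : D b = 0) (h1 : (1 : P) ∈ A) (h2 : a ∈ A)
    (h3 : b ∈ A) (h4 : a * b ∈ A) (i j : ℕ) : a ^ i * b ^ j ∈ A := by
  have hD1 : D 1 = 0 := by simpa using hD 1 1
  have hD1' : D' 1 = 0 := by simpa using hD' 1 1
  have c1 : b ^ j ∈ A := by simpa using pow_mul_mem hA' hD' he' hb hD1' h1 (by simpa using h3) j
  have c2 : a * b ^ j ∈ A := by
    rw [(hab.pow_right j).eq]
    exact pow_mul_mem hA' hD' he' hb ha' h2 (by rwa [← hab.eq]) j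
  have hb0 : D (b ^ j) = 0 := by
    rw [pow_leibniz D hD hD1 (0 : K) (by rw [hb', zero_smul]), mul_zero, zero_smul]
  exact pow_mul_mem hA hD he ha hb0 c1 c2 i

end Abstract

section Ann

theorem neg_sgn_smul_neg_sgn_smul {E : Type*} [AddCommGroup E] (p : ZMod 2) (x : E) :
    (-sgn p) • -(sgn p • x) = x := by
  rw [neg_smul, smul_neg, neg_neg, sgn_smul_sgn_smul]

variable [CharZero K] {n : ℕ} {X : Op M n} {p : ZMod 2}

variable (X) in
/-- The functions on which an operation vanishes for all vectors. -/
def ann : Submodule K (OT K N n) := ⨅ v, LinearMap.ker (X v)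

theorem mem_ann {f : OT K N n} : f ∈ ann X ↔ ∀ v, X v f = 0 := by simp [ann, Submodule.mem_iInf]

theorem mul_z_mem_ann (hX : IsChiralOf M p X) {f : OT K N n} (hf : f ∈ ann X) (k l : Fin n) :
    f * zT k l ∈ ann X :=
  mem_ann.mpr fun v => (hX.mul_z v f k l).trans
    ((congrArg (nDlam M l k) (mem_ann.mp hf v)).trans (map_zero _))

theorem mul_ζ_mem_ann (hX : IsChiralOf M p X) {f : OT K N n} (hf : f ∈ ann X) (k l : Fin n)
    (i : Fin N) : f * zeT k l i ∈ ann X :=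
  mem_ann.mpr fun v => (hX.mul_ζ v f k l i).trans
    ((congrArg (fun x => nDodd M k l i (nPar M n x)) (mem_ann.mp hf v)).trans
      ((congrArg (nDodd M k l i) (map_zero _)).trans (map_zero _)))

theorem dzT_mem_ann (hX : IsChiralOf M p X) {f : OT K N n} (hf : f ∈ ann X) (k : Fin n) :
    dzT k f ∈ ann X :=
  mem_ann.mpr fun v => by
    have h := hX.d_z v f k
    rw [mem_ann.mp hf, mem_ann.mp hf, map_zero, sub_zero] at h
    exact h.symm

theorem mem_ann_of_permT {σ : Equiv.Perm (Fin n)} (hσ : act M σ X = X) {f : OT K N n}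
    (hf : permT K N σ f ∈ ann X) : f ∈ ann X := by
  rw [mem_ann]
  intro v
  have h : (LinearMap.applyₗ f).compMultilinearMap X = 0 :=
    multilinear_ext_homogeneous M fun ε v hv => by
      have h1 : act M σ X v f = 0 := by rw [act_apply σ hv f, mem_ann.mp hf, map_zero, zsmul_zero]
      rw [hσ] at h1
      exact h1
  exact DFunLike.congr_fun h v

theorem permT_swap_mem_ann {k l : Fin n} (hσ : act M (Equiv.swap k l) X = X) {f : OT K N n}
    (hf : f ∈ ann X) : permT K N (Equiv.swap k l) f ∈ ann X := by
  refine mem_ann_of_permT hσ ?_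
  rw [permT_permT, Equiv.swap_mul_self, permT_one]
  exact hf

theorem eq_zero_of_poles (hX : IsChiralOf M p X) (h : ∀ u ∈ poleMonoid K N n, u ∈ ann X) :
    X = 0 := by
  refine MultilinearMap.ext fun v => LinearMap.ext fun f => ?_
  exact mem_ann.mp (mem_of_poles (fun f hf k l => mul_z_mem_ann hX hf k l)
    (fun f hf k l i => mul_ζ_mem_ann hX hf k l i) h f) v

theorem nMul_odd_apply (hX : IsChiralOf M p X) {f : OT K N n} {k : Fin n} {i : Fin N}
    (hf : dzeT k i f = 0) (v : Fin n → V) : ∃ (s : ℤ) (w : Fin n → V),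
      nMul M (odd k i) (X v f) = s • X w f := by
  have h := hX.d_ζ (fun j => if j < k then M.par (v j) else v j) f k i
  have e : (fun j => if j < k then M.par (if j < k then M.par (v j) else v j)
      else if j < k then M.par (v j) else v j) = v := by
    funext j
    split_ifs
    · exact M.par_par _
    · rfl
  rw [hf, map_zero, zero_sub, e] at h
  exact ⟨-sgn p, _, (neg_sgn_smul_neg_sgn_smul p _).symm.trans
    (congrArg (fun y => (-sgn p : ℤ) • y) h.symm)⟩

variable (M) in
/-- The multiples of the values at a given function, after elimination of the last variable. -/
def elimVals (X : Op M (n + 1)) (f : OT K N (n + 1)) : Set (VPoly K N V n) :=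
  {x | ∃ (s : ℤ) (v : Fin (n + 1) → V), x = s • elim M n (X v f)}

theorem lmul_odd_mem_elimVals {X : Op M (n + 1)} (hX : IsChiralOf M p X) {f : OT K N (n + 1)}
    (hf : ∀ k i, dzeT k i f = 0) (k : Fin n) {x : VPoly K N V n} (hx : x ∈ elimVals M X f)
    (i : Fin N) : lmul (odd k i) x ∈ elimVals M X f := by
  obtain ⟨s, v, rfl⟩ := hx
  obtain ⟨s', w, e⟩ := nMul_odd_apply hX (hf k.castSucc i) v
  refine ⟨s * s', w, ?_⟩
  rw [map_zsmul, ← elim_odd_castSucc, e, map_zsmul, mul_smul]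

theorem Dlam_elim_apply {X : Op M (n + 1)} (hX : IsChiralOf M p X) {f : OT K N (n + 1)}
    (k : Fin n) (hf : f * zT (Fin.last n) k.castSucc ∈ ann X) {x : VPoly K N V n}
    (hx : x ∈ elimVals M X f) : Dlam k x = 0 := by
  obtain ⟨s, v, rfl⟩ := hx
  rw [map_zsmul, ← elim_nDlam, ← hX.mul_z, mem_ann.mp hf, map_zero, zsmul_zero]

theorem mem_ann_of_elimVals {X : Op M (n + 1)} {f : OT K N (n + 1)}
    (h : ∀ x ∈ elimVals M X f, x = 0) : f ∈ ann X :=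
  mem_ann.mpr fun v => elim_injective ((h _ ⟨1, v, (one_smul _ _).symm⟩).trans (map_zero _).symm)

end Ann

section Two

variable [CharZero K] {p : ZMod 2}

theorem dzT_ziT_zero {n : ℕ} {k l : Fin n} (h : k ≠ l) :
    dzT k (ziT k l : OT K N n) = (-1 : K) • (ziT k l * ziT k l) := by
  have e := dzT_ziT_pow (K := K) (N := N) h k 1
  rw [if_neg h.symm, if_pos rfl, Nat.cast_one, one_mul, zero_sub] at e
  rw [← pow_one (ziT k l), e, pow_one, pow_succ, pow_one]

theorem dzT_ziT_one {n : ℕ} {k l : Fin n} (h : k ≠ l) :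
    dzT l (ziT k l : OT K N n) = (1 : K) • (ziT k l * ziT k l) := by
  have e := dzT_ziT_pow (K := K) (N := N) h l 1
  rw [if_neg h, if_pos rfl, Nat.cast_one, one_mul, sub_zero] at e
  rw [← pow_one (ziT k l), e, pow_one, pow_succ, pow_one]

theorem dzT_ziT_of_ne {n : ℕ} {j k l : Fin n} (h : k ≠ l) (hj : k ≠ j) (hj' : l ≠ j) :
    dzT j (ziT k l : OT K N n) = 0 := by
  have e := dzT_ziT_pow (K := K) (N := N) h j 1
  rw [if_neg hj, if_neg hj', sub_zero, mul_zero, zero_smul, pow_one] at e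
  exact e

theorem dzeT_ziT {n : ℕ} {k l : Fin n} (h : k ≠ l) (j : Fin n) (i : Fin N) :
    dzeT j i (ziT k l : OT K N n) = 0 := by
  have e := dzeT_ziT_pow (K := K) h j i 1
  rwa [pow_one] at e

theorem ziT_mul_zT_swap {n : ℕ} {k l : Fin n} (h : k ≠ l) : (ziT k l * zT l k : OT K N n) = -1 := by
  rw [zT_eq, zB_swap, mul_neg, ← zT_eq, ziT_mul_zT h]

theorem mul_mem_of_eq_neg {P : Type*} [Ring P] [Module K P] {A : Submodule K P} {x y z : P}
    (h : x * y = -z) (hz : z ∈ A) : x * y ∈ A := h ▸ A.neg_mem hz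

theorem ziT_mem_ann_two {X : Op M 2} (hX : IsChiralOf M p X) (h0 : (1 : OT K N 2) ∈ ann X)
    (h1 : ∀ v, resInv (elim M 1 (X v (ziT 0 1))) = 0) : (ziT 0 1 : OT K N 2) ∈ ann X := by
  refine mem_ann_of_elimVals (X := X) (eq_zero_of_cstV_Dtop
    (fun x hx i => lmul_odd_mem_elimVals hX (fun k i => dzeT_ziT (by decide) k i) 0 hx i)
    (fun x hx => Dlam_elim_apply hX (f := ziT 0 1) 0
      (mul_mem_of_eq_neg (P := OT K N 2) (ziT_mul_zT_swap (by decide)) h0) hx) ?_)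
  rintro x ⟨s, v, rfl⟩
  rw [map_zsmul, map_zsmul, ← resInv_eq, h1, zsmul_zero]

theorem pow_mem_ann_two {X : Op M 2} (hX : IsChiralOf M p X) (h0 : (1 : OT K N 2) ∈ ann X)
    (h1 : (ziT 0 1 : OT K N 2) ∈ ann X) (k : ℕ) : (ziT 0 1 ^ k * 1 : OT K N 2) ∈ ann X :=
  pow_mul_mem (P := OT K N 2) (A := ann X) (D := dzT 0) (fun f hf => dzT_mem_ann hX hf 0)
    (dzT_mul (K := K) (N := N) (b := (id : Fin 2 → Fin 2)) 0)
    (neg_ne_zero.mpr one_ne_zero : (-1 : K) ≠ 0)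
    (dzT_ziT_zero (K := K) (N := N) (n := 2) (k := 0) (l := 1) (by decide))
    (dzT_one (K := K) (N := N) (b := (id : Fin 2 → Fin 2)) 0) h0
    ((mul_one (ziT 0 1 : OT K N 2)).symm ▸ h1) k

theorem generator_two {x : OT K N 2} (hx : x ∈ {x : OT K N 2 | ∃ k l, k ≠ l ∧ x = ziT k l}) :
    x = ziT 0 1 ∨ x = -(ziT 0 1 : OT K N 2) := by
  obtain ⟨k, l, h, rfl⟩ := hx
  obtain ⟨rfl, rfl⟩ | ⟨rfl, rfl⟩ : k = 0 ∧ l = 1 ∨ k = 1 ∧ l = 0 := by omega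
  · exact Or.inl rfl
  · exact Or.inr (ziT_swap _ _)

/-- An operation of arity `2` is determined by its values at `1` and its residues at
`z_{1,2}^{-1}`. -/
theorem eq_zero_of_two {X : Op M 2} (hX : IsChiralOf M p X) (h0 : ∀ v, X v 1 = 0)
    (h1 : ∀ v, resInv (elim M 1 (X v (ziT 0 1))) = 0) : X = 0 := by
  have a0 : (1 : OT K N 2) ∈ ann X := mem_ann.mpr h0
  have a2 := pow_mem_ann_two hX a0 (ziT_mem_ann_two hX a0 h1)
  refine eq_zero_of_poles hX fun u hu => ?_
  obtain ⟨k, hk⟩ := eq_pow_of_mem_closure (P := OT K N 2) (a := ziT 0 1) (fun x hx => generator_two hx) hu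
  have e := a2 k
  rw [mul_one] at e
  obtain rfl | rfl := hk
  · exact e
  · exact (ann X).neg_mem e

end Two

section Three

variable [CharZero K] {p : ZMod 2}

theorem subst_inv_iterate {n m : ℕ} (A : Fin n → Fin m → K) (r : ℕ) (a : SPoly K N n) :
    subst A (inv^[r] a) = inv^[r] (subst A a) := by
  induction r with
  | zero => rfl
  | succ r ih => rw [Function.iterate_succ_apply', Function.iterate_succ_apply', ← inv_subst, ih]

theorem resTwo_lmul {a : SPoly K N 2} (ha : ∀ i, dOdd 1 i a = 0) (x : VPoly K N V 2) :
    resTwo K N V (lmul a x) = lmul (inv^[N] (subst ![![1], ![0]] a)) (resTwo K N V x) := by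
  rw [resTwo, LinearMap.comp_apply, Dtop, DL_lmul ha, substW_lmul, length_top, subst_inv_iterate]
  rfl

theorem resTwo_lmul_odd (i : Fin N) (x : VPoly K N V 2) :
    resTwo K N V (lmul (odd 0 i) x) = lmul (inv^[N] (odd 0 i)) (resTwo K N V x) := by
  rw [resTwo_lmul (fun j => by rw [dOdd_odd, if_neg (by simp)]), subst_odd]
  simp

theorem Dlam_resTwo (x : VPoly K N V 2) : Dlam 0 (resTwo K N V x) = resTwo K N V (Dlam 0 x) := by
  rw [resTwo, LinearMap.comp_apply, LinearMap.comp_apply, Dlam_substW, Fin.sum_univ_two]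
  simp only [Matrix.cons_val_zero, Matrix.cons_val_one, one_smul, zero_smul, add_zero]
  rw [Dtop, DL_comm (Dlam 0) (fun i x => Dodd_Dlam _ _ _ _)]

theorem inv_iterate_odd (r : ℕ) (i : Fin N) :
    inv^[r] (odd 0 i : SPoly K N 1) = ((-1) ^ r : ℤ) • odd 0 i := by
  induction r with
  | zero => simp
  | succ r ih => rw [Function.iterate_succ_apply', ih, map_zsmul, inv_odd, pow_succ]; simp

theorem partial_fractions : (ziT 0 1 * ziT 1 2 : OT K N 3) = ziT 0 2 * (ziT 0 1 + ziT 1 2) := by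
  have h01 := zT_mul_ziT (K := K) (N := N) (k := (0 : Fin 3)) (l := 1) (by decide)
  have h12 := zT_mul_ziT (K := K) (N := N) (k := (1 : Fin 3)) (l := 2) (by decide)
  have h02 := ziT_mul_zT (K := K) (N := N) (k := (0 : Fin 3)) (l := 2) (by decide)
  have hz : (zT 0 1 + zT 1 2 : OT K N 3) = zT 0 2 := zB_add 0 1 2
  have e : (zT 0 2 : OT K N 3) * (ziT 0 1 * ziT 1 2) = ziT 0 1 + ziT 1 2 := by
    rw [← hz, add_mul, ← mul_assoc, h01, one_mul, ziT_comm 0 1, ← mul_assoc, h12, one_mul, add_comm]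
  rw [← e, ← mul_assoc, h02, one_mul]

theorem resTwo_image_lmul_odd {U : Set (VPoly K N V 2)} (hs : ∀ x ∈ U, -x ∈ U)
    (hU : ∀ x ∈ U, ∀ i, lmul (odd 0 i) x ∈ U) :
    ∀ x ∈ resTwo K N V '' U, ∀ i, lmul (odd 0 i) x ∈ resTwo K N V '' U := by
  rintro _ ⟨x, hx, rfl⟩ i
  have e : ∀ y : VPoly K N V 1,
      lmul (inv^[N] (odd 0 i)) y = ((-1) ^ N : ℤ) • lmul (odd 0 i : SPoly K N 1) y := fun y => by
    rw [inv_iterate_odd, map_zsmul]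
    rfl
  have h := (resTwo_lmul_odd (K := K) (V := V) i x).trans (e _)
  obtain h' | h' := neg_one_pow_eq_or ℤ N <;> rw [h'] at h
  · exact ⟨_, hU x hx i, by rw [h, one_smul]⟩
  · exact ⟨_, hs _ (hU x hx i), by rw [map_neg, h, neg_smul, one_smul, neg_neg]⟩

theorem neg_mem_elimVals {n : ℕ} {X : Op M (n + 1)} {f : OT K N (n + 1)} {x : VPoly K N V n}
    (hx : x ∈ elimVals M X f) : -x ∈ elimVals M X f := by
  obtain ⟨s, v, rfl⟩ := hx
  exact ⟨-s, v, (neg_zsmul _ _).symm⟩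

variable {X : Op M 3} (hX : IsChiralOf M p X)
include hX

theorem ziT_mem_ann_three (h0 : (1 : OT K N 3) ∈ ann X)
    (h1 : ∀ v, resTwo K N V (elim M 2 (X v (ziT 1 2))) = 0) : (ziT 1 2 : OT K N 3) ∈ ann X := by
  refine mem_ann_of_elimVals (X := X) (eq_zero_of_resTwo
    (fun x hx i => lmul_odd_mem_elimVals hX (fun k i => dzeT_ziT (by decide) k i) 1 hx i)
    (fun x hx => Dlam_elim_apply hX (f := ziT 1 2) 1
      (mul_mem_of_eq_neg (P := OT K N 3) (ziT_mul_zT_swap (by decide)) h0) hx) ?_)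
  rintro x ⟨s, v, rfl⟩
  rw [map_zsmul, h1, zsmul_zero]

omit hX in
theorem dzeT_ziT_mul_ziT (k : Fin 3) (i : Fin N) : dzeT k i (ziT 0 1 * ziT 1 2 : OT K N 3) = 0 := by
  rw [dzeT_mul, dzeT_ziT (by decide) k i, dzeT_ziT (by decide) k i, zero_mul, mul_zero, add_zero]

omit hX in
theorem ziT_mul_ziT_mul_zT_two_one :
    (ziT 0 1 * ziT 1 2 * zT 2 1 : OT K N 3) = -(ziT 0 1 : OT K N 3) := by
  rw [mul_assoc, ziT_mul_zT_swap (by decide), mul_neg, mul_one]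

omit hX in
theorem ziT_mul_ziT_mul_zT_one_zero :
    (ziT 0 1 * ziT 1 2 * zT 1 0 : OT K N 3) = -(ziT 1 2 : OT K N 3) := by
  rw [ziT_comm, mul_assoc, ziT_mul_zT_swap (by decide), mul_neg, mul_one]

theorem ziT_mul_ziT_mem_ann (h1 : (ziT 0 1 : OT K N 3) ∈ ann X) (h2 : (ziT 1 2 : OT K N 3) ∈ ann X)
    (h3 : ∀ v, resInv (resTwo K N V (elim M 2 (X v (ziT 0 1 * ziT 1 2)))) = 0) :
    (ziT 0 1 * ziT 1 2 : OT K N 3) ∈ ann X := by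
  have m21 : (ziT 0 1 * ziT 1 2 * zT 2 1 : OT K N 3) ∈ ann X :=
    mul_mem_of_eq_neg (P := OT K N 3) ziT_mul_ziT_mul_zT_two_one h1
  have m10 : (ziT 0 1 * ziT 1 2 * zT 1 0 : OT K N 3) ∈ ann X :=
    mul_mem_of_eq_neg (P := OT K N 3) ziT_mul_ziT_mul_zT_one_zero h2
  have m20 : (ziT 0 1 * ziT 1 2 * zT 2 0 : OT K N 3) ∈ ann X := by
    have e : (zT 2 1 + zT 1 0 : OT K N 3) = zT 2 0 := zB_add 2 1 0
    rw [← e, mul_add]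
    exact (ann X).add_mem m21 m10
  have hR : ∀ y ∈ resTwo K N V '' elimVals M X (ziT 0 1 * ziT 1 2), y = 0 := by
    refine eq_zero_of_cstV_Dtop (resTwo_image_lmul_odd (fun x hx => neg_mem_elimVals hx)
      fun x hx i => lmul_odd_mem_elimVals hX dzeT_ziT_mul_ziT 0 hx i) ?_ ?_
    · rintro _ ⟨x, hx, rfl⟩
      rw [Dlam_resTwo, Dlam_elim_apply hX (f := ziT 0 1 * ziT 1 2) 0 m20 hx, map_zero]
    · rintro _ ⟨x, ⟨s, v, rfl⟩, rfl⟩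
      rw [← resInv_eq, map_zsmul, map_zsmul, h3, zsmul_zero]
  exact mem_ann_of_elimVals (X := X) (eq_zero_of_resTwo
    (fun x hx i => lmul_odd_mem_elimVals hX dzeT_ziT_mul_ziT 1 hx i)
    (fun x hx => Dlam_elim_apply hX (f := ziT 0 1 * ziT 1 2) 1 m21 hx)
    fun x hx => hR _ ⟨x, hx, rfl⟩)

theorem pow_mul_pow_mem_ann (h0 : (1 : OT K N 3) ∈ ann X) (h1 : (ziT 0 1 : OT K N 3) ∈ ann X)
    (h2 : (ziT 1 2 : OT K N 3) ∈ ann X) (h3 : (ziT 0 1 * ziT 1 2 : OT K N 3) ∈ ann X) (i j : ℕ) :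
    (ziT 0 1 ^ i * ziT 1 2 ^ j : OT K N 3) ∈ ann X :=
  pow_mul_pow_mem (P := OT K N 3) (A := ann X) (D := dzT 0) (D' := dzT 2)
    (fun f hf => dzT_mem_ann hX hf 0) (fun f hf => dzT_mem_ann hX hf 2)
    (dzT_mul (K := K) (N := N) (b := (id : Fin 3 → Fin 3)) 0)
    (dzT_mul (K := K) (N := N) (b := (id : Fin 3 → Fin 3)) 2)
    (neg_ne_zero.mpr one_ne_zero : (-1 : K) ≠ 0) (one_ne_zero : (1 : K) ≠ 0)
    (dzT_ziT_zero (K := K) (N := N) (k := (0 : Fin 3)) (l := 1) (by decide))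
    (dzT_ziT_one (K := K) (N := N) (k := (1 : Fin 3)) (l := 2) (by decide))
    (ziT_comm 0 1 _)
    (dzT_ziT_of_ne (K := K) (N := N) (k := (0 : Fin 3)) (l := 1) (j := 2)
      (by decide) (by decide) (by decide))
    (dzT_ziT_of_ne (K := K) (N := N) (k := (1 : Fin 3)) (l := 2) (j := 0)
      (by decide) (by decide) (by decide))
    h0 h1 h2 h3 i j

omit hX in
theorem permT_swap_zero_one_mul (i j : ℕ) :
    permT K N (Equiv.swap (0 : Fin 3) 1) (ziT 0 1 ^ i * ziT 1 2 ^ j) =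
      (-1 : K) ^ i • (ziT 0 1 ^ i * ziT 0 2 ^ j : OT K N 3) := by
  rw [map_mul, permT_swap_pow, map_pow, permT_ziT, smul_mul_assoc]
  rfl

omit hX in
theorem permT_swap_one_two_mul (i j : ℕ) :
    permT K N (Equiv.swap (1 : Fin 3) 2) (ziT 0 1 ^ i * ziT 1 2 ^ j) =
      (-1 : K) ^ j • (ziT 1 2 ^ j * ziT 0 2 ^ i : OT K N 3) := by
  have e : (ziT 1 2 ^ j * ziT 0 2 ^ i : OT K N 3) = ziT 0 2 ^ i * ziT 1 2 ^ j :=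
    pow_comm_of_comm (P := OT K N 3) (ziT_comm 1 2) j _
  rw [map_mul, permT_swap_pow, map_pow, permT_ziT, mul_smul_comm, e]
  rfl

omit hX in
theorem mem_of_neg_one_pow_smul_mem {P : Type*} [AddCommGroup P] [Module K P] {A : Submodule K P}
    {x : P} {j : ℕ} (h : (-1 : K) ^ j • x ∈ A) : x ∈ A := by
  obtain e | e := neg_one_pow_eq_or K j <;> rw [e] at h
  · simpa using h
  · simpa using h

omit hX in
theorem generator_three {x : OT K N 3} (hx : x ∈ {x : OT K N 3 | ∃ k l, k ≠ l ∧ x = ziT k l}) :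
    (x = ziT 0 1 ∨ x = -(ziT 0 1 : OT K N 3)) ∨ (x = ziT 1 2 ∨ x = -(ziT 1 2 : OT K N 3)) ∨
      x = ziT 0 2 ∨ x = -(ziT 0 2 : OT K N 3) := by
  obtain ⟨k, l, h, rfl⟩ := hx
  obtain ⟨rfl, rfl⟩ | ⟨rfl, rfl⟩ | ⟨rfl, rfl⟩ | ⟨rfl, rfl⟩ | ⟨rfl, rfl⟩ | ⟨rfl, rfl⟩ :
    k = 0 ∧ l = 1 ∨ k = 1 ∧ l = 0 ∨ k = 1 ∧ l = 2 ∨ k = 2 ∧ l = 1 ∨ k = 0 ∧ l = 2 ∨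
      k = 2 ∧ l = 0 := by omega
  · exact Or.inl (Or.inl rfl)
  · exact Or.inl (Or.inr (ziT_swap _ _))
  · exact Or.inr (Or.inl (Or.inl rfl))
  · exact Or.inr (Or.inl (Or.inr (ziT_swap _ _)))
  · exact Or.inr (Or.inr (Or.inl rfl))
  · exact Or.inr (Or.inr (Or.inr (ziT_swap _ _)))

/-- A symmetric operation of arity `3` is determined by its values at `1`, its residues in the
second variable at `z_{2,3}^{-1}` and its iterated residues at `z_{1,2}^{-1} z_{2,3}^{-1}`. -/
theorem eq_zero_of_three (hs : act M (Equiv.swap 0 1) X = X) (hs' : act M (Equiv.swap 1 2) X = X)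
    (h0 : ∀ v, X v 1 = 0) (h1 : ∀ v, resTwo K N V (elim M 2 (X v (ziT 1 2))) = 0)
    (h2 : ∀ v, resInv (resTwo K N V (elim M 2 (X v (ziT 0 1 * ziT 1 2)))) = 0) : X = 0 := by
  have a0 : (1 : OT K N 3) ∈ ann X := mem_ann.mpr h0
  have a1 := ziT_mem_ann_three hX a0 h1
  have a2 : (ziT 0 2 : OT K N 3) ∈ ann X :=
    (permT_ziT (K := K) (N := N) (Equiv.swap (0 : Fin 3) 1) 1 2) ▸ permT_swap_mem_ann hs a1
  have a3 : (ziT 0 1 : OT K N 3) ∈ ann X :=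
    (permT_ziT (K := K) (N := N) (Equiv.swap (1 : Fin 3) 2) 0 2) ▸ permT_swap_mem_ann hs' a2
  have a4 := pow_mul_pow_mem_ann hX a0 a3 a1 (ziT_mul_ziT_mem_ann hX a3 a1 h2)
  have a5 : ∀ i k : ℕ, (ziT 0 1 ^ i * ziT 0 2 ^ k : OT K N 3) ∈ ann X := fun i k =>
    mem_of_neg_one_pow_smul_mem ((permT_swap_zero_one_mul (K := K) (N := N) i k) ▸
      permT_swap_mem_ann hs (a4 i k))
  have a6 : ∀ j k : ℕ, (ziT 1 2 ^ j * ziT 0 2 ^ k : OT K N 3) ∈ ann X := fun j k =>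
    mem_of_neg_one_pow_smul_mem ((permT_swap_one_two_mul (K := K) (N := N) k j) ▸
      permT_swap_mem_ann hs' (a4 k j))
  refine eq_zero_of_poles hX fun u hu => ?_
  have a7 := mem_of_partial_fractions (P := OT K N 3) (A := ann X) (ziT_comm 0 1 _)
    (ziT_comm 0 1 _) (ziT_comm 1 2 _) partial_fractions a6 a5
  obtain ⟨i, j, k, hk⟩ := eq_pow_mul_pow_of_mem_closure (P := OT K N 3) (ziT_comm 0 1 _)
    (ziT_comm 0 1 (ziT 0 2)) (ziT_comm 1 2 _) (fun x hx => generator_three hx) hu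
  have e := a7 i j k
  obtain rfl | rfl := hk
  · exact e
  · exact (ann X).neg_mem e

end Three

section Coefficients

variable {W W' : Type*} [AddCommGroup W] [Module K W] [AddCommGroup W'] [Module K W']

theorem coefMap_comp (F : W →ₗ[K] W') (φ : ℕ → V →ₗ[K] W) (x : VPoly K N V 1) :
    F (coefMap φ x) = coefMap (fun m => F ∘ₗ φ m) x := by
  apply vpoly_mon_ext x; intro s e v
  simp only [coefMap_monomial, map_smul, LinearMap.comp_apply]

theorem coefMap_congr {φ ψ : ℕ → V →ₗ[K] W} (h : ∀ m, φ m = ψ m) (x : VPoly K N V 1) :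
    coefMap φ x = coefMap ψ x := by rw [funext h]

theorem coefMap_add (φ ψ : ℕ → V →ₗ[K] W) (x : VPoly K N V 1) :
    coefMap (fun m => φ m + ψ m) x = coefMap φ x + coefMap ψ x := by
  apply vpoly_mon_ext x; intro s e v
  simp only [coefMap_monomial, LinearMap.add_apply, smul_add]

theorem coefMap_smul (r : K) (φ : ℕ → V →ₗ[K] W) (x : VPoly K N V 1) :
    coefMap (fun m => r • φ m) x = r • coefMap φ x := by
  apply vpoly_mon_ext x; intro s e v
  simp only [coefMap_monomial, LinearMap.smul_apply, smul_comm r]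

theorem coefMap_Dlam (φ : ℕ → V →ₗ[K] W) (x : VPoly K N V 1) :
    coefMap φ (Dlam 0 x) = coefMap (fun m => (m : K) • φ (m - 1)) x := by
  apply vpoly_mon_ext x; intro s e v
  have h : Dlam 0 ((MvPolynomial.monomial s (1 : K) ⊗ₜ[K] e) ⊗ₜ[K] v : VPoly K N V 1) =
      (s 0 : K) • ((MvPolynomial.monomial (s - Finsupp.single 0 1) (1 : K) ⊗ₜ[K] e) ⊗ₜ[K] v) := by
    simp only [Dlam, LinearMap.rTensor_tmul, dlam, dEven]
    rw [show (MvPolynomial.pderiv (0 : Fin 1)).toLinearMap (MvPolynomial.monomial s (1 : K)) =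
      (s 0 : K) • MvPolynomial.monomial (s - Finsupp.single 0 1) 1 from by
        rw [MvPolynomial.smul_monomial]
        exact (MvPolynomial.pderiv_monomial ..).trans (by simp)]
    simp only [TensorProduct.smul_tmul']
  rw [h, map_smul, coefMap_monomial, coefMap_monomial, LinearMap.smul_apply, smul_comm]
  simp

variable [CharZero K]

theorem Dtop_eq_coefMap (x : VPoly K N V 1) :
    Dtop K N V 0 x = coefMap (fun m => TensorProduct.mk K (SPoly K N 1) V (lam 0 ^ m)) x := by
  rw [Dtop_eq, coefMap_eq]

theorem topCoeff_involute (e : Grass K N 1) :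
    topCoeff K N (CliffordAlgebra.involute e) = (-1 : K) ^ N * topCoeff K N e := by
  have h := Dtop_monomial (K := K) (N := N) (V := K) (1 : MvPolynomial (Fin 1) K)
    (CliffordAlgebra.involute e) 1
  have h' := Dtop_monomial (K := K) (N := N) (V := K) (1 : MvPolynomial (Fin 1) K) e 1
  have hA := DL_anticomm (K := K) (N := N) (V := K) (k := (0 : Fin 1)) (j := 0)
    (L := (List.finRange N).reverse) ((inv (K := K) (N := N)).toLinearMap.rTensor K) (fun i x => by
      apply tensor_ext x; intro a v
      simp only [Dodd, LinearMap.rTensor_tmul, AlgHom.toLinearMap_apply]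
      rw [inv_dOdd]
      simp only [TensorProduct.neg_tmul, neg_neg]) ((1 ⊗ₜ e) ⊗ₜ 1)
  rw [LinearMap.rTensor_tmul, length_top] at hA
  change Dtop K N K 0 ((inv (1 ⊗ₜ e)) ⊗ₜ 1) = (-1 : K) ^ N • _ at hA
  rw [show (inv (1 ⊗ₜ e) : SPoly K N 1) = 1 ⊗ₜ CliffordAlgebra.involute e from by simp [inv], h]
    at hA
  change _ = (-1 : K) ^ N • (LinearMap.rTensor K inv.toLinearMap) (Dtop K N K 0 _) at hA
  rw [h', map_smul, LinearMap.rTensor_tmul] at hA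
  have h2 := congrArg (cstV K N K 1) hA
  simpa [cstV_tmul, cst, inv] using h2

theorem coefMap_par (M : HWSupermodule K N V) (φ : ℕ → V →ₗ[K] W) (x : VPoly K N V 1) :
    coefMap (fun m => φ m ∘ₗ M.par) x = (-1 : K) ^ N • coefMap φ (parx M 1 x) := by
  apply vpoly_mon_ext x; intro s e v
  have h : parx M 1 ((MvPolynomial.monomial s (1 : K) ⊗ₜ[K] e) ⊗ₜ[K] v) =
      (MvPolynomial.monomial s (1 : K) ⊗ₜ[K] CliffordAlgebra.involute e) ⊗ₜ[K] M.par v := by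
    simp [parx, inv]
  rw [h, coefMap_monomial, coefMap_monomial, topCoeff_involute, smul_smul, ← mul_assoc,
    ← mul_pow, neg_one_mul, neg_neg, one_pow, one_mul, LinearMap.comp_apply]

theorem resInv_lmul_lam (x : VPoly K N V 1) : resInv (lmul (lam 0) x) = 0 := by
  rw [resInv_eq, Dtop, DL_comm (lmul (lam 0)) (fun i x => Dodd_lmul_lam 0 0 i x), cstV_lmul,
    cst_lam, zero_smul]

theorem Dodd_negNabla (i : Fin N) (x : VPoly K N V 1) :
    Dodd 0 i (negNabla M x) = -negNabla M (Dodd 0 i x) := by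
  induction x using vpoly_one_induction with
  | one v => rw [negNabla_one, Dodd_one, map_zero, neg_zero]
  | add x y hx hy => simp only [map_add, hx, hy, neg_add]
  | smul c x hx => simp only [map_smul, hx, smul_neg]
  | lam x hx =>
    rw [negNabla_lam, Dodd_lmul_lam, negNabla_lam, map_sub, map_neg, Dodd_lmul_lam, Dodd_Tx, hx]
    simp only [map_neg, neg_neg]
    abel
  | odd j x hx =>
    rw [negNabla_odd, Dodd_lmul_odd, map_sub, map_sub, negNabla_odd, map_neg, Dodd_lmul_odd,
      Dodd_Sx, hx]
    split_ifs <;> simp only [map_neg, map_zero] <;> abel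

theorem resInv_negNabla (x : VPoly K N V 1) :
    resInv (negNabla M x) = (-1 : K) ^ N • coefMap (fun m => (-M.T) ^ m) x := by
  have h : ∀ (m : ℕ) (v : V), cstV K N V 1 (negNabla M ((lam 0 ^ m) ⊗ₜ v)) = ((-M.T) ^ m) v := by
    intro m v
    induction m with
    | zero => rw [pow_zero, pow_zero, negNabla_one, cstV_tmul, map_one, one_smul]; rfl
    | succ m ih =>
      have hT : ∀ y : VPoly K N V 1, cstV K N V 1 (Tx M 1 y) = M.T (cstV K N V 1 y) := by
        intro y
        apply tensor_ext y; intro a v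
        rw [Tx, TensorProduct.map_tmul, cstV_tmul, cstV_tmul, map_smul]; rfl
      rw [pow_succ', ← lmul_tmul, negNabla_lam, map_sub, map_neg, cstV_lmul, cst_lam, zero_smul,
        neg_zero, zero_sub, hT, ih, pow_succ']
      rfl
  rw [resInv_eq, Dtop, DL_anticomm (negNabla M) (fun i x => Dodd_negNabla i x), length_top,
    map_smul]
  change _ • cstV K N V 1 (negNabla M (Dtop K N V 0 x)) = _
  rw [Dtop_eq_coefMap, coefMap_comp, coefMap_comp]
  exact congrArg (_ • ·) (coefMap_congr (fun m => LinearMap.ext fun v => h m v) x)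

theorem resInv_sub_resInv_negNabla (x : VPoly K N V 1) :
    resInv x - (-1 : K) ^ N • resInv (negNabla M x) = integ (-M.T) 0 (Dlam 0 x) := by
  rw [resInv_negNabla, smul_smul, ← mul_pow, neg_one_mul, neg_neg, one_pow, one_smul, integ,
    coefMap_Dlam, resInv, sub_eq_iff_eq_add, ← coefMap_add]
  refine coefMap_congr (fun m => ?_) x
  obtain _ | m := m
  · simp only [if_true, Nat.cast_zero, zero_smul, pow_zero, zero_add]; rfl
  · rw [if_neg (Nat.succ_ne_zero m), Nat.add_sub_cancel, smul_smul, Nat.cast_succ,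
      mul_inv_cancel₀ (Nat.cast_add_one_ne_zero m), one_smul, zero_pow (Nat.succ_ne_zero m),
      zero_sub, neg_add_cancel]

theorem Dtop_eq_add_integLam (x : VPoly K N V 1) :
    Dtop K N V 0 x = 1 ⊗ₜ resInv x + integLam (Dlam 0 x) := by
  have h : (1 ⊗ₜ resInv x : VPoly K N V 1) = coefMap (fun m =>
      TensorProduct.mk K (SPoly K N 1) V 1 ∘ₗ (if m = 0 then LinearMap.id else 0)) x :=
    coefMap_comp (TensorProduct.mk K (SPoly K N 1) V 1) _ x
  rw [h, integLam, coefMap_Dlam, ← coefMap_add, Dtop_eq_coefMap]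
  refine coefMap_congr (fun m => ?_) x
  obtain _ | m := m
  · rw [if_pos rfl, Nat.cast_zero, zero_smul, add_zero, pow_zero]; rfl
  · rw [if_neg (Nat.succ_ne_zero m), Nat.add_sub_cancel, smul_smul, Nat.cast_succ,
      mul_inv_cancel₀ (Nat.cast_add_one_ne_zero m), one_smul, LinearMap.comp_zero, zero_add]

theorem resInv_lmul_Dtop (a : SPoly K N 1) (x : VPoly K N V 1) :
    resInv (lmul a (Dtop K N V 0 x)) = resInv (a ⊗ₜ[K] resInv x) := by
  have h : ∀ v, resInv (a ⊗ₜ[K] v : VPoly K N V 1) =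
      resInv (lmul a ((1 : SPoly K N 1) ⊗ₜ[K] v)) := fun v => by rw [lmul_tmul, mul_one]
  rw [h, Dtop_eq_coefMap]
  have e : (1 ⊗ₜ resInv x : VPoly K N V 1) = coefMap (fun m =>
      TensorProduct.mk K (SPoly K N 1) V 1 ∘ₗ (if m = 0 then LinearMap.id else 0)) x :=
    coefMap_comp (TensorProduct.mk K (SPoly K N 1) V 1) _ x
  have c1 := coefMap_comp (resInv ∘ₗ lmul a) (fun m => TensorProduct.mk K (SPoly K N 1) V
    (lam 0 ^ m)) x
  have c2 := coefMap_comp (resInv ∘ₗ lmul a) (fun m => TensorProduct.mk K (SPoly K N 1) V 1 ∘ₗ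
    (if m = 0 then LinearMap.id else 0)) x
  rw [e]
  refine c1.trans (Eq.trans (coefMap_congr (fun m => LinearMap.ext fun v => ?_) x) c2.symm)
  obtain _ | m := m
  · rw [if_pos rfl, pow_zero]; rfl
  · rw [if_neg (Nat.succ_ne_zero m), LinearMap.comp_zero, LinearMap.comp_zero,
      LinearMap.zero_apply]
    change resInv (lmul a ((lam 0 ^ (m + 1)) ⊗ₜ[K] v)) = 0
    rw [pow_succ', ← lmul_tmul, ← lmul_lam_comm, resInv_lmul_lam]

end Coefficients

section Nest

theorem neg_one_pow_smul {E : Type*} [AddCommGroup E] [Module K E] (r : ℕ) (x : E) :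
    (-1 : K) ^ r • x = sgn (r : ZMod 2) • x := by
  obtain hr | hr := Nat.even_or_odd r
  · rw [hr.neg_one_pow, one_smul, (ZMod.natCast_eq_zero_iff_even).mpr hr, sgn_zero_smul]
  · rw [hr.neg_one_pow, neg_one_smul, (ZMod.natCast_eq_one_iff_odd).mpr hr, sgn_one_smul]

theorem sgn_smul_smul_comm {E : Type*} [AddCommGroup E] [Module K E] (p : ZMod 2)
    (c : K) (x : E) : sgn p • c • x = c • sgn p • x := smul_comm _ _ _

variable [CharZero K] (M)

/-- The operator `v ↦ (-1)^{p p(v)} v`. -/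
def parPow (p : ZMod 2) : V →ₗ[K] V := if p = 0 then LinearMap.id else M.par

/-- The operator `x ↦ (-1)^{p p(x)} x` on `V[Λ]`. -/
def parxPow (p : ZMod 2) : VPoly K N V 1 →ₗ[K] VPoly K N V 1 :=
  if p = 0 then LinearMap.id else parx M 1

theorem invPow_invPow {n : ℕ} (p q : ZMod 2) (a : SPoly K N n) :
    invPow p (invPow q a) = invPow (p + q) a := by
  obtain rfl | rfl : p = 0 ∨ p = 1 := by revert p; decide
  · rw [zero_add]; rfl
  obtain rfl | rfl : q = 0 ∨ q = 1 := by revert q; decide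
  · rfl
  · exact inv_inv a

theorem invPow_lam {n : ℕ} (p : ZMod 2) (k : Fin n) : invPow p (lam k : SPoly K N n) = lam k := by
  obtain rfl | rfl : p = 0 ∨ p = 1 := by revert p; decide
  · rfl
  · rw [invPow_one, inv_lam]

theorem invPow_odd {n : ℕ} (p : ZMod 2) (k : Fin n) (i : Fin N) :
    invPow p (odd k i : SPoly K N n) = sgn p • odd k i := by
  obtain rfl | rfl : p = 0 ∨ p = 1 := by revert p; decide
  · rw [sgn_zero_smul]; rfl
  · rw [invPow_one, inv_odd, sgn_one_smul]

theorem iterate_inv_eq {n : ℕ} (r : ℕ) (a : SPoly K N n) : inv^[r] a = invPow r a := by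
  induction r with
  | zero => rfl
  | succ r ih =>
    rw [Function.iterate_succ_apply', ih, ← invPow_one, invPow_invPow, Nat.cast_succ, add_comm]

theorem parxPow_tmul (p : ZMod 2) (a : SPoly K N 1) (v : V) :
    parxPow M p (a ⊗ₜ v) = invPow p a ⊗ₜ parPow M p v := by
  obtain rfl | rfl : p = 0 ∨ p = 1 := by revert p; decide
  · rfl
  · rfl

variable {M}

theorem parxPow_eq {d : ZMod 2} {x : VPoly K N V 1} (hx : parx M 1 x = sgn d • x) (p : ZMod 2) :
    parxPow M p x = sgn (p * d) • x := by
  obtain rfl | rfl : p = 0 ∨ p = 1 := by revert p; decide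
  · rw [zero_mul, sgn_zero_smul]; rfl
  · rw [one_mul, ← hx]; rfl

theorem parPow_of_mem {d : ZMod 2} {v : V} (hv : v ∈ M.deg d) (p : ZMod 2) :
    parPow M p v = sgn (p * d) • v := by
  obtain rfl | rfl : p = 0 ∨ p = 1 := by revert p; decide
  · rw [zero_mul, sgn_zero_smul]; rfl
  · rw [one_mul, ← M.par_of_mem hv]; rfl

theorem nest_tmul (A B : Fin 2 → K) (p : ZMod 2) (g : V →ₗ[K] VPoly K N V 1) (a : SPoly K N 1)
    (u : V) : nest A B p g (a ⊗ₜ u) =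
      lmul (subst (fun _ => B) (invPow p a)) (substW V (fun _ => A) (g u)) := rfl

theorem nest_lmul (A B : Fin 2 → K) (p : ZMod 2) (g : V →ₗ[K] VPoly K N V 1) (a : SPoly K N 1)
    (y : VPoly K N V 1) : nest A B p g (lmul a y) =
      lmul (subst (fun _ => B) (invPow p a)) (nest A B p g y) := by
  apply tensor_ext y; intro c v
  rw [lmul_tmul, nest_tmul, nest_tmul, map_mul, map_mul, lmul_mul]

theorem nest_one (A B : Fin 2 → K) (p : ZMod 2) (g : V →ₗ[K] VPoly K N V 1) (u : V) :
    nest A B p g (1 ⊗ₜ u) = substW V (fun _ => A) (g u) := by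
  rw [nest_tmul, map_one, map_one, lmul_one]

theorem nest_parPow (A B : Fin 2 → K) (p q : ZMod 2) (g : V →ₗ[K] VPoly K N V 1)
    (y : VPoly K N V 1) : nest A B q (g ∘ₗ parPow M p) y = nest A B (q + p) g (parxPow M p y) := by
  apply tensor_ext y; intro c v
  rw [parxPow_tmul, nest_tmul, nest_tmul, invPow_invPow, add_assoc,
    show p + p = 0 from by revert p; decide, add_zero]
  rfl

theorem subst_single_lam (j : Fin 2) :
    subst (fun _ => Pi.single j 1) (lam 0 : SPoly K N 1) = lam j := by
  rw [subst_lam, Fin.sum_univ_two]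
  fin_cases j <;> simp

theorem subst_single_odd (j : Fin 2) (i : Fin N) :
    subst (fun _ => Pi.single j 1) (odd 0 i : SPoly K N 1) = odd j i := by
  rw [subst_odd, Fin.sum_univ_two]
  fin_cases j <;> simp

theorem single_zero_eq : (Pi.single 0 1 : Fin 2 → K) = ![1, 0] := by funext j; fin_cases j <;> rfl

theorem single_one_eq : (Pi.single 1 1 : Fin 2 → K) = ![0, 1] := by funext j; fin_cases j <;> rfl

theorem nest_lam (A : Fin 2 → K) (j : Fin 2) (p : ZMod 2) (g : V →ₗ[K] VPoly K N V 1)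
    (y : VPoly K N V 1) : nest A (Pi.single j 1) p g (lmul (lam 0) y) =
      lmul (lam j) (nest A (Pi.single j 1) p g y) := by
  rw [nest_lmul, invPow_lam, subst_single_lam]

theorem nest_odd (A : Fin 2 → K) (j : Fin 2) (p : ZMod 2) (g : V →ₗ[K] VPoly K N V 1)
    (i : Fin N) (y : VPoly K N V 1) : nest A (Pi.single j 1) p g (lmul (odd 0 i) y) =
      sgn p • lmul (odd j i) (nest A (Pi.single j 1) p g y) := by
  rw [nest_lmul, invPow_odd, map_zsmul, subst_single_odd, map_zsmul]
  rfl

theorem nest_unique {L : VPoly K N V 1 →ₗ[K] VPoly K N V 2} {A : Fin 2 → K} {j : Fin 2}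
    {p : ZMod 2} {g : V →ₗ[K] VPoly K N V 1} (one : ∀ u, L (1 ⊗ₜ u) = substW V (fun _ => A) (g u))
    (lam : ∀ y, L (lmul (lam 0) y) = lmul (lam j) (L y))
    (odd : ∀ i y, L (lmul (odd 0 i) y) = sgn p • lmul (odd j i) (L y)) (y : VPoly K N V 1) :
    L y = nest A (Pi.single j 1) p g y := by
  induction y using vpoly_one_induction with
  | one v => rw [one, nest_one]
  | add x y hx hy => simp only [map_add, hx, hy]
  | smul c x hx => simp only [map_smul, hx]
  | lam x hx => rw [lam, hx, nest_lam]
  | odd i x hx => rw [odd, hx, nest_odd]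

end Nest

section Residue

variable [CharZero K] {W : Type*} [AddCommGroup W] [Module K W]

theorem smul_sgn_smul {n : ℕ} (p : ZMod 2) (c : K) (x : VPoly K N V n) :
    c • sgn p • x = sgn p • c • x := (sgn_smul_smul_comm p c x).symm

theorem neg_one_pow_smul_vpoly {n : ℕ} (r : ℕ) (x : VPoly K N V n) :
    (-1 : K) ^ r • x = sgn (r : ZMod 2) • x := neg_one_pow_smul r x

/-- The residue of a family of maps `L_i` that represent the multiplication by `λ` as
`λ_j + i (L_i ↦ L_{i+1})`. -/
theorem residue_family {L : ℕ → VPoly K N V 1 →ₗ[K] VPoly K N V 2} {j : Fin 2} {p : ZMod 2}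
    {κ : VPoly K N V 2 →ₗ[K] W} (hκ : ∀ x, κ (lmul (lam j) x) = 0)
    (hlam : ∀ i y, L i (lmul (lam 0) y) = lmul (lam j) (L i y) + (i : K) • L (i + 1) y)
    (hodd : ∀ i ι y, L i (lmul (odd 0 ι) y) = sgn p • lmul (odd j ι) (L i y))
    (hone : ∀ i ι u, Dodd j ι (L i (1 ⊗ₜ u)) = 0) (i : ℕ) (y : VPoly K N V 1) :
    κ (Dtop K N V j (L i y)) = sgn (p * N) • coefMap (fun m =>
      ((i.ascFactorial m : ℕ) : K) • κ ∘ₗ L (i + m) ∘ₗ TensorProduct.mk K (SPoly K N 1) V 1) y := by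
  have hD : ∀ ι i y, Dodd j ι (L i y) = sgn p • L i (Dodd 0 ι y) := by
    intro ι i y
    induction y using vpoly_one_induction generalizing i with
    | one v => rw [hone, Dodd_one, map_zero, zsmul_zero]
    | add x y hx hy => rw [map_add, map_add, hx, hy, map_add, map_add, zsmul_add]
    | smul c x hx => rw [map_smul, map_smul, hx, map_smul, map_smul, smul_sgn_smul]
    | lam x hx =>
      rw [hlam, map_add, Dodd_lmul_lam, map_smul, hx, hx, Dodd_lmul_lam, hlam, map_zsmul, zsmul_add,
        smul_sgn_smul]
    | odd i' x hx =>
      rw [hodd, map_zsmul, Dodd_lmul_odd, Dodd_lmul_odd, map_sub, hodd, hx, map_zsmul]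
      simp only [true_and]
      congr 2
      split_ifs <;> simp
  have hT : Dtop K N V j (L i y) = sgn (p * N) • L i (Dtop K N V 0 y) := by
    obtain rfl | rfl : p = 0 ∨ p = 1 := by clear hodd hD; revert p; decide
    · rw [zero_mul, sgn_zero_smul]
      exact DL_comm _ (fun ι x => (hD ι i x).trans (sgn_zero_smul _)) y
    · have h := DL_anticomm (L i) (L := (List.finRange N).reverse)
        (fun ι x => (hD ι i x).trans (sgn_one_smul _)) y
      rw [length_top] at h
      refine h.trans ?_
      rw [one_mul]
      change _ = sgn (N : ZMod 2) • L i (DL 0 _ y)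
      exact neg_one_pow_smul_vpoly N _
  have hm : ∀ (m i : ℕ) (u : V), κ (L i ((lam 0 ^ m) ⊗ₜ u)) =
      ((i.ascFactorial m : ℕ) : K) • κ (L (i + m) (1 ⊗ₜ u)) := by
    intro m
    induction m with
    | zero => intro i u; simp
    | succ m ih =>
      intro i u
      rw [pow_succ', ← lmul_tmul, hlam, map_add, hκ, zero_add, map_smul, ih, smul_smul,
        ← Nat.cast_mul, add_right_comm, add_assoc, Nat.ascFactorial_succ,
        Nat.succ_ascFactorial]
  rw [hT, map_zsmul, Dtop_eq_coefMap, coefMap_comp (L i), coefMap_comp κ]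
  exact congrArg (_ • ·) (coefMap_congr (fun m => LinearMap.ext fun u => hm m i u) y)

theorem substW_kill_lam_one (x : VPoly K N V 2) :
    substW V ![![1], ![0]] (lmul (lam 1) x) = (0 : VPoly K N V 1) := by
  rw [substW_lmul, subst_lam]
  simp

theorem substW_kill_lam_zero (x : VPoly K N V 2) :
    substW V ![![0], ![1]] (lmul (lam 0) x) = (0 : VPoly K N V 1) := by
  rw [substW_lmul, subst_lam]
  simp

theorem substW_id {n : ℕ} {A : Fin n → Fin n → K} (hA : A = fun k l => if l = k then 1 else 0)
    (x : VPoly K N V n) : substW V A x = x := by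
  subst hA
  apply tensor_ext x; intro a v
  rw [substW_tmul, subst_id]

theorem Dtop_substW_of_eq_one {n : ℕ} {A : Fin 1 → Fin n → K} {j : Fin n} (hA : A 0 j = 1)
    (x : VPoly K N V 1) : Dtop K N V j (substW V A x) = substW V A (Dtop K N V 0 x) :=
  DL_comm (substW V A) (fun i x => by rw [Dodd_substW, Fin.sum_univ_one, hA, one_smul]) x

theorem resTwo_substW_zero_one (x : VPoly K N V 1) :
    resTwo K N V (substW V (fun _ => ![0, 1]) x) = 1 ⊗ₜ resInv x := by
  rw [resTwo, LinearMap.comp_apply, Dtop_substW_of_eq_one (by simp), substW_substW, resInv_eq,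
    ← substW_kill_one]
  congr 2
  funext k l
  simp [killMat, Fin.sum_univ_two, Subsingleton.elim k 0]

theorem resTwo_substW_one_one (x : VPoly K N V 1) :
    resTwo K N V (substW V (fun _ => ![1, 1]) x) = Dtop K N V 0 x := by
  rw [resTwo, LinearMap.comp_apply, Dtop_substW_of_eq_one (by simp), substW_substW]
  refine substW_id ?_ _
  funext k l
  simp [Fin.sum_univ_two, Subsingleton.elim k 0, Subsingleton.elim l 0]

theorem subst_kill_single (a : SPoly K N 1) :
    subst ![![1], ![0]] (subst (fun _ => Pi.single 0 1) a) = a := by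
  rw [subst_subst]
  conv_rhs => rw [← subst_id a]
  congr 2
  funext k l
  simp [Subsingleton.elim k 0, Subsingleton.elim l 0]

theorem dOdd_subst_single {j k : Fin 2} (h : j ≠ k) (i : Fin N) (a : SPoly K N 1) :
    dOdd k i (subst (fun _ => Pi.single j 1) a) = 0 := by
  rw [dOdd_subst, Fin.sum_univ_one, Pi.single_eq_of_ne h.symm, zero_smul]

theorem resTwo_lmul_subst (a : SPoly K N 1) (x : VPoly K N V 2) :
    resTwo K N V (lmul (subst (fun _ => Pi.single 0 1) a) x) =
      lmul (invPow N a) (resTwo K N V x) := by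
  rw [resTwo_lmul (fun i => dOdd_subst_single (by decide) i a), subst_kill_single, iterate_inv_eq]

theorem resTwo_nest_zero_one (p : ZMod 2) (g : V →ₗ[K] VPoly K N V 1) (y : VPoly K N V 1) :
    resTwo K N V (nest ![0, 1] (Pi.single 0 1) p g y) =
      TensorProduct.map (invPow (p + N)).toLinearMap (resInv ∘ₗ g) y := by
  apply tensor_ext y; intro c v
  rw [nest_tmul, resTwo_lmul_subst, resTwo_substW_zero_one, lmul_tmul, mul_one, invPow_invPow,
    add_comm, TensorProduct.map_tmul]
  rfl

theorem resTwo_nest_one_one (p : ZMod 2) (g : V →ₗ[K] VPoly K N V 1) (y : VPoly K N V 1) :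
    resTwo K N V (nest ![1, 1] (Pi.single 0 1) p g y) =
      TensorProduct.map (invPow (p + N)).toLinearMap (resInv ∘ₗ g) y +
        TensorProduct.lift ((lmul ∘ₗ (invPow (p + N)).toLinearMap).compl₂
          (integLam ∘ₗ Dlam 0 ∘ₗ g)) y := by
  apply tensor_ext y; intro c v
  rw [nest_tmul, resTwo_lmul_subst, resTwo_substW_one_one, invPow_invPow, add_comm (N : ZMod 2),
    Dtop_eq_add_integLam, map_add, lmul_tmul, mul_one]
  rfl

theorem resInv_map_invPow (s : ZMod 2) (f : V →ₗ[K] V) (y : VPoly K N V 1) :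
    resInv (TensorProduct.map (invPow s).toLinearMap f y) = sgn (s * N) • f (resInv y) := by
  apply vpoly_mon_ext y; intro t e v
  obtain rfl | rfl : s = 0 ∨ s = 1 := by revert s; decide
  · rw [zero_mul, sgn_zero_smul]
    change resInv ((MvPolynomial.monomial t 1 ⊗ₜ[K] e) ⊗ₜ[K] f v) = _
    rw [resInv, coefMap_monomial, coefMap_monomial, map_smul]
    split_ifs <;> simp
  · have h : TensorProduct.map (invPow 1).toLinearMap f
        ((MvPolynomial.monomial t (1 : K) ⊗ₜ[K] e) ⊗ₜ[K] v : VPoly K N V 1) =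
        (MvPolynomial.monomial t (1 : K) ⊗ₜ[K] CliffordAlgebra.involute e) ⊗ₜ[K] f v := by
      simp [inv, invPow_one]
    rw [h, one_mul, resInv, coefMap_monomial, coefMap_monomial, topCoeff_involute, map_smul]
    have hs : ∀ w : V, ((-1 : K) ^ N * topCoeff K N e) • w =
        sgn (N : ZMod 2) • topCoeff K N e • w := by
      intro w
      rw [mul_smul, neg_one_pow_smul]
    rw [hs]
    split_ifs <;> simp

theorem resInv_resTwo_nest_one_one (p : ZMod 2) (g : V →ₗ[K] VPoly K N V 1)
    (y : VPoly K N V 1) : resInv (resTwo K N V (nest ![1, 1] (Pi.single 0 1) p g y)) =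
      sgn ((p + N) * N) • resInv (g (resInv y)) := by
  rw [← LinearMap.comp_apply resInv g, ← resInv_map_invPow]
  apply tensor_ext y; intro c v
  rw [nest_tmul, resTwo_lmul_subst, resTwo_substW_one_one, invPow_invPow, add_comm (N : ZMod 2),
    resInv_lmul_Dtop, TensorProduct.map_tmul]
  rfl

theorem cstV_substW {n m : ℕ} (A : Fin n → Fin m → K) (x : VPoly K N V n) :
    cstV K N V m (substW V A x) = cstV K N V n x := by
  induction x using vpoly_induction with
  | one v => rw [substW_tmul, map_one, cstV_tmul, cstV_tmul, map_one, map_one]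
  | add x y hx hy => simp only [map_add, hx, hy]
  | smul c x hx => simp only [map_smul, hx]
  | lam k x hx =>
    rw [substW_lmul, cstV_lmul, cstV_lmul, subst_lam, map_sum, cst_lam, zero_smul]
    simp [cst_lam]
  | odd k i x hx =>
    rw [substW_lmul, cstV_lmul, cstV_lmul, subst_odd, map_sum, cst_odd, zero_smul]
    simp [cst_odd]

variable (K N V) in
/-- The residue in the first variable. -/
def resOne : VPoly K N V 2 →ₗ[K] VPoly K N V 1 := substW V ![![0], ![1]] ∘ₗ Dtop K N V 0

theorem Dtop_Dtop (x : VPoly K N V 2) :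
    Dtop K N V 0 (Dtop K N V 1 x) = sgn (N : ZMod 2) • Dtop K N V 1 (Dtop K N V 0 x) := by
  have h : ∀ i (x : VPoly K N V 2),
      Dodd 0 i (Dtop K N V 1 x) = (-1 : K) ^ N • Dtop K N V 1 (Dodd 0 i x) := by
    intro i x
    have h1 := DL_anticomm (K := K) (N := N) (V := V) (k := (1 : Fin 2)) (j := 1)
      (L := (List.finRange N).reverse) (Dodd 0 i) (fun i' x => Dodd_Dodd _ _ _ _ _) x
    rw [length_top] at h1
    change Dtop K N V 1 (Dodd 0 i x) = (-1 : K) ^ N • Dodd 0 i (Dtop K N V 1 x) at h1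
    rw [h1, smul_smul, ← mul_pow, neg_one_mul, neg_neg, one_pow, one_smul]
  obtain hN | hN : (N : ZMod 2) = 0 ∨ (N : ZMod 2) = 1 := by
    generalize (N : ZMod 2) = q; revert q; decide
  · rw [hN, sgn_zero_smul]
    exact DL_comm _ (fun i x => (h i x).trans
      ((neg_one_pow_smul_vpoly N _).trans
        ((congrArg (sgn · • _) hN).trans (sgn_zero_smul _)))) x
  · have h2 := DL_anticomm (L := (List.finRange N).reverse) (k := (0 : Fin 2))
      (Dtop K N V (1 : Fin 2)) (fun i x => (h i x).trans
        ((neg_one_pow_smul_vpoly N _).trans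
          ((congrArg (sgn · • _) hN).trans (sgn_one_smul _)))) x
    rw [length_top] at h2
    exact h2.trans (neg_one_pow_smul_vpoly N _)

theorem resInv_resTwo (x : VPoly K N V 2) :
    resInv (resTwo K N V x) = sgn (N : ZMod 2) • resInv (resOne K N V x) := by
  have h1 : ∀ y : VPoly K N V 2, Dtop K N V 0 (substW V ![![1], ![0]] y) =
      substW V ![![1], ![0]] (Dtop K N V 0 y) := fun y =>
    DL_comm (substW V ![![1], ![0]]) (fun i x => by rw [Dodd_substW, Fin.sum_univ_two]; simp) y
  have h2 : ∀ y : VPoly K N V 2, Dtop K N V 0 (substW V ![![0], ![1]] y) =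
      substW V ![![0], ![1]] (Dtop K N V 1 y) := fun y =>
    DL_comm (substW V ![![0], ![1]]) (fun i x => by rw [Dodd_substW, Fin.sum_univ_two]; simp) y
  rw [resInv_eq, resInv_eq, resTwo, resOne, LinearMap.comp_apply, LinearMap.comp_apply, h1, h2,
    cstV_substW, cstV_substW, Dtop_Dtop, map_zsmul]

theorem resTwo_nest_one_zero (p : ZMod 2) (g : V →ₗ[K] VPoly K N V 1) (y : VPoly K N V 1) :
    resTwo K N V (nest ![1, 0] (Pi.single 1 1) p g y) = sgn (p * N) • g (resInv y) := by
  have hg : ∀ u, substW V ![![1], ![0]] (substW V (fun _ => ![1, 0]) (g u)) = g u := fun u => by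
    rw [substW_substW]
    refine substW_id ?_ _
    funext k l
    simp [Fin.sum_univ_two, Subsingleton.elim k 0, Subsingleton.elim l 0]
  have h := residue_family (W := VPoly K N V 1) (p := p) (j := 1)
    (L := fun i => if i = 0 then nest ![1, 0] (Pi.single 1 1) p g else 0)
    (κ := substW V ![![1], ![0]]) substW_kill_lam_one
    (fun i y => by
      obtain _ | i := i
      · rw [if_pos rfl, Nat.cast_zero, zero_smul, add_zero, nest_lam]
      · simp)
    (fun i ι y => by
      obtain _ | i := i
      · rw [if_pos rfl, nest_odd]
      · simp only [Nat.succ_ne_zero, if_false, LinearMap.zero_apply, map_zero]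
        exact (zsmul_zero (sgn p)).symm)
    (fun i ι u => by
      obtain _ | i := i
      · rw [if_pos rfl, nest_one, Dodd_substW]; simp
      · simp) 0 y
  rw [if_pos rfl] at h
  refine h.trans (congrArg (_ • ·) ?_)
  rw [resInv, coefMap_comp]
  refine coefMap_congr (fun m => LinearMap.ext fun u => ?_) y
  obtain _ | m := m
  · simp only [Nat.ascFactorial_zero, Nat.cast_one, one_smul, zero_add, if_true,
      LinearMap.comp_apply, TensorProduct.mk_apply, nest_one, hg, LinearMap.id_apply]
  · simp

end Residue

section BoxTerm

variable [CharZero K] (X : Op M 2)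

/-- `a ⊗ b ↦ X_{Λ,-Λ-∇}(a ⊗ b ⊗ z_{1,2}^{-k})`. -/
def poleMap (k : ℕ) : V →ₗ[K] V →ₗ[K] VPoly K N V 1 :=
  LinearMap.mk₂ K (poleVal X k) (poleVal_add_left k) (poleVal_smul_left k) (poleVal_add_right k)
    (poleVal_smul_right k)

theorem poleMap_apply (k : ℕ) (a b : V) : poleMap X k a b = poleVal X k a b := rfl

theorem elim_nSubst_of_last {b : Fin 3 → Fin 2} (hb : b 2 = 1) (w : VNabla M 2) :
    elim M 2 (nSubst M b w) =
      substW V (fun _ l => if b l.castSucc = 0 then 1 else 0) (elim M 1 w) := by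
  have hb' : b (Fin.last 2) = 1 := hb
  suffices h : ∀ x : VPoly K N V 1, elim M 2 (nSubst M b (unelim M 1 x)) =
      substW V (fun _ l => if b l.castSucc = 0 then 1 else 0) x by
    rw [← h, unelim_elim]
  intro x
  induction x using vpoly_one_induction with
  | one v => rw [unelim_one, nSubst_cls, map_one, elim_one, substW_tmul, map_one]
  | add x y hx hy => simp only [map_add, hx, hy]
  | smul c x hx => simp only [map_smul, hx]
  | lam x hx =>
    rw [unelim_lmul_lam, Fin.castSucc_zero, nSubst_nMul_lam, substW_lmul, subst_lam, map_sum,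
      map_sum, LinearMap.sum_apply, Finset.sum_filter, Fin.sum_univ_castSucc, hb',
      if_neg (by decide), add_zero]
    refine Finset.sum_congr rfl fun l _ => ?_
    rw [elim_lam_castSucc, hx]
    split_ifs <;> simp
  | odd i x hx =>
    rw [unelim_lmul_odd, Fin.castSucc_zero, nSubst_nMul_odd, substW_lmul, subst_odd, map_sum,
      map_sum, LinearMap.sum_apply, Finset.sum_filter, Fin.sum_univ_castSucc, hb',
      if_neg (by decide), add_zero]
    refine Finset.sum_congr rfl fun l _ => ?_
    rw [elim_odd_castSucc, hx]
    split_ifs <;> simp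

/-- The contribution of the permutation `τ` to the values of `X □ X`. -/
def boxTerm (τ : Equiv.Perm (Fin 3)) (c : V) (f : OBT K N (block 1 1)) :
    VPoly K N V 1 →ₗ[K] VPoly K N V 2 := elim M 2 ∘ₗ nSubst M τ ∘ₗ bcomp M X c f

theorem boxTerm_apply (τ : Equiv.Perm (Fin 3)) (c : V) (f : OBT K N (block 1 1))
    (y : VPoly K N V 1) : boxTerm X τ c f y = elim M 2 (nSubst M τ (bcomp M X c f y)) := rfl

variable {X} {τ : Equiv.Perm (Fin 3)} {j : Fin 2}

theorem boxTerm_lam (hτ : τ j.castSucc = 0) (c : V) (f : OBT K N (block 1 1))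
    (y : VPoly K N V 1) : boxTerm X τ c f (lmul (lam 0) y) =
      lmul (lam j) (boxTerm X τ c f y) - boxTerm X τ c (dzT 0 f) y := by
  rw [boxTerm_apply, boxTerm_apply, boxTerm_apply, bcomp_lam, map_sub, map_sub,
    ← elim_lam_castSucc, ← nSubst_perm_lam, hτ]

theorem boxTerm_odd (hτ : τ j.castSucc = 0) (c : V) {f : OBT K N (block 1 1)}
    (hf : ∀ i, dzeT 0 i f = 0) (i : Fin N) (y : VPoly K N V 1) :
    boxTerm X τ c f (lmul (odd 0 i) y) = sgn 1 • lmul (odd j i) (boxTerm X τ c f y) := by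
  rw [sgn_one_smul, boxTerm_apply, boxTerm_apply, bcomp_odd, hf, bcomp_zero_fun, sub_zero, map_neg,
    map_neg, ← elim_odd_castSucc, ← nSubst_perm_odd, hτ]

theorem boxTerm_one_id (c : V) (f : OBT K N (block 1 1)) (u : V) :
    boxTerm X 1 c f (1 ⊗ₜ u) = substW V (fun _ => ![1, 1]) (elim M 1 (X ![u, c] (restr f))) := by
  rw [boxTerm_apply, bcomp_one, nSubst_nSubst, elim_nSubst_of_last (by decide)]
  refine congrArg (fun A => substW V A _) ?_
  funext k l
  fin_cases l <;> rfl

theorem apply_zsmul_right (s : ℤ) (a b : V) (f : OT K N 2) : X ![a, s • b] f = s • X ![a, b] f := by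
  rw [← Int.cast_smul_eq_zsmul K s b, apply_smul_right, LinearMap.smul_apply]
  exact Int.cast_smul_eq_zsmul K s _

theorem apply_swap_parPow (hs : act M (Equiv.swap 0 1) X = X) {r : ZMod 2} {c : V}
    (hc : c ∈ M.deg r) (u : V) (f : OT K N 2) : X ![u, c] f = nSubst M (Equiv.swap (0 : Fin 2) 1)
        (X ![c, parPow M r u] (permT K N (Equiv.swap 0 1) f)) := by
  induction u using M.homogeneous_induction with
  | h p u hu =>
    conv_lhs => rw [← hs, act_swap_apply hu hc]
    rw [parPow_of_mem hu, mul_comm p r, apply_zsmul_right, map_zsmul]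
  | hadd u v hu hv =>
    rw [apply_add_left, LinearMap.add_apply, hu, hv, map_add, apply_add_right,
      LinearMap.add_apply, map_add]

theorem boxTerm_one_swap (hs : act M (Equiv.swap 0 1) X = X) {r : ZMod 2} {c : V}
    (hc : c ∈ M.deg r) (hτ : block 1 1 (τ 2) = 0) (f : OBT K N (block 1 1)) (u : V) :
    boxTerm X τ c f (1 ⊗ₜ u) = substW V (fun _ l => if block 1 1 (τ l.castSucc) = 1 then 1 else 0)
        (elim M 1 (X ![c, parPow M r u] (permT K N (Equiv.swap 0 1) (restr f)))) := by
  rw [boxTerm_apply, bcomp_one, apply_swap_parPow hs hc, nSubst_nSubst, nSubst_nSubst,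
    elim_nSubst_of_last (by simp [hτ])]
  refine congrArg (fun A => substW V A _) ?_
  funext k l
  have h : ∀ x, ((Equiv.swap (0 : Fin 2) 1) (block 1 1 x) = 0) ↔ block 1 1 x = 1 := by decide
  exact if_congr (h (τ l.castSucc)) rfl rfl

theorem boxTerm_eq_nest (c : V) {f : OBT K N (block 1 1)} (hf : dzT 0 f = 0)
    (hf' : ∀ i, dzeT 0 i f = 0) {k : ℕ} (hk : restr f = ziT 0 1 ^ k) (y : VPoly K N V 1) :
    boxTerm X 1 c f y = nest ![1, 1] (Pi.single 0 1) 1 ((poleMap X k).flip c) y := by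
  refine nest_unique (fun u => ?_) (fun y => ?_) (fun i y => boxTerm_odd rfl c hf' i y) y
  · rw [boxTerm_one_id, hk]; rfl
  · rw [boxTerm_lam (j := 0) rfl, hf, boxTerm_apply X 1 c 0 y, bcomp_zero_fun, map_zero, map_zero,
      sub_zero]

theorem boxTerm_eq_nest_swap (hs : act M (Equiv.swap 0 1) X = X) {r : ZMod 2} {c : V}
    (hc : c ∈ M.deg r) (hj : τ j.castSucc = 0) (hτ : block 1 1 (τ 2) = 0) {A : Fin 2 → K}
    (hA : A = fun l => if block 1 1 (τ l.castSucc) = 1 then 1 else 0)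
    {f : OBT K N (block 1 1)} (hf : dzT 0 f = 0) (hf' : ∀ i, dzeT 0 i f = 0) {k : ℕ}
    (hk : permT K N (Equiv.swap 0 1) (restr f) = ziT 0 1 ^ k) {d : ZMod 2} {y : VPoly K N V 1}
    (hy : parx M 1 y = sgn d • y) :
    boxTerm X τ c f y = sgn (r * d) • nest A (Pi.single j 1) (1 + r) (poleMap X k c) y := by
  have h : boxTerm X τ c f y = nest A (Pi.single j 1) 1 (poleMap X k c ∘ₗ parPow M r) y := by
    refine nest_unique (fun u => ?_) (fun y => ?_) (fun i y => boxTerm_odd hj c hf' i y) y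
    · rw [boxTerm_one_swap hs hc hτ, hk, hA]; rfl
    · rw [boxTerm_lam hj, hf, boxTerm_apply X τ c 0 y, bcomp_zero_fun, map_zero, map_zero, sub_zero]
  rw [h, nest_parPow, parxPow_eq hy, map_zsmul]

end BoxTerm

section BoxValue

variable [CharZero K] {X : Op M 2}

theorem crossing_swap_one_two (p r s : ZMod 2) :
    crossing (Equiv.swap (1 : Fin 3) 2) ![p, r, s] = r * s := by
  revert p r s; unfold crossing; decide

theorem crossing_cycle (p r s : ZMod 2) :
    crossing (Equiv.swap (1 : Fin 3) 2 * Equiv.swap 0 1) ![p, r, s] = p * r + p * s := by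
  revert p r s; unfold crossing; decide

theorem elim_boxOp (hX : IsChiralOf M 1 X) {p r s : ZMod 2} {a b c : V} (ha : a ∈ M.deg p)
    (hb : b ∈ M.deg r) (hc : c ∈ M.deg s) {f : OT K N 3} {f₁ f₂ f₃ : OBT K N (block 1 1)}
    {k₁ k₂ k₃ : ℕ} (h₁ : f = incl K N f₁ * ziT 0 1 ^ k₁)
    (h₂ : permT K N (Equiv.swap 1 2) f = incl K N f₂ * ziT 0 1 ^ k₂)
    (h₃ : permT K N (Equiv.swap 1 2 * Equiv.swap 0 1) f = incl K N f₃ * ziT 0 1 ^ k₃) :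
    elim M 2 (boxOp hX ![a, b, c] f) = boxTerm X 1 c f₁ (poleVal X k₁ a b) +
      sgn (r * s) • boxTerm X (Equiv.swap 1 2) b f₂ (poleVal X k₂ a c) + sgn (p * r + p * s) •
          boxTerm X (Equiv.swap 1 2 * Equiv.swap 0 1) a f₃ (poleVal X k₃ b c) := by
  have e₁ : elim M 2 (compOp hX ![a, b, c] f) = boxTerm X 1 c f₁ (poleVal X k₁ a b) := by
    refine (congrArg (fun g => elim M 2 (compOp hX ![a, b, c] g)) h₁).trans ?_
    rw [compOp_apply, boxTerm_apply]
    exact congrArg (elim M 2) (nSubst_id _).symm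
  have e₂ : elim M 2 (act M (Equiv.swap 1 2) (compOp hX) ![a, b, c] f) =
      sgn (r * s) • boxTerm X (Equiv.swap 1 2) b f₂ (poleVal X k₂ a c) := by
    rw [act_apply _ (mem_triple ha hb hc), h₂, compOp_apply, crossing_swap_one_two, map_zsmul]
    rfl
  have e₃ : elim M 2 (act M (Equiv.swap 1 2 * Equiv.swap 0 1) (compOp hX) ![a, b, c] f) =
      sgn (p * r + p * s) •
        boxTerm X (Equiv.swap 1 2 * Equiv.swap 0 1) a f₃ (poleVal X k₃ b c) := by
    rw [act_apply _ (mem_triple ha hb hc), h₃, compOp_apply, crossing_cycle, map_zsmul]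
    rfl
  rw [← e₁, ← e₂, ← e₃, ← map_add, ← map_add]
  rfl

end BoxValue

section PoleFunctions

variable [CharZero K]

theorem eq_map_one_mul_pow_zero {O P : Type*} [Ring O] [Algebra K O] [Ring P] [Algebra K P]
    (R : O →ₐ[K] P) (u : P) : 1 = R 1 * u ^ 0 := by rw [map_one, pow_zero, mul_one]

theorem eq_map_mul_pow_zero {O P : Type*} [Ring O] [Algebra K O] [Ring P] [Algebra K P]
    {R : O →ₐ[K] P} {f : O} {g : P} (u : P) (h : R f = g) : g = R f * u ^ 0 := by
  rw [h, pow_zero, mul_one]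

theorem eq_map_one_mul_pow_one {O P : Type*} [Ring O] [Algebra K O] [Ring P] [Algebra K P]
    (R : O →ₐ[K] P) (u : P) : u = R 1 * u ^ 1 := by rw [map_one, pow_one, one_mul]

theorem mul_eq_map_mul_pow_one {O P : Type*} [Ring O] [Algebra K O] [Ring P] [Algebra K P]
    {R : O →ₐ[K] P} {f : O} {g : P} (u : P) (h : R f = g) : g * u = R f * u ^ 1 := by
  rw [h, pow_one]

theorem restr_ziB {k l : Fin 3} (h : block 1 1 k ≠ block 1 1 l) :
    restr (ziB h : OBT K N (block 1 1)) = ziT (block 1 1 k) (block 1 1 l) := by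
  rw [ziT_of_ne h]
  exact relT_ziB (b := block 1 1) (b' := id) (c := block 1 1) _ h

theorem dzT_ziB_of_ne {k l : Fin 3} (h : block 1 1 k ≠ block 1 1 l) {j : Fin 3} (hk : k ≠ j)
    (hl : l ≠ j) : dzT j (ziB h : OBT K N (block 1 1)) = 0 := by
  rw [dzT_ziB, if_neg hk, if_neg hl, sub_zero, zero_mul]

theorem permT_one_three (σ : Equiv.Perm (Fin 3)) :
    permT K N σ 1 = incl K N 1 * (ziT 0 1 : OT K N 3) ^ 0 :=
  (map_one (permT K N σ)).trans (eq_map_one_mul_pow_zero (incl K N) (ziT 0 1 : OT K N 3))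

theorem ne_one_two : block 1 1 1 ≠ block 1 1 2 := by decide

theorem ne_two_one : block 1 1 2 ≠ block 1 1 1 := by decide

theorem ne_zero_two : block 1 1 0 ≠ block 1 1 2 := by decide

theorem permT_swap_ziT_one_two : permT K N (Equiv.swap (1 : Fin 3) 2) (ziT 1 2) =
    incl K N (ziB ne_two_one) * (ziT 0 1 : OT K N 3) ^ 0 :=
  (permT_ziT _ _ _).trans (eq_map_mul_pow_zero (R := incl K N) (ziT 0 1 : OT K N 3)
    (incl_ziB ne_two_one))

theorem permT_cycle_ziT_one_two : permT K N (Equiv.swap (1 : Fin 3) 2 * Equiv.swap 0 1) (ziT 1 2) =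
    incl K N 1 * (ziT 0 1 : OT K N 3) ^ 1 :=
  (permT_ziT _ _ _).trans (eq_map_one_mul_pow_one (incl K N) (ziT 0 1 : OT K N 3))

theorem ziT_one_two_eq :
    (ziT 1 2 : OT K N 3) = incl K N (ziB ne_one_two) * (ziT 0 1 : OT K N 3) ^ 0 :=
  eq_map_mul_pow_zero (R := incl K N) (ziT 0 1 : OT K N 3) (incl_ziB ne_one_two)

theorem restr_one_eq (u : OT K N 2) : restr (1 : OBT K N (block 1 1)) = u ^ 0 :=
  (map_one restr).trans (pow_zero u).symm

theorem permT_restr_one (σ : Equiv.Perm (Fin 2)) (u : OT K N 2) :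
    permT K N σ (restr (1 : OBT K N (block 1 1))) = u ^ 0 :=
  (congrArg (permT K N σ) (map_one restr)).trans ((map_one _).trans (pow_zero u).symm)

theorem restr_ziB_one_two :
    restr (ziB ne_one_two : OBT K N (block 1 1)) = (ziT 0 1 : OT K N 2) ^ 1 :=
  (restr_ziB ne_one_two).trans (pow_one (ziT 0 1 : OT K N 2)).symm

theorem permT_restr_ziB_two_one : permT K N (Equiv.swap (0 : Fin 2) 1)
    (restr (ziB ne_two_one : OBT K N (block 1 1))) = (ziT 0 1 : OT K N 2) ^ 1 :=
  (congrArg (permT K N _) (restr_ziB ne_two_one)).trans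
    ((permT_ziT _ _ _).trans (pow_one (ziT 0 1 : OT K N 2)).symm)

end PoleFunctions

section BoxValues

variable [CharZero K] {X : Op M 2}

theorem poleVal_zsmul_left (k : ℕ) (s : ℤ) (a b : V) :
    poleVal X k (s • a) b = s • poleVal X k a b := by
  rw [← Int.cast_smul_eq_zsmul K s a, poleVal_smul_left]
  exact Int.cast_smul_eq_zsmul K s (poleVal X k a b)

theorem poleVal_zsmul_right (k : ℕ) (s : ℤ) (a b : V) :
    poleVal X k a (s • b) = s • poleVal X k a b := by
  rw [← Int.cast_smul_eq_zsmul K s b, poleVal_smul_right]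
  exact Int.cast_smul_eq_zsmul K s (poleVal X k a b)

theorem neg_sgn_smul_sgn_smul {E : Type*} [AddCommGroup E] (p r : ZMod 2) (x : E) :
    -(sgn p • sgn r • x) = sgn (1 + p + r) • x := by
  rw [smul_smul, sgn_add, sgn_add, show sgn 1 = -1 from rfl, neg_one_mul, neg_mul, neg_smul]

variable (hX : IsChiralOf M 1 X)
include hX

theorem parx_poleVal_of_mem {p r : ZMod 2} {a b : V} (ha : a ∈ M.deg p) (hb : b ∈ M.deg r)
    (k : ℕ) : parx M 1 (poleVal X k a b) = sgn (1 + p + r) • poleVal X k a b := by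
  rw [parx_poleVal hX, M.par_of_mem ha, M.par_of_mem hb, poleVal_zsmul_left,
    poleVal_zsmul_right]
  exact neg_sgn_smul_sgn_smul p r _

variable (hs : act M (Equiv.swap 0 1) X = X) {p r s : ZMod 2} {a b c : V} (ha : a ∈ M.deg p)
  (hb : b ∈ M.deg r) (hc : c ∈ M.deg s)
include hs ha hb hc

theorem boxTerm_swap_eq {f : OBT K N (block 1 1)} (hf : dzT 0 f = 0) (hf' : ∀ i, dzeT 0 i f = 0)
    {k : ℕ} (hk : permT K N (Equiv.swap 0 1) (restr f) = ziT 0 1 ^ k) (l : ℕ) :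
    sgn (r * s) • boxTerm X (Equiv.swap 1 2) b f (poleVal X l a c) =
      sgn (r * (p + 1)) • nest ![0, 1] (Pi.single 0 1) (1 + r) (poleMap X k b)
        (poleVal X l a c) := by
  rw [boxTerm_eq_nest_swap hs hb (j := 0) rfl (by decide) (A := ![0, 1])
    (by funext l; fin_cases l <;> rfl) hf hf' hk (parx_poleVal_of_mem hX ha hc l), smul_smul,
    ← sgn_add]
  congr 2
  clear ha hb hc hs hX hf hf' hk
  revert p r s; decide

theorem boxTerm_cycle_eq {f : OBT K N (block 1 1)} (hf : dzT 0 f = 0) (hf' : ∀ i, dzeT 0 i f = 0)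
    {k : ℕ} (hk : permT K N (Equiv.swap 0 1) (restr f) = ziT 0 1 ^ k) (l : ℕ) :
    sgn (p * r + p * s) • boxTerm X (Equiv.swap 1 2 * Equiv.swap 0 1) a f (poleVal X l b c) =
      sgn p • nest ![1, 0] (Pi.single 1 1) (1 + p) (poleMap X k a) (poleVal X l b c) := by
  rw [boxTerm_eq_nest_swap hs ha (j := 1) rfl (by decide) (A := ![1, 0])
    (by funext l; fin_cases l <;> rfl) hf hf' hk (parx_poleVal_of_mem hX hb hc l), smul_smul,
    ← sgn_add]
  congr 2
  clear ha hb hc hs hX hf hf' hk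
  revert p r s; decide

theorem elim_boxOp_one : elim M 2 (boxOp hX ![a, b, c] 1) =
    nest ![1, 1] (Pi.single 0 1) 1 ((poleMap X 0).flip c) (poleVal X 0 a b) + sgn (r * (p + 1)) •
        nest ![0, 1] (Pi.single 0 1) (1 + r) (poleMap X 0 b) (poleVal X 0 a c) +
      sgn p • nest ![1, 0] (Pi.single 1 1) (1 + p) (poleMap X 0 a) (poleVal X 0 b c) := by
  rw [elim_boxOp hX ha hb hc (eq_map_one_mul_pow_zero (incl K N) (ziT 0 1 : OT K N 3))
    (permT_one_three _) (permT_one_three _),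
    boxTerm_eq_nest c (dzT_one 0) (dzeT_one 0) (restr_one_eq _),
    boxTerm_swap_eq hX hs ha hb hc (dzT_one 0) (dzeT_one 0) (permT_restr_one _ _),
    boxTerm_cycle_eq hX hs ha hb hc (dzT_one 0) (dzeT_one 0) (permT_restr_one _ _)]

theorem resTwo_elim_boxOp : resTwo K N V (elim M 2 (boxOp hX ![a, b, c] (ziT 1 2))) =
    TensorProduct.map (invPow (1 + N)).toLinearMap (resInv ∘ₗ (poleMap X 1).flip c)
        (poleVal X 0 a b) + TensorProduct.lift ((lmul ∘ₗ (invPow (1 + N)).toLinearMap).compl₂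
        (integLam ∘ₗ Dlam 0 ∘ₗ (poleMap X 1).flip c)) (poleVal X 0 a b) +
      sgn (r * (p + 1)) • TensorProduct.map (invPow (1 + r + N)).toLinearMap
        (resInv ∘ₗ poleMap X 1 b) (poleVal X 0 a c) +
      sgn p • sgn ((1 + p) * N) • poleVal X 0 a (resInv (poleVal X 1 b c)) := by
  rw [elim_boxOp hX ha hb hc ziT_one_two_eq permT_swap_ziT_one_two permT_cycle_ziT_one_two,
    boxTerm_eq_nest c (dzT_ziB_of_ne ne_one_two (by decide) (by decide))
      (fun i => dzeT_ziB ne_one_two 0 i) restr_ziB_one_two,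
    boxTerm_swap_eq hX hs ha hb hc (dzT_ziB_of_ne ne_two_one (by decide) (by decide))
      (fun i => dzeT_ziB ne_two_one 0 i) permT_restr_ziB_two_one,
    boxTerm_cycle_eq hX hs ha hb hc (dzT_one 0) (dzeT_one 0) (permT_restr_one _ _), map_add,
    map_add, map_zsmul, map_zsmul, resTwo_nest_one_one, resTwo_nest_zero_one,
    resTwo_nest_one_zero]
  rfl

end BoxValues

section ResidueValues

variable [CharZero K] {W : Type*} [AddCommGroup W] [Module K W] {X : Op M 2}

variable (X) in
/-- `a ⊗ b ↦ Res_Λ(λ^{-1} X_{Λ,-Λ-∇}(a ⊗ b ⊗ z_{1,2}^{-1}))`. -/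
def resMul : V →ₗ[K] V →ₗ[K] V := (poleMap X 1).compr₂ resInv

theorem resMul_apply (a b : V) : resMul X a b = resInv (poleVal X 1 a b) := rfl

theorem resInv_poleVal_succ (hX : IsChiralOf M 1 X) (k : ℕ) (a b : V) :
    resInv (poleVal X (k + 1) a b) =
      ((-1 : K) ^ k * ((k.factorial : ℕ) : K)⁻¹) • resMul X ((M.T ^ k) a) b := by
  induction k generalizing a with
  | zero => simp [resMul_apply]
  | succ k ih =>
    have h := congrArg resInv (poleVal_T_left hX (k + 1) a b)
    rw [ih, map_sub, map_neg, resInv_lmul_lam, neg_zero, zero_sub, map_smul] at h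
    have hk : ((k + 1 : ℕ) : K) ≠ 0 := Nat.cast_ne_zero.mpr (Nat.succ_ne_zero k)
    have h' : resInv (poleVal X (k + 1 + 1) a b) = -(((k + 1 : ℕ) : K)⁻¹ •
        -(((k + 1 : ℕ) : K) • resInv (poleVal X (k + 1 + 1) a b))) := by
      rw [smul_neg, neg_neg, smul_smul, inv_mul_cancel₀ hk, one_smul]
    rw [h', ← h, smul_smul, ← neg_smul, pow_succ (M.T), Module.End.mul_apply]
    congr 1
    rw [pow_succ, Nat.factorial_succ, Nat.cast_mul, mul_inv]
    ring

theorem coefMap_parPow (q : ZMod 2) (φ : ℕ → V →ₗ[K] W) (x : VPoly K N V 1) :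
    coefMap (fun m => φ m ∘ₗ parPow M q) x = sgn (q * N) • coefMap φ (parxPow M q x) := by
  obtain rfl | rfl : q = 0 ∨ q = 1 := by revert q; decide
  · rw [zero_mul, sgn_zero_smul]; rfl
  · rw [one_mul, ← neg_one_pow_smul (K := K)]
    exact coefMap_par M φ x

theorem sgn_smul_sgn_smul_sgn_smul {E : Type*} [AddCommGroup E] (p q r : ZMod 2) (x : E) :
    sgn p • sgn q • sgn r • x = sgn (p + q + r) • x := by
  rw [smul_smul, smul_smul, sgn_add, sgn_add, mul_assoc]

theorem residue_boxTerm (hs : act M (Equiv.swap 0 1) X = X) {r : ZMod 2} {c : V}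
    (hc : c ∈ M.deg r) {τ : Equiv.Perm (Fin 3)} {j : Fin 2} (hj : τ j.castSucc = 0)
    (hτ : block 1 1 (τ 2) = 0) {A : Fin 2 → K}
    (hA : A = fun l => if block 1 1 (τ l.castSucc) = 1 then 1 else 0) (hAj : A j = 0)
    {κ : VPoly K N V 2 →ₗ[K] VPoly K N V 1} (hκ : ∀ x, κ (lmul (lam j) x) = 0)
    (hκA : ∀ x, κ (substW V (fun _ => A) x) = x) {f : ℕ → OBT K N (block 1 1)}
    (hf : ∀ i, dzT 0 (f i) = -((i : K) • f (i + 1))) (hf' : ∀ i ι, dzeT 0 ι (f i) = 0) {e : K}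
    {k : ℕ} (hk : ∀ i, permT K N (Equiv.swap 0 1) (restr (f i)) =
      (e * (-1) ^ i) • ziT 0 1 ^ (i + k)) {d : ZMod 2} {y : VPoly K N V 1}
    (hy : parx M 1 y = sgn d • y) :
    κ (Dtop K N V j (boxTerm X τ c (f 1) y)) = sgn (N + r * N + r * d) •
      coefMap (fun m => (((m.factorial : ℕ) : K) * (e * (-1) ^ (1 + m))) •
        poleMap X (1 + m + k) c) y := by
  have hone : ∀ i u, boxTerm X τ c (f i) (1 ⊗ₜ u) =
      substW V (fun _ => A) ((e * (-1) ^ i) • poleVal X (i + k) c (parPow M r u)) := by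
    intro i u
    rw [boxTerm_one_swap hs hc hτ, hk, hA, map_smul, map_smul]
    rfl
  have h := residue_family (L := fun i => boxTerm X τ c (f i)) (p := 1) hκ
    (fun i y => by
      rw [boxTerm_lam hj, hf, boxTerm_apply X τ c (-((i : K) • f (i + 1))), bcomp_neg_fun,
        bcomp_smul_fun, map_neg, map_neg, map_smul, map_smul, sub_neg_eq_add]
      rfl)
    (fun i ι y => boxTerm_odd hj c (hf' i) ι y)
    (fun i ι u => by rw [hone, Dodd_substW, Fin.sum_univ_one, hAj, zero_smul]) 1 y
  rw [h, one_mul, coefMap_congr (ψ := fun m => ((((m.factorial : ℕ) : K) * (e * (-1) ^ (1 + m))) •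
    poleMap X (1 + m + k) c) ∘ₗ parPow M r) (fun m => LinearMap.ext fun u => ?_), coefMap_parPow,
    parxPow_eq hy, map_zsmul]
  · exact sgn_smul_sgn_smul_sgn_smul _ _ _ _
  · rw [LinearMap.smul_apply, LinearMap.comp_apply, LinearMap.comp_apply, TensorProduct.mk_apply,
      hone, hκA, Nat.one_ascFactorial, smul_smul]
    rfl

end ResidueValues

section PoleFamilies

theorem map_pow_mul_eq {O P : Type*} [Ring O] [Algebra K O] [Ring P] [Algebra K P]
    (R : O →ₐ[K] P) {x y : O} {u : P} (hx : R x = -u) (hy : R y = u) (i : ℕ) :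
    R (x ^ i * y) = ((1 : K) * (-1) ^ i) • u ^ (i + 1) := by
  rw [map_mul, map_pow, hx, hy, neg_pow, one_mul, pow_succ, mul_assoc]
  obtain h | h := neg_one_pow_eq_or K i
  · obtain h' | h' := Nat.even_or_odd i
    · rw [h, h'.neg_one_pow, one_smul, one_mul]
    · rw [h'.neg_one_pow, h'.neg_one_pow, neg_one_mul, neg_smul, one_smul]
  · obtain h' | h' := Nat.even_or_odd i
    · rw [h'.neg_one_pow, h'.neg_one_pow, one_smul, one_mul]
    · rw [h, h'.neg_one_pow, neg_one_mul, neg_smul, one_smul]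

theorem map_neg_pow_eq {O P : Type*} [Ring O] [Algebra K O] [Ring P] [Algebra K P]
    (R : O →ₐ[K] P) {x : O} {u : P} (hx : R x = -u) (i : ℕ) :
    R (-x ^ i) = ((-1 : K) * (-1) ^ i) • u ^ (i + 0) := by
  rw [map_neg, map_pow, hx, neg_pow, add_zero, neg_one_mul, neg_smul]
  obtain h' | h' := Nat.even_or_odd i
  · rw [h'.neg_one_pow, h'.neg_one_pow, one_smul, one_mul]
  · rw [h'.neg_one_pow, h'.neg_one_pow, neg_one_mul, neg_smul, one_smul]

theorem leibniz_pow_mul {P : Type*} [Ring P] [Algebra K P] {D : P → P}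
    (hD : ∀ x y, D (x * y) = D x * y + x * D y) (h1 : D 1 = 0) {u w : P}
    (hu : D u = (-1 : K) • (u * u)) (hw : D w = 0) (i : ℕ) :
    D (u ^ i * w) = -((i : K) • (u ^ (i + 1) * w)) := by
  rw [hD, hw, mul_zero, add_zero, pow_leibniz D hD h1 (-1 : K) hu, mul_neg_one, neg_smul, neg_mul,
    smul_mul_assoc]

theorem leibniz_neg_pow {P : Type*} [Ring P] [Algebra K P] {D : P →ₗ[K] P}
    (hD : ∀ x y, D (x * y) = D x * y + x * D y) (h1 : D 1 = 0) {u : P}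
    (hu : D u = (-1 : K) • (u * u)) (i : ℕ) : D (-u ^ i) = -((i : K) • -u ^ (i + 1)) := by
  rw [map_neg, pow_leibniz D hD h1 (-1 : K) hu, mul_neg_one, neg_smul, smul_neg]

theorem twisted_leibniz_pow_mul {P : Type*} [Ring P] {D ι : P → P}
    (hD : ∀ x y, D (x * y) = D x * y + ι x * D y) (h1 : D 1 = 0) {u w : P} (hu : D u = 0)
    (hw : D w = 0) (i : ℕ) : D (u ^ i * w) = 0 := by
  rw [hD, hw, mul_zero, add_zero, dzeT_pow_eq_zero hD h1 hu, zero_mul]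

variable [CharZero K]

theorem dzT_zero_ziB : dzT 0 (ziB ne_zero_two : OBT K N (block 1 1)) =
    (-1 : K) • (ziB ne_zero_two * ziB ne_zero_two : OBT K N (block 1 1)) := by
  rw [dzT_ziB, ite_sub_ite_mul (K := K), if_neg (by decide), if_pos rfl, zero_sub]

variable (K N) in
/-- The functions `z_{1,3}^{-i} z_{3,2}^{-1}`. -/
def poleFam (i : ℕ) : OBT K N (block 1 1) := ziB ne_zero_two ^ i * ziB ne_two_one

variable (K N) in
/-- The functions `-z_{1,3}^{-i}`. -/
def poleFam' (i : ℕ) : OBT K N (block 1 1) := -(ziB ne_zero_two : OBT K N (block 1 1)) ^ i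

theorem dzT_poleFam (i : ℕ) : dzT 0 (poleFam K N i) =
    (-((i : K) • poleFam K N (i + 1)) : OBT K N (block 1 1)) :=
  leibniz_pow_mul (P := OBT K N (block 1 1)) (D := dzT 0) (dzT_mul 0) (dzT_one 0) dzT_zero_ziB
    (dzT_ziB_of_ne ne_two_one (by decide) (by decide)) i

theorem dzT_poleFam' (i : ℕ) : dzT 0 (poleFam' K N i) =
    (-((i : K) • poleFam' K N (i + 1)) : OBT K N (block 1 1)) :=
  leibniz_neg_pow (P := OBT K N (block 1 1)) (D := dzT 0) (dzT_mul 0) (dzT_one 0) dzT_zero_ziB i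

theorem dzeT_poleFam (i : ℕ) (ι : Fin N) : dzeT 0 ι (poleFam K N i) = 0 :=
  twisted_leibniz_pow_mul (P := OBT K N (block 1 1)) (D := dzeT 0 ι) (ι := invT) (dzeT_mul 0 ι)
    (dzeT_one 0 ι) (dzeT_ziB ne_zero_two 0 ι) (dzeT_ziB ne_two_one 0 ι) i

theorem dzeT_poleFam' (i : ℕ) (ι : Fin N) : dzeT 0 ι (poleFam' K N i) = 0 :=
  (map_neg (dzeT 0 ι) (ziB ne_zero_two ^ i : OBT K N (block 1 1))).trans
    (neg_eq_zero.mpr (dzeT_pow_eq_zero (P := OBT K N (block 1 1)) (D := dzeT 0 ι) (ι := invT)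
      (dzeT_mul 0 ι) (dzeT_one 0 ι) (dzeT_ziB ne_zero_two 0 ι) i))

theorem permT_restr_ziB_zero_two : ((permT K N (Equiv.swap (0 : Fin 2) 1)).comp restr)
    (ziB ne_zero_two : OBT K N (block 1 1)) = -(ziT 0 1 : OT K N 2) :=
  (congrArg (permT K N _) (restr_ziB ne_zero_two)).trans ((permT_ziT _ _ _).trans (ziT_swap 1 0))

theorem permT_restr_poleFam (i : ℕ) : permT K N (Equiv.swap (0 : Fin 2) 1)
    (restr (poleFam K N i)) = ((1 : K) * (-1) ^ i) • (ziT 0 1 : OT K N 2) ^ (i + 1) :=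
  map_pow_mul_eq (O := OBT K N (block 1 1)) (P := OT K N 2)
    ((permT K N (Equiv.swap (0 : Fin 2) 1)).comp restr) permT_restr_ziB_zero_two
    (permT_restr_ziB_two_one.trans (pow_one (ziT 0 1 : OT K N 2))) i

theorem permT_restr_poleFam' (i : ℕ) : permT K N (Equiv.swap (0 : Fin 2) 1)
    (restr (poleFam' K N i)) = ((-1 : K) * (-1) ^ i) • (ziT 0 1 : OT K N 2) ^ (i + 0) :=
  map_neg_pow_eq (O := OBT K N (block 1 1)) (P := OT K N 2)
    ((permT K N (Equiv.swap (0 : Fin 2) 1)).comp restr) permT_restr_ziB_zero_two i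

theorem map_pow_one_mul {O P : Type*} [Ring O] [Algebra K O] [Ring P] [Algebra K P]
    {R : O →ₐ[K] P} {x y : O} {a b u : P} (hx : R x = a) (hy : R y = b) :
    a * b = R (x ^ 1 * y) * u ^ 0 := by
  rw [map_mul, map_pow, pow_one, pow_zero, mul_one, hx, hy]

theorem map_neg_pow_one_mul {O P : Type*} [Ring O] [Algebra K O] [Ring P] [Algebra K P]
    {R : O →ₐ[K] P} {x : O} {a u : P} (hx : R x = a) : -a * u = R (-x ^ 1) * u ^ 1 := by
  rw [map_neg, map_pow, pow_one, pow_one, hx]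

theorem permT_ziT_mul_ziT (σ : Equiv.Perm (Fin 3)) :
    permT K N σ (ziT 0 1 * ziT 1 2) = ziT (σ 0) (σ 1) * ziT (σ 1) (σ 2) := by
  rw [map_mul, permT_ziT, permT_ziT]

theorem permT_swap_ziT_mul_ziT : permT K N (Equiv.swap (1 : Fin 3) 2) (ziT 0 1 * ziT 1 2) =
    incl K N (poleFam K N 1) * (ziT 0 1 : OT K N 3) ^ 0 :=
  (permT_ziT_mul_ziT _).trans (map_pow_one_mul (O := OBT K N (block 1 1)) (P := OT K N 3)
    (R := incl K N) (incl_ziB ne_zero_two) (incl_ziB ne_two_one))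

theorem permT_cycle_ziT_mul_ziT :
    permT K N (Equiv.swap (1 : Fin 3) 2 * Equiv.swap 0 1) (ziT 0 1 * ziT 1 2) =
      incl K N (poleFam' K N 1) * (ziT 0 1 : OT K N 3) ^ 1 :=
  (permT_ziT_mul_ziT _).trans ((congrArg (· * (ziT 0 1 : OT K N 3)) (ziT_swap 2 0)).trans
    (map_neg_pow_one_mul (O := OBT K N (block 1 1)) (P := OT K N 3) (R := incl K N)
      (incl_ziB ne_zero_two)))

theorem ziT_mul_ziT_eq : (ziT 0 1 * ziT 1 2 : OT K N 3) =
    incl K N (ziB ne_one_two) * (ziT 0 1 : OT K N 3) ^ 1 :=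
  (ziT_comm 0 1 (ziT 1 2 : OT K N 3)).trans (mul_eq_map_mul_pow_one (O := OBT K N (block 1 1))
    (P := OT K N 3) (R := incl K N) (ziT 0 1 : OT K N 3) (incl_ziB ne_one_two))

end PoleFamilies

section ResidueBox

variable [CharZero K] {X : Op M 2}

theorem substW_kill_self {A : Fin 2 → K} {B : Fin 2 → Fin 1 → K}
    (h : A 0 * B 0 0 + A 1 * B 1 0 = 1) (x : VPoly K N V 1) :
    substW V B (substW V (fun _ => A) x) = x := by
  rw [substW_substW]
  refine substW_id ?_ x
  funext k l
  obtain rfl : k = 0 := Subsingleton.elim _ _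
  obtain rfl : l = 0 := Subsingleton.elim _ _
  rw [Fin.sum_univ_two, if_pos rfl, h]

variable (hX : IsChiralOf M 1 X) (hs : act M (Equiv.swap 0 1) X = X) {p r s : ZMod 2} {a b c : V}
  (ha : a ∈ M.deg p) (hb : b ∈ M.deg r) (hc : c ∈ M.deg s)
include hX

theorem factorial_smul_resInv (i j : ℕ) (hij : j = i + 1) {e e' : K}
    (he : e * ((-1 : K) ^ i * ((i.factorial : ℕ) : K)⁻¹) = e') (b u : V) :
    resInv ((e • poleMap X j b) u) = e' • resMul X ((M.T ^ i) b) u := by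
  subst hij he
  rw [LinearMap.smul_apply, map_smul, poleMap_apply, resInv_poleVal_succ hX, smul_smul]

end ResidueBox

section ResidueBoxValue

variable [CharZero K] {X : Op M 2}

theorem neg_one_pow_mul_self (K : Type*) [Field K] (m : ℕ) : (-1 : K) ^ m * (-1) ^ m = 1 := by
  rw [← mul_pow, neg_one_mul, neg_neg, one_pow]

theorem factorial_mul_inv (m : ℕ) : ((m.factorial : ℕ) : K) * (1 * (-1) ^ (1 + m)) *
    ((-1 : K) ^ (m + 1) * (((m + 1).factorial : ℕ) : K)⁻¹) = ((m : K) + 1)⁻¹ := by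
  have h : ((m.factorial : ℕ) : K) ≠ 0 := Nat.cast_ne_zero.mpr m.factorial_ne_zero
  rw [add_comm 1 m, Nat.factorial_succ, Nat.cast_mul, mul_inv, Nat.cast_succ]
  calc _ = ((-1 : K) ^ (m + 1) * (-1) ^ (m + 1)) *
        (((m.factorial : ℕ) : K) * ((m.factorial : ℕ) : K)⁻¹) * ((m : K) + 1)⁻¹ := by ring
    _ = _ := by rw [neg_one_pow_mul_self, mul_inv_cancel₀ h, one_mul, one_mul]

theorem factorial_mul_neg_inv (m : ℕ) : ((m.factorial : ℕ) : K) * (-1 * (-1) ^ (1 + m)) *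
    ((-1 : K) ^ m * ((m.factorial : ℕ) : K)⁻¹) = 1 := by
  have h : ((m.factorial : ℕ) : K) ≠ 0 := Nat.cast_ne_zero.mpr m.factorial_ne_zero
  calc _ = ((-1 : K) ^ m * (-1) ^ m) *
        (((m.factorial : ℕ) : K) * ((m.factorial : ℕ) : K)⁻¹) := by ring
    _ = _ := by rw [neg_one_pow_mul_self, mul_inv_cancel₀ h, one_mul]

theorem integMul_zero_eq (μ : V →ₗ[K] V →ₗ[K] V) (T : Module.End K V) (a : V)
    (x : VPoly K N V 1) : integMul μ 0 T a x =
      coefMap (fun m => ((m : K) + 1)⁻¹ • μ ((T ^ (m + 1)) a)) x := by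
  refine coefMap_congr (fun m => ?_) x
  rw [zero_pow (Nat.succ_ne_zero m), LinearMap.zero_apply, sub_zero, map_smul]

theorem coefMap_pow_eq (μ : V →ₗ[K] V →ₗ[K] V) (T : Module.End K V) (a : V)
    (x : VPoly K N V 1) : coefMap (fun m => μ ((T ^ m) a)) x =
      μ a (resInv x) + integMul μ 0 T a (Dlam 0 x) := by
  rw [integMul_zero_eq, coefMap_Dlam, resInv, coefMap_comp, ← coefMap_add]
  refine coefMap_congr (fun m => ?_) x
  obtain _ | m := m
  · rw [if_pos rfl, Nat.cast_zero, zero_smul, add_zero]; rfl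
  · have h : ((m : K) + 1) ≠ 0 := Nat.cast_add_one_ne_zero m
    rw [if_neg (Nat.succ_ne_zero m), LinearMap.comp_zero, zero_add, Nat.add_sub_cancel, smul_smul,
      Nat.cast_succ, mul_inv_cancel₀ h, one_smul]

variable (hX : IsChiralOf M 1 X) (hs : act M (Equiv.swap 0 1) X = X) {p r s : ZMod 2} {a b c : V}
  (ha : a ∈ M.deg p) (hb : b ∈ M.deg r) (hc : c ∈ M.deg s)
include hX hs ha hb hc

theorem resInv_resTwo_boxTerm_swap : sgn (r * s) • resInv (resTwo K N V
    (boxTerm X (Equiv.swap 1 2) b (poleFam K N 1) (poleVal X 0 a c))) =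
      sgn (r * (1 + p + N)) • integMul (resMul X) 0 M.T b (poleVal X 0 a c) := by
  have h := residue_boxTerm hs hb (τ := Equiv.swap 1 2) (j := 0) rfl (by decide) (A := ![0, 1])
    (by funext l; fin_cases l <;> rfl) rfl (κ := substW V ![![0], ![1]]) substW_kill_lam_zero
    (substW_kill_self (by simp)) dzT_poleFam dzeT_poleFam permT_restr_poleFam
    (parx_poleVal_of_mem hX ha hc 0)
  rw [resInv_resTwo, resOne, LinearMap.comp_apply, h, map_zsmul, coefMap_comp, integMul_zero_eq,
    coefMap_congr (ψ := fun m => ((m : K) + 1)⁻¹ • resMul X ((M.T ^ (m + 1)) b))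
      (fun m => LinearMap.ext fun u => factorial_smul_resInv hX (m + 1) (1 + m + 1)
        (by omega) (factorial_mul_inv m) b u), sgn_smul_sgn_smul_sgn_smul]
  congr 2
  clear ha hb hc hs h hX
  generalize (N : ZMod 2) = q
  revert p r s q; decide

theorem resInv_resTwo_boxTerm_cycle : sgn (p * r + p * s) • resInv (resTwo K N V
    (boxTerm X (Equiv.swap 1 2 * Equiv.swap 0 1) a (poleFam' K N 1) (poleVal X 1 b c))) =
      sgn (N + p * (N + 1)) • (resMul X a (resMul X b c) -
        integMul (resMul X) 0 M.T a (poleVal X 0 b c)) := by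
  have h := residue_boxTerm hs ha (τ := Equiv.swap 1 2 * Equiv.swap 0 1) (j := 1) rfl (by decide)
    (A := ![1, 0]) (by funext l; fin_cases l <;> rfl) rfl (κ := substW V ![![1], ![0]])
    substW_kill_lam_one (substW_kill_self (by simp)) dzT_poleFam' dzeT_poleFam'
    permT_restr_poleFam' (parx_poleVal_of_mem hX hb hc 1)
  have h0 : Dlam 0 (poleVal X 1 b c) = -poleVal X 0 b c := Dlam_poleVal hX 0 b c
  rw [resTwo, LinearMap.comp_apply, h, map_zsmul, coefMap_comp,
    coefMap_congr (ψ := fun m => resMul X ((M.T ^ m) a))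
      (fun m => LinearMap.ext fun u => (factorial_smul_resInv hX m (1 + m + 0)
        (by omega) (factorial_mul_neg_inv m) a u).trans (one_smul K _)), coefMap_pow_eq, h0,
    map_neg, ← sub_eq_add_neg, smul_smul, ← sgn_add]
  congr 2
  clear ha hb hc hs h h0 hX
  generalize (N : ZMod 2) = q
  revert p r s q; decide

theorem resInv_resTwo_elim_boxOp :
    resInv (resTwo K N V (elim M 2 (boxOp hX ![a, b, c] (ziT 0 1 * ziT 1 2)))) =
      resMul X (resMul X a b) c +
        sgn (r * (1 + p + N)) • integMul (resMul X) 0 M.T b (poleVal X 0 a c) +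
        sgn (N + p * (N + 1)) • (resMul X a (resMul X b c) -
          integMul (resMul X) 0 M.T a (poleVal X 0 b c)) := by
  have hN : ((1 : ZMod 2) + N) * N = 0 := by generalize (N : ZMod 2) = q; revert q; decide
  rw [elim_boxOp hX ha hb hc ziT_mul_ziT_eq permT_swap_ziT_mul_ziT permT_cycle_ziT_mul_ziT,
    boxTerm_eq_nest c (dzT_ziB_of_ne ne_one_two (by decide) (by decide))
      (fun i => dzeT_ziB ne_one_two 0 i) restr_ziB_one_two, map_add, map_add, map_zsmul, map_zsmul,
    map_add, map_add, map_zsmul, map_zsmul, resInv_resTwo_nest_one_one, hN, sgn_zero_smul,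
    resInv_resTwo_boxTerm_swap hX hs ha hb hc, resInv_resTwo_boxTerm_cycle hX hs ha hb hc]
  rfl

end ResidueBoxValue

section Vanishing

variable [CharZero K] {X : Op M 2}

theorem eq_zero_of_homogeneous {n : ℕ} {W : Type*} [AddCommGroup W] [Module K W]
    {Z : Op M n} {f : OT K N n} (L : VNabla M n →ₗ[K] W)
    (h : ∀ (ε : Fin n → ZMod 2) (v : Fin n → V), (∀ j, v j ∈ M.deg (ε j)) → L (Z v f) = 0)
    (v : Fin n → V) : L (Z v f) = 0 :=
  apply_ext_homogeneous (M := M) (F := (L ∘ₗ LinearMap.applyₗ f).compMultilinearMap Z) (G := 0)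
    (fun ε v hv => h ε v hv) v

theorem boxOp_eq_zero (hX : IsChiralOf M 1 X) (hs : act M (Equiv.swap 0 1) X = X)
    (h0 : ∀ p r s, ∀ a ∈ M.deg p, ∀ b ∈ M.deg r, ∀ c ∈ M.deg s,
      elim M 2 (boxOp hX ![a, b, c] 1) = 0)
    (h1 : ∀ p r s, ∀ a ∈ M.deg p, ∀ b ∈ M.deg r, ∀ c ∈ M.deg s,
      resTwo K N V (elim M 2 (boxOp hX ![a, b, c] (ziT 1 2))) = 0)
    (h2 : ∀ p r s, ∀ a ∈ M.deg p, ∀ b ∈ M.deg r, ∀ c ∈ M.deg s,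
      resInv (resTwo K N V (elim M 2 (boxOp hX ![a, b, c] (ziT 0 1 * ziT 1 2)))) = 0) :
    boxOp hX = 0 := by
  have e : ∀ v : Fin 3 → V, ![v 0, v 1, v 2] = v := fun v => by funext j; fin_cases j <;> rfl
  refine eq_zero_of_three (boxOp_isChiralOf hX) (act_swap_zero_one_boxOp hX hs)
    (act_swap_one_two_boxOp hX hs) (fun v => elim_injective ?_) (fun v => ?_) (fun v => ?_)
  · rw [map_zero]
    refine eq_zero_of_homogeneous (elim M 2) (fun ε v hv => ?_) v
    rw [← e v]; exact h0 _ _ _ _ (hv 0) _ (hv 1) _ (hv 2)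
  · refine eq_zero_of_homogeneous (resTwo K N V ∘ₗ elim M 2) (fun ε v hv => ?_) v
    rw [← e v]; exact h1 _ _ _ _ (hv 0) _ (hv 1) _ (hv 2)
  · refine eq_zero_of_homogeneous (resInv ∘ₗ resTwo K N V ∘ₗ elim M 2) (fun ε v hv => ?_) v
    rw [← e v]; exact h2 _ _ _ _ (hv 0) _ (hv 1) _ (hv 2)

end Vanishing

section Signs

theorem zmod_two_eq (x : ZMod 2) : x = 0 ∨ x = 1 := by revert x; decide

variable {E : Type*} [AddCommGroup E]

theorem jacobi_signs (P Q N : ZMod 2) (x y z : E) : sgn (P * (N + 1)) • sgn (Q * (N + 1)) • z -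
      (sgn ((P + N) * N) • sgn ((N + 1) * (P + Q + N)) • sgn (P * (N + 1)) • x +
        sgn ((P + N) * (Q + N)) • sgn (Q * (N + 1)) • sgn (P * (N + 1)) • y) =
      sgn (P * (N + 1) + Q * (N + 1) + P + N + 1) •
        (x + sgn ((Q + (N + 1)) * (P + (N + 1) + 1)) • y + sgn (P + (N + 1)) • z) := by
  obtain rfl | rfl := zmod_two_eq P <;> obtain rfl | rfl := zmod_two_eq Q <;>
    obtain rfl | rfl := zmod_two_eq N <;> simp +decide [sgn] <;> abel

theorem wick_signs (P Q N : ZMod 2) (x x' y z : E) : sgn (P * (N + 1)) • -(sgn (Q * (N + 1)) • z) -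
      (-(sgn ((N + 1) * (P + Q + N)) • sgn (P * (N + 1)) • x) +
        sgn ((P + N) * Q) • -(sgn (Q * (N + 1)) • sgn (P * (N + 1)) • y) +
        sgn ((N + 1) * (P + Q + N)) • sgn (P * (N + 1)) • -x') =
      sgn ((N + 1) * Q) • (x + x' + sgn ((Q + (N + 1)) * (P + (N + 1) + 1)) • y +
        sgn (P + (N + 1)) • sgn ((1 + (P + (N + 1))) * N) • z) := by
  obtain rfl | rfl := zmod_two_eq P <;> obtain rfl | rfl := zmod_two_eq Q <;>
    obtain rfl | rfl := zmod_two_eq N <;> simp +decide [sgn] <;> abel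

theorem assoc_signs (P Q N : ZMod 2) (x y z w : E) :
    -(sgn ((P + Q) * (N + 1)) • -(sgn (P * (N + 1)) • x)) -
        -(sgn (P * (N + 1)) • -(sgn (Q * (N + 1)) • z)) -
      (-(sgn (P * (N + 1)) • sgn (Q * (N + 1)) • w) +
        sgn (P * Q) • -(sgn (Q * (N + 1)) • sgn (P * (N + 1)) • y)) =
      sgn (Q * (N + 1)) • (x + sgn ((Q + (N + 1)) * (1 + (P + (N + 1)) + N)) • y +
        sgn (N + (P + (N + 1)) * (N + 1)) • (z - w)) := by
  obtain rfl | rfl := zmod_two_eq P <;> obtain rfl | rfl := zmod_two_eq Q <;>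
    obtain rfl | rfl := zmod_two_eq N <;> simp +decide [sgn] <;> abel

end Signs

section LinearSigns

variable [CharZero K]

theorem nest_zsmul (A B : Fin 2 → K) (p : ZMod 2) (s : ℤ) (g : V →ₗ[K] VPoly K N V 1)
    (y : VPoly K N V 1) : nest A B p (s • g) y = s • nest A B p g y := by
  refine tensor_ind y (fun c v => ?_)
    fun x y hx hy => by rw [map_add, map_add, hx, hy]; exact (zsmul_add _ _ s).symm
  rw [nest_tmul, nest_tmul, show (s • g) v = s • g v from rfl, map_zsmul, map_zsmul]

theorem map_invPow_zsmul (s : ZMod 2) (k : ℤ) (g : V →ₗ[K] V) (y : VPoly K N V 1) :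
    TensorProduct.map (invPow s).toLinearMap (k • g) y =
      k • TensorProduct.map (invPow s).toLinearMap g y := by
  refine tensor_ind y (fun c v => ?_)
    fun x y hx hy => by rw [map_add, map_add, hx, hy]; exact (zsmul_add _ _ k).symm
  rw [TensorProduct.map_tmul, TensorProduct.map_tmul, LinearMap.smul_apply]
  exact map_zsmul (TensorProduct.mk K (SPoly K N 1) V _) k (g v)

theorem map_invPow_parPow (s q : ZMod 2) (g : V →ₗ[K] V) (y : VPoly K N V 1) :
    TensorProduct.map (invPow s).toLinearMap (g ∘ₗ parPow M q) y =
      TensorProduct.map (invPow (s + q)).toLinearMap g (parxPow M q y) := by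
  apply tensor_ext y; intro c v
  rw [parxPow_tmul, TensorProduct.map_tmul, TensorProduct.map_tmul]
  refine congrArg (· ⊗ₜ[K] _) ?_
  change invPow s c = invPow (s + q) (invPow q c)
  rw [invPow_invPow, add_assoc, show q + q = 0 from by revert q; decide, add_zero]

theorem lift_invPow_parPow (s q : ZMod 2) (g : V →ₗ[K] VPoly K N V 1) (y : VPoly K N V 1) :
    TensorProduct.lift ((lmul ∘ₗ (invPow s).toLinearMap).compl₂ (g ∘ₗ parPow M q)) y =
      TensorProduct.lift ((lmul ∘ₗ (invPow (s + q)).toLinearMap).compl₂ g) (parxPow M q y) := by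
  apply tensor_ext y; intro c v
  rw [parxPow_tmul, TensorProduct.lift.tmul, TensorProduct.lift.tmul]
  change lmul (invPow s c) _ = lmul (invPow (s + q) (invPow q c)) _
  rw [invPow_invPow, add_assoc, show q + q = 0 from by revert q; decide, add_zero]
  rfl

theorem lift_lmul_neg (s : ZMod 2) (g : V →ₗ[K] VPoly K N V 1) (y : VPoly K N V 1) :
    TensorProduct.lift ((lmul ∘ₗ (invPow s).toLinearMap).compl₂ (-g)) y =
      -TensorProduct.lift ((lmul ∘ₗ (invPow s).toLinearMap).compl₂ g) y := by
  refine tensor_ind y (fun c v => ?_)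
    fun x y hx hy => by rw [map_add, map_add, hx, hy]; exact (neg_add _ _).symm
  rw [TensorProduct.lift.tmul, TensorProduct.lift.tmul]
  exact map_neg (lmul (invPow s c)) (g v)

theorem integMul_zsmul (μ : V →ₗ[K] V →ₗ[K] V) (T : Module.End K V) {a : V} {ν : V →ₗ[K] V →ₗ[K] V}
    {k : ℤ} (h : ∀ m, μ ((T ^ m) a) = k • ν ((T ^ m) a)) (x : VPoly K N V 1) :
    integMul μ 0 T a x = k • integMul ν 0 T a x := by
  rw [integMul_zero_eq, integMul_zero_eq, ← Int.cast_smul_eq_zsmul K, ← coefMap_smul]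
  refine coefMap_congr (fun m => ?_) x
  rw [h, Int.cast_smul_eq_zsmul, smul_comm]

variable (M)

theorem parPow_eq_pow (k : ℕ) : parPow M k = M.par ^ k := by
  induction k with
  | zero => rw [Nat.cast_zero, pow_zero]; rfl
  | succ k ih =>
    rw [pow_succ, ← ih, Nat.cast_succ]
    refine LinearMap.ext fun v => ?_
    obtain h | h := zmod_two_eq (k : ZMod 2)
    · rw [h, zero_add]; rfl
    · rw [h]; exact (M.par_par v).symm

variable {M}

theorem mem_shift {P : ZMod 2} {a : V} (ha : a ∈ M.deg P) :
    a ∈ (M.shift (N + 1)).deg (P + (N + 1)) := by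
  have e : P + ((N : ZMod 2) + 1) + ((N + 1 : ℕ) : ZMod 2) = P := by
    rw [Nat.cast_succ]
    generalize (N : ZMod 2) = q
    clear ha; revert P q; decide
  change a ∈ M.deg (P + ((N : ZMod 2) + 1) + ((N + 1 : ℕ) : ZMod 2))
  rwa [e]

theorem mem_of_mem_shift {p : ZMod 2} {a : V} (ha : a ∈ (M.shift (N + 1)).deg p) :
    a ∈ M.deg (p + (N + 1)) := by
  have h : a ∈ M.deg (p + ((N + 1 : ℕ) : ZMod 2)) := ha
  rwa [Nat.cast_succ] at h

theorem par_shift (v : V) : (M.shift (N + 1)).par v = sgn (N + 1) • M.par v := by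
  induction v using M.homogeneous_induction with
  | h p v hv =>
    rw [M.par_of_mem hv, (M.shift (N + 1)).par_of_mem (mem_shift hv), smul_smul, ← sgn_add,
      add_comm p]
  | hadd v w hv hw => rw [map_add, map_add, hv, hw, smul_add]

theorem parx_shift (x : VPoly K N V 1) : parx (M.shift (N + 1)) 1 x = sgn (N + 1) • parx M 1 x := by
  refine tensor_ind x (fun c v => ?_)
    fun x y hx hy => by rw [map_add, map_add, hx, hy]; exact (zsmul_add _ _ _).symm
  refine (congrArg (fun w => inv c ⊗ₜ[K] w) (par_shift v)).trans ?_
  exact map_zsmul (TensorProduct.mk K (SPoly K N 1) V _) _ _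

end LinearSigns

section Structure

variable [CharZero K] {X : Op (M.shift (N + 1)) 2}

theorem brOf_apply (a b : V) : brOf M X a b = poleVal X 0 ((M.par ^ (N + 1)) a) b := by
  change elim (M.shift (N + 1)) 1 (X ![(M.par ^ (N + 1)) a, b] 1) = _
  rw [poleVal]
  exact congrArg (fun f => elim (M.shift (N + 1)) 1 (X ![(M.par ^ (N + 1)) a, b] f))
    (pow_zero (ziT 0 1 : OT K N 2)).symm

theorem mulOf_apply (a b : V) : mulOf M X a b = -resMul X ((M.par ^ (N + 1)) a) b := by
  refine congrArg (fun x => -resInv x) ?_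
  change elim (M.shift (N + 1)) 1 (X ![(M.par ^ (N + 1)) a, b] (ziT 0 1)) = _
  rw [poleMap_apply, poleVal]
  exact congrArg (fun f => elim (M.shift (N + 1)) 1 (X ![(M.par ^ (N + 1)) a, b] f))
    (pow_one (ziT 0 1 : OT K N 2)).symm

theorem par_pow_of_mem {P : ZMod 2} {a : V} (ha : a ∈ M.deg P) :
    (M.par ^ (N + 1)) a = sgn (P * (N + 1)) • a := by
  rw [← parPow_eq_pow, parPow_of_mem ha, Nat.cast_succ, mul_comm]

variable {P Q R : ZMod 2} {a b c : V} (ha : a ∈ M.deg P) (hb : b ∈ M.deg Q) (hc : c ∈ M.deg R)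

include ha in
theorem brOf_of_mem (b : V) : brOf M X a b = sgn (P * (N + 1)) • poleVal X 0 a b := by
  rw [brOf_apply, par_pow_of_mem ha, poleVal_zsmul_left]

include ha in
theorem brOf_eq : brOf M X a = sgn (P * (N + 1)) • poleMap X 0 a :=
  LinearMap.ext fun b => brOf_of_mem ha b

include ha in
theorem mulOf_of_mem (b : V) : mulOf M X a b = -(sgn (P * (N + 1)) • resMul X a b) := by
  rw [mulOf_apply, par_pow_of_mem ha, map_zsmul, LinearMap.smul_apply]

include ha in
theorem mulOf_eq : mulOf M X a = (-sgn (P * (N + 1))) • resMul X a :=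
  LinearMap.ext fun b => by rw [mulOf_of_mem ha, LinearMap.smul_apply, neg_smul]

theorem brOf_flip (c : V) : (brOf M X).flip c = (poleMap X 0).flip c ∘ₗ parPow M (N + 1) := by
  refine LinearMap.ext fun a => ?_
  rw [LinearMap.flip_apply, brOf_apply, ← parPow_eq_pow, Nat.cast_succ]
  rfl

theorem mulOf_flip (c : V) :
    (mulOf M X).flip c = (-1 : ℤ) • ((resMul X).flip c ∘ₗ parPow M (N + 1)) := by
  refine LinearMap.ext fun a => ?_
  rw [LinearMap.flip_apply, mulOf_apply, ← parPow_eq_pow, Nat.cast_succ, LinearMap.smul_apply,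
    neg_one_smul]
  rfl

theorem shift_sum_eq (P Q N : ZMod 2) : N + 1 + (1 + (P + (N + 1)) + (Q + (N + 1))) = P + Q + N := by
  revert P Q N; decide

variable (hX : IsChiralOf (M.shift (N + 1)) 1 X)
include hX ha hb

theorem parx_unshifted (k : ℕ) :
    parx M 1 (poleVal X k a b) = sgn (P + Q + N) • poleVal X k a b := by
  have h := parx_poleVal_of_mem hX (mem_shift ha) (mem_shift hb) k
  rw [parx_shift] at h
  rw [← shift_sum_eq, sgn_add, mul_smul, ← h, smul_smul, sgn_mul_self, one_smul]

theorem parx_brOf : parx M 1 (brOf M X a b) = sgn (P + Q + N) • brOf M X a b := by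
  rw [brOf_of_mem ha, map_zsmul, parx_unshifted ha hb hX, smul_smul, smul_smul, mul_comm]

end Structure

section Conversion

variable [CharZero K] {X : Op (M.shift (N + 1)) 2} (hX : IsChiralOf (M.shift (N + 1)) 1 X)
  {P Q R : ZMod 2} {a b c : V} (ha : a ∈ M.deg P) (hb : b ∈ M.deg Q) (hc : c ∈ M.deg R)

theorem one_add_shift (P N : ZMod 2) : 1 + (P + (N + 1)) = P + N := by revert P N; decide

theorem one_add_shift_add (Q N : ZMod 2) : 1 + (Q + (N + 1)) + N = Q := by revert Q N; decide

theorem add_add_one_self (N : ZMod 2) : N + (N + 1) = 1 := by revert N; decide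

include hX ha hb in
theorem nest_brOf_flip : nest ![1, 1] ![1, 0] (N : ZMod 2) ((brOf M X).flip c) (brOf M X a b) =
    sgn ((N + 1) * (P + Q + N)) • sgn (P * (N + 1)) •
      nest ![1, 1] (Pi.single 0 1) 1 ((poleMap X 0).flip c) (poleVal X 0 a b) := by
  rw [brOf_flip, nest_parPow, parxPow_eq (parx_brOf ha hb hX), map_zsmul, brOf_of_mem ha,
    map_zsmul, add_add_one_self, single_zero_eq]

include hX ha hb in
theorem lTensor_mulOf : ((mulOf M X).flip c).lTensor (SPoly K N 1) (brOf M X a b) =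
    -(sgn ((N + 1) * (P + Q + N)) • sgn (P * (N + 1)) •
      TensorProduct.map (invPow (1 + N)).toLinearMap (resInv ∘ₗ (poleMap X 1).flip c)
        (poleVal X 0 a b)) := by
  change TensorProduct.map (invPow 0).toLinearMap ((mulOf M X).flip c) (brOf M X a b) = _
  rw [mulOf_flip, map_invPow_zsmul, map_invPow_parPow, parxPow_eq (parx_brOf ha hb hX), map_zsmul,
    brOf_of_mem ha, map_zsmul, zero_add, add_comm (N : ZMod 2) 1]
  exact neg_one_zsmul _

include hX in
theorem integLam_Dlam_flip : integLam ∘ₗ Dlam 0 ∘ₗ (poleMap X 1).flip c =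
    -(integLam ∘ₗ (poleMap X 0).flip c) := by
  refine LinearMap.ext fun u => ?_
  change integLam (Dlam 0 (poleVal X 1 u c)) = -integLam (poleVal X 0 u c)
  rw [← map_neg]
  exact congrArg integLam (Dlam_poleVal hX 0 u c)

include hX ha hb in
theorem integBr_brOf : integBr (brOf M X) c (brOf M X a b) =
    sgn ((N + 1) * (P + Q + N)) • sgn (P * (N + 1)) •
      -TensorProduct.lift ((lmul ∘ₗ (invPow (1 + N)).toLinearMap).compl₂
        (integLam ∘ₗ Dlam 0 ∘ₗ (poleMap X 1).flip c)) (poleVal X 0 a b) := by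
  rw [integLam_Dlam_flip hX, lift_lmul_neg, neg_neg]
  change TensorProduct.lift ((lmul ∘ₗ (invPow 0).toLinearMap).compl₂
    (integLam ∘ₗ (brOf M X).flip c)) (brOf M X a b) = _
  rw [brOf_flip, ← LinearMap.comp_assoc, lift_invPow_parPow, parxPow_eq (parx_brOf ha hb hX),
    map_zsmul, brOf_of_mem ha, map_zsmul, zero_add, add_comm (N : ZMod 2) 1]

variable (hs : act (M.shift (N + 1)) (Equiv.swap 0 1) X = X)
include ha hb hc hs

theorem jacobi_sub_eq : nest ![1, 0] ![0, 1] (P + N) (brOf M X a) (brOf M X b c) -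
      (sgn ((P + N) * N) • nest ![1, 1] ![1, 0] N ((brOf M X).flip c) (brOf M X a b) +
        sgn ((P + N) * (Q + N)) • nest ![0, 1] ![1, 0] (Q + N) (brOf M X b) (brOf M X a c)) =
      sgn (P * (N + 1) + Q * (N + 1) + P + N + 1) •
        elim (M.shift (N + 1)) 2 (boxOp hX ![a, b, c] 1) := by
  rw [elim_boxOp_one hX hs (mem_shift ha) (mem_shift hb) (mem_shift hc), nest_brOf_flip hX ha hb,
    brOf_of_mem hb, brOf_of_mem ha, brOf_eq ha, brOf_eq hb, nest_zsmul, nest_zsmul, map_zsmul,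
    map_zsmul, one_add_shift, one_add_shift, single_zero_eq, single_one_eq]
  exact jacobi_signs P Q N _ _ _

theorem wick_sub_eq :
    brOf M X a (mulOf M X b c) - (((mulOf M X).flip c).lTensor (SPoly K N 1) (brOf M X a b) +
      sgn ((P + N) * Q) • TensorProduct.map (invPow Q).toLinearMap (mulOf M X b) (brOf M X a c) +
        integBr (brOf M X) c (brOf M X a b)) =
      sgn ((N + 1) * Q) • resTwo K N V (elim (M.shift (N + 1)) 2
        (boxOp hX ![a, b, c] (ziT 1 2))) := by
  rw [resTwo_elim_boxOp hX hs (mem_shift ha) (mem_shift hb) (mem_shift hc),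
    lTensor_mulOf hX ha hb, integBr_brOf hX ha hb, mulOf_eq hb, map_invPow_zsmul,
    brOf_of_mem ha, brOf_of_mem ha, map_zsmul, one_add_shift_add,
    show ((-sgn (Q * (N + 1))) • resMul X b) c = (-sgn (Q * (N + 1))) • resMul X b c from rfl,
    poleVal_zsmul_right]
  simp only [neg_zsmul]
  exact wick_signs P Q N _ _ _ _

theorem assoc_sub_eq (hμ : mulOf M X a b ∈ M.deg (P + Q)) :
    mulOf M X (mulOf M X a b) c - mulOf M X a (mulOf M X b c) -
      (integMul (mulOf M X) 0 M.T a (brOf M X b c) +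
        sgn (P * Q) • integMul (mulOf M X) 0 M.T b (brOf M X a c)) =
      sgn (Q * (N + 1)) • resInv (resTwo K N V (elim (M.shift (N + 1)) 2
        (boxOp hX ![a, b, c] (ziT 0 1 * ziT 1 2)))) := by
  have hT : ∀ {P : ZMod 2} {a : V}, a ∈ M.deg P → ∀ m, (M.T ^ m) a ∈ M.deg P := by
    intro P a ha m
    induction m with
    | zero => exact ha
    | succ m ih => rw [pow_succ', Module.End.mul_apply]; exact M.T_mem _ _ ih
  rw [resInv_resTwo_elim_boxOp hX hs (mem_shift ha) (mem_shift hb) (mem_shift hc),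
    integMul_zsmul (mulOf M X) M.T (fun m => mulOf_eq (hT ha m)),
    integMul_zsmul (mulOf M X) M.T (fun m => mulOf_eq (hT hb m)), mulOf_of_mem hμ,
    mulOf_of_mem ha, mulOf_of_mem ha, mulOf_of_mem hb, brOf_of_mem ha, brOf_of_mem hb, map_zsmul,
    map_zsmul, map_neg, map_neg, map_zsmul, map_zsmul, LinearMap.neg_apply, LinearMap.smul_apply]
  simp only [neg_zsmul]
  exact assoc_signs P Q N _ _ _ _

end Conversion

section LinearAxioms

variable [CharZero K]

theorem mem_deg_of_par {p : ZMod 2} {v : V} (h : M.par v = sgn p • v) : v ∈ M.deg p := by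
  have hv : v = M.proj p v + M.proj (p + 1) v := by
    conv_lhs => rw [← M.sum_proj v]
    obtain rfl | rfl := zmod_two_eq p
    · exact Fin.sum_univ_two _
    · exact (Fin.sum_univ_two _).trans (add_comm _ _)
  have h1 : M.par v = sgn p • M.proj p v - sgn p • M.proj (p + 1) v := by
    conv_lhs => rw [hv]
    rw [map_add, M.par_of_mem (M.proj_mem p v), M.par_of_mem (M.proj_mem (p + 1) v),
      HWSupermodule.sgn_add_one, neg_smul, sub_eq_add_neg]
  have h2 : sgn p • ((2 : K) • M.proj (p + 1) v) = 0 := by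
    rw [two_smul, smul_add]
    have h3 := h.symm.trans h1
    conv_lhs at h3 => rw [hv, smul_add]
    rw [add_comm, sub_eq_add_neg, add_comm (sgn p • M.proj p v)] at h3
    exact eq_neg_iff_add_eq_zero.mp (add_right_cancel h3)
  have h3 : M.proj (p + 1) v = 0 := by
    have h4 := congrArg (sgn p • ·) h2
    simp only [sgn_smul_sgn_smul, smul_zero] at h4
    exact (smul_eq_zero.mp h4).resolve_left two_ne_zero
  rw [hv, h3, add_zero]
  exact M.proj_mem p v

theorem par_resInv (x : VPoly K N V 1) : M.par (resInv x) = sgn N • resInv (parx M 1 x) := by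
  rw [resInv, ← neg_one_pow_smul (K := K), ← coefMap_par, coefMap_comp]
  exact coefMap_congr (fun m => by
    split_ifs
    · rfl
    · rw [LinearMap.comp_zero, LinearMap.zero_comp]) x

theorem resInv_Tx (x : VPoly K N V 1) : resInv (Tx M 1 x) = M.T (resInv x) := by
  have h := resInv_map_invPow (0 : ZMod 2) M.T x
  rw [zero_mul, sgn_zero_smul] at h
  exact h

theorem resInv_Sx (i : Fin N) (x : VPoly K N V 1) :
    resInv (Sx M 1 i x) = sgn N • M.S i (resInv x) := by
  have h := resInv_map_invPow (1 : ZMod 2) (M.S i) x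
  rw [one_mul] at h
  exact h

theorem par_pow_T (k : ℕ) (a : V) : (M.par ^ k) (M.T a) = M.T ((M.par ^ k) a) := by
  induction k with
  | zero => rfl
  | succ k ih => rw [pow_succ', Module.End.mul_apply, ih, M.par_T]; rfl

theorem par_pow_S (k : ℕ) (i : Fin N) (a : V) :
    (M.par ^ k) (M.S i a) = sgn k • M.S i ((M.par ^ k) a) := by
  induction k with
  | zero => rw [Nat.cast_zero, sgn_zero_smul]; rfl
  | succ k ih =>
    rw [pow_succ', Module.End.mul_apply, ih, map_zsmul, M.par_S, Nat.cast_succ,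
      HWSupermodule.sgn_add_one, neg_smul, smul_neg]
    rfl

variable {X : Op (M.shift (N + 1)) 2} (hX : IsChiralOf (M.shift (N + 1)) 1 X)
  (hs : act (M.shift (N + 1)) (Equiv.swap 0 1) X = X)

theorem S_right_signs {E : Type*} [AddCommGroup E] (P N : ZMod 2) (x y : E) :
    sgn (P * (N + 1)) • (-(sgn (P + (N + 1)) • x) - sgn (P + (N + 1)) • y) =
      sgn (P + N) • (sgn (P * (N + 1)) • x + sgn (P * (N + 1)) • y) := by
  obtain rfl | rfl := zmod_two_eq P <;> obtain rfl | rfl := zmod_two_eq N <;>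
    simp +decide [sgn] <;> abel

theorem skew_signs {E : Type*} [AddCommGroup E] (P Q N : ZMod 2) (x : E) :
    sgn (Q * (N + 1)) • sgn ((Q + (N + 1)) * (P + (N + 1))) • x =
      -(sgn (P * Q + N) • sgn (P * (N + 1)) • x) := by
  obtain rfl | rfl := zmod_two_eq P <;> obtain rfl | rfl := zmod_two_eq Q <;>
    obtain rfl | rfl := zmod_two_eq N <;> simp +decide [sgn]

theorem add_add_add_six {E : Type*} [AddCommGroup E] (a b c a' b' c' : E) :
    a + b + c + (a' + b' + c') = a + a' + (b + b') + (c + c') := by abel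

theorem add_neg_sub_cancel {E : Type*} [AddCommGroup E] (x z : E) : x + (-x - z) = -z := by abel

theorem S_mul_signs {E : Type*} [AddCommGroup E] (P N : ZMod 2) {x y z : E}
    (h : x + sgn (P + (N + 1)) • y = -(sgn N • z)) : -(sgn (P * (N + 1)) • z) =
      -(sgn ((P + 1) * (N + 1)) • x) + sgn P • -(sgn (P * (N + 1)) • y) := by
  have hz : z = -(sgn N • (x + sgn (P + (N + 1)) • y)) := by
    rw [h, smul_neg, neg_neg, sgn_smul_sgn_smul]
  rw [hz]
  obtain rfl | rfl := zmod_two_eq P <;> obtain rfl | rfl := zmod_two_eq N <;>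
    simp +decide [sgn]

theorem quasiComm_signs {E : Type*} [AddCommGroup E] (P Q N : ZMod 2) (x y : E) :
    -(sgn (P * (N + 1)) • x) -
        sgn (P * Q) • -(sgn (Q * (N + 1)) • sgn ((Q + (N + 1)) * (P + (N + 1))) • -y) =
      -(sgn (P * (N + 1)) • (x - sgn N • y)) := by
  obtain rfl | rfl := zmod_two_eq P <;> obtain rfl | rfl := zmod_two_eq Q <;>
    obtain rfl | rfl := zmod_two_eq N <;> simp +decide [sgn] <;> abel

include hX in
theorem brOf_T_left (a b : V) : brOf M X (M.T a) b = -lmul (lam 0) (brOf M X a b) := by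
  have h := poleVal_T_left hX 0 ((M.par ^ (N + 1)) a) b
  rw [Nat.cast_zero, zero_smul, sub_zero] at h
  rw [brOf_apply, brOf_apply, par_pow_T]
  exact h

include hX in
theorem brOf_T_right (a b : V) :
    brOf M X a (M.T b) = lmul (lam 0) (brOf M X a b) + Tx M 1 (brOf M X a b) := by
  have h := poleVal_T_right hX 0 ((M.par ^ (N + 1)) a) b
  rw [Nat.cast_zero, zero_smul, add_zero] at h
  rw [brOf_apply, brOf_apply]
  exact h

include hX in
theorem brOf_S_left (i : Fin N) (a b : V) :
    brOf M X (M.S i a) b = -(sgn N • lmul (odd 0 i) (brOf M X a b)) := by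
  have h := poleVal_S_left hX 0 i ((M.par ^ (N + 1)) a) b
  rw [brOf_apply, brOf_apply, par_pow_S, poleVal_zsmul_left, Nat.cast_succ,
    HWSupermodule.sgn_add_one, neg_smul]
  exact congrArg (fun x => -(sgn N • x)) h

include hX in
theorem brOf_S_right (i : Fin N) {P : ZMod 2} {a : V} (ha : a ∈ M.deg P) (b : V) :
    brOf M X a (M.S i b) =
      sgn (P + N) • (lmul (odd 0 i) (brOf M X a b) + Sx M 1 i (brOf M X a b)) := by
  have h := poleVal_S_right hX 0 i a b
  rw [(M.shift (N + 1)).par_of_mem (mem_shift ha), poleVal_zsmul_left, map_zsmul, map_zsmul] at h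
  rw [brOf_of_mem ha, brOf_of_mem ha, map_zsmul, map_zsmul]
  exact (congrArg (sgn (P * (N + 1)) • ·) h).trans (S_right_signs P N _ _)

include hs in
theorem brOf_skew {P Q : ZMod 2} {a b : V} (ha : a ∈ M.deg P) (hb : b ∈ M.deg Q) :
    brOf M X b a = -(sgn (P * Q + N) • negNabla M (brOf M X a b)) := by
  have h := poleVal_swap hs (mem_shift hb) (mem_shift ha) 0
  rw [pow_zero, one_smul] at h
  rw [brOf_of_mem ha, brOf_of_mem hb, map_zsmul]
  exact (congrArg (sgn (Q * (N + 1)) • ·) h).trans (skew_signs P Q N _)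

include hX in
theorem mulOf_mem {P Q : ZMod 2} {a b : V} (ha : a ∈ M.deg P) (hb : b ∈ M.deg Q) :
    mulOf M X a b ∈ M.deg (P + Q) := by
  rw [mulOf_of_mem ha]
  refine Submodule.neg_mem _ (zsmul_mem (mem_deg_of_par ?_) _)
  rw [resMul_apply, par_resInv, parx_unshifted ha hb hX, map_zsmul, smul_smul, ← sgn_add,
    show (N : ZMod 2) + (P + Q + N) = P + Q by
      generalize (N : ZMod 2) = q; clear ha hb; revert P Q q; decide]

include hX in
theorem mulOf_T (a b : V) : M.T (mulOf M X a b) = mulOf M X (M.T a) b + mulOf M X a (M.T b) := by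
  have h := congrArg resInv (poleVal_T_left hX 1 ((M.par ^ (N + 1)) a) b)
  have h' := congrArg resInv (poleVal_T_right hX 1 ((M.par ^ (N + 1)) a) b)
  rw [map_sub, map_neg, resInv_lmul_lam, neg_zero, zero_sub] at h
  rw [map_add, map_add, resInv_lmul_lam, zero_add, resInv_Tx] at h'
  rw [mulOf_apply, mulOf_apply, mulOf_apply, par_pow_T, map_neg, ← neg_add, neg_inj]
  refine Eq.trans ?_ (congrArg₂ (· + ·) h h').symm
  rw [add_comm (M.shift (N + 1) |>.T _), neg_add_cancel_left]
  rfl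

include hX in
theorem mulOf_S (i : Fin N) {P : ZMod 2} {a : V} (ha : a ∈ M.deg P) (b : V) :
    M.S i (mulOf M X a b) = mulOf M X (M.S i a) b + sgn P • mulOf M X a (M.S i b) := by
  have h := congrArg resInv (poleVal_S_left hX 1 i a b)
  have h' := congrArg resInv (poleVal_S_right hX 1 i ((M.shift (N + 1)).par a) b)
  rw [HWSupermodule.par_par, map_sub, map_neg, resInv_Sx, ← h,
    (M.shift (N + 1)).par_of_mem (mem_shift ha), poleVal_zsmul_left, map_zsmul] at h'
  rw [mulOf_of_mem ha, mulOf_of_mem ha, mulOf_of_mem (M.S_mem i _ _ ha), map_neg, map_zsmul]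
  exact S_mul_signs P N ((congrArg (_ + ·) h').trans (add_neg_sub_cancel _ _))

include hX hs in
theorem mulOf_quasiComm {P Q : ZMod 2} {a b : V} (ha : a ∈ M.deg P) (hb : b ∈ M.deg Q) :
    mulOf M X a b - sgn (P * Q) • mulOf M X b a = integ (-M.T) 0 (brOf M X a b) := by
  have h := congrArg resInv (poleVal_swap hs (mem_shift hb) (mem_shift ha) 1)
  have h0 : Dlam 0 (poleVal X 1 a b) = -poleVal X 0 a b := Dlam_poleVal hX 0 a b
  rw [map_zsmul, pow_one, map_smul, neg_one_smul] at h
  rw [mulOf_of_mem ha, mulOf_of_mem hb, brOf_of_mem ha, map_zsmul]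
  refine (congrArg (fun x => _ - _ • -(_ • x)) h).trans ?_
  refine (quasiComm_signs P Q N _ _).trans ?_
  have h1 := resInv_sub_resInv_negNabla (M := M) (poleVal X 1 a b)
  rw [neg_one_pow_smul, h0, map_neg] at h1
  refine (congrArg (fun x => -(_ • x)) h1).trans ?_
  rw [smul_neg, neg_neg]

theorem nest_add (A B : Fin 2 → K) (p : ZMod 2) (f g : V →ₗ[K] VPoly K N V 1)
    (x : VPoly K N V 1) : nest A B p (f + g) x = nest A B p f x + nest A B p g x := by
  induction x using TensorProduct.induction_on with
  | zero => rw [map_zero, map_zero, map_zero]; exact (add_zero _).symm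
  | tmul a v => exact (congrArg (lmul _) (map_add (substV A) (f v) (g v))).trans (map_add (lmul _) _ _)
  | add x y hx hy =>
    rw [map_add, map_add, map_add, hx, hy]
    exact add_add_add_comm _ _ _ _

theorem integBr_add (br : V →ₗ[K] V →ₗ[K] VPoly K N V 1) (c d : V) (x : VPoly K N V 1) :
    integBr br (c + d) x = integBr br c x + integBr br d x := by
  induction x using TensorProduct.induction_on with
  | zero => rw [map_zero, map_zero, map_zero]; exact (add_zero _).symm
  | tmul a v =>
    exact (congrArg (lmul a) ((congrArg integLam (map_add (br v) c d)).trans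
      (map_add integLam _ _))).trans (map_add (lmul a) _ _)
  | add x y hx hy =>
    rw [map_add, map_add, map_add, hx, hy]
    exact add_add_add_comm _ _ _ _

theorem eq_smul_add_smul_of_add {E : Type*} [AddCommGroup E] {s t : ℤ} {a b c a' b' c' x y z : E}
    (hx : x = a + a') (hy : y = b + b') (hz : z = c + c') (h : a = s • b + t • c)
    (h' : a' = s • b' + t • c') : x = s • y + t • z := by
  rw [hx, hy, hz, h, h', smul_add, smul_add, add_add_add_comm]

theorem eq_of_sub_eq_smul {E : Type*} [AddCommGroup E] {s : ℤ} {x y z : E}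
    (h : x - y = s • z) (hz : z = 0) : x = y := by
  rw [hz, smul_zero] at h
  exact sub_eq_zero.mp h

include hs in
/-- An odd symmetric chiral operation with `X □ X = 0` defines a vertex algebra. -/
theorem isVA_of_boxOp (hbox : boxOp hX = 0) : IsVA M (brOf M X) (mulOf M X) where
  parity p q a ha b hb := parx_brOf ha hb hX
  T_left := brOf_T_left hX
  T_right := brOf_T_right hX
  S_left := brOf_S_left hX
  S_right i p a ha b := brOf_S_right hX i ha b
  skew p q a ha b hb := brOf_skew hs ha hb
  even p q a ha b hb := mulOf_mem hX ha hb
  T_mul := mulOf_T hX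
  S_mul i p a ha b := mulOf_S hX i ha b
  quasiComm p q a ha b hb := mulOf_quasiComm hX hs ha hb
  jacobi p q a ha b hb c := by
    induction c using M.homogeneous_induction with
    | h r c hc =>
      refine eq_of_sub_eq_smul (jacobi_sub_eq hX ha hb hc hs) ?_
      rw [hbox]
      exact map_zero _
    | hadd c d hc hd =>
      refine eq_smul_add_smul_of_add ?_ ?_ ?_ hc hd
      · rw [map_add, map_add]
      · rw [map_add, nest_add]
      · rw [map_add, map_add]
  quasiAssoc p q a ha b hb c := by
    induction c using M.homogeneous_induction with
    | h r c hc =>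
      refine eq_of_sub_eq_smul (assoc_sub_eq hX ha hb hc hs (mulOf_mem hX ha hb)) ?_
      rw [hbox]
      exact (congrArg resInv ((congrArg (resTwo K N V) (map_zero _)).trans (map_zero _))).trans
        (map_zero _)
    | hadd c d hc hd =>
      simp only [map_add, smul_add]
      rw [add_sub_add_comm, hc, hd, add_add_add_comm]
  wick p q a ha b hb c := by
    induction c using M.homogeneous_induction with
    | h r c hc =>
      refine eq_of_sub_eq_smul (wick_sub_eq hX ha hb hc hs) ?_
      rw [hbox]
      exact (congrArg (resTwo K N V) (map_zero _)).trans (map_zero _)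
    | hadd c d hc hd =>
      rw [map_add, map_add, hc, hd, integBr_add, map_add (mulOf M X).flip, LinearMap.lTensor_add,
        map_add (brOf M X a), map_add (TensorProduct.map _ _), zsmul_add, LinearMap.add_apply]
      exact add_add_add_six _ _ _ _ _ _

end LinearAxioms

section Brackets

/-- Operators on `E` that satisfy the relations of `T`, `S^i`, the parity involution, the
multiplications by `λ`, `θ^i`, the derivation `∂_λ`, the integral from `0` to `λ` and the right actions of the `ζ_{1,2}^i` on
`V[Λ]`. -/
structure ValueOps (K : Type*) [Field K] (N : ℕ) (E : Type*) [AddCommGroup E] [Module K E] where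
  T : E →ₗ[K] E
  S : Fin N → E →ₗ[K] E
  π : E →ₗ[K] E
  l : E →ₗ[K] E
  θ : Fin N → E →ₗ[K] E
  D : E →ₗ[K] E
  I : E →ₗ[K] E
  e : Fin N → E →ₗ[K] E
  T_θ : ∀ i x, T (θ i x) = θ i (T x)
  S_θ : ∀ i j x, S i (θ j x) = -θ j (S i x)
  π_θ : ∀ i x, π (θ i x) = -θ i (π x)
  D_θ : ∀ i x, D (θ i x) = θ i (D x)
  θ_θ : ∀ i j x, θ i (θ j x) = -θ j (θ i x)
  T_l : ∀ x, T (l x) = l (T x)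
  S_l : ∀ i x, S i (l x) = l (S i x)
  π_l : ∀ x, π (l x) = l (π x)
  l_θ : ∀ i x, θ i (l x) = l (θ i x)
  D_l : ∀ x, D (l x) = l (D x) + x
  D_T : ∀ x, D (T x) = T (D x)
  D_S : ∀ i x, D (S i x) = S i (D x)
  D_π : ∀ x, D (π x) = π (D x)
  T_I : ∀ x, I (T x) = T (I x)
  S_I : ∀ i x, I (S i x) = S i (I x)
  π_I : ∀ x, I (π x) = π (I x)
  θ_I : ∀ i x, I (θ i x) = θ i (I x)
  D_I : ∀ x, D (I x) = x
  T_e : ∀ i x, T (e i x) = e i (T x)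
  S_e : ∀ i j x, S i (e j x) = e j (S i x)
  π_e : ∀ i x, π (e i x) = -e i (π x)
  l_e : ∀ i x, l (e i x) = e i (l x)
  e_D : ∀ i x, e i (D x) = D (e i x)
  e_e : ∀ i j x, e i (e j x) = -e j (e i x)
  e_θ : ∀ i j x, e j (θ i x) = θ i (e j x) - if i = j then π x else 0

variable [CharZero K] {E : Type*} [AddCommGroup E] [Module K E] {A : ValueOps K N E}

theorem eq_zero_of_eq_neg (K : Type*) [Field K] [CharZero K] {E : Type*} [AddCommGroup E]
    [Module K E] {x : E} (h : x = -x) : x = 0 := by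
  rw [eq_neg_iff_add_eq_zero, ← two_smul K] at h
  exact (smul_eq_zero.mp h).resolve_left two_ne_zero

theorem S_self (i : Fin N) (a : V) : M.S i (M.S i a) = 0 :=
  eq_zero_of_eq_neg K (eq_neg_of_add_eq_zero_left (M.S_S i i a))

theorem ValueOps.θ_self (i : Fin N) (x : E) : A.θ i (A.θ i x) = 0 :=
  eq_zero_of_eq_neg K (A.θ_θ i i x)

variable (M A) in
/-- A bilinear map `h : V ⊗ V → E` that is compatible, up to the sign `s`, with parities and
with the diagonal action of `T` and `S^i`. -/
structure IsEquivariant (s : ℤ) (h : V →ₗ[K] V →ₗ[K] E) : Prop where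
  T_add : ∀ a b, h (M.T a) b + h a (M.T b) = A.T (h a b)
  par : ∀ a b, A.π (h a b) = -(s • h (M.par a) (M.par b))
  S_add : ∀ i a b, h (M.par a) (M.S i b) + h (M.S i a) b + s • A.S i (h a b) = 0

variable (M A) in
/-- `s h(S^i a, b) = θ^i h(a, b)`. -/
def OddLinear (s : ℤ) (i : Fin N) (h : V →ₗ[K] V →ₗ[K] E) : Prop :=
  ∀ a b, A.θ i (h a b) = s • h (M.S i a) b

variable (M A) in
/-- The bilinear map `θ^i h(a, b) - s h(S^i a, b)`. -/
def oddRaise (s : ℤ) (i : Fin N) (h : V →ₗ[K] V →ₗ[K] E) : V →ₗ[K] V →ₗ[K] E :=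
  h.compr₂ (A.θ i) - s • h ∘ₗ M.S i

variable {s : ℤ} {h : V →ₗ[K] V →ₗ[K] E}

theorem oddRaise_apply (i : Fin N) (a b : V) :
    oddRaise M A s i h a b = A.θ i (h a b) - s • h (M.S i a) b := rfl

theorem IsEquivariant.oddRaise (hs : s * s = 1) (hh : IsEquivariant M A s h) (j : Fin N) :
    IsEquivariant M A (-s) (oddRaise M A s j h) where
  T_add a b := by
    simp only [oddRaise_apply, map_sub, A.T_θ, map_zsmul, ← hh.T_add, map_add, smul_add, M.T_S]
    abel
  par a b := by
    simp only [oddRaise_apply, map_sub, A.π_θ, map_zsmul, hh.par, M.par_S, map_neg,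
      LinearMap.neg_apply, smul_neg, neg_smul, smul_sub, smul_smul, hs, neg_mul,
      neg_neg, one_smul]
    abel
  S_add i a b := by
    have h1 := congrArg (A.θ j) (hh.S_add i a b)
    have h2 := congrArg (s • ·) (hh.S_add i (M.S j a) b)
    simp only [oddRaise_apply, map_sub, A.S_θ, map_zsmul, map_add, map_zero, smul_add, smul_zero,
      M.par_S, map_neg, LinearMap.neg_apply, smul_neg, neg_smul, smul_sub, smul_smul, hs, neg_mul,
      neg_neg, one_smul, eq_neg_of_add_eq_zero_left (M.S_S i j a)] at h1 h2 ⊢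
    rw [← add_zero (0 : E)]
    nth_rw 1 [← h1]
    rw [← h2]
    abel

theorem oddLinear_oddRaise (i : Fin N) : OddLinear M A (-s) i (oddRaise M A s i h) := by
  intro a b
  simp only [oddRaise_apply, map_sub, A.θ_self, S_self, map_zero, LinearMap.zero_apply, smul_zero,
    map_zsmul, sub_zero, zero_sub, neg_smul]

theorem OddLinear.oddRaise (hs : s * s = 1) {i : Fin N} (hi : OddLinear M A s i h) (j : Fin N) :
    OddLinear M A (-s) i (oddRaise M A s j h) := by
  intro a b
  simp only [oddRaise_apply, map_sub, A.θ_θ i j, hi _ _, map_zsmul, smul_sub, smul_smul, neg_smul,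
    neg_mul, hs, one_smul, eq_neg_of_add_eq_zero_left (M.S_S i j a), map_neg, LinearMap.neg_apply]

variable (M A) in
/-- `(λ + T_{(1)}) h`. -/
def evenRaise (h : V →ₗ[K] V →ₗ[K] E) : V →ₗ[K] V →ₗ[K] E := h ∘ₗ M.T + h.compr₂ A.l

theorem evenRaise_apply (a b : V) : evenRaise M A h a b = h (M.T a) b + A.l (h a b) := rfl

variable (M A) in
/-- The conditions on the values `X_{Λ,-Λ-∇}(a ⊗ b ⊗ z_{1,2}^{-k})` of an odd chiral operation that
do not involve `z_{1,2}`. -/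
structure IsPoleMap (h : V →ₗ[K] V →ₗ[K] E) : Prop extends IsEquivariant M A 1 h where
  S_left : ∀ i a b, h (M.S i a) b = A.θ i (h a b)

theorem IsPoleMap.smul (hh : IsPoleMap M A h) (c : K) : IsPoleMap M A (c • h) where
  T_add a b := by simp only [LinearMap.smul_apply, ← smul_add, hh.T_add, map_smul]
  par a b := by simp only [LinearMap.smul_apply, map_smul, hh.par, one_smul, smul_neg]
  S_add i a b := by
    simpa only [LinearMap.smul_apply, map_smul, one_smul, ← smul_add, smul_zero] using
      congrArg (c • ·) (hh.S_add i a b)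
  S_left i a b := by simp only [LinearMap.smul_apply, map_smul, hh.S_left]

theorem IsPoleMap.evenRaise (hh : IsPoleMap M A h) : IsPoleMap M A (evenRaise M A h) where
  T_add a b := by
    simp only [evenRaise_apply, map_add, A.T_l, ← hh.T_add]
    abel
  par a b := by
    simp only [evenRaise_apply, map_add, A.π_l, hh.par, M.par_T, one_smul, map_neg, neg_add]
  S_add i a b := by
    have h1 := congrArg A.l (hh.S_add i a b)
    have h2 := hh.S_add i (M.T a) b
    simp only [evenRaise_apply, map_add, A.S_l, M.par_T, M.T_S, one_smul, map_zero] at h1 h2 ⊢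
    rw [← add_zero (0 : E)]
    nth_rw 1 [← h1]
    rw [← h2]
    abel
  S_left i a b := by simp only [evenRaise_apply, M.T_S, hh.S_left, map_add, A.l_θ]

variable (M A) in
/-- The values at `z_{1,2}^{-k}`, computed from the values `q`, `r` at `1` and `z_{1,2}^{-1}`. -/
def poleSeq (q r : V →ₗ[K] V →ₗ[K] E) : ℕ → V →ₗ[K] V →ₗ[K] E
  | 0 => q
  | 1 => r
  | k + 2 => -((k : K) + 1)⁻¹ • evenRaise M A (poleSeq q r (k + 1))

variable {q r : V →ₗ[K] V →ₗ[K] E}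

theorem isPoleMap_poleSeq (hq : IsPoleMap M A q) (hr : IsPoleMap M A r) :
    ∀ k, IsPoleMap M A (poleSeq M A q r k)
  | 0 => hq
  | 1 => hr
  | k + 2 => (isPoleMap_poleSeq hq hr (k + 1)).evenRaise.smul _

theorem evenRaise_poleSeq (h0 : evenRaise M A q = 0) (k : ℕ) :
    evenRaise M A (poleSeq M A q r k) = -((k : K) • poleSeq M A q r (k + 1)) := by
  cases k with
  | zero => rw [Nat.cast_zero, zero_smul, neg_zero]; exact h0
  | succ k =>
    rw [poleSeq, smul_smul, mul_neg, Nat.cast_succ, mul_inv_cancel₀ (Nat.cast_add_one_ne_zero k),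
      neg_one_smul, neg_neg]

theorem D_poleSeq (h0 : evenRaise M A q = 0) (hr : ∀ a b, A.D (r a b) = -q a b) (k : ℕ) (a b : V) :
    A.D (poleSeq M A q r (k + 1) a b) = -poleSeq M A q r k a b := by
  induction k generalizing a b with
  | zero => exact hr a b
  | succ k ih =>
    have h1 : poleSeq M A q r k (M.T a) b + A.l (poleSeq M A q r k a b) =
        -((k : K) • poleSeq M A q r (k + 1) a b) :=
      LinearMap.congr_fun₂ (evenRaise_poleSeq h0 k) a b
    rw [poleSeq, LinearMap.smul_apply, LinearMap.smul_apply, evenRaise_apply, map_smul, map_add, ih,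
      A.D_l, ih, map_neg, ← add_assoc, ← neg_add, h1, neg_neg]
    nth_rw 2 [← one_smul K (poleSeq M A q r (k + 1) a b)]
    rw [← add_smul, smul_smul, neg_mul, inv_mul_cancel₀ (Nat.cast_add_one_ne_zero k), neg_one_smul]

variable (M A) in
/-- `(θ^{i_1} - s_1 S^{i_1}_{(1)}) ⋯ (θ^{i_r} - s_r S^{i_r}_{(1)}) c` for a list `i_1, …, i_r`. -/
def topMap (c : V →ₗ[K] V →ₗ[K] E) : List (Fin N) → V →ₗ[K] V →ₗ[K] E
  | [] => c
  | i :: L => oddRaise M A (sgn (N + L.length)) i (topMap c L)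

variable {c : V →ₗ[K] V →ₗ[K] E}

theorem sgn_add_succ (N k : ℕ) : sgn (N + (k + 1 : ℕ)) = -sgn (N + k) := by
  rw [Nat.cast_succ, ← add_assoc, HWSupermodule.sgn_add_one]

theorem isEquivariant_topMap (hc : IsEquivariant M A (sgn N) c) (L : List (Fin N)) :
    IsEquivariant M A (sgn (N + L.length)) (topMap M A c L) := by
  induction L with
  | nil => rwa [List.length_nil, Nat.cast_zero, add_zero]
  | cons i L ih => rw [List.length_cons, sgn_add_succ]; exact ih.oddRaise (sgn_mul_self _) i

theorem oddLinear_topMap {i : Fin N} {L : List (Fin N)} (hi : i ∈ L) :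
    OddLinear M A (sgn (N + L.length)) i (topMap M A c L) := by
  induction L with
  | nil => exact absurd hi List.not_mem_nil
  | cons j L ih =>
    rw [List.length_cons, sgn_add_succ]
    obtain rfl | h := List.mem_cons.mp hi
    · exact oddLinear_oddRaise i
    · exact (ih h).oddRaise (sgn_mul_self _) j

variable (M A) in
/-- The value at `z_{1,2}^{-1}`, computed from the value `q` at `1` and the residue `c`. -/
def poleOne (q c : V →ₗ[K] V →ₗ[K] E) : V →ₗ[K] V →ₗ[K] E :=
  topMap M A c (List.finRange N) - q.compr₂ A.I

theorem poleOne_apply (a b : V) :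
    poleOne M A q c a b = topMap M A c (List.finRange N) a b - A.I (q a b) := rfl

theorem isPoleMap_poleOne (hq : IsPoleMap M A q) (hc : IsEquivariant M A (sgn N) c) :
    IsPoleMap M A (poleOne M A q c) := by
  have hs : sgn (N + (List.finRange N).length) = 1 := by
    rw [List.length_finRange, ← two_mul, show (2 : ZMod 2) = 0 from rfl, zero_mul]; rfl
  have h1 := isEquivariant_topMap hc (List.finRange N)
  rw [hs] at h1
  refine ⟨⟨fun a b => ?_, fun a b => ?_, fun i a b => ?_⟩, fun i a b => ?_⟩
  · simp only [poleOne_apply, map_sub, ← h1.T_add, ← A.T_I, ← hq.T_add, map_add]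
    abel
  · simp only [poleOne_apply, map_sub, h1.par, ← A.π_I, hq.par, map_neg, one_smul]
    abel
  · have h2 := h1.S_add i a b
    have h3 := congrArg A.I (hq.S_add i a b)
    simp only [poleOne_apply, map_add, map_sub, A.S_I, one_smul, map_zero] at h2 h3 ⊢
    rw [← sub_zero (0 : E)]
    nth_rw 1 [← h2]
    rw [← h3]
    abel
  · have h2 := oddLinear_topMap (M := M) (A := A) (c := c) (List.mem_finRange i) a b
    rw [hs, one_smul] at h2
    simp only [poleOne_apply, map_sub, ← h2, hq.S_left, A.θ_I]

end Brackets

section TopBracket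

variable [CharZero K] (M)

/-- The operators on `V[Λ]`. -/
def vpolyOps : ValueOps K N (VPoly K N V 1) where
  T := Tx M 1
  S := Sx M 1
  π := parx M 1
  l := lmul (lam 0)
  θ i := lmul (odd 0 i)
  D := Dlam 0
  I := Ilam 0
  e i := Dodd 0 i ∘ₗ parx M 1
  T_θ i x := Tx_lmul M _ x
  S_θ i j x := Sx_lmul_odd 0 i j x
  π_θ i x := parx_lmul_odd 0 i x
  D_θ i x := Dlam_lmul_odd 0 0 i x
  θ_θ i j x := lmul_odd_odd 0 0 i j x
  T_l x := Tx_lmul M _ x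
  S_l i x := Sx_lmul_lam 0 i x
  π_l x := parx_lmul_lam 0 x
  l_θ i x := (lmul_lam_comm 0 _ x).symm
  D_l x := by rw [Dlam_lmul_lam, if_pos rfl]
  D_T x := Dlam_Tx 0 x
  D_S i x := Dlam_Sx 0 i x
  D_π x := (parx_Dlam 0 x).symm
  T_I x := Ilam_Tx 0 x
  S_I i x := Ilam_Sx 0 i x
  π_I x := Ilam_parx 0 x
  θ_I i x := Ilam_lmul_odd 0 0 i x
  D_I x := Dlam_Ilam 0 x
  T_e i x := by rw [LinearMap.comp_apply, LinearMap.comp_apply, parx_Tx, Dodd_Tx]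
  S_e i j x := by rw [LinearMap.comp_apply, LinearMap.comp_apply, parx_Sx, map_neg, Dodd_Sx, neg_neg]
  π_e i x := by rw [LinearMap.comp_apply, LinearMap.comp_apply, parx_Dodd]
  l_e i x := by rw [LinearMap.comp_apply, LinearMap.comp_apply, parx_lmul_lam, Dodd_lmul_lam]
  e_D i x := by rw [LinearMap.comp_apply, LinearMap.comp_apply, parx_Dlam, Dodd_Dlam]
  e_e i j x := by
    simp only [LinearMap.comp_apply]
    rw [parx_Dodd, parx_Dodd, map_neg, map_neg, parx_parx, Dodd_Dodd]
  e_θ i j x := by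
    rw [LinearMap.comp_apply, LinearMap.comp_apply, parx_lmul_odd, map_neg, Dodd_lmul_odd, neg_sub]
    simp only [true_and, eq_comm]

variable {M} (m : V →ₗ[K] V →ₗ[K] V)

/-- A product on `V` as a bracket without `Λ`. -/
def constBr : V →ₗ[K] V →ₗ[K] VPoly K N V 1 := m.compr₂ (TensorProduct.mk K (SPoly K N 1) V 1)

theorem Dlam_topMap (L : List (Fin N)) (a b : V) :
    Dlam 0 (topMap M (vpolyOps M) (constBr m) L a b) = 0 := by
  induction L generalizing a b with
  | nil => exact Dlam_one 0 _
  | cons j L ih =>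
    rw [topMap, oddRaise_apply, map_sub, map_zsmul, ih, zsmul_zero, sub_zero]
    refine (Dlam_lmul_odd 0 0 j _).trans ?_
    rw [ih, map_zero]

theorem Dodd_topMap {i : Fin N} {L : List (Fin N)} (hi : i ∉ L) (a b : V) :
    Dodd 0 i (topMap M (vpolyOps M) (constBr m) L a b) = 0 := by
  induction L generalizing a b with
  | nil => exact Dodd_one 0 i _
  | cons j L ih =>
    rw [List.mem_cons, not_or] at hi
    rw [topMap, oddRaise_apply, map_sub, map_zsmul, ih hi.2, zsmul_zero, sub_zero]
    refine (Dodd_lmul_odd 0 0 i j _).trans ?_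
    rw [if_neg (fun h => hi.1 h.2), ih hi.2, map_zero, sub_zero]

theorem DL_concat (L : List (Fin N)) (i : Fin N) (x : VPoly K N V 1) :
    DL 0 (L ++ [i]) x = DL 0 L (Dodd 0 i x) := by
  induction L with
  | nil => rfl
  | cons j L ih => rw [List.cons_append, DL_cons, DL_cons, ih]

theorem DL_topMap {L : List (Fin N)} (hL : L.Nodup) (a b : V) :
    DL 0 L.reverse (topMap M (vpolyOps M) (constBr m) L a b) = 1 ⊗ₜ m a b := by
  induction L with
  | nil => rfl
  | cons j L ih =>
    rw [List.nodup_cons] at hL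
    rw [List.reverse_cons, DL_concat, ← ih hL.2]
    congr 1
    rw [topMap, oddRaise_apply, map_sub, map_zsmul, Dodd_topMap m hL.1, zsmul_zero, sub_zero]
    refine (Dodd_lmul_odd 0 0 j j _).trans ?_
    rw [if_pos ⟨rfl, rfl⟩, Dodd_topMap m hL.1, map_zero, sub_zero]

theorem cstV_Ilam (x : VPoly K N V 1) : cstV K N V 1 (Ilam 0 x) = 0 := by
  apply vpoly_mon_ext x; intro s e v
  have h : Ilam 0 ((MvPolynomial.monomial s (1 : K) ⊗ₜ[K] e) ⊗ₜ[K] v) =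
      ((intg 0 (MvPolynomial.monomial s (1 : K)) ⊗ₜ[K] e : SPoly K N 1) ⊗ₜ[K] v) := rfl
  rw [h, cstV_tmul, cst, Algebra.TensorProduct.lift_tmul, intg_monomial,
    MvPolynomial.aeval_monomial, Finsupp.prod, Finset.prod_eq_zero (i := 0) (by simp) (by simp),
    mul_zero, zero_mul, zero_smul]

theorem resInv_Ilam (x : VPoly K N V 1) : resInv (Ilam 0 x) = 0 := by
  rw [resInv_eq, Dtop, DL_comm (Ilam 0) (fun i x => (Ilam_Dodd 0 0 i x).symm), cstV_Ilam]

theorem resInv_poleOne (q : V →ₗ[K] V →ₗ[K] VPoly K N V 1) (a b : V) :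
    resInv (poleOne M (vpolyOps M) q (constBr m) a b) = m a b := by
  rw [poleOne_apply, map_sub]
  refine (congrArg₂ (· - ·) ?_ (resInv_Ilam (q a b))).trans (sub_zero _)
  rw [resInv_eq, Dtop, DL_topMap m (List.nodup_finRange N), cstV_tmul, map_one, one_smul]

end TopBracket

section PolyTwo

variable [CharZero K]

theorem zeB_mul_zeB {n m : ℕ} (b : Fin n → Fin m) (k l : Fin n) (i j : Fin N) :
    zeB b k l i * zeB b k l j + zeB b k l j * zeB b k l i = (0 : OBT K N b) := by
  refine Subtype.ext ?_
  have h : ∀ k l : Fin n, (odd k i * odd l j : OB K N b) = -(odd l j * odd k i) := fun k l =>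
    eq_neg_of_add_eq_zero_left (odd_mul_odd k l i j)
  change ((odd k i - odd l i) * (odd k j - odd l j) + (odd k j - odd l j) * (odd k i - odd l i) :
    OB K N b) = 0
  rw [sub_mul, mul_sub, mul_sub, sub_mul, mul_sub, mul_sub, h, h, h, h]
  abel

variable (K N) in
/-- The algebra map `f(Λ) ↦ f(Z_1 - Z_2)`. -/
def polyTwo : SPoly K N 1 →ₐ[K] OT K N 2 :=
  evalHom (A := OT K N 2) (fun _ => zB id 0 1) (fun p => zeB id 0 1 p.2)
    ⟨fun _ _ => rfl, fun _ _ => zB_comm 0 1 _, fun p q => zeB_mul_zeB id 0 1 p.2 q.2⟩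

theorem polyTwo_lam : polyTwo K N (lam 0) = zT 0 1 := evalHom_evn (A := OT K N 2) _ _ _ 0

theorem polyTwo_odd (i : Fin N) : polyTwo K N (odd 0 i) = zeT 0 1 i :=
  evalHom_odd (A := OT K N 2) _ _ _ 0 i

variable (K N) in
/-- The algebra map `f(Z_1, Z_2) ↦ f(Λ, 0)`. -/
def evalZero : OB K N (id : Fin 2 → Fin 2) →ₐ[K]
    SAlg K N (FractionRing (MvPolynomial (Fin 1) K)) 1 :=
  Algebra.TensorProduct.map
    (locLift id ![algebraMap (MvPolynomial (Fin 1) K) _ (MvPolynomial.X 0), 0] (by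
      intro k l hkl
      obtain ⟨rfl, rfl⟩ | ⟨rfl, rfl⟩ : k = 0 ∧ l = 1 ∨ k = 1 ∧ l = 0 := by
        have : k ≠ l := hkl
        omega
      · simp
      · simp))
    (gmap ![![1], ![0]])

theorem evalZero_polyTwo (a : SPoly K N 1) :
    evalZero K N (polyTwo K N a : OB K N (id : Fin 2 → Fin 2)) =
      Algebra.TensorProduct.map (IsScalarTower.toAlgHom K (MvPolynomial (Fin 1) K)
        (FractionRing (MvPolynomial (Fin 1) K))) (AlgHom.id K (Grass K N 1)) a := by
  have hm : ∀ a b : SPoly K N 1, ((polyTwo K N (a * b) : OT K N 2) : OB K N (id : Fin 2 → Fin 2)) =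
      (polyTwo K N a : OB K N (id : Fin 2 → Fin 2)) * (polyTwo K N b : OB K N _) := fun a b => by
    rw [map_mul]; rfl
  have hz : evalZero K N (zz id 0 1) = evn (algebraMap (MvPolynomial (Fin 1) K) _
      (MvPolynomial.X 0)) := by
    rw [evalZero, zz, evn]
    simp [locLift_zc, evn]
  have hζ : ∀ i, evalZero K N (ze id 0 1 i) = odd 0 i := fun i => by
    rw [ze, map_sub, evalZero, odd, odd, Algebra.TensorProduct.map_tmul,
      Algebra.TensorProduct.map_tmul, gmap_ι_single, gmap_ι_single]
    simp [odd]
  induction a using spoly_induction with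
  | one => rw [map_one, map_one]; exact map_one (evalZero K N)
  | add a b ha hb => rw [map_add, map_add, ← ha, ← hb]; exact map_add (evalZero K N) _ _
  | smul c a ha => rw [map_smul, map_smul, ← ha]; exact map_smul (evalZero K N) c _
  | lam k a ha =>
    obtain rfl := Subsingleton.elim k 0
    rw [hm, map_mul, map_mul, ha, polyTwo_lam]
    refine congrArg (· * _) (hz.trans ?_)
    simp [lam, evn]
  | odd k i a ha =>
    obtain rfl := Subsingleton.elim k 0
    rw [hm, map_mul, map_mul, ha, polyTwo_odd]
    refine congrArg (· * _) ((hζ i).trans ?_)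
    simp [odd]

theorem polyTwo_injective : Function.Injective (polyTwo K N) := by
  have hi : Function.Injective ((IsScalarTower.toAlgHom K (MvPolynomial (Fin 1) K)
        (FractionRing (MvPolynomial (Fin 1) K))).toLinearMap.rTensor (Grass K N 1)) :=
    Module.Flat.rTensor_preserves_injective_linearMap _
      (IsFractionRing.injective (MvPolynomial (Fin 1) K) (FractionRing (MvPolynomial (Fin 1) K)))
  intro a b hab
  refine hi ?_
  exact (evalZero_polyTwo a).symm.trans (hab ▸ evalZero_polyTwo b)

theorem zB_cases {C : OT K N 2 → Prop} (zero : C 0) (pos : C (zT 0 1))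
    (neg : ∀ f, C f → C (-f)) (k l : Fin 2) : C (zT k l) := by
  obtain ⟨rfl, rfl⟩ | ⟨rfl, rfl⟩ | rfl : (k = 0 ∧ l = 1) ∨ (k = 1 ∧ l = 0) ∨ k = l := by omega
  · exact pos
  · rw [zT_eq, zB_swap]; exact neg _ pos
  · rw [zT_eq, zB_self]; exact zero

theorem zeB_cases {C : OT K N 2 → Prop} (zero : C 0) (i : Fin N) (pos : C (zeT 0 1 i))
    (neg : ∀ f, C f → C (-f)) (k l : Fin 2) : C (zeT k l i) := by
  have hs : zeB id (1 : Fin 2) 0 i = -(zeB id 0 1 i : OT K N 2) := by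
    refine eq_neg_of_add_eq_zero_left ((zeB_add (b := id) 1 0 1 i).trans (zeB_self _ i))
  obtain ⟨rfl, rfl⟩ | ⟨rfl, rfl⟩ | rfl : (k = 0 ∧ l = 1) ∨ (k = 1 ∧ l = 0) ∨ k = l := by omega
  · exact pos
  · rw [zeT_eq, hs]; exact neg _ pos
  · rw [zeT_eq, zeB_self]; exact zero

variable (K N) in
theorem polyTwo_isInverting : IsInverting (O := SPoly K N 1) (P := OT K N 2) K (polyTwo K N)
    (lam 0) (ziT 0 1) :=
  isInverting_of_adjoin (O := SPoly K N 1) (P := OT K N 2) polyTwo_injective (ziT_comm 0 1)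
    ((congrArg (· * (ziT 0 1 : OT K N 2)) polyTwo_lam).trans (zT_mul_ziT (by decide)))
    (adjoin_OBT id) (by
      have neg : ∀ f : OT K N 2, (∃ k g, f = polyTwo K N g * ziT 0 1 ^ k) →
          ∃ k g, -f = polyTwo K N g * ziT 0 1 ^ k := by
        rintro f ⟨k, g, rfl⟩
        exact ⟨k, -g, by rw [map_neg, neg_mul]⟩
      have zero : ∃ k g, (0 : OT K N 2) = polyTwo K N g * ziT 0 1 ^ k :=
        ⟨0, 0, by rw [map_zero, zero_mul]⟩
      rintro ⟨x, hx⟩ ((⟨k, l, h⟩ | ⟨k, l, hkl, h⟩) | ⟨k, l, i, h⟩)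
      · have e : (⟨x, hx⟩ : OT K N 2) = zT k l := Subtype.ext h
        rw [e]
        exact zB_cases (C := fun f => ∃ k g, f = polyTwo K N g * ziT 0 1 ^ k) zero
          ⟨0, lam 0, by rw [pow_zero, mul_one, polyTwo_lam]⟩ neg k l
      · have e : (⟨x, hx⟩ : OT K N 2) = ziT k l := by
          rw [ziT_of_ne (show k ≠ l from hkl)]
          exact Subtype.ext h
        rw [e]
        have pos : ∃ j g, (ziT 0 1 : OT K N 2) = polyTwo K N g * ziT 0 1 ^ j :=
          ⟨1, 1, by rw [map_one, one_mul, pow_one]⟩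
        obtain h | h := generator_two (K := K) (N := N) ⟨k, l, hkl, rfl⟩
        · rw [h]; exact pos
        · rw [h]; exact neg _ pos
      · have e : (⟨x, hx⟩ : OT K N 2) = zeT k l i := Subtype.ext h
        rw [e]
        exact zeB_cases (C := fun f => ∃ k g, f = polyTwo K N g * ziT 0 1 ^ k) zero i
          ⟨0, odd 0 i, by rw [pow_zero, mul_one, polyTwo_odd]⟩ neg k l)

theorem two_induction {C : OT K N 2 → Prop} (add : ∀ f g, C f → C g → C (f + g))
    (smul : ∀ (c : K) f, C f → C (c • f)) (pow : ∀ k, C (ziT 0 1 ^ k))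
    (mul_z : ∀ f, C f → C (f * zT 0 1)) (mul_ζ : ∀ i f, C f → C (f * zeT 0 1 i))
    (f : OT K N 2) : C f := by
  have zero : C 0 := zero_smul K (ziT 0 1 ^ 0 : OT K N 2) ▸ smul 0 _ (pow 0)
  have neg : ∀ f, C f → C (-f) := fun f hf => neg_one_smul K f ▸ smul (-1) f hf
  refine mem_of_poles (A := ⟨⟨⟨{f | C f}, fun hf hg => add _ _ hf hg⟩, zero⟩,
    fun c f hf => smul c f hf⟩) ?_ ?_ ?_ f
  · intro f hf k l
    exact zB_cases (C := fun g => C (f * g)) (by rw [mul_zero]; exact zero) (mul_z f hf)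
      (fun g hg => by rw [mul_neg]; exact neg _ hg) k l
  · intro f hf k l i
    exact zeB_cases (C := fun g => C (f * g)) (by rw [mul_zero]; exact zero) i (mul_ζ i f hf)
      (fun g hg => by rw [mul_neg]; exact neg _ hg) k l
  · intro u hu
    obtain ⟨k, rfl | rfl⟩ := eq_pow_of_mem_closure (P := OT K N 2) (a := ziT 0 1)
      (fun x hx => generator_two hx) hu
    · exact pow k
    · exact neg _ (pow k)

end PolyTwo

section Family

variable [CharZero K] {E : Type*} [AddCommGroup E] [Module K E] (A : ValueOps K N E)

/-- The right action of `K[Λ]` on `E` with `λ ↦ -∂_λ` and `θ^i ↦ e^i`. -/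
def rightAct : SPoly K N 1 →ₐ[K] (Module.End K E)ᵐᵒᵖ :=
  evalHom (fun _ => MulOpposite.op (-A.D)) (fun p => MulOpposite.op (A.e p.2)) {
    tt := fun _ _ => rfl
    ts := fun _ p => by
      rw [← MulOpposite.op_mul, ← MulOpposite.op_mul]
      refine congrArg _ (LinearMap.ext fun x => ?_)
      simp only [Module.End.mul_apply, LinearMap.neg_apply, map_neg, A.e_D]
    ss := fun p q => by
      rw [← MulOpposite.op_mul, ← MulOpposite.op_mul, ← MulOpposite.op_add]
      refine congrArg _ (LinearMap.ext fun x => ?_)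
      simp only [LinearMap.add_apply, Module.End.mul_apply, A.e_e p.2 q.2, LinearMap.zero_apply,
        add_neg_cancel] }

/-- `f ↦ x f` for the right action. -/
def actOn (x : E) : SPoly K N 1 →ₗ[K] E :=
  LinearMap.applyₗ x ∘ₗ (MulOpposite.opLinearEquiv K).symm.toLinearMap ∘ₗ (rightAct A).toLinearMap

theorem actOn_one (x : E) : actOn A x 1 = x := by simp [actOn]

theorem actOn_add (x y : E) (f : SPoly K N 1) : actOn A (x + y) f = actOn A x f + actOn A y f := by
  simp [actOn]

theorem actOn_smul (c : K) (x : E) (f : SPoly K N 1) : actOn A (c • x) f = c • actOn A x f := by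
  simp [actOn]

theorem actOn_mul (x : E) (f g : SPoly K N 1) : actOn A x (f * g) = actOn A (actOn A x f) g := by
  simp [actOn]

theorem actOn_lam (x : E) : actOn A x (lam 0) = -A.D x := by
  simp [actOn, rightAct, lam, evalHom_evn]

theorem actOn_odd (x : E) (i : Fin N) : actOn A x (odd 0 i) = A.e i x := by
  simp [actOn, rightAct, evalHom_odd]

theorem actOn_mul_lam {p : ℕ → E} (hp : ∀ k, A.D (p (k + 1)) = -p k) (k : ℕ) (f : SPoly K N 1) :
    actOn A (p (k + 1)) (f * lam 0) = actOn A (p k) f := by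
  rw [lam, ← evn_comm, ← lam, actOn_mul, actOn_lam, hp, neg_neg]

/-- The map on `O_2^{⋆T}` with `z_{1,2}^{-k} ↦ p_k` that is linear for the right action. -/
def family {p : ℕ → E} (hp : ∀ k, A.D (p (k + 1)) = -p k) : OT K N 2 →ₗ[K] E :=
  (polyTwo_isInverting K N).extend (O := SPoly K N 1) (P := OT K N 2) (fun k => actOn A (p k))
    (actOn_mul_lam A hp)

variable {A} {p : ℕ → E} (hp : ∀ k, A.D (p (k + 1)) = -p k)

theorem family_apply (k : ℕ) (f : SPoly K N 1) :
    family A hp (polyTwo K N f * ziT 0 1 ^ k) = actOn A (p k) f :=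
  (polyTwo_isInverting K N).extend_apply (O := SPoly K N 1) (P := OT K N 2) _
    (actOn_mul_lam A hp) k f

theorem family_pow (k : ℕ) : family A hp (ziT 0 1 ^ k) = p k := by
  have h := family_apply hp k 1
  rwa [actOn_one, map_one, one_mul] at h

theorem family_mul (f : OT K N 2) (g : SPoly K N 1) :
    family A hp (f * polyTwo K N g) = actOn A (family A hp f) g := by
  obtain ⟨k, f, rfl⟩ := (polyTwo_isInverting K N).gen f
  rw [mul_assoc, (polyTwo_isInverting K N).pow_comm, ← mul_assoc, ← map_mul, family_apply,
    family_apply, actOn_mul]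

theorem family_mul_z (f : OT K N 2) : family A hp (f * zT 0 1) = -A.D (family A hp f) := by
  rw [← polyTwo_lam, family_mul, actOn_lam]

theorem family_mul_ζ (f : OT K N 2) (i : Fin N) :
    family A hp (f * zeT 0 1 i) = A.e i (family A hp f) := by
  rw [← polyTwo_odd, family_mul, actOn_odd]

end Family

section Bilinear

variable [CharZero K] {E : Type*} [AddCommGroup E] [Module K E] {A : ValueOps K N E}
  {p : ℕ → V →ₗ[K] V →ₗ[K] E} (hD : ∀ k a b, A.D (p (k + 1) a b) = -p k a b)

/-- `family` for bilinear maps. -/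
def bifamily (a b : V) : OT K N 2 →ₗ[K] E := family A (p := fun k => p k a b) fun k => hD k a b

theorem bifamily_pow (a b : V) (k : ℕ) : bifamily hD a b (ziT 0 1 ^ k) = p k a b := family_pow _ k

theorem bifamily_mul_z (a b : V) (f : OT K N 2) :
    bifamily hD a b (f * zT 0 1) = -A.D (bifamily hD a b f) :=
  family_mul_z _ f

theorem bifamily_mul_ζ (a b : V) (f : OT K N 2) (i : Fin N) :
    bifamily hD a b (f * zeT 0 1 i) = A.e i (bifamily hD a b f) := family_mul_ζ _ f i

theorem bifamily_apply (a b : V) (k : ℕ) (f : SPoly K N 1) :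
    bifamily hD a b (polyTwo K N f * ziT 0 1 ^ k) = actOn A (p k a b) f := family_apply _ k f

theorem bifamily_add_left (a a' b : V) (f : OT K N 2) :
    bifamily hD (a + a') b f = bifamily hD a b f + bifamily hD a' b f := by
  obtain ⟨k, f, rfl⟩ := (polyTwo_isInverting K N).gen f
  simp only [bifamily_apply, map_add, LinearMap.add_apply, actOn_add]

theorem bifamily_smul_left (c : K) (a b : V) (f : OT K N 2) :
    bifamily hD (c • a) b f = c • bifamily hD a b f := by
  obtain ⟨k, f, rfl⟩ := (polyTwo_isInverting K N).gen f
  simp only [bifamily_apply, map_smul, LinearMap.smul_apply, actOn_smul]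

theorem bifamily_add_right (a b b' : V) (f : OT K N 2) :
    bifamily hD a (b + b') f = bifamily hD a b f + bifamily hD a b' f := by
  obtain ⟨k, f, rfl⟩ := (polyTwo_isInverting K N).gen f
  simp only [bifamily_apply, map_add, actOn_add]

theorem bifamily_smul_right (c : K) (a b : V) (f : OT K N 2) :
    bifamily hD a (c • b) f = c • bifamily hD a b f := by
  obtain ⟨k, f, rfl⟩ := (polyTwo_isInverting K N).gen f
  simp only [bifamily_apply, map_smul, actOn_smul]

variable (hp : ∀ k, IsPoleMap M A (p k))
  (hl : ∀ k a b, p k (M.T a) b + A.l (p k a b) = -((k : K) • p (k + 1) a b))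
include hp

theorem bifamily_T_add (a b : V) (f : OT K N 2) :
    bifamily hD (M.T a) b f + bifamily hD a (M.T b) f = A.T (bifamily hD a b f) := by
  induction f using two_induction with
  | add f g hf hg => simp only [map_add, ← hf, ← hg]; abel
  | smul c f hf => simp only [map_smul, ← hf, smul_add]
  | pow k => simp only [bifamily_pow, (hp k).T_add]
  | mul_z f hf => rw [bifamily_mul_z, bifamily_mul_z, bifamily_mul_z, ← neg_add, ← map_add, hf,
      map_neg, A.D_T]
  | mul_ζ i f hf => rw [bifamily_mul_ζ, bifamily_mul_ζ, bifamily_mul_ζ, ← map_add, hf, A.T_e]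

theorem bifamily_par (a b : V) (f : OT K N 2) :
    A.π (bifamily hD a b f) = -bifamily hD (M.par a) (M.par b) (invT f) := by
  induction f using two_induction with
  | add f g hf hg => rw [map_add, map_add, hf, hg, map_add, map_add, neg_add]
  | smul c f hf => rw [map_smul, map_smul, hf, map_smul, map_smul, smul_neg]
  | pow k => rw [bifamily_pow, (hp k).par, one_smul, map_pow, invT_ziT (by decide), bifamily_pow]
  | mul_z f hf =>
    have e : invT (f * zT 0 1) = invT f * (zT 0 1 : OT K N 2) :=
      (map_mul invT _ _).trans (congrArg (invT f * ·) (invT_zB (b := id) 0 1))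
    rw [e, bifamily_mul_z, bifamily_mul_z, map_neg, ← A.D_π, hf, map_neg]
  | mul_ζ i f hf =>
    have e : invT (f * zeT 0 1 i) = -(invT f * (zeT 0 1 i : OT K N 2)) :=
      (map_mul invT _ _).trans ((congrArg (invT f * ·) (invT_zeB (b := id) 0 1 i)).trans
        (mul_neg _ _))
    rw [e, map_neg, bifamily_mul_ζ, bifamily_mul_ζ, A.π_e, hf, map_neg]

theorem bifamily_S_add (i : Fin N) (a b : V) (f : OT K N 2) : bifamily hD (M.par a) (M.S i b) f +
    bifamily hD (M.S i a) b f + A.S i (bifamily hD a b f) = 0 := by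
  induction f using two_induction with
  | add f g hf hg =>
    simp only [map_add]
    rw [← add_zero (0 : E)]
    nth_rw 1 [← hf]
    rw [← hg]
    abel
  | smul c f hf => simp only [map_smul, ← smul_add, hf, smul_zero]
  | pow k => simpa only [bifamily_pow, one_smul] using (hp k).S_add i a b
  | mul_z f hf =>
    rw [bifamily_mul_z, bifamily_mul_z, bifamily_mul_z, map_neg, ← A.D_S, ← neg_add, ← neg_add,
      ← map_add, ← map_add, hf, map_zero, neg_zero]
  | mul_ζ j f hf =>
    rw [bifamily_mul_ζ, bifamily_mul_ζ, bifamily_mul_ζ, A.S_e, ← map_add, ← map_add, hf, map_zero]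

theorem bifamily_S_left (i : Fin N) (a b : V) (f : OT K N 2) : bifamily hD (M.S i a) b f =
    bifamily hD (M.par a) (M.par b) (dzeT 0 i f) + A.θ i (bifamily hD a b f) := by
  induction f using two_induction with
  | add f g hf hg => simp only [map_add, hf, hg]; abel
  | smul c f hf => simp only [map_smul, hf, smul_add]
  | pow k =>
    rw [dzeT_ziT_pow (by decide), map_zero, zero_add, bifamily_pow, bifamily_pow, (hp k).S_left]
  | mul_z f hf =>
    have e : dzeT 0 i (f * zT 0 1) = dzeT 0 i f * (zT 0 1 : OT K N 2) := by
      rw [dzeT_mul, zT_eq, dzeT_zB, mul_zero, add_zero]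
    rw [e, bifamily_mul_z, bifamily_mul_z, bifamily_mul_z, hf, map_add, A.D_θ, map_neg, neg_add]
  | mul_ζ j f hf =>
    have e : dzeT 0 i (f * zeT 0 1 j) =
        dzeT 0 i f * (zeT 0 1 j : OT K N 2) + if i = j then invT f else 0 := by
      rw [dzeT_mul, zeT_eq, dzeT_zeB]
      congr 1
      by_cases h : i = j <;> simp [h]
    rw [e, map_add, bifamily_mul_ζ, bifamily_mul_ζ, bifamily_mul_ζ, hf, map_add, A.e_θ,
      bifamily_par hD hp]
    split_ifs
    · abel
    · rw [map_zero]; abel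

include hl in
theorem bifamily_T_left (a b : V) (f : OT K N 2) : bifamily hD (M.T a) b f =
    bifamily hD a b (dzT 0 f) - A.l (bifamily hD a b f) := by
  induction f using two_induction with
  | add f g hf hg => simp only [map_add, hf, hg]; abel
  | smul c f hf => simp only [map_smul, hf, smul_sub]
  | pow k =>
    rw [dzT_zero_pow, map_neg, map_smul, bifamily_pow, bifamily_pow, bifamily_pow, ← hl,
      add_sub_cancel_right]
  | mul_z f hf =>
    have e : dzT 0 (f * zT 0 1) = dzT 0 f * (zT 0 1 : OT K N 2) + f := by
      rw [dzT_mul, zT_eq, dzT_zB, if_pos rfl, if_neg (by decide), sub_zero, mul_one]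
    rw [e, map_add, bifamily_mul_z, bifamily_mul_z, bifamily_mul_z, hf, map_sub, A.D_l, map_neg]
    abel
  | mul_ζ i f hf =>
    have e : dzT 0 (f * zeT 0 1 i) = dzT 0 f * (zeT 0 1 i : OT K N 2) := by
      rw [dzT_mul, zeT_eq, dzT_zeB, mul_zero, add_zero]
    rw [e, bifamily_mul_ζ, bifamily_mul_ζ, bifamily_mul_ζ, hf, map_sub, A.l_e]

end Bilinear

section Construct

variable [CharZero K]

/-- A multilinear map in two vectors. -/
def bilin {W : Type*} [AddCommGroup W] [Module K W] (φ : V → V → W)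
    (h1 : ∀ a a' b, φ (a + a') b = φ a b + φ a' b) (h1' : ∀ (r : K) a b, φ (r • a) b = r • φ a b)
    (h2 : ∀ a b b', φ a (b + b') = φ a b + φ a b') (h2' : ∀ (r : K) a b, φ a (r • b) = r • φ a b) :
    MultilinearMap K (fun _ : Fin 2 => V) W where
  toFun v := φ (v 0) (v 1)
  map_update_add' v i x y := by
    obtain rfl | rfl : i = 0 ∨ i = 1 := by omega
    all_goals simp [Function.update, h1, h2]
  map_update_smul' v i r x := by
    obtain rfl | rfl : i = 0 ∨ i = 1 := by omega
    all_goals simp [Function.update, h1', h2']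

variable {p : ℕ → V →ₗ[K] V →ₗ[K] VPoly K N V 1}
  (hD : ∀ k a b, (vpolyOps M).D (p (k + 1) a b) = -p k a b)

/-- The operation with values `p_k` at `z_{1,2}^{-k}`. -/
def opOf : Op M 2 :=
  bilin (fun a b => unelim M 1 ∘ₗ bifamily hD a b)
    (fun a a' b => LinearMap.ext fun f =>
      (congrArg (unelim M 1) (bifamily_add_left hD a a' b f)).trans (map_add _ _ _))
    (fun r a b => LinearMap.ext fun f =>
      (congrArg (unelim M 1) (bifamily_smul_left hD r a b f)).trans (map_smul _ _ _))
    (fun a b b' => LinearMap.ext fun f =>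
      (congrArg (unelim M 1) (bifamily_add_right hD a b b' f)).trans (map_add _ _ _))
    (fun r a b => LinearMap.ext fun f =>
      (congrArg (unelim M 1) (bifamily_smul_right hD r a b f)).trans (map_smul _ _ _))

theorem elim_opOf (v : Fin 2 → V) (f : OT K N 2) :
    elim M 1 (opOf hD v f) = bifamily hD (v 0) (v 1) f := elim_unelim _

theorem poleVal_opOf (k : ℕ) (a b : V) : poleVal (opOf hD) k a b = p k a b :=
  (elim_opOf hD _ _).trans (bifamily_pow hD a b k)

variable (hp : ∀ k, IsPoleMap M (vpolyOps M) (p k))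
  (hl : ∀ k a b, p k (M.T a) b + (vpolyOps M).l (p k a b) = -((k : K) • p (k + 1) a b))

theorem dzT_one_eq (f : OT K N 2) : dzT 1 f = -dzT 0 f := by
  have h := sum_dzT f
  rw [Fin.sum_univ_two] at h
  exact eq_neg_of_add_eq_zero_right h

theorem dzeT_one_eq (i : Fin N) (f : OT K N 2) : dzeT 1 i f = -dzeT 0 i f := by
  have h := sum_dzeT i f
  rw [Fin.sum_univ_two] at h
  exact eq_neg_of_add_eq_zero_right h

theorem T_right_eq {E : Type*} [AddCommGroup E] {x y z u w : E} (h : x + y = w) (h' : x = z - u) :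
    y = -z - (-u - w) := by
  rw [← h, h']; abel

theorem S_right_eq {E : Type*} [AddCommGroup E] {x y z u w : E} (h : y + x + w = 0)
    (h' : x = z + u) : y = -z - -1 • (-u - w) := by
  have e : y = -x - w := by rw [eq_sub_iff_add_eq, eq_neg_iff_add_eq_zero, add_right_comm]; exact h
  rw [e, h']; abel

theorem S_left_eq {E : Type*} [AddCommGroup E] {x z u : E} (h : x = z + u) : x = z - -1 • u := by
  rw [h]; abel

set_option maxHeartbeats 400000 in
include hp hl in
theorem opOf_isChiralOf : IsChiralOf M 1 (opOf hD) where
  mul_z v f k l := by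
    refine elim_injective ?_
    obtain ⟨rfl, rfl⟩ | ⟨rfl, rfl⟩ | rfl : (k = 0 ∧ l = 1) ∨ (k = 1 ∧ l = 0) ∨ k = l := by omega
    · rw [nDlam_swap, map_neg, elim_nDlam_zero_one, elim_opOf, elim_opOf]
      exact bifamily_mul_z hD _ _ f
    · rw [zT_eq, zB_swap, mul_neg, map_neg, map_neg, elim_nDlam_zero_one, elim_opOf, elim_opOf,
        neg_eq_iff_eq_neg]
      exact bifamily_mul_z hD _ _ f
    · rw [nDlam_self, zT_eq, zB_self, mul_zero, map_zero]
  mul_ζ v f k l i := by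
    refine elim_injective ?_
    have key : elim M 1 (opOf hD v (f * zeT 0 1 i)) =
        elim M 1 (nDodd M 0 1 i (nPar M 2 (opOf hD v f))) := by
      rw [elim_opOf]
      refine (bifamily_mul_ζ hD _ _ f i).trans ?_
      refine Eq.trans ?_ (elim_nDodd 0 i _).symm
      rw [elim_nPar, elim_opOf]
      rfl
    obtain ⟨rfl, rfl⟩ | ⟨rfl, rfl⟩ | rfl : (k = 0 ∧ l = 1) ∨ (k = 1 ∧ l = 0) ∨ k = l := by omega
    · exact key
    · have hs : zeB id (1 : Fin 2) 0 i = -(zeB id 0 1 i : OT K N 2) :=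
        eq_neg_of_add_eq_zero_left ((zeB_add (b := id) 1 0 1 i).trans (zeB_self _ i))
      rw [nDodd_swap, map_neg, ← key, zeT_eq, hs, mul_neg, map_neg, map_neg]
      rfl
    · rw [nDodd_self, zeT_eq, zeB_self, mul_zero, map_zero]
  d_z v f k := by
    refine elim_injective ?_
    obtain rfl | rfl : k = 0 ∨ k = 1 := by omega
    · rw [map_sub, elim_lam_zero, elim_opOf, elim_opOf, elim_opOf]
      exact bifamily_T_left hD hp hl (v 0) (v 1) f
    · rw [map_sub, elim_lam_one, elim_opOf, elim_opOf, elim_opOf, dzT_one_eq, map_neg]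
      exact T_right_eq (bifamily_T_add hD hp (v 0) (v 1) f) (bifamily_T_left hD hp hl (v 0) (v 1) f)
  parity v f := by
    refine elim_injective ?_
    rw [elim_nPar, map_zsmul, elim_opOf, elim_opOf]
    exact (bifamily_par hD hp (v 0) (v 1) f).trans (neg_one_zsmul _).symm
  d_ζ v f k i := by
    refine elim_injective ?_
    obtain rfl | rfl : k = 0 ∨ k = 1 := by omega
    · rw [map_sub, map_zsmul, elim_odd_zero, elim_opOf, elim_opOf, elim_opOf]
      exact S_left_eq (bifamily_S_left hD hp i (v 0) (v 1) f)
    · rw [map_sub, map_zsmul, elim_odd_one, elim_opOf, elim_opOf, elim_opOf, dzeT_one_eq, map_neg]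
      have h1 := bifamily_S_add hD hp i (M.par (v 0)) (v 1) f
      have h2 := bifamily_S_left hD hp i (M.par (v 0)) (v 1) f
      rw [M.par_par] at h1 h2
      exact S_right_eq h1 h2

end Construct

section Uniqueness

variable [CharZero K] {X Y : Op (M.shift (N + 1)) 2}

theorem sgn_smul_cancel {E : Type*} [AddCommGroup E] {s : ZMod 2} {x y : E}
    (h : sgn s • x = sgn s • y) : x = y := by
  rw [← sgn_smul_sgn_smul s x, h, sgn_smul_sgn_smul]

theorem map_add_neg_eq_zero {E F : Type*} [AddCommGroup E] [AddCommGroup F] [Module K E]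
    [Module K F] (L : E →ₗ[K] F) {x y : E} (h : L x = L y) : L (x + -y) = 0 := by
  rw [map_add, map_neg, h, add_neg_cancel]

theorem add_self_cancel (p N : ZMod 2) : p + (N + 1) + (N + 1) = p := by revert p N; decide

theorem pair_eq (v : Fin 2 → V) : v = ![v 0, v 1] := by
  funext j
  obtain rfl | rfl : j = 0 ∨ j = 1 := by omega
  · rfl
  · rfl

/-- An odd chiral operation of arity `2` is determined by its values at `1` and its residues at
`z_{1,2}^{-1}` on homogeneous vectors. -/
theorem op_two_ext {M : HWSupermodule K N V} {X Y : Op M 2} (hX : IsChiralOf M 1 X)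
    (hY : IsChiralOf M 1 Y)
    (h0 : ∀ p q, ∀ a ∈ M.deg p, ∀ b ∈ M.deg q, poleVal X 0 a b = poleVal Y 0 a b)
    (h1 : ∀ p q, ∀ a ∈ M.deg p, ∀ b ∈ M.deg q,
      resInv (poleVal X 1 a b) = resInv (poleVal Y 1 a b)) : X = Y := by
  have key := eq_zero_of_two (hX.add hY.neg)
    (fun v => elim_injective ((eq_zero_of_homogeneous (elim M 1) (fun ε v hv => ?_) v).trans
      (map_zero _).symm))
    (eq_zero_of_homogeneous (resInv ∘ₗ elim M 1) fun ε v hv => ?_)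
  · exact eq_of_sub_eq_zero ((sub_eq_add_neg X Y).trans key)
  · have h := h0 _ _ _ (hv 0) _ (hv 1)
    rw [poleVal, poleVal, ← pair_eq, pow_zero] at h
    exact map_add_neg_eq_zero (elim M 1) h
  · have h := h1 _ _ _ (hv 0) _ (hv 1)
    rw [poleVal, poleVal, ← pair_eq, pow_one] at h
    exact map_add_neg_eq_zero (resInv ∘ₗ elim M 1) h

theorem eq_of_brOf_mulOf (hX : IsChiralOf (M.shift (N + 1)) 1 X)
    (hY : IsChiralOf (M.shift (N + 1)) 1 Y) (hbr : brOf M X = brOf M Y)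
    (hmul : mulOf M X = mulOf M Y) : X = Y := by
  refine op_two_ext hX hY (fun p q a ha b hb => ?_) (fun p q a ha b hb => ?_)
  · have h := LinearMap.congr_fun₂ hbr a b
    rw [brOf_of_mem (mem_of_mem_shift ha), brOf_of_mem (mem_of_mem_shift ha)] at h
    exact sgn_smul_cancel h
  · have h := LinearMap.congr_fun₂ hmul a b
    rw [mulOf_of_mem (mem_of_mem_shift ha), mulOf_of_mem (mem_of_mem_shift ha), neg_inj] at h
    exact sgn_smul_cancel h

theorem act_swap_eq_of_isVA (hX : IsChiralOf (M.shift (N + 1)) 1 X)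
    (hVA : IsVA M (brOf M X) (mulOf M X)) : act (M.shift (N + 1)) (Equiv.swap 0 1) X = X := by
  refine op_two_ext (act_isChiralOf hX (crossingShift_two _)) hX (fun p q b hb a ha => ?_)
    (fun p q b hb a ha => ?_)
  · rw [poleVal_act_swap hb ha, pow_zero, one_smul]
    have h := hVA.skew _ _ _ (mem_of_mem_shift ha) _ (mem_of_mem_shift hb)
    rw [brOf_of_mem (mem_of_mem_shift ha), brOf_of_mem (mem_of_mem_shift hb), map_zsmul] at h
    refine (sgn_smul_cancel (h.trans (Eq.trans (skew_signs _ _ N _).symm ?_))).symm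
    rw [add_self_cancel, add_self_cancel]
    rfl
  · rw [poleVal_act_swap hb ha, pow_one, map_zsmul, map_smul, neg_one_smul]
    have h := hVA.quasiComm _ _ _ (mem_of_mem_shift ha) _ (mem_of_mem_shift hb)
    have hD : Dlam 0 (poleVal X 1 a b) = -poleVal X 0 a b := Dlam_poleVal hX 0 a b
    have h1 := resInv_sub_resInv_negNabla (M := M) (poleVal X 1 a b)
    rw [neg_one_pow_smul, hD, map_neg] at h1
    rw [mulOf_of_mem (mem_of_mem_shift ha), mulOf_of_mem (mem_of_mem_shift hb),
      brOf_of_mem (mem_of_mem_shift ha), map_zsmul] at h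
    have h3 : ∀ s : ℤ, s • integ (-M.T) 0 (poleVal X 0 a b) = -(s • (resInv (poleVal X 1 a b) -
        sgn N • resInv (negNabla M (poleVal X 1 a b)))) := fun s => by rw [h1, smul_neg, neg_neg]
    have h2 := sgn_smul_cancel (neg_inj.mp (sgn_smul_cancel (sub_right_inj.mp
      (h.trans ((h3 _).trans (quasiComm_signs _ (p + (N + 1)) _ _ _).symm)))))
    rw [resMul_apply] at h2
    refine Eq.trans ?_ h2.symm
    rw [add_self_cancel, add_self_cancel]
    rfl

theorem eq_zero_of_sub_eq_smul {E : Type*} [AddCommGroup E] {s : ZMod 2} {x y z : E}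
    (h : x - y = sgn s • z) (hz : x = y) : z = 0 := by
  rw [hz, sub_self, ← smul_zero (sgn s)] at h
  exact (sgn_smul_cancel h).symm

theorem boxOp_eq_zero_of_isVA (hX : IsChiralOf (M.shift (N + 1)) 1 X)
    (hVA : IsVA M (brOf M X) (mulOf M X)) : boxOp hX = 0 := by
  have hs := act_swap_eq_of_isVA hX hVA
  refine boxOp_eq_zero hX hs (fun p r s a ha b hb c hc => ?_) (fun p r s a ha b hb c hc => ?_)
    (fun p r s a ha b hb c hc => ?_) <;>
    replace ha := mem_of_mem_shift ha <;> replace hb := mem_of_mem_shift hb <;>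
    replace hc := mem_of_mem_shift hc
  · exact eq_zero_of_sub_eq_smul (jacobi_sub_eq hX ha hb hc hs) (hVA.jacobi _ _ a ha b hb c)
  · exact eq_zero_of_sub_eq_smul (wick_sub_eq hX ha hb hc hs) (hVA.wick _ _ a ha b hb c)
  · exact eq_zero_of_sub_eq_smul (assoc_sub_eq hX ha hb hc hs (hVA.even _ _ a ha b hb))
      (hVA.quasiAssoc _ _ a ha b hb c)

end Uniqueness

section Existence

variable [CharZero K] {br : V →ₗ[K] V →ₗ[K] VPoly K N V 1} {μ : V →ₗ[K] V →ₗ[K] V}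
  (hVA : IsVA M br μ)

theorem par_pow_par (k : ℕ) (a : V) : (M.par ^ k) (M.par a) = M.par ((M.par ^ k) a) := by
  rw [← Module.End.mul_apply, ← Module.End.mul_apply, pow_mul_comm']

theorem par_pow_par_pow (k : ℕ) (a : V) : (M.par ^ k) ((M.par ^ k) a) = a := by
  have h : M.par ^ 2 = 1 := LinearMap.ext fun a => by
    rw [pow_two, Module.End.mul_apply, M.par_par]; rfl
  rw [← Module.End.mul_apply, ← pow_add, ← two_mul, pow_mul, h, one_pow]; rfl

theorem sgn_succ_mul (N : ZMod 2) : sgn (N + 1) * sgn N = -1 := by revert N; decide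

theorem sgn_succ_smul {E : Type*} [AddCommGroup E] (N : ZMod 2) (x : E) :
    sgn (N + 1) • sgn N • x = -x := by
  rw [smul_smul, sgn_succ_mul, neg_one_zsmul]

/-- The value at `1`. -/
def baseBr (M : HWSupermodule K N V) (br : V →ₗ[K] V →ₗ[K] VPoly K N V 1) :
    V →ₗ[K] V →ₗ[K] VPoly K N V 1 := br ∘ₗ (M.par ^ (N + 1) : Module.End K V)

/-- The residue at `z_{1,2}^{-1}`. -/
def baseMul (M : HWSupermodule K N V) (μ : V →ₗ[K] V →ₗ[K] V) : V →ₗ[K] V →ₗ[K] V :=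
  -(μ ∘ₗ (M.par ^ (N + 1) : Module.End K V))

theorem baseBr_apply (a b : V) : baseBr M br a b = br ((M.par ^ (N + 1)) a) b := rfl

theorem baseMul_apply (a b : V) : baseMul M μ a b = -μ ((M.par ^ (N + 1)) a) b := rfl

section Homogeneous

variable {E : Type*} [AddCommGroup E] [Module K E] {h : V →ₗ[K] V →ₗ[K] E}

theorem bilinear_ext_homogeneous {F G : V →ₗ[K] V →ₗ[K] E}
    (h : ∀ p q, ∀ a ∈ M.deg p, ∀ b ∈ M.deg q, F a b = G a b) : F = G := by
  refine LinearMap.ext₂ fun a b => ?_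
  induction a using M.homogeneous_induction with
  | h p a ha =>
    induction b using M.homogeneous_induction with
    | h q b hb => exact h p q a ha b hb
    | hadd b b' hb hb' => rw [map_add, map_add, hb, hb']
  | hadd a a' ha ha' => rw [map_add, map_add, LinearMap.add_apply, LinearMap.add_apply, ha, ha']

theorem parity_of_homogeneous {π : E →ₗ[K] E} {n : ZMod 2}
    (hh : ∀ p q, ∀ a ∈ M.deg p, ∀ b ∈ M.deg q, π (h a b) = sgn (p + q + n) • h a b) (a b : V) :
    π (h a b) = sgn n • h (M.par a) (M.par b) := by
  refine LinearMap.congr_fun₂ (bilinear_ext_homogeneous (M := M) (F := h.compr₂ π)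
    (G := sgn n • h.compl₁₂ M.par M.par) fun p q a ha b hb => ?_) a b
  refine (hh p q a ha b hb).trans (Eq.trans ?_
    (show sgn n • h (M.par a) (M.par b) = _ from rfl))
  rw [M.par_of_mem ha, M.par_of_mem hb, map_zsmul, map_zsmul, LinearMap.smul_apply, smul_smul,
    smul_smul, sgn_add, sgn_add]
  congr 1
  ring

theorem S_right_of_homogeneous {L : E →ₗ[K] E} {n : ZMod 2} {i : Fin N}
    (hh : ∀ p, ∀ a ∈ M.deg p, ∀ b, h a (M.S i b) = sgn (p + n) • L (h a b)) (a b : V) :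
    h (M.par a) (M.S i b) = sgn n • L (h a b) := by
  induction a using M.homogeneous_induction with
  | h p a ha =>
    rw [M.par_of_mem ha, map_zsmul, LinearMap.smul_apply, hh p a ha, smul_smul, ← sgn_add,
      ← add_assoc, CharTwo.add_self_eq_zero, zero_add]
  | hadd a a' ha ha' => simp only [map_add, LinearMap.add_apply, ha, ha', smul_add]

theorem apply_par_shift_left (a b : V) :
    h ((M.shift (N + 1)).par a) b = sgn (N + 1) • h (M.par a) b := by
  rw [par_shift, map_zsmul, LinearMap.smul_apply]

theorem apply_par_shift (a b : V) :
    h ((M.shift (N + 1)).par a) ((M.shift (N + 1)).par b) = h (M.par a) (M.par b) := by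
  rw [apply_par_shift_left, par_shift, map_zsmul, sgn_smul_sgn_smul]

theorem neg_add_add_add_cancel {x y z w : E} (hx : x = -(z + w)) (hy : y = z) : x + y + w = 0 := by
  rw [hx, hy]; abel

end Homogeneous

include hVA

theorem IsVA.parx_br (a b : V) : parx M 1 (br a b) = sgn N • br (M.par a) (M.par b) :=
  parity_of_homogeneous hVA.parity a b

theorem IsVA.br_S (i : Fin N) (a b : V) :
    br (M.par a) (M.S i b) = sgn N • (lmul (odd 0 i) (br a b) + Sx M 1 i (br a b)) :=
  S_right_of_homogeneous (L := lmul (odd 0 i) + Sx M 1 i) (hVA.S_right i) a b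

theorem IsVA.par_mul (a b : V) : M.par (μ a b) = μ (M.par a) (M.par b) := by
  have h := parity_of_homogeneous (M := M) (h := μ) (π := M.par) (n := 0)
    (fun p q a ha b hb => by rw [M.par_of_mem (hVA.even p q a ha b hb), add_zero]) a b
  rwa [sgn_zero_smul] at h

theorem IsVA.mul_S (i : Fin N) (a b : V) :
    M.S i (μ a b) = μ (M.S i a) b + μ (M.par a) (M.S i b) := by
  induction a using M.homogeneous_induction with
  | h p a ha => rw [hVA.S_mul i p a ha, M.par_of_mem ha, map_zsmul, LinearMap.smul_apply]
  | hadd a a' ha ha' => simp only [map_add, LinearMap.add_apply, ha, ha']; abel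

theorem baseBr_S_left (i : Fin N) (a b : V) :
    baseBr M br (M.S i a) b = lmul (odd 0 i) (baseBr M br a b) := by
  rw [baseBr_apply, baseBr_apply, par_pow_S, map_zsmul]
  refine (congrArg (sgn _ • ·) (hVA.S_left i _ b)).trans ?_
  rw [Nat.cast_succ]
  exact (zsmul_neg _ _).trans (neg_eq_iff_eq_neg.mpr (sgn_succ_smul _ _))

theorem isPoleMap_baseBr :
    IsPoleMap (M.shift (N + 1)) (vpolyOps (M.shift (N + 1))) (baseBr M br) where
  T_add a b := by
    change br ((M.par ^ (N + 1)) (M.T a)) b + br ((M.par ^ (N + 1)) a) (M.T b) = _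
    rw [par_pow_T, hVA.T_left, hVA.T_right]
    exact neg_add_cancel_left _ _
  par a b := by
    rw [apply_par_shift, one_smul]
    refine (parx_shift _).trans ?_
    rw [baseBr_apply, hVA.parx_br, ← par_pow_par]
    exact sgn_succ_smul _ _
  S_add i a b := by
    have h := hVA.br_S i ((M.par ^ (N + 1)) a) b
    rw [← par_pow_par] at h
    rw [apply_par_shift_left, one_smul]
    exact neg_add_add_add_cancel (congrArg (_ • ·) h |>.trans (sgn_succ_smul _ _))
      (baseBr_S_left hVA i a b)
  S_left i a b := baseBr_S_left hVA i a b

theorem isEquivariant_baseMul : IsEquivariant (M.shift (N + 1)) (vpolyOps (M.shift (N + 1))) (sgn N)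
      (constBr (baseMul M μ)) where
  T_add a b := by
    have h : M.T (baseMul M μ a b) = baseMul M μ (M.T a) b + baseMul M μ a (M.T b) := by
      simp only [baseMul_apply, par_pow_T, map_neg, hVA.T_mul, neg_add]
    refine Eq.trans ?_ (congrArg (fun x => (1 : SPoly K N 1) ⊗ₜ[K] x) h.symm)
    exact (TensorProduct.tmul_add _ _ _).symm
  par a b := by
    have h : (M.shift (N + 1)).par (baseMul M μ a b) =
        -(sgn N • baseMul M μ (M.par a) (M.par b)) := by
      rw [par_shift, baseMul_apply, map_neg, hVA.par_mul, ← par_pow_par, HWSupermodule.sgn_add_one,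
        neg_smul]
      rfl
    rw [apply_par_shift]
    have e : ∀ v, parx (M.shift (N + 1)) 1 ((1 : SPoly K N 1) ⊗ₜ[K] v) =
        TensorProduct.mk K (SPoly K N 1) V 1 ((M.shift (N + 1)).par v) := fun v => by
      simp [parx]
    refine (e _).trans ?_
    rw [h, map_neg, map_zsmul]
    rfl
  S_add i a b := by
    have h : sgn (N + 1) • baseMul M μ (M.par a) (M.S i b) + baseMul M μ (M.S i a) b +
        sgn N • M.S i (baseMul M μ a b) = 0 := by
      simp only [baseMul_apply, par_pow_S, map_zsmul, LinearMap.smul_apply, map_neg, hVA.mul_S,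
        LinearMap.neg_apply,
        par_pow_par, Nat.cast_succ, HWSupermodule.sgn_add_one, neg_smul, smul_neg, smul_add]
      abel
    have e : ∀ v, Sx M 1 i ((1 : SPoly K N 1) ⊗ₜ[K] v) =
        TensorProduct.mk K (SPoly K N 1) V 1 (M.S i v) := fun v => by
      simp [Sx]
    rw [apply_par_shift_left]
    refine (congrArg (fun x => _ + sgn (N : ZMod 2) • x) (e _)).trans ?_
    refine Eq.trans ?_ ((congrArg (TensorProduct.mk K (SPoly K N 1) V 1) h).trans (map_zero _))
    rw [map_add, map_add, map_zsmul, map_zsmul]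
    rfl

theorem evenRaise_baseBr :
    evenRaise (M.shift (N + 1)) (vpolyOps (M.shift (N + 1))) (baseBr M br) = 0 := by
  refine LinearMap.ext₂ fun a b => ?_
  change br ((M.par ^ (N + 1)) (M.T a)) b + lmul (lam 0) (br ((M.par ^ (N + 1)) a) b) = 0
  rw [par_pow_T, hVA.T_left]
  exact neg_add_cancel _

omit hVA in
theorem D_poleOne (q : V →ₗ[K] V →ₗ[K] VPoly K N V 1) (m : V →ₗ[K] V →ₗ[K] V) (a b : V) :
    (vpolyOps M).D (poleOne M (vpolyOps M) q (constBr m) a b) = -q a b := by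
  rw [poleOne_apply, map_sub, (vpolyOps M).D_I]
  exact (congrArg (· - q a b) (Dlam_topMap m _ a b)).trans (zero_sub _)

/-- Every vertex algebra structure comes from an odd chiral operation. -/
theorem IsVA.exists_op : ∃ X : Op (M.shift (N + 1)) 2, IsChiralOf (M.shift (N + 1)) 1 X ∧
    brOf M X = br ∧ mulOf M X = μ := by
  have hq := isPoleMap_baseBr hVA
  have hr := isPoleMap_poleOne hq (isEquivariant_baseMul hVA)
  have h0 := evenRaise_baseBr hVA
  have hD := D_poleSeq h0 (D_poleOne (M := M.shift (N + 1)) (baseBr M br) (baseMul M μ))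
  refine ⟨opOf hD, opOf_isChiralOf hD (isPoleMap_poleSeq hq hr)
    (fun k a b => LinearMap.congr_fun₂ (evenRaise_poleSeq h0 k) a b), LinearMap.ext₂ fun a b => ?_,
    LinearMap.ext₂ fun a b => ?_⟩
  · rw [brOf_apply, poleVal_opOf]
    change br ((M.par ^ (N + 1)) ((M.par ^ (N + 1)) a)) b = br a b
    rw [par_pow_par_pow]
  · rw [mulOf_apply, resMul_apply, poleVal_opOf]
    refine (congrArg Neg.neg (resInv_poleOne (M := M.shift (N + 1)) (baseMul M μ)
      (baseBr M br) _ b)).trans ?_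
    rw [baseMul_apply, par_pow_par_pow, neg_neg]

end Existence

section Main

variable [CharZero K]

theorem mem_LP_one_iff {X : Op M 2} :
    X ∈ LP M 1 ↔ IsChiral M X ∧ act M (Equiv.swap 0 1) X = X := by
  refine ⟨fun h => ⟨h.1, h.2 _⟩, fun h => ⟨h.1, fun σ => ?_⟩⟩
  have key : ∀ σ : Equiv.Perm (Fin 2), σ = 1 ∨ σ = Equiv.swap 0 1 := by decide
  obtain rfl | rfl := key σ
  · exact act_one X
  · exact h.2

theorem mem_MCodd_iff {X : Op M 2} : X ∈ MCodd M ↔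
    ∃ hX : IsChiralOf M 1 X, act M (Equiv.swap 0 1) X = X ∧ boxOp hX = 0 := by
  constructor
  · rintro ⟨h1, h2, h3⟩
    have hX : IsChiralOf M 1 X := isChiralOf_iff.mpr ⟨h1.1, h2⟩
    exact ⟨hX, (mem_LP_one_iff.mp h1).2, (box_eq hX).symm.trans h3⟩
  · rintro ⟨hX, hs, hb⟩
    have h := isChiralOf_iff.mp hX
    exact ⟨mem_LP_one_iff.mpr ⟨h.1, hs⟩, h.2, (box_eq hX).trans hb⟩

end Main

end
end SUSY


theorem mainTheorem1 {K : Type*} [Field K] [CharZero K] {N : ℕ} (hN : 0 < N)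
    {V : Type*} [AddCommGroup V] [Module K V] (M : SUSY.HWSupermodule K N V) :
    (∀ X ∈ SUSY.LP (M.shift (N + 1)) 1, SUSY.HasParity (M.shift (N + 1)) 1 X →
      ∃ Z ∈ SUSY.Pch (M.shift (N + 1)) 3,
        SUSY.IsCompOne (M.shift (N + 1)) (n := 1) (m := 1) 1 X X Z ∧
          ∀ Z', SUSY.IsCompOne (M.shift (N + 1)) (n := 1) (m := 1) 1 X X Z' → Z' = Z) ∧
    (∀ X ∈ SUSY.MCodd (M.shift (N + 1)), SUSY.IsVA M (SUSY.brOf M X) (SUSY.mulOf M X)) ∧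
    Set.BijOn (fun X => (SUSY.brOf M X, SUSY.mulOf M X)) (SUSY.MCodd (M.shift (N + 1)))
      {s | SUSY.IsVA M s.1 s.2} := by
  have hVA : ∀ X ∈ SUSY.MCodd (M.shift (N + 1)),
      SUSY.IsVA M (SUSY.brOf M X) (SUSY.mulOf M X) := fun X hX => by
    obtain ⟨hX, hs, hb⟩ := SUSY.mem_MCodd_iff.mp hX
    exact SUSY.isVA_of_boxOp hX hs hb
  refine ⟨fun X h hp => ?_, hVA, fun X hX => hVA X hX, fun X hX Y hY h => ?_, ?_⟩
  · have hX : SUSY.IsChiralOf (M.shift (N + 1)) 1 X := SUSY.isChiralOf_iff.mpr ⟨h.1, hp⟩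
    exact ⟨SUSY.compOp hX, (SUSY.isChiralOf_iff.mp (SUSY.compOp_isChiralOf hX)).1,
      SUSY.compOp_isCompOne hX, fun Z hZ => SUSY.eq_compOp hX hZ⟩
  · obtain ⟨hX, -⟩ := SUSY.mem_MCodd_iff.mp hX
    obtain ⟨hY, -⟩ := SUSY.mem_MCodd_iff.mp hY
    exact SUSY.eq_of_brOf_mulOf hX hY (congrArg Prod.fst h) (congrArg Prod.snd h)
  · rintro ⟨br, μ⟩ h
    obtain ⟨X, hX, rfl, rfl⟩ := SUSY.IsVA.exists_op h
    exact ⟨X, SUSY.mem_MCodd_iff.mpr ⟨hX, SUSY.act_swap_eq_of_isVA hX h,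
      SUSY.boxOp_eq_zero_of_isVA hX h⟩, rfl⟩
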